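/- **Setting.** Let $n\ge 1$, let $M$ be a smooth $d$-dimensional manifold and $(E,\rho,[-,-])$ a Lie algebroid over $M$: $E\to M$ is a smooth vector bundle of rank $r$, $\rho:E\to TM$ a bundle map and $[-,-]$ a Lie bracket on $\Gamma(E)$ with $[s,ft]=f[s,t]+(\rho(s)f)\,t$. Let $J\in\Gamma(\wedge^{n+1}E^*)$ and let $H\in\Omega^{n+2}(M)$ be closed, $\mathrm dH=0$. Consider the $(n+1)$-dimensional sigma model $$S=\int_\Sigma\Big[Z_i\wedge \mathrm dX^i+Y_a\wedge \mathrm dA^a-\rho^i_aZ_i\wedge A^a+\tfrac12C^c_{ab}Y_c\wedge A^a\wedge A^b+\tfrac1{(n+1)!}J_{a_1\ldots a_{n+1}}A^{a_1}\wedge\ldots\wedge A^{a_{n+1}}\Big]+\int_N X^*H,\qquad \partial N=\Sigma,$$ with space $T^n$. Here $x^i$ are local coordinates on $M$, $e_a\in\Gamma(E)$ is a frame over their domain, $\rho(e_a)=\rho^i_a\partial_i$ and $[e_a,e_b]=C_{ab}^ce_c$. The spatial fields are smooth: a map $X$ from $T^n$ into the coordinate domain, $1$-forms $A^a$, $(n-1)$-forms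 $Y_a$ and $n$-forms $Z_i$ on $T^n$. For an $n$-form $\theta$ on $T^n$ let $(\theta)^{(s)}$ denote its coefficient. Write $Y^\mu_a=\tfrac1{(n-1)!}\epsilon^{\mu\nu_2\ldots\nu_n}Y_{\nu_2\ldots\nu_na}$ and $Z_i^{(s)}=(Z_i)^{(s)}$. The canonical momenta $\delta S/\delta\dot X^i$ and $\delta S/\delta\dot A^a_\mu$ give the Poisson brackets $$\{X^i(\sigma),Z^{(s)}_j(\sigma')\}=(-1)^n\delta^i_j\,\delta(\sigma-\sigma'),\qquad \{A^a_\mu(\sigma),Y^\nu_b(\sigma')\}=\delta^a_b\delta^\nu_\mu\,\delta(\sigma-\sigma'),$$ $$\{Z^{(s)}_i(\sigma),Z^{(s)}_j(\sigma')\}=\tfrac1{n!}H_{ijk_1\ldots k_n}(X)\,(\mathrm dX^{k_1}\wedge\ldots\wedge \mathrm dX^{k_n})^{(s)}\,\delta(\sigma-\sigma'),$$ all other brackets of the fundamental fields being zero. The constraints are the spatial components of $$G_X^i=\mathrm dX^i-\rho^i_aA^a,\qquad G_A^a=\mathrm dA^a+\tfrac12C^a_{bc}A^b\wedge A^c,$$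 $$G_{Ya}=\mathrm dY_a+(-1)^{n+1}\rho^i_aZ_i+(-1)^{n-1}C^c_{ab}Y_c\wedge A^b+\tfrac1{n!}J_{ab_2\ldots b_{n+1}}A^{b_2}\wedge\ldots\wedge A^{b_{n+1}}.$$ They are called *first class* if, in all such local coordinates of the target, they generate a closed algebra: for any two components $G_K,G_L$ there are field-dependent structure functions $c^N_{KL}$ with $\{G_K(\sigma),G_L(\sigma')\}=\sum_Nc_{KL}^N(\sigma)\,G_N(\sigma)\,\delta(\sigma-\sigma')$. All brackets are understood after smearing with smooth functions on $T^n$. **Theorem.** (1) The constraints $G_X^i,G_A^a,G_{Ya}$ are first class if and only if $J$ is bracket-compatible, that is $${}^E\mathrm dJ=-\langle\otimes^{n+2}\rho,H\rangle,$$ where $\langle\otimes^{n+2}\rho,H\rangle(s_1,\ldots,s_{n+2})=H(\rho(s_1),\ldots,\rho(s_{n+2}))$ and ${}^E\mathrm d$ is the Lie algebroid differential $${}^E\mathrm dJ(s_1,\ldots,s_{n+2})=\sum_i(-1)^{i-1}\rho(s_i)J(\ldots,\check s_i,\ldots)+\sum_{i<j}(-1)^{i+j}J([s_i,s_j],\ldots,\check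 s_i,\ldots,\check s_j,\ldots).$$ (2) If this condition holds, then $\{G_X,G_X\}=\{G_X,G_A\}=\{G_A,G_A\}=0$ and, omitting the factor $\delta(\sigma-\sigma')$ (with the spatial components of the forms understood), $$\{G_X^i,G_{Ya}\}=-\partial_j\rho^i_a\,G_X^j,\qquad \{G_A^a,G_{Yb}\}=C^a_{bc}G_A^c-\partial_iC^a_{bc}\,A^c\wedge G_X^i,$$ $$\{G_{Ya},G_{Yb}\}=C_{ab}^cG_{Yc}+\partial_iC_{ab}^c\,G_X^i\wedge Y_c+\tfrac1{(n-1)!}\partial_iJ_{abc_3\ldots c_{n+1}}G_X^i\wedge A^{c_3}\wedge\ldots\wedge A^{c_{n+1}}+\mathcal J_{ab}(G_A)+\mathcal H_{ab},$$ where $\mathcal J_{ab}(\Theta)=\tfrac1{(n-2)!}J_{abce_4\ldots e_{n+1}}\Theta^c\wedge A^{e_4}\wedge\ldots\wedge A^{e_{n+1}}$ (zero if $n=1$) and $$\mathcal H_{ab}=\tfrac1{n!}\rho^i_a\rho^j_bH_{ijk_1\ldots k_n}\sum_{m=1}^n\mathrm dX^{k_1}\wedge\ldots\wedge \mathrm dX^{k_{m-1}}\wedge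 G_X^{k_m}\wedge\rho^{k_{m+1}}_{c_{m+1}}A^{c_{m+1}}\wedge\ldots\wedge\rho^{k_n}_{c_n}A^{c_n}.$$ (3) Let moreover $\nabla$ be any smooth connection on $E$, $\nabla_ie_b=\omega^c_{bi}e_c$, with $E$-torsion $T(s,t)=\nabla_{\rho(s)}t-\nabla_{\rho(t)}s-[s,t]$, curvature $[\nabla_i,\nabla_j]e_a=R_{ija}^ce_c$ and basic curvature $S_{iab}^c=\nabla_iT_{ab}^c+\rho^j_bR_{ija}^c-\rho^j_aR_{ijb}^c$. Put $\nabla A^a=\mathrm dA^a-\omega^a_{bi}A^b\wedge \mathrm dX^i$, $\nabla Y_a=\mathrm dY_a+(-1)^n\omega^c_{ai}Y_c\wedge \mathrm dX^i$, $Z^\nabla_i=Z_i+\omega^c_{bi}Y_c\wedge A^b$, $\nabla_j\rho^i_b=\partial_j\rho^i_b-\omega^c_{bj}\rho^i_c$, let $\nabla_iJ$ be the covariant derivative of $J$, and set $$G_A^{\nabla a}=\nabla A^a-\tfrac12T^a_{bc}A^b\wedge A^c,$$ $$G^\nabla_{Ya}=\nabla Y_a+(-1)^{n+1}\rho^i_aZ^\nabla_i+(-1)^nT_{ab}^cY_c\wedge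 A^b+\tfrac1{n!}J_{ab_2\ldots b_{n+1}}A^{b_2}\wedge\ldots\wedge A^{b_{n+1}}.$$ Then $G_A^{\nabla a}=G_A^a-\omega^a_{bi}A^b\wedge G_X^i$ and $G^\nabla_{Ya}=G_{Ya}+(-1)^n\omega^c_{ai}Y_c\wedge G_X^i$. Under the bracket-compatible condition, $\{G_X,G_X\}=\{G_X,G_A^\nabla\}=\{G_A^\nabla,G_A^\nabla\}=0$ and $$\{G_X^i,G^\nabla_{Yb}\}=-\nabla_j\rho^i_b\,G_X^j,$$ $$\{G_A^{\nabla a},G^\nabla_{Yb}\}=(-T_{bc}^a+\rho^i_b\omega^a_{ci})G_A^{\nabla c}+S_{ibc}^aA^c\wedge G_X^i-\tfrac12R_{ijb}^aG_X^i\wedge G_X^j,$$ $$\{G^\nabla_{Ya},G^\nabla_{Yb}\}=(-T_{ab}^c+\rho^i_a\omega^c_{bi}-\rho^i_b\omega^c_{ai})G^\nabla_{Yc}-S_{iab}^c\,G_X^i\wedge Y_c+\tfrac1{(n-1)!}\nabla_iJ_{abc_3\ldots c_{n+1}}G_X^i\wedge A^{c_3}\wedge\ldots\wedge A^{c_{n+1}}+\mathcal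 J_{ab}(G_A^\nabla)+\mathcal H_{ab}.$$ (The terms with $\omega$ next to $T$ are $\nabla_{\rho(e_b)}e_c$ and $\nabla_{\rho(e_a)}e_b-\nabla_{\rho(e_b)}e_a$; they appear because components in a fixed frame are smeared with field-independent functions, and they vanish wherever $\omega=0$.) -/

import Mathlib

open Bundle
open scoped Manifold ContDiff

noncomputable section

namespace LASM

/-! ## Lie algebroids, E-differential forms, closed forms on the target -/

/-- The Euclidean model of the target: a chart takes values here. -/
abbrev Pt (d : ℕ) : Type := EuclideanSpace ℝ (Fin d)

section Target

variable {d r : ℕ} {M : Type*} [TopologicalSpace M] [ChartedSpace (Pt d) M]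
  [IsManifold (𝓡 d) ∞ M]
  (E : M → Type*) [TopologicalSpace (TotalSpace (EuclideanSpace ℝ (Fin r)) E)]
  [∀ x, AddCommGroup (E x)] [∀ x, Module ℝ (E x)] [∀ x, TopologicalSpace (E x)]
  [FiberBundle (EuclideanSpace ℝ (Fin r)) E] [VectorBundle ℝ (EuclideanSpace ℝ (Fin r)) E]

/-- `Γ(E)`: smooth global sections of the rank `r` vector bundle `E` over `M`. -/
abbrev Sec : Type _ := Cₛ^∞⟮𝓡 d; EuclideanSpace ℝ (Fin r), E⟯

/-- A Lie algebroid structure on `E`: a smooth bundle map `ρ : E → TM` and a Lie bracket on `Γ(E)`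
satisfying the Leibniz rule `[s, f t] = f [s, t] + (ρ(s) f) t`. -/
structure LieAlgebroid where
  anchor : ∀ x : M, E x →ₗ[ℝ] TangentSpace (𝓡 d) x
  anchor_smooth : ∀ s : Sec (d := d) (r := r) E,
    ContMDiff (𝓡 d) (𝓡 d).tangent ∞
      (fun x => (⟨x, anchor x (s x)⟩ : TangentBundle (𝓡 d) M))
  bracket : Sec (d := d) (r := r) E →ₗ[ℝ] Sec (d := d) (r := r) E →ₗ[ℝ] Sec (d := d) (r := r) E
  bracket_self : ∀ s, bracket s s = 0
  jacobi : ∀ s t u, bracket s (bracket t u) + bracket t (bracket u s) + bracket u (bracket s t) = 0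
  leibniz : ∀ (f : M → ℝ), ContMDiff (𝓡 d) 𝓘(ℝ, ℝ) ∞ f →
    ∀ s t ft : Sec (d := d) (r := r) E, (∀ x, ft x = f x • t x) →
      ∀ x, bracket s ft x = f x • bracket s t x + mvfderiv (𝓡 d) f x (anchor x (s x)) • t x

variable {E}

/-- A smooth `E`-`k`-form `J ∈ Γ(⋀ᵏ E*)`. -/
def IsSmoothEForm {k : ℕ} (J : ∀ x : M, E x [⋀^Fin k]→ₗ[ℝ] ℝ) : Prop :=
  ∀ s : Fin k → Sec (d := d) (r := r) E,
    ContMDiff (𝓡 d) 𝓘(ℝ, ℝ) ∞ (fun x => J x (fun i => s i x))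

/-- The Lie algebroid differential
`ᴱd α (s₀,…,s_m) = ∑ᵢ (-1)ⁱ ρ(sᵢ) α(…,ŝᵢ,…) + ∑_{i<j} (-1)^{i+j} α([sᵢ,sⱼ],…,ŝᵢ,…,ŝⱼ,…)`
of an `m`-form with `m = k + 1`, evaluated on sections. The pairs `i < j` of elements of
`Fin (k + 2)` are written `(i.castSucc, j.succ)` with `i ≤ j` in `Fin (k + 1)`, so that the sign
is `(-1)^{i + j + 1}`. -/
def LieAlgebroid.differential (L : LieAlgebroid (d := d) (r := r) E) {k : ℕ}
    (J : ∀ x : M, E x [⋀^Fin (k + 1)]→ₗ[ℝ] ℝ) (s : Fin (k + 2) → Sec (d := d) (r := r) E)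
    (x : M) : ℝ :=
  (∑ i : Fin (k + 2), (-1 : ℝ) ^ (i : ℕ) *
      mvfderiv (𝓡 d) (fun y => J y (fun l => i.removeNth s l y)) x (L.anchor x (s i x)))
    + ∑ i : Fin (k + 1), ∑ j ∈ Finset.Ici i, (-1 : ℝ) ^ ((i : ℕ) + (j : ℕ) + 1) *
        J x (Matrix.vecCons (L.bracket (s i.castSucc) (s j.succ) x)
          (fun l => j.removeNth (i.castSucc.removeNth s) l x))

/-- The bracket-compatible condition `ᴱd J = - ⟨⊗^{n+2} ρ, H⟩`. -/
def BracketCompatible (L : LieAlgebroid (d := d) (r := r) E) {n : ℕ}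
    (J : ∀ x : M, E x [⋀^Fin (n + 1)]→ₗ[ℝ] ℝ)
    (H : ∀ x : M, TangentSpace (𝓡 d) x [⋀^Fin (n + 2)]→L[ℝ] ℝ) : Prop :=
  ∀ (s : Fin (n + 2) → Sec (d := d) (r := r) E) (x : M),
    L.differential J s x = - H x (fun i => L.anchor x (s i x))

/-- The expression of a differential form in a chart (its pullback by the inverse of the chart). -/
def chartForm (c : OpenPartialHomeomorph M (Pt d)) {k : ℕ}
    (H : ∀ x : M, TangentSpace (𝓡 d) x [⋀^Fin k]→L[ℝ] ℝ) (y : Pt d) : Pt d [⋀^Fin k]→L[ℝ] ℝ :=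
  (H (c.symm y)).compContinuousLinearMap
    (mfderiv (𝓡 d) (𝓡 d) c.symm y : Pt d →L[ℝ] TangentSpace (𝓡 d) (c.symm y))

/-- `H ∈ Ωᵏ(M)` is smooth. -/
def IsSmoothForm {k : ℕ} (H : ∀ x : M, TangentSpace (𝓡 d) x [⋀^Fin k]→L[ℝ] ℝ) : Prop :=
  ∀ c ∈ IsManifold.maximalAtlas (𝓡 d) ∞ M, ContDiffOn ℝ ∞ (chartForm c H) c.target

/-- `dH = 0`. -/
def IsClosedForm {k : ℕ} (H : ∀ x : M, TangentSpace (𝓡 d) x [⋀^Fin k]→L[ℝ] ℝ) : Prop :=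
  ∀ c ∈ IsManifold.maximalAtlas (𝓡 d) ∞ M, ∀ y ∈ c.target, extDeriv (chartForm c H) y = 0

/-- The `E`-torsion `T(s, t) = ∇_{ρ(s)} t - ∇_{ρ(t)} s - [s, t]` of a connection `∇` on `E`. -/
def LieAlgebroid.torsion [∀ x, IsTopologicalAddGroup (E x)] [∀ x, ContinuousSMul ℝ (E x)]
    (L : LieAlgebroid (d := d) (r := r) E)
    (D : CovariantDerivative (𝓡 d) (EuclideanSpace ℝ (Fin r)) E)
    (s t : Sec (d := d) (r := r) E) (x : M) : E x :=
  D (fun y => t y) x (L.anchor x (s x)) - D (fun y => s y) x (L.anchor x (t x))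
    - L.bracket s t x

variable (E) in
/-- A system of local coordinates on the target: a chart of `M` together with sections
`e_a ∈ Γ(E)` which form a basis of the fibres over the domain of the chart. -/
structure Patch where
  chart : OpenPartialHomeomorph M (Pt d)
  chart_mem : chart ∈ IsManifold.maximalAtlas (𝓡 d) ∞ M
  frame : Fin r → Sec (d := d) (r := r) E
  isFrame : IsLocalFrameOn (𝓡 d) (EuclideanSpace ℝ (Fin r)) ∞ (fun a x => frame a x) chart.source

end Target

/-! ## Local coordinate expressions -/

/-- The target data in local coordinates, as functions of the coordinates `y ∈ dom`:
`rho y a = (ρ^i_a)_i`, `C y a b c = C_{ab}^c`, and the forms `J`, `H`. -/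
structure LocalTarget (d r n : ℕ) where
  dom : Set (Pt d)
  rho : Pt d → Fin r → Pt d
  C : Pt d → Fin r → Fin r → Fin r → ℝ
  J : Pt d → (Fin r → ℝ) [⋀^Fin (n + 1)]→ₗ[ℝ] ℝ
  H : Pt d → Pt d [⋀^Fin (n + 2)]→L[ℝ] ℝ

/-- The connection in local coordinates: `om y b i c = ω^c_{bi}`, that is `∇_i e_b = ω^c_{bi} e_c`,
and the components `T y a b c = T_{ab}^c` of the `E`-torsion. -/
structure LocalConnection (d r : ℕ) where
  om : Pt d → Fin r → Fin d → Fin r → ℝ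
  T : Pt d → Fin r → Fin r → Fin r → ℝ

section Coordinates

variable {d r n : ℕ} {M : Type*} [TopologicalSpace M] [ChartedSpace (Pt d) M]
  [IsManifold (𝓡 d) ∞ M]
  {E : M → Type*} [TopologicalSpace (TotalSpace (EuclideanSpace ℝ (Fin r)) E)]
  [∀ x, AddCommGroup (E x)] [∀ x, Module ℝ (E x)] [∀ x, TopologicalSpace (E x)]
  [FiberBundle (EuclideanSpace ℝ (Fin r)) E] [VectorBundle ℝ (EuclideanSpace ℝ (Fin r)) E]

/-- `ρ(e_a) = ρ^i_a ∂_i`, `[e_a, e_b] = C_{ab}^c e_c`, and `J`, `H` in the coordinates of a patch. -/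
def Patch.localTarget (P : Patch (d := d) (r := r) E) (L : LieAlgebroid (d := d) (r := r) E)
    (J : ∀ x : M, E x [⋀^Fin (n + 1)]→ₗ[ℝ] ℝ)
    (H : ∀ x : M, TangentSpace (𝓡 d) x [⋀^Fin (n + 2)]→L[ℝ] ℝ) : LocalTarget d r n where
  dom := P.chart.target
  rho y a := mfderiv (𝓡 d) (𝓡 d) P.chart (P.chart.symm y)
    (L.anchor (P.chart.symm y) (P.frame a (P.chart.symm y)))
  C y a b c := P.isFrame.coeff c (P.chart.symm y)
    (L.bracket (P.frame a) (P.frame b) (P.chart.symm y))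
  J y := (J (P.chart.symm y)).compLinearMap
    (Fintype.linearCombination ℝ (fun a => P.frame a (P.chart.symm y)))
  H y := chartForm P.chart H y

/-- A connection in the coordinates of a patch. -/
def Patch.localConnection [∀ x, IsTopologicalAddGroup (E x)] [∀ x, ContinuousSMul ℝ (E x)]
    (P : Patch (d := d) (r := r) E) (L : LieAlgebroid (d := d) (r := r) E)
    (D : CovariantDerivative (𝓡 d) (EuclideanSpace ℝ (Fin r)) E) : LocalConnection d r where
  om y b i c := P.isFrame.coeff c (P.chart.symm y)
    (D (fun x => P.frame b x) (P.chart.symm y)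
      (mfderiv (𝓡 d) (𝓡 d) P.chart.symm y (EuclideanSpace.single i (1 : ℝ))))
  T y a b c := P.isFrame.coeff c (P.chart.symm y)
    (L.torsion D (P.frame a) (P.frame b) (P.chart.symm y))

end Coordinates

/-- `∂_i f` for a function of the target coordinates. -/
def pd {d : ℕ} (i : Fin d) (f : Pt d → ℝ) (y : Pt d) : ℝ :=
  fderiv ℝ f y (EuclideanSpace.single i 1)

section Curvature

variable {d r n : ℕ} (m : LocalTarget d r n) (w : LocalConnection d r)

/-- The curvature, `[∇_i, ∇_j] e_a = R_{ija}^c e_c`. -/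
def curv (y : Pt d) (i j : Fin d) (a c : Fin r) : ℝ :=
  pd i (fun z => w.om z a j c) y - pd j (fun z => w.om z a i c) y
    + ∑ e, (w.om y a j e * w.om y e i c - w.om y a i e * w.om y e j c)

/-- `∇_i T_{ab}^c`. -/
def nablaT (y : Pt d) (i : Fin d) (a b c : Fin r) : ℝ :=
  pd i (fun z => w.T z a b c) y
    + ∑ e, (w.om y e i c * w.T y a b e - w.om y a i e * w.T y e b c - w.om y b i e * w.T y a e c)

/-- The basic curvature `S = ∇T + 2 Alt ι_ρ R`:
`S_{iab}^c = ∇_i T_{ab}^c + ρ^j_b R_{ija}^c - ρ^j_a R_{ijb}^c`. -/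
def basicCurv (y : Pt d) (i : Fin d) (a b c : Fin r) : ℝ :=
  nablaT w y i a b c + ∑ j, (m.rho y b j * curv w y i j a c - m.rho y a j * curv w y i j b c)

/-- `∇_j ρ^i_b = ∂_j ρ^i_b - ω^c_{bj} ρ^i_c`. -/
def nablaRho (y : Pt d) (j : Fin d) (b : Fin r) (i : Fin d) : ℝ :=
  pd j (fun z => m.rho z b i) y - ∑ c, w.om y b j c * m.rho y c i

/-- `(∇_i J)(v₀,…,v_n)`. -/
def nablaJ (y : Pt d) (i : Fin d) (v : Fin (n + 1) → (Fin r → ℝ)) : ℝ :=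
  pd i (fun z => m.J z v) y
    - ∑ k, m.J y (Function.update v k (fun c => ∑ b, v k b * w.om y b i c))

end Curvature

/-! ## Field space over the spatial torus `Tⁿ` -/

/-- Coordinates `σ = (σ¹,…,σⁿ)` on the universal cover of the torus `Tⁿ = ℝⁿ/ℤⁿ`. -/
abbrev Sp (n : ℕ) : Type := Fin n → ℝ

/-- Smooth functions on `Tⁿ`, as smooth `ℤⁿ`-periodic functions on `ℝⁿ`. -/
def IsTorusFun {n : ℕ} {V : Type*} [NormedAddCommGroup V] [NormedSpace ℝ V]
    (f : Sp n → V) : Prop :=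
  ContDiff ℝ ∞ f ∧ ∀ (σ : Sp n) (k : Fin n → ℤ), f (σ + fun μ => (k μ : ℝ)) = f σ

/-- `∂_μ f`. -/
def dd {n : ℕ} {V : Type*} [NormedAddCommGroup V] [NormedSpace ℝ V] (μ : Fin n) (f : Sp n → V)
    (σ : Sp n) : V :=
  fderiv ℝ f σ (Pi.single μ 1)

/-- The integral over `Tⁿ`. -/
def torusInt {n : ℕ} (f : Sp n → ℝ) : ℝ := ∫ σ in Set.Icc (0 : Sp n) 1, f σ

/-- The spatial components of the fields in local coordinates of the target:
`X σ i = X^i`; `A σ μ a = A^a_μ`; `Y σ μ a = (1/(n-1)!) ε^{μ ν₂…ν_n} Y_{ν₂…ν_n a}` for the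
`(n-1)`-form `Y_a`; `Z σ i = (1/n!) ε^{μ₁…μ_n} Z_{μ₁…μ_n i}` for the `n`-form `Z_i`.
The same type is used for variations of the fields and for gradients of functionals. -/
@[ext]
structure Fields (d r n : ℕ) where
  X : Sp n → Pt d
  A : Sp n → Fin n → (Fin r → ℝ)
  Y : Sp n → Fin n → (Fin r → ℝ)
  Z : Sp n → (Fin d → ℝ)

namespace Fields

variable {d r n : ℕ}

/-- All components are smooth functions on `Tⁿ`. -/
def Smooth (φ : Fields d r n) : Prop :=
  IsTorusFun φ.X ∧ IsTorusFun φ.A ∧ IsTorusFun φ.Y ∧ IsTorusFun φ.Z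

/-- `φ + t ψ`. -/
def vary (φ ψ : Fields d r n) (t : ℝ) : Fields d r n where
  X σ := φ.X σ + t • ψ.X σ
  A σ := φ.A σ + t • ψ.A σ
  Y σ := φ.Y σ + t • ψ.Y σ
  Z σ := φ.Z σ + t • ψ.Z σ

/-- The pointwise pairing of a gradient with a variation. -/
def pairing (g ψ : Fields d r n) (σ : Sp n) : ℝ :=
  (∑ i, g.X σ i * ψ.X σ i) + (∑ μ, ∑ a, g.A σ μ a * ψ.A σ μ a)
    + (∑ μ, ∑ a, g.Y σ μ a * ψ.Y σ μ a) + ∑ i, g.Z σ i * ψ.Z σ i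

end Fields

section Hamiltonian

variable {d r n : ℕ}

/-- `g = (δF/δX, δF/δA, δF/δY, δF/δZ)` is the functional derivative of `F` at `φ`. -/
def HasGradient (F : Fields d r n → ℝ) (φ g : Fields d r n) : Prop :=
  g.Smooth ∧ ∀ ψ : Fields d r n, ψ.Smooth →
    HasDerivAt (fun t : ℝ => F (φ.vary ψ t)) (torusInt (g.pairing ψ)) 0

variable (m : LocalTarget d r n)

/-- Fields on `Tⁿ` whose map `X` takes values in the coordinate domain. -/
def IsField (φ : Fields d r n) : Prop := φ.Smooth ∧ ∀ σ, φ.X σ ∈ m.dom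

/-- The Poisson bivector of the field space, contracted with two gradients. The momenta
`δS/δẊ^i = (-1)ⁿ Z_i + (1/n!) B_{i j₁…j_n} ∂X^{j₁}⋯` (with `H = dB` locally) and
`δS/δȦ^a_μ = Y^μ_a` of the action
`S = ∫_Σ (Z_i ∧ dX^i + Y_a ∧ dA^a + …) + ∫_N X^*H` give
`{X^i(σ), Z_j(σ')} = (-1)ⁿ δ^i_j δ(σ-σ')`, `{A^a_μ(σ), Y^ν_b(σ')} = δ^a_b δ^ν_μ δ(σ-σ')`,
`{Z_i(σ), Z_j(σ')} = H(∂_i, ∂_j, ∂₁X, …, ∂_nX) δ(σ-σ')`; the last coefficient is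
`(1/n!) H_{ij k₁…k_n} (dX^{k₁} ∧ … ∧ dX^{k_n})^{(s)}`. -/
def bivector (φ g g' : Fields d r n) (σ : Sp n) : ℝ :=
  (-1 : ℝ) ^ n * (∑ i, (g.X σ i * g'.Z σ i - g.Z σ i * g'.X σ i))
    + (∑ μ, ∑ a, (g.A σ μ a * g'.Y σ μ a - g.Y σ μ a * g'.A σ μ a))
    + ∑ i, ∑ j, g.Z σ i * g'.Z σ j *
        m.H (φ.X σ) (Matrix.vecCons (EuclideanSpace.single i 1)
          (Matrix.vecCons (EuclideanSpace.single j 1) (fun μ => dd μ φ.X σ)))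

/-- `F` and `G` have functional derivatives at `φ`, and `{F, G}(φ) = v`. -/
def HasBracket (F G : Fields d r n → ℝ) (φ : Fields d r n) (v : ℝ) : Prop :=
  ∃ g g' : Fields d r n, HasGradient F φ g ∧ HasGradient G φ g' ∧
    torusInt (bivector m φ g g') = v

/-- `∫ f(σ) D(φ)(σ) dσ`. -/
def smear (D : Fields d r n → Sp n → ℝ) (f : Sp n → ℝ) (φ : Fields d r n) : ℝ :=
  torusInt (fun σ => f σ * D φ σ)

/-- `{D₁(σ), D₂(σ')} = B(σ) δ(σ - σ')` at the field `φ`, tested against all pairs of smooth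
functions on `Tⁿ`. -/
def LocalBracket (D₁ D₂ : Fields d r n → Sp n → ℝ) (φ : Fields d r n) (B : Sp n → ℝ) : Prop :=
  ∀ f g : Sp n → ℝ, IsTorusFun f → IsTorusFun g →
    HasBracket m (smear D₁ f) (smear D₂ g) φ (torusInt (fun σ => f σ * g σ * B σ))

/-! ## Constraints -/

/-- `G_X^i = (dX^i - ρ^i_a A^a)^{(s)}`, component `μ`. -/
def GX (φ : Fields d r n) (σ : Sp n) (μ : Fin n) : Pt d :=
  dd μ φ.X σ - ∑ a, φ.A σ μ a • m.rho (φ.X σ) a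

/-- `G_A^a = (dA^a + ½ C^a_{bc} A^b ∧ A^c)^{(s)}`, component `(μ, ν)`. -/
def GA (φ : Fields d r n) (σ : Sp n) (μ ν : Fin n) (a : Fin r) : ℝ :=
  dd μ φ.A σ ν a - dd ν φ.A σ μ a
    + ∑ b, ∑ c, m.C (φ.X σ) b c a * φ.A σ μ b * φ.A σ ν c

/-- `G_{Ya} = (dY_a + (-1)^{n+1} ρ^i_a Z_i + (-1)^{n-1} C_{ab}^c Y_c ∧ A^b
  + (1/n!) J_{a b₂…b_{n+1}} A^{b₂} ∧ … ∧ A^{b_{n+1}})^{(s)}`.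
Here `(dY)^{(s)} = ∂_μ Y^μ`, `(-1)^{n-1} (Y ∧ A)^{(s)} = Y^μ A_μ`, and the last term is
`J(e_a, A_1, …, A_n)`. -/
def GY (φ : Fields d r n) (σ : Sp n) (a : Fin r) : ℝ :=
  (∑ μ, dd μ φ.Y σ μ a) + (-1 : ℝ) ^ (n + 1) * (∑ i, m.rho (φ.X σ) a i * φ.Z σ i)
    + (∑ μ, ∑ b, ∑ c, m.C (φ.X σ) a b c * φ.Y σ μ c * φ.A σ μ b)
    + m.J (φ.X σ) (Matrix.vecCons (Pi.single a 1) (φ.A σ))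

/-- Labels of the components of the constraints `G_X^i`, `G_A^a`, `G_{Ya}`. -/
abbrev Label (d r n : ℕ) : Type := (Fin n × Fin d) ⊕ (Fin n × Fin n × Fin r) ⊕ Fin r

/-- All the component constraints. -/
def constraint : Label d r n → Fields d r n → Sp n → ℝ
  | .inl (μ, i), φ, σ => GX m φ σ μ i
  | .inr (.inl (μ, ν, a)), φ, σ => GA m φ σ μ ν a
  | .inr (.inr a), φ, σ => GY m φ σ a

/-- The constraints generate a closed algebra under Poisson brackets:
`{G_K(σ), G_L(σ')} = ∑_N c_{KL}^N(φ, σ) G_N(σ) δ(σ - σ')` with field dependent structure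
functions `c_{KL}^N`. -/
def ClosedAlgebra : Prop :=
  ∀ K L : Label d r n, ∃ c : Fields d r n → Label d r n → Sp n → ℝ,
    ∀ φ, IsField m φ → (∀ N, IsTorusFun (c φ N)) ∧
      LocalBracket m (constraint m K) (constraint m L) φ
        (fun σ => ∑ N, c φ N σ * constraint m N φ σ)

/-- `(1/n!) ρ^i_a ρ^j_b H_{ij k₁…k_n} ∑_m (dX^{k₁} ∧ … ∧ dX^{k_{m-1}} ∧ G_X^{k_m} ∧
ρ^{k_{m+1}}_c A^c ∧ … ∧ ρ^{k_n}_c A^c)^{(s)}`, as the telescoping sum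
`∑_μ H(ρ_a, ρ_b, ∂₁X, …, ∂_{μ-1}X, G_{Xμ}, ρ(A_{μ+1}), …, ρ(A_n))`. -/
def HTerm (φ : Fields d r n) (σ : Sp n) (a b : Fin r) : ℝ :=
  ∑ μ : Fin n, m.H (φ.X σ) (Matrix.vecCons (m.rho (φ.X σ) a) (Matrix.vecCons (m.rho (φ.X σ) b)
    (fun ν => if ν < μ then dd ν φ.X σ else if ν = μ then GX m φ σ μ
      else ∑ c, φ.A σ ν c • m.rho (φ.X σ) c)))

/-- The arguments `(e_a, A_1, …, e_b, …, A_n)` with `e_b` in the place of `A_μ`. Thus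
`∑_μ K(slot μ) θ_μ = (1/(n-1)!) K_{ab c₃…c_{n+1}} (θ ∧ A^{c₃} ∧ … ∧ A^{c_{n+1}})^{(s)}`
for a `1`-form `θ`. -/
def slot (φ : Fields d r n) (σ : Sp n) (a b : Fin r) (μ : Fin n) : Fin (n + 1) → (Fin r → ℝ) :=
  Matrix.vecCons (Pi.single a 1) (Function.update (φ.A σ) μ (Pi.single b 1))

/-- `(1/(n-2)!) J_{abc e₄…e_{n+1}} (Θ^c ∧ A^{e₄} ∧ … ∧ A^{e_{n+1}})^{(s)}` for a `2`-form `Θ`: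
the sum over `μ < ν` of `J(e_a, A_1, …, e_b, …, Θ_{μν}, …, A_n)` with `e_b` in the place of `A_μ`
and `Θ_{μν}` in the place of `A_ν`. -/
def JTerm (φ : Fields d r n) (σ : Sp n) (a b : Fin r) (Θ : Fin n → Fin n → (Fin r → ℝ)) : ℝ :=
  ∑ μ : Fin n, ∑ ν ∈ Finset.Ioi μ, m.J (φ.X σ) (Matrix.vecCons (Pi.single a 1)
    (Function.update (Function.update (φ.A σ) μ (Pi.single b 1)) ν (Θ μ ν)))

/-- The explicit constraint algebra in local coordinates. -/
structure ExplicitAlgebra (φ : Fields d r n) : Prop where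
  XX : ∀ μ ν i j, LocalBracket m (fun φ σ => GX m φ σ μ i) (fun φ σ => GX m φ σ ν j) φ 0
  XA : ∀ μ κ ν i a, LocalBracket m (fun φ σ => GX m φ σ μ i) (fun φ σ => GA m φ σ κ ν a) φ 0
  XY : ∀ μ i a, LocalBracket m (fun φ σ => GX m φ σ μ i) (fun φ σ => GY m φ σ a) φ
    (fun σ => -∑ j, pd j (fun y => m.rho y a i) (φ.X σ) * GX m φ σ μ j)
  AA : ∀ μ ν κ τ a b,
    LocalBracket m (fun φ σ => GA m φ σ μ ν a) (fun φ σ => GA m φ σ κ τ b) φ 0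
  AY : ∀ μ ν a b, LocalBracket m (fun φ σ => GA m φ σ μ ν a) (fun φ σ => GY m φ σ b) φ
    (fun σ => (∑ c, m.C (φ.X σ) b c a * GA m φ σ μ ν c)
      - ∑ i, ∑ c, pd i (fun y => m.C y b c a) (φ.X σ) *
          (φ.A σ μ c * GX m φ σ ν i - φ.A σ ν c * GX m φ σ μ i))
  YY : ∀ a b, LocalBracket m (fun φ σ => GY m φ σ a) (fun φ σ => GY m φ σ b) φ
    (fun σ => (∑ c, m.C (φ.X σ) a b c * GY m φ σ c)
      + (∑ μ, ∑ i, ((∑ c, pd i (fun y => m.C y a b c) (φ.X σ) * φ.Y σ μ c)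
          + pd i (fun y => m.J y (slot φ σ a b μ)) (φ.X σ)) * GX m φ σ μ i)
      + JTerm m φ σ a b (GA m φ σ)
      + HTerm m φ σ a b)

/-! ## Covariantized constraints -/

variable (w : LocalConnection d r)

/-- `G_A^{∇a} = (∇A^a - ½ T^a_{bc} A^b ∧ A^c)^{(s)}` with
`∇A^a = dA^a - ω^a_{bi} A^b ∧ dX^i`. -/
def GAcov (φ : Fields d r n) (σ : Sp n) (μ ν : Fin n) (a : Fin r) : ℝ :=
  dd μ φ.A σ ν a - dd ν φ.A σ μ a
    - (∑ b, ∑ i, w.om (φ.X σ) b i a *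
        (φ.A σ μ b * dd ν φ.X σ i - φ.A σ ν b * dd μ φ.X σ i))
    - ∑ b, ∑ c, w.T (φ.X σ) b c a * φ.A σ μ b * φ.A σ ν c

/-- `Z^∇_i = (Z_i + ω^c_{bi} Y_c ∧ A^b)^{(s)}`, for which
`Z_i ∧ dX^i + Y_a ∧ dA^a = Z^∇_i ∧ dX^i + Y_a ∧ ∇A^a`. -/
def Zcov (φ : Fields d r n) (σ : Sp n) (i : Fin d) : ℝ :=
  φ.Z σ i + (-1 : ℝ) ^ (n + 1) *
    ∑ μ, ∑ b, ∑ c, w.om (φ.X σ) b i c * φ.Y σ μ c * φ.A σ μ b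

/-- `G^∇_{Ya} = (∇Y_a + (-1)^{n+1} ρ^i_a Z^∇_i + (-1)ⁿ T_{ab}^c Y_c ∧ A^b
  + (1/n!) J_{a b₂…b_{n+1}} A^{b₂} ∧ … ∧ A^{b_{n+1}})^{(s)}` with
`∇Y_a = dY_a + (-1)ⁿ ω^c_{ai} Y_c ∧ dX^i`. -/
def GYcov (φ : Fields d r n) (σ : Sp n) (a : Fin r) : ℝ :=
  (∑ μ, (dd μ φ.Y σ μ a - ∑ c, ∑ i, w.om (φ.X σ) a i c * φ.Y σ μ c * dd μ φ.X σ i))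
    + (-1 : ℝ) ^ (n + 1) * (∑ i, m.rho (φ.X σ) a i * Zcov w φ σ i)
    - (∑ μ, ∑ b, ∑ c, w.T (φ.X σ) a b c * φ.Y σ μ c * φ.A σ μ b)
    + m.J (φ.X σ) (Matrix.vecCons (Pi.single a 1) (φ.A σ))

/-- The explicit constraint algebra in terms of a connection. The combinations
`ρ^i_b ω^a_{ci}` and `ρ^i_a ω^c_{bi}` are the components of `∇_{ρ(e_b)} e_c` and
`∇_{ρ(e_a)} e_b`; they are present because the constraints are smeared in a fixed frame `e_a`. -/
structure CovariantAlgebra (φ : Fields d r n) : Prop where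
  A_eq : ∀ σ μ ν a, GAcov w φ σ μ ν a = GA m φ σ μ ν a
    - ∑ b, ∑ i, w.om (φ.X σ) b i a * (φ.A σ μ b * GX m φ σ ν i - φ.A σ ν b * GX m φ σ μ i)
  Y_eq : ∀ σ a, GYcov m w φ σ a = GY m φ σ a
    - ∑ μ, ∑ c, ∑ i, w.om (φ.X σ) a i c * φ.Y σ μ c * GX m φ σ μ i
  XX : ∀ μ ν i j, LocalBracket m (fun φ σ => GX m φ σ μ i) (fun φ σ => GX m φ σ ν j) φ 0
  XA : ∀ μ κ ν i a, LocalBracket m (fun φ σ => GX m φ σ μ i) (fun φ σ => GAcov w φ σ κ ν a) φ 0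
  XY : ∀ μ i b, LocalBracket m (fun φ σ => GX m φ σ μ i) (fun φ σ => GYcov m w φ σ b) φ
    (fun σ => -∑ j, nablaRho m w (φ.X σ) j b i * GX m φ σ μ j)
  AA : ∀ μ ν κ τ a b,
    LocalBracket m (fun φ σ => GAcov w φ σ μ ν a) (fun φ σ => GAcov w φ σ κ τ b) φ 0
  AY : ∀ μ ν a b, LocalBracket m (fun φ σ => GAcov w φ σ μ ν a) (fun φ σ => GYcov m w φ σ b) φ
    (fun σ => (∑ c, (-w.T (φ.X σ) b c a + ∑ i, m.rho (φ.X σ) b i * w.om (φ.X σ) c i a)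
          * GAcov w φ σ μ ν c)
      + (∑ i, ∑ c, basicCurv m w (φ.X σ) i b c a *
          (φ.A σ μ c * GX m φ σ ν i - φ.A σ ν c * GX m φ σ μ i))
      - ∑ i, ∑ j, curv w (φ.X σ) i j b a * GX m φ σ μ i * GX m φ σ ν j)
  YY : ∀ a b, LocalBracket m (fun φ σ => GYcov m w φ σ a) (fun φ σ => GYcov m w φ σ b) φ
    (fun σ => (∑ c, (-w.T (φ.X σ) a b c
          + ∑ i, (m.rho (φ.X σ) a i * w.om (φ.X σ) b i c - m.rho (φ.X σ) b i * w.om (φ.X σ) a i c))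
          * GYcov m w φ σ c)
      + (∑ μ, ∑ i, (-(∑ c, basicCurv m w (φ.X σ) i a b c * φ.Y σ μ c)
          + nablaJ m w (φ.X σ) i (slot φ σ a b μ)) * GX m φ σ μ i)
      + JTerm m φ σ a b (GAcov w φ σ)
      + HTerm m φ σ a b)

end Hamiltonian

section FirstClass

variable {d r n : ℕ} {M : Type*} [TopologicalSpace M] [ChartedSpace (Pt d) M]
  [IsManifold (𝓡 d) ∞ M]
  {E : M → Type*} [TopologicalSpace (TotalSpace (EuclideanSpace ℝ (Fin r)) E)]
  [∀ x, AddCommGroup (E x)] [∀ x, Module ℝ (E x)] [∀ x, TopologicalSpace (E x)]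
  [FiberBundle (EuclideanSpace ℝ (Fin r)) E] [VectorBundle ℝ (EuclideanSpace ℝ (Fin r)) E]

/-- The constraints `G_X`, `G_A`, `G_Y` are first class: in all local coordinates of the target
they generate a closed algebra under Poisson brackets. -/
def FirstClass (L : LieAlgebroid (d := d) (r := r) E)
    (J : ∀ x : M, E x [⋀^Fin (n + 1)]→ₗ[ℝ] ℝ)
    (H : ∀ x : M, TangentSpace (𝓡 d) x [⋀^Fin (n + 2)]→L[ℝ] ℝ) : Prop :=
  ∀ P : Patch (d := d) (r := r) E, ClosedAlgebra (P.localTarget L J H)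

end FirstClass

end LASM

end

/-!
# The constraint algebra of the sigma model of a Lie algebroid with a bracket-compatible form

A smeared constraint is the integral over the torus of a density: a smooth function of the first
jet of the fields, times the smearing function. Integration by parts represents the variation of
such an integral by the Euler expressions of its density, and a pairing with all smooth variations
determines the representing functions, so the brackets may be computed with these. A Poisson
bracket with a constraint `F₂` is then the variation along the Hamiltonian vector field of `F₂`; if
along that field the density `F₁` changes by the smearing function times some `B`, without its
derivatives, then `{F₁(σ), F₂(σ')} = B(σ) δ(σ - σ')` (`densityBracket_of_variation`). All brackets
of the constraints are of this ultralocal kind. The Hamiltonian field of `G_Y` is an infinitesimal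
gauge transformation by a section of `E`; its brackets with `G_X` and `G_A` reduce to the fact that
`ρ` is a homomorphism of brackets and to the Jacobi identity.

The bracket `{G_Y, G_Y}` (`densityBracket_YY`) is the asserted combination of constraints plus one
further term, `defect`. To see this, `dX` and `dA` are rewritten as `G_X + ρ(A)` and
`G_A - ½[A ∧ A]`; the form `H(ρ(a), ρ(b), dX, …, dX)` telescopes, which gives the terms `𝓗_ab` and
leaves `H(ρ(a), ρ(b), ρ(A), …, ρ(A))`. Together with what `J` leaves, this is the value of
`ᴱdJ + ⟨⊗ρ, H⟩` on the sections with constant components `a, b, A_1, …, A_n`. Hence the algebra is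
closed if `defect` vanishes (`closedAlgebra_of_defect`). Conversely, fields exist with prescribed
`X` and `A` at one point of the torus on which all constraints vanish at that point: `dX` and `dA`
can be prescribed there by sines, and `Y = 0`, while a suitable `dY` makes `G_Y` vanish. On such a
field closure forces `defect` to vanish (`defect_eq_zero_of_closedAlgebra`).

The covariant constraints differ from the original ones by multiples of `G_X` with coefficients
that depend on the fields without derivatives. So their brackets follow from the same computation
of variations, and the connection terms recombine into torsion, curvature and basic curvature
(`covariantAlgebra`).

It remains to pass between a coordinate patch and the manifold. The Jacobi and Leibniz identities
imply that `ρ` is a homomorphism of brackets (`LieAlgebroid.anchor_bracket`), so that in a patch the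
structure functions satisfy the local identities (`Patch.isLieAlgebroid`), and `defect` is the value
of `ᴱdJ + ⟨⊗ρ, H⟩` on frame sections (`anomaly_sec`). This expression is alternating and linear over
functions, so it vanishes on all sections once it vanishes on frames (`anomaly_eq_zero_of_frame`);
and every point lies in a patch (`exists_patch`). Closedness of `H` plays no part here: it is the
Jacobi identity of the Poisson bracket, which is not needed to compute the brackets.
-/

noncomputable section

namespace LASM

/-! ### Calculus on the torus -/

section Torus

variable {n : ℕ} {V W : Type*} [NormedAddCommGroup V] [NormedSpace ℝ V]
  [NormedAddCommGroup W] [NormedSpace ℝ W]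

theorem IsTorusFun.differentiable {f : Sp n → V} (hf : IsTorusFun f) : Differentiable ℝ f :=
  hf.1.differentiable (by simp)

theorem IsTorusFun.continuous {f : Sp n → V} (hf : IsTorusFun f) : Continuous f :=
  hf.1.continuous

theorem isTorusFun_const (v : V) : IsTorusFun (fun _ : Sp n => v) :=
  ⟨contDiff_const, fun _ _ => rfl⟩

theorem IsTorusFun.add {f g : Sp n → V} (hf : IsTorusFun f) (hg : IsTorusFun g) :
    IsTorusFun (fun σ => f σ + g σ) :=
  ⟨hf.1.add hg.1, fun σ k => by simp only [hf.2 σ k, hg.2 σ k]⟩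

theorem IsTorusFun.sub {f g : Sp n → V} (hf : IsTorusFun f) (hg : IsTorusFun g) :
    IsTorusFun (fun σ => f σ - g σ) :=
  ⟨hf.1.sub hg.1, fun σ k => by simp only [hf.2 σ k, hg.2 σ k]⟩

theorem IsTorusFun.neg {f : Sp n → V} (hf : IsTorusFun f) : IsTorusFun (fun σ => -f σ) :=
  ⟨hf.1.neg, fun σ k => by simp only [hf.2 σ k]⟩

theorem IsTorusFun.smul {f : Sp n → ℝ} {g : Sp n → V} (hf : IsTorusFun f) (hg : IsTorusFun g) :
    IsTorusFun (fun σ => f σ • g σ) :=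
  ⟨hf.1.smul hg.1, fun σ k => by simp only [hf.2 σ k, hg.2 σ k]⟩

theorem IsTorusFun.mul {f g : Sp n → ℝ} (hf : IsTorusFun f) (hg : IsTorusFun g) :
    IsTorusFun (fun σ => f σ * g σ) :=
  hf.smul hg

theorem IsTorusFun.sum {ι : Type*} {s : Finset ι} {f : ι → Sp n → V}
    (hf : ∀ i ∈ s, IsTorusFun (f i)) : IsTorusFun (fun σ => ∑ i ∈ s, f i σ) :=
  ⟨ContDiff.sum fun i hi => (hf i hi).1,
    fun σ k => Finset.sum_congr rfl fun i hi => (hf i hi).2 σ k⟩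

theorem IsTorusFun.clm_apply {L : Sp n → V →L[ℝ] W} {f : Sp n → V} (hL : IsTorusFun L)
    (hf : IsTorusFun f) : IsTorusFun (fun σ => L σ (f σ)) :=
  ⟨hL.1.clm_apply hf.1, fun σ k => by simp only [hf.2 σ k, hL.2 σ k]⟩

theorem IsTorusFun.prodMk {f : Sp n → V} {g : Sp n → W} (hf : IsTorusFun f)
    (hg : IsTorusFun g) : IsTorusFun (fun σ => (f σ, g σ)) :=
  ⟨hf.1.prodMk hg.1, fun σ k => by simp only [hf.2 σ k, hg.2 σ k]⟩

theorem isTorusFun_pi {ι : Type*} [Fintype ι] {V : ι → Type*}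
    [∀ i, NormedAddCommGroup (V i)] [∀ i, NormedSpace ℝ (V i)] {f : Sp n → ∀ i, V i} :
    IsTorusFun f ↔ ∀ i, IsTorusFun (fun σ => f σ i) :=
  ⟨fun h i => ⟨contDiff_pi.1 h.1 i, fun σ k => congrFun (h.2 σ k) i⟩,
    fun h => ⟨contDiff_pi.2 fun i => (h i).1, fun σ k => funext fun i => (h i).2 σ k⟩⟩

theorem isTorusFun_euclidean {d : ℕ} {f : Sp n → Pt d} :
    IsTorusFun f ↔ ∀ i, IsTorusFun (fun σ => f σ i) :=
  ⟨fun h i => ⟨contDiff_euclidean.1 h.1 i, fun σ k => by simp only [h.2 σ k]⟩,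
    fun h => ⟨contDiff_euclidean.2 fun i => (h i).1, fun σ k => by
      ext i; exact (h i).2 σ k⟩⟩

theorem IsTorusFun.comp {U : Set V} (hU : IsOpen U) {F : V → W} (hF : ContDiffOn ℝ ∞ F U)
    {f : Sp n → V} (hf : IsTorusFun f) (hm : ∀ σ, f σ ∈ U) : IsTorusFun (fun σ => F (f σ)) :=
  ⟨contDiff_iff_contDiffAt.2 fun σ =>
    (hF.contDiffAt (hU.mem_nhds (hm σ))).comp σ hf.1.contDiffAt,
    fun σ k => by simp only [hf.2 σ k]⟩

theorem IsTorusFun.dd {f : Sp n → V} (hf : IsTorusFun f) (μ : Fin n) :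
    IsTorusFun (LASM.dd μ f) := by
  refine ⟨(hf.1.fderiv_right (m := ∞) (by simp)).clm_apply contDiff_const, fun σ k => ?_⟩
  have h : (fun τ => f (τ + fun μ => (k μ : ℝ))) = f := funext fun τ => hf.2 τ k
  unfold LASM.dd
  rw [← fderiv_comp_add_right, h]

theorem dd_add {f g : Sp n → V} (hf : IsTorusFun f) (hg : IsTorusFun g) (μ : Fin n) (σ : Sp n) :
    dd μ (fun τ => f τ + g τ) σ = dd μ f σ + dd μ g σ := by
  unfold dd
  rw [fderiv_fun_add hf.differentiable.differentiableAt hg.differentiable.differentiableAt]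
  rfl

theorem dd_smul {f : Sp n → ℝ} {g : Sp n → V} (hf : IsTorusFun f) (hg : IsTorusFun g)
    (μ : Fin n) (σ : Sp n) :
    dd μ (fun τ => f τ • g τ) σ = dd μ f σ • g σ + f σ • dd μ g σ := by
  unfold dd
  rw [fderiv_fun_smul hf.differentiable.differentiableAt hg.differentiable.differentiableAt]
  simp [add_comm]

theorem dd_mul {f g : Sp n → ℝ} (hf : IsTorusFun f) (hg : IsTorusFun g)
    (μ : Fin n) (σ : Sp n) :
    dd μ (fun τ => f τ * g τ) σ = dd μ f σ * g σ + f σ * dd μ g σ :=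
  dd_smul hf hg μ σ

theorem dd_clm (L : V →L[ℝ] W) {f : Sp n → V} (hf : IsTorusFun f) (μ : Fin n) (σ : Sp n) :
    dd μ (fun τ => L (f τ)) σ = L (dd μ f σ) := by
  unfold dd
  have h := L.hasFDerivAt.comp σ hf.differentiable.differentiableAt.hasFDerivAt
  have h2 : HasFDerivAt (fun τ => L (f τ)) (L.comp (fderiv ℝ f σ)) σ := h
  rw [h2.fderiv]
  rfl

theorem dd_apply {ι : Type*} [Fintype ι] {f : Sp n → ι → V} (hf : IsTorusFun f) (i : ι)
    (μ : Fin n) (σ : Sp n) : dd μ (fun τ => f τ i) σ = dd μ f σ i :=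
  dd_clm (ContinuousLinearMap.proj (R := ℝ) (φ := fun _ : ι => V) i) hf μ σ

theorem dd_comm {f : Sp n → V} (hf : IsTorusFun f) (μ ν : Fin n) (σ : Sp n) :
    dd μ (dd ν f) σ = dd ν (dd μ f) σ := by
  have h2 : DifferentiableAt ℝ (fderiv ℝ f) σ :=
    (hf.1.fderiv_right (m := 1) (by norm_cast)).differentiable (by simp) σ
  have key : ∀ μ ν : Fin n, dd μ (dd ν f) σ
      = fderiv ℝ (fderiv ℝ f) σ (Pi.single μ 1) (Pi.single ν 1) := by
    intro μ ν
    unfold dd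
    have := (h2.hasFDerivAt.clm_apply (hasFDerivAt_const (Pi.single ν (1 : ℝ)) σ)).fderiv
    rw [this]
    simp
  rw [key, key]
  have hs : IsSymmSndFDerivAt ℝ f σ :=
    (hf.1.contDiffAt (x := σ)).isSymmSndFDerivAt (by simpa using ENat.LEInfty.out)
  exact hs _ _

theorem torusInt_add {f g : Sp n → ℝ} (hf : IsTorusFun f) (hg : IsTorusFun g) :
    torusInt (fun σ => f σ + g σ) = torusInt f + torusInt g :=
  MeasureTheory.integral_add (hf.continuous.continuousOn.integrableOn_compact isCompact_Icc)
    (hg.continuous.continuousOn.integrableOn_compact isCompact_Icc)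

theorem torusInt_neg (f : Sp n → ℝ) : torusInt (fun σ => -f σ) = -torusInt f :=
  MeasureTheory.integral_neg _

theorem torusInt_sum {ι : Type*} {s : Finset ι} {f : ι → Sp n → ℝ}
    (hf : ∀ i ∈ s, IsTorusFun (f i)) :
    torusInt (fun σ => ∑ i ∈ s, f i σ) = ∑ i ∈ s, torusInt (f i) :=
  MeasureTheory.integral_finsetSum _ fun i hi =>
    (hf i hi).continuous.continuousOn.integrableOn_compact isCompact_Icc

/-- Stokes' theorem on the torus. -/
theorem torusInt_dd {h : Sp n → ℝ} (hh : IsTorusFun h) (μ : Fin n) : torusInt (dd μ h) = 0 := by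
  obtain _ | k := n
  · exact μ.elim0
  have hc : Continuous (dd μ h) := (hh.dd μ).continuous
  have e : ∀ σ, ∑ i, (if i = μ then fderiv ℝ h σ else 0) (Pi.single i 1) = dd μ h σ := by
    intro σ
    rw [Finset.sum_eq_single μ (by intro b _ hb; simp [hb]) (by simp)]
    simp [dd]
  have key := MeasureTheory.integral_divergence_of_hasFDerivAt_off_countable'
    (0 : Fin (k + 1) → ℝ) 1 (fun _ => zero_le_one)
    (fun i σ => if i = μ then h σ else 0)
    (fun i σ => if i = μ then fderiv ℝ h σ else 0) ∅ Set.countable_empty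
    (fun i => by
      by_cases hi : i = μ
      · simpa [hi] using hh.continuous.continuousOn
      · simpa [hi] using continuousOn_const)
    (fun x _ i => by
      by_cases hi : i = μ
      · simpa [hi] using hh.differentiable.differentiableAt.hasFDerivAt
      · simpa [hi] using hasFDerivAt_const (0 : ℝ) x)
    (by
      simp only [e]
      exact hc.continuousOn.integrableOn_compact isCompact_Icc)
  simp only [e] at key
  rw [torusInt, key, Finset.sum_eq_single μ (by intro b _ hb; simp [hb]) (by simp)]
  simp only [if_true]
  rw [sub_eq_zero]
  congr 1
  funext x
  have := hh.2 (Fin.insertNth μ 0 x) (Pi.single μ 1)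
  refine Eq.trans ?_ this
  congr 1
  funext i
  refine Fin.succAboveCases μ ?_ (fun j => ?_) i <;> simp

theorem torusInt_parts {f g : Sp n → ℝ} (hf : IsTorusFun f) (hg : IsTorusFun g) (μ : Fin n) :
    torusInt (fun σ => -dd μ f σ * g σ) = torusInt (fun σ => f σ * dd μ g σ) := by
  have h := torusInt_dd (hf.mul hg) μ
  have h1 : dd μ (fun τ => f τ * g τ) = fun σ => dd μ f σ * g σ + f σ * dd μ g σ :=
    funext fun σ => dd_mul hf hg μ σ
  rw [h1, torusInt_add ((hf.dd μ).mul hg) (hf.mul (hg.dd μ))] at h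
  simp only [neg_mul, torusInt_neg]
  linarith

theorem torusInt_congr {f g : Sp n → ℝ} (h : ∀ σ, f σ = g σ) : torusInt f = torusInt g := by
  rw [show f = g from funext h]

/-- A smooth function whose square has integral zero vanishes in the interior of the fundamental
domain. -/
theorem eq_zero_of_torusInt_sq {f : Sp n → ℝ} (hf : IsTorusFun f)
    (h : torusInt (fun σ => f σ * f σ) = 0) {σ : Sp n} (hσ : ∀ μ, σ μ ∈ Set.Ioo (0 : ℝ) 1) :
    f σ = 0 := by
  have hc : Continuous fun σ => f σ * f σ := hf.continuous.mul hf.continuous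
  have h1 := (MeasureTheory.setIntegral_eq_zero_iff_of_nonneg_ae
    (MeasureTheory.ae_of_all _ fun σ => mul_self_nonneg (f σ))
    (hc.continuousOn.integrableOn_compact isCompact_Icc)).1 h
  have hO : IsOpen (Set.pi Set.univ fun _ : Fin n => Set.Ioo (0 : ℝ) 1) :=
    isOpen_set_pi Set.finite_univ fun _ _ => isOpen_Ioo
  have hsub : (Set.pi Set.univ fun _ : Fin n => Set.Ioo (0 : ℝ) 1) ⊆ Set.Icc (0 : Sp n) 1 :=
    fun x hx => ⟨fun i => (hx i trivial).1.le, fun i => (hx i trivial).2.le⟩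
  have h2 := MeasureTheory.ae_mono (MeasureTheory.Measure.restrict_mono hsub le_rfl) h1
  have h3 := MeasureTheory.Measure.eqOn_open_of_ae_eq h2 hO hc.continuousOn continuousOn_const
  have := h3 (fun μ _ => hσ μ)
  simpa using this

end Torus

/-! ### Jets of fields and functional derivatives -/

section Jets

variable {d r n : ℕ}

/-- The values `(X, A, Y, Z)` of the fields at a point. -/
abbrev Val (d r n : ℕ) : Type :=
  Pt d × (Fin n → Fin r → ℝ) × (Fin n → Fin r → ℝ) × (Fin d → ℝ)

/-- First jets of fields: the values and the `n` partial derivatives. -/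
abbrev Jet (d r n : ℕ) : Type := Val d r n × (Fin n → Val d r n)

/-- The first jet of the fields at `σ`. -/
def Fields.jet (φ : Fields d r n) (σ : Sp n) : Jet d r n :=
  ((φ.X σ, φ.A σ, φ.Y σ, φ.Z σ), fun μ => (dd μ φ.X σ, dd μ φ.A σ, dd μ φ.Y σ, dd μ φ.Z σ))

theorem Fields.Smooth.jet {φ : Fields d r n} (h : φ.Smooth) : IsTorusFun φ.jet :=
  (h.1.prodMk (h.2.1.prodMk (h.2.2.1.prodMk h.2.2.2))).prodMk <| isTorusFun_pi.2 fun μ =>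
    (h.1.dd μ).prodMk ((h.2.1.dd μ).prodMk ((h.2.2.1.dd μ).prodMk (h.2.2.2.dd μ)))

theorem jet_vary {φ ψ : Fields d r n} (hφ : φ.Smooth) (hψ : ψ.Smooth) (t : ℝ) (σ : Sp n) :
    (φ.vary ψ t).jet σ = φ.jet σ + t • ψ.jet σ := by
  have key : ∀ {V : Type} [NormedAddCommGroup V] [NormedSpace ℝ V] {f g : Sp n → V},
      IsTorusFun f → IsTorusFun g → ∀ μ, dd μ (fun σ => f σ + t • g σ) σ
        = dd μ f σ + t • dd μ g σ := by
    intro V _ _ f g hf hg μ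
    rw [dd_add hf ((isTorusFun_const t).smul hg)]
    congr 1
    exact dd_clm (t • ContinuousLinearMap.id ℝ V) hg μ σ
  refine Prod.ext rfl (funext fun μ => ?_)
  exact Prod.ext (key hφ.1 hψ.1 μ) (Prod.ext (key hφ.2.1 hψ.2.1 μ)
    (Prod.ext (key hφ.2.2.1 hψ.2.2.1 μ) (key hφ.2.2.2 hψ.2.2.2 μ)))

/-- Labels of the components of the fields. -/
abbrev Comp (d r n : ℕ) : Type := Fin d ⊕ (Fin n × Fin r) ⊕ (Fin n × Fin r) ⊕ Fin d

/-- The coordinate vectors of the space of values of the fields. -/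
def compVec : Comp d r n → Val d r n
  | .inl i => (EuclideanSpace.single i 1, 0, 0, 0)
  | .inr (.inl (μ, a)) => (0, Pi.single μ (Pi.single a 1), 0, 0)
  | .inr (.inr (.inl (μ, a))) => (0, 0, Pi.single μ (Pi.single a 1), 0)
  | .inr (.inr (.inr i)) => (0, 0, 0, Pi.single i 1)

/-- The components of the fields. -/
def Fields.coord (φ : Fields d r n) : Comp d r n → Sp n → ℝ
  | .inl i => fun σ => φ.X σ i
  | .inr (.inl (μ, a)) => fun σ => φ.A σ μ a
  | .inr (.inr (.inl (μ, a))) => fun σ => φ.Y σ μ a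
  | .inr (.inr (.inr i)) => fun σ => φ.Z σ i

/-- The fields with given components. -/
def ofCoord (c : Comp d r n → Sp n → ℝ) : Fields d r n where
  X σ := WithLp.toLp 2 fun i => c (.inl i) σ
  A σ μ a := c (.inr (.inl (μ, a))) σ
  Y σ μ a := c (.inr (.inr (.inl (μ, a)))) σ
  Z σ i := c (.inr (.inr (.inr i))) σ

theorem coord_ofCoord (c : Comp d r n → Sp n → ℝ) (k : Comp d r n) : (ofCoord c).coord k = c k := by
  rcases k with i | ⟨μ, a⟩ | ⟨μ, a⟩ | i <;> rfl

theorem smooth_iff_coord {φ : Fields d r n} : φ.Smooth ↔ ∀ k, IsTorusFun (φ.coord k) := by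
  unfold Fields.Smooth
  simp only [Sum.forall, Prod.forall, isTorusFun_euclidean, isTorusFun_pi]
  rfl

theorem pairing_eq_sum (g ψ : Fields d r n) (σ : Sp n) :
    g.pairing ψ σ = ∑ k, g.coord k σ * ψ.coord k σ := by
  simp only [Fields.pairing, Fintype.sum_sum_type, Fintype.sum_prod_type, Fields.coord]
  ring

theorem euclidean_eq_sum (x : Pt d) : x = ∑ i, x i • EuclideanSpace.single i (1 : ℝ) := by
  ext j
  simp [Pi.single_apply]

theorem pi_eq_sum {ι : Type*} [Fintype ι] [DecidableEq ι] (x : ι → ℝ) :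
    x = ∑ i, x i • (Pi.single i 1 : ι → ℝ) := by
  ext j
  simp [Pi.single_apply]

theorem pi₂_eq_sum {ι κ : Type*} [Fintype ι] [DecidableEq ι] [Fintype κ] [DecidableEq κ]
    (x : ι → κ → ℝ) :
    x = ∑ i, ∑ j, x i j • (Pi.single i (Pi.single j 1) : ι → κ → ℝ) := by
  ext a b
  simp [Finset.sum_apply, Pi.single_apply, ite_apply]

theorem val_eq_sum (v : Val d r n) :
    v = (∑ i, v.1 i • (compVec (.inl i) : Val d r n))
      + ((∑ μ, ∑ a, v.2.1 μ a • compVec (.inr (.inl (μ, a))))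
      + ((∑ μ, ∑ a, v.2.2.1 μ a • compVec (.inr (.inr (.inl (μ, a)))))
      + ∑ i, v.2.2.2 i • compVec (.inr (.inr (.inr i))))) := by
  obtain ⟨x, a, y, z⟩ := v
  simp only [compVec, Prod.smul_mk, smul_zero]
  refine Prod.ext ?_ (Prod.ext ?_ (Prod.ext ?_ ?_))
  · simp only [Prod.fst_add, Prod.fst_sum, Finset.sum_const_zero, add_zero]
    exact euclidean_eq_sum x
  · simp only [Prod.fst_add, Prod.fst_sum, Prod.snd_add, Prod.snd_sum, Finset.sum_const_zero,
      add_zero, zero_add]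
    exact pi₂_eq_sum a
  · simp only [Prod.fst_add, Prod.fst_sum, Prod.snd_add, Prod.snd_sum, Finset.sum_const_zero,
      add_zero, zero_add]
    exact pi₂_eq_sum y
  · simp only [Prod.snd_add, Prod.snd_sum, Finset.sum_const_zero, zero_add]
    exact pi_eq_sum z

theorem jet_eq_sum {ψ : Fields d r n} (hψ : ψ.Smooth) (σ : Sp n) :
    ψ.jet σ = ∑ k, (ψ.coord k σ • compVec k, fun μ => dd μ (ψ.coord k) σ • compVec k) := by
  have hX : ∀ i μ, dd μ (fun τ => ψ.X τ i) σ = dd μ ψ.X σ i := fun i μ =>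
    dd_clm (EuclideanSpace.proj (𝕜 := ℝ) i) hψ.1 μ σ
  have hA : ∀ ν a μ, dd μ (fun τ => ψ.A τ ν a) σ = dd μ ψ.A σ ν a := fun ν a μ => by
    rw [← dd_apply hψ.2.1 ν μ σ, ← dd_apply (isTorusFun_pi.1 hψ.2.1 ν) a μ σ]
  have hY : ∀ ν a μ, dd μ (fun τ => ψ.Y τ ν a) σ = dd μ ψ.Y σ ν a := fun ν a μ => by
    rw [← dd_apply hψ.2.2.1 ν μ σ, ← dd_apply (isTorusFun_pi.1 hψ.2.2.1 ν) a μ σ]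
  have hZ : ∀ i μ, dd μ (fun τ => ψ.Z τ i) σ = dd μ ψ.Z σ i := fun i μ =>
    dd_apply hψ.2.2.2 i μ σ
  refine Prod.ext ?_ (funext fun μ => ?_)
  · rw [Prod.fst_sum]
    simp only [Fintype.sum_sum_type, Fintype.sum_prod_type]
    exact val_eq_sum _
  · rw [Prod.snd_sum, Finset.sum_apply]
    simp only [Fintype.sum_sum_type, Fintype.sum_prod_type, Fields.coord, hX, hA, hY, hZ]
    exact val_eq_sum _

/-- The component of the Euler–Lagrange expression of `ψ ↦ ∫ l(jet ψ)` in the direction `v`. -/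
def eulerComp (l : Sp n → Jet d r n →L[ℝ] ℝ) (v : Val d r n) (σ : Sp n) : ℝ :=
  l σ (v, 0) - ∑ μ, dd μ (fun τ => l τ (0, Pi.single μ v)) σ

/-- The Euler–Lagrange expression of the linear functional `ψ ↦ ∫ l(jet ψ)`. -/
def euler (l : Sp n → Jet d r n →L[ℝ] ℝ) : Fields d r n := ofCoord fun k => eulerComp l (compVec k)

theorem isTorusFun_eulerComp {l : Sp n → Jet d r n →L[ℝ] ℝ} (hl : IsTorusFun l) (v : Val d r n) :
    IsTorusFun (eulerComp l v) :=
  (hl.clm_apply (isTorusFun_const _)).sub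
    (IsTorusFun.sum fun μ _ => (hl.clm_apply (isTorusFun_const _)).dd μ)

theorem smooth_euler {l : Sp n → Jet d r n →L[ℝ] ℝ} (hl : IsTorusFun l) : (euler l).Smooth :=
  smooth_iff_coord.2 fun k => by
    rw [euler, coord_ofCoord]
    exact isTorusFun_eulerComp hl _

theorem torusInt_eulerComp_mul {l : Sp n → Jet d r n →L[ℝ] ℝ} (hl : IsTorusFun l)
    (v : Val d r n) {s : Sp n → ℝ} (hs : IsTorusFun s) :
    torusInt (fun σ => eulerComp l v σ * s σ)
      = torusInt (fun σ => l σ (s σ • v, fun μ => dd μ s σ • v)) := by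
  have h0 : IsTorusFun fun τ => l τ (v, 0) := hl.clm_apply (isTorusFun_const _)
  have h1 : ∀ μ, IsTorusFun fun τ => l τ (0, Pi.single μ v) := fun μ =>
    hl.clm_apply (isTorusFun_const _)
  have e1 : ∀ σ, eulerComp l v σ * s σ
      = l σ (v, 0) * s σ + ∑ μ, -dd μ (fun τ => l τ (0, Pi.single μ v)) σ * s σ := by
    intro σ
    rw [eulerComp, sub_mul, sub_eq_add_neg, Finset.sum_mul, ← Finset.sum_neg_distrib]
    simp only [neg_mul]
  have e2 : ∀ σ, l σ (s σ • v, fun μ => dd μ s σ • v)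
      = l σ (v, 0) * s σ + ∑ μ, l σ (0, Pi.single μ v) * dd μ s σ := by
    intro σ
    have : ((s σ • v, fun μ => dd μ s σ • v) : Jet d r n)
        = s σ • (v, 0) + ∑ μ, dd μ s σ • (0, Pi.single μ v) := by
      refine Prod.ext ?_ ?_
      · simp [Prod.fst_sum]
      · funext μ
        simp only [Prod.snd_add, Prod.smul_snd, Prod.snd_sum, smul_zero, zero_add,
          Finset.sum_apply, Pi.smul_apply]
        rw [Finset.sum_eq_single μ (fun b _ hb => by simp [Pi.single_eq_of_ne hb.symm]) (by simp)]
        simp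
    rw [this, map_add, map_sum, map_smul]
    simp only [map_smul, smul_eq_mul, mul_comm]
  rw [torusInt_congr e1, torusInt_congr e2, torusInt_add (h0.mul hs)
      (IsTorusFun.sum fun μ _ => ((h1 μ).dd μ).neg.mul hs),
    torusInt_add (h0.mul hs) (IsTorusFun.sum fun μ _ => (h1 μ).mul (hs.dd μ)),
    torusInt_sum fun μ _ => ((h1 μ).dd μ).neg.mul hs,
    torusInt_sum fun μ _ => (h1 μ).mul (hs.dd μ)]
  congr 1
  exact Finset.sum_congr rfl fun μ _ => torusInt_parts (h1 μ) hs μ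

/-- The Euler–Lagrange expression is the gradient of the functional, by integration by parts. -/
theorem torusInt_euler_pairing {l : Sp n → Jet d r n →L[ℝ] ℝ} (hl : IsTorusFun l)
    {ψ : Fields d r n} (hψ : ψ.Smooth) :
    torusInt ((euler l).pairing ψ) = torusInt (fun σ => l σ (ψ.jet σ)) := by
  have hc := smooth_iff_coord.1 hψ
  have e1 : ∀ σ, (euler l).pairing ψ σ = ∑ k, eulerComp l (compVec k) σ * ψ.coord k σ := by
    intro σ
    rw [pairing_eq_sum]
    simp only [euler, coord_ofCoord]
  have e2 : ∀ σ, l σ (ψ.jet σ)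
      = ∑ k, l σ (ψ.coord k σ • compVec k, fun μ => dd μ (ψ.coord k) σ • compVec k) := by
    intro σ
    rw [jet_eq_sum hψ, map_sum]
  have hj : ∀ k : Comp d r n, IsTorusFun
      (fun σ => ((ψ.coord k σ • compVec k, fun μ => dd μ (ψ.coord k) σ • compVec k) :
        Jet d r n)) := fun k =>
    ((hc k).smul (isTorusFun_const _)).prodMk
      (isTorusFun_pi.2 fun μ => ((hc k).dd μ).smul (isTorusFun_const _))
  rw [torusInt_congr e1, torusInt_congr e2,
    torusInt_sum fun k _ => (isTorusFun_eulerComp hl _).mul (hc k),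
    torusInt_sum fun k _ => hl.clm_apply (hj k)]
  exact Finset.sum_congr rfl fun k _ => torusInt_eulerComp_mul hl _ (hc k)

theorem eulerComp_add {l l' : Sp n → Jet d r n →L[ℝ] ℝ} (hl : IsTorusFun l) (hl' : IsTorusFun l')
    (v : Val d r n) (σ : Sp n) :
    eulerComp (fun σ => l σ + l' σ) v σ = eulerComp l v σ + eulerComp l' v σ := by
  simp only [eulerComp, add_apply]
  have : ∀ μ, dd μ (fun τ => l τ (0, Pi.single μ v) + l' τ (0, Pi.single μ v)) σ
      = dd μ (fun τ => l τ (0, Pi.single μ v)) σ + dd μ (fun τ => l' τ (0, Pi.single μ v)) σ :=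
    fun μ => dd_add (hl.clm_apply (isTorusFun_const _)) (hl'.clm_apply (isTorusFun_const _)) μ σ
  simp only [this, Finset.sum_add_distrib]
  ring

end Jets

/-! ### Poisson brackets of local functionals -/

section Poisson

variable {d r n : ℕ} (m : LocalTarget d r n)

/-- The jets over the coordinate domain. -/
def jetDom : Set (Jet d r n) := {w | w.1.1 ∈ m.dom}

/-- The Hamiltonian vector field of a functional with gradient `g`, with the sign for which
`{F, G}` is the derivative of `F` along the vector field of `G`. -/
def ham (φ g : Fields d r n) : Fields d r n where
  X σ := WithLp.toLp 2 fun i => (-1 : ℝ) ^ n * g.Z σ i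
  A σ := g.Y σ
  Y σ := -g.A σ
  Z σ j := -((-1 : ℝ) ^ n * g.X σ j) + ∑ k, g.Z σ k *
    m.H (φ.X σ) (Matrix.vecCons (EuclideanSpace.single j 1)
      (Matrix.vecCons (EuclideanSpace.single k 1) (fun μ => dd μ φ.X σ)))

theorem bivector_eq_pairing_ham (φ g g' : Fields d r n) (σ : Sp n) :
    bivector m φ g g' σ = g.pairing (ham m φ g') σ := by
  simp only [bivector, Fields.pairing, ham, Pi.neg_apply, mul_add, Finset.sum_add_distrib,
    Finset.sum_sub_distrib, mul_sub, Finset.mul_sum]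
  have e1 : ∀ i, g.X σ i * ((-1 : ℝ) ^ n * g'.Z σ i) = (-1) ^ n * (g.X σ i * g'.Z σ i) :=
    fun i => by ring
  have e2 : ∀ i, g.Z σ i * -((-1 : ℝ) ^ n * g'.X σ i) = -((-1) ^ n * (g.Z σ i * g'.X σ i)) :=
    fun i => by ring
  simp only [e1, e2, Finset.sum_neg_distrib, mul_neg, mul_assoc]
  ring

theorem map_vecCons_swap {R V W : Type*} [CommRing R] [AddCommGroup V] [Module R V]
    [AddCommGroup W] [Module R W] {k : ℕ} (f : V [⋀^Fin (k + 2)]→ₗ[R] W) (a b : V) (v : Fin k → V) :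
    f (Matrix.vecCons b (Matrix.vecCons a v)) = -f (Matrix.vecCons a (Matrix.vecCons b v)) := by
  rw [← AlternatingMap.map_swap f (Matrix.vecCons a (Matrix.vecCons b v))
    (show (0 : Fin (k + 2)) ≠ 1 by simp)]
  refine congrArg _ (funext fun l => ?_)
  refine Fin.cases ?_ (fun l => Fin.cases ?_ (fun l => ?_) l) l
  · simp
  · rw [Fin.succ_zero_eq_one]; simp
  · rw [Function.comp_apply, Equiv.swap_apply_of_ne_of_ne (Fin.succ_ne_zero _)
      (fun h => Fin.succ_ne_zero l (Fin.succ_injective _ (h.trans Fin.succ_zero_eq_one.symm)))]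
    rfl

theorem bivector_antisymm (φ g g' : Fields d r n) (σ : Sp n) :
    bivector m φ g' g σ = -bivector m φ g g' σ := by
  have hs : ∀ i j, m.H (φ.X σ) (Matrix.vecCons (EuclideanSpace.single j 1)
        (Matrix.vecCons (EuclideanSpace.single i 1) (fun μ => dd μ φ.X σ)))
      = -m.H (φ.X σ) (Matrix.vecCons (EuclideanSpace.single i 1)
        (Matrix.vecCons (EuclideanSpace.single j 1) (fun μ => dd μ φ.X σ))) := by
    exact fun i j => map_vecCons_swap (m.H (φ.X σ)).toAlternatingMap _ _ _
  have h1 : (∑ i, ∑ j, g'.Z σ i * g.Z σ j *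
        m.H (φ.X σ) (Matrix.vecCons (EuclideanSpace.single i 1)
          (Matrix.vecCons (EuclideanSpace.single j 1) (fun μ => dd μ φ.X σ))))
      = -∑ i, ∑ j, g.Z σ i * g'.Z σ j *
        m.H (φ.X σ) (Matrix.vecCons (EuclideanSpace.single i 1)
          (Matrix.vecCons (EuclideanSpace.single j 1) (fun μ => dd μ φ.X σ))) := by
    rw [Finset.sum_comm]
    simp only [← Finset.sum_neg_distrib]
    refine Finset.sum_congr rfl fun j _ => Finset.sum_congr rfl fun i _ => ?_
    rw [hs]; ring
  simp only [bivector, h1, Finset.sum_sub_distrib, mul_comm (g'.X σ _), mul_comm (g'.Z σ _) (g.X σ _),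
    mul_comm (g'.A σ _ _), mul_comm (g'.Y σ _ _)]
  ring

theorem torusInt_bivector (φ g g' : Fields d r n) :
    torusInt (bivector m φ g g') = torusInt (g.pairing (ham m φ g')) :=
  torusInt_congr (bivector_eq_pairing_ham m φ g g')

theorem contDiff_alternating_apply {E F : Type*} [NormedAddCommGroup E] [NormedSpace ℝ E]
    [NormedAddCommGroup F] [NormedSpace ℝ F] {k : ℕ} :
    ContDiff ℝ ∞ (fun p : (E [⋀^Fin k]→L[ℝ] F) × (Fin k → E) => p.1 p.2) :=
  contDiffOn_univ.1 ((ContinuousLinearMap.analyticOnNhd_uncurry_of_multilinear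
    (ContinuousAlternatingMap.toContinuousMultilinearMapCLM ℝ :
      E [⋀^Fin k]→L[ℝ] F →L[ℝ] _) (s := Set.univ)).contDiffOn uniqueDiffOn_univ)

variable {m}

theorem smooth_ham (hdom : IsOpen m.dom) (hH : ContDiffOn ℝ ∞ m.H m.dom) {φ g : Fields d r n}
    (hφ : IsField m φ) (hg : g.Smooth) : (ham m φ g).Smooth := by
  refine ⟨isTorusFun_euclidean.2 fun i => ?_, hg.2.2.1, hg.2.1.neg, isTorusFun_pi.2 fun j => ?_⟩
  · exact (isTorusFun_const _).mul (isTorusFun_pi.1 hg.2.2.2 i)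
  · refine IsTorusFun.add (((isTorusFun_const _).mul (isTorusFun_euclidean.1 hg.1 j)).neg)
      (IsTorusFun.sum fun k _ => (isTorusFun_pi.1 hg.2.2.2 k).mul ?_)
    have h1 : IsTorusFun fun σ => m.H (φ.X σ) := hφ.1.1.comp hdom hH hφ.2
    have h2 : IsTorusFun fun σ => (Matrix.vecCons (EuclideanSpace.single j 1)
      (Matrix.vecCons (EuclideanSpace.single k 1) (fun μ => dd μ φ.X σ)) : Fin (n + 2) → Pt d) := by
      refine isTorusFun_pi.2 fun l => ?_
      refine Fin.cases ?_ (fun l => Fin.cases ?_ (fun l => ?_) l) l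
      · exact isTorusFun_const _
      · exact isTorusFun_const _
      · exact hφ.1.1.dd l
    exact (h1.prodMk h2).comp isOpen_univ contDiff_alternating_apply.contDiffOn fun _ => trivial

theorem HasGradient.torusInt_eq {F : Fields d r n → ℝ} {φ g g' ψ : Fields d r n}
    (h : HasGradient F φ g) (h' : HasGradient F φ g') (hψ : ψ.Smooth) :
    torusInt (g.pairing ψ) = torusInt (g'.pairing ψ) :=
  (h.2 ψ hψ).unique (h'.2 ψ hψ)

/-- The Poisson bracket does not depend on the choice of the functional derivatives. -/
theorem HasBracket.eq_of_hasGradient (hdom : IsOpen m.dom) (hH : ContDiffOn ℝ ∞ m.H m.dom)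
    {F G : Fields d r n → ℝ} {φ g g' : Fields d r n} (hφ : IsField m φ) {v : ℝ}
    (h : HasBracket m F G φ v) (hg : HasGradient F φ g) (hg' : HasGradient G φ g') :
    torusInt (bivector m φ g g') = v := by
  obtain ⟨k, k', hk, hk', rfl⟩ := h
  have anti : ∀ a b : Fields d r n,
      torusInt (bivector m φ a b) = -torusInt (bivector m φ b a) := fun a b => by
    rw [← torusInt_neg]
    exact torusInt_congr fun σ => bivector_antisymm m φ b a σ
  rw [torusInt_bivector, hg.torusInt_eq hk (smooth_ham hdom hH hφ hg'.1), ← torusInt_bivector,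
    anti, torusInt_bivector, hg'.torusInt_eq hk' (smooth_ham hdom hH hφ hk.1), ← torusInt_bivector,
    ← anti]

/-- `F` is a smooth function of the first jet of the fields (a local density). -/
def IsDensity (m : LocalTarget d r n) (F : Jet d r n → ℝ) : Prop := ContDiffOn ℝ ∞ F (jetDom m)

/-- `D` is given by the local density `F` at the points which the field maps into the coordinate
domain. -/
def Represents (m : LocalTarget d r n) (F : Jet d r n → ℝ) (D : Fields d r n → Sp n → ℝ) : Prop :=
  ∀ φ σ, φ.X σ ∈ m.dom → D φ σ = F (φ.jet σ)

theorem isOpen_jetDom (hdom : IsOpen m.dom) : IsOpen (jetDom m) :=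
  hdom.preimage (continuous_fst.comp continuous_fst)

/-- The gradient of the smeared density `∫ f F(jet)`. -/
def grad (F : Jet d r n → ℝ) (φ : Fields d r n) (f : Sp n → ℝ) : Fields d r n :=
  euler fun σ => f σ • fderiv ℝ F (φ.jet σ)

theorem IsField.jet_mem {φ : Fields d r n} (hφ : IsField m φ) (σ : Sp n) : φ.jet σ ∈ jetDom m :=
  hφ.2 σ

theorem isTorusFun_density (hdom : IsOpen m.dom) {F : Jet d r n → ℝ} (hF : IsDensity m F)
    {φ : Fields d r n} (hφ : IsField m φ) : IsTorusFun fun σ => F (φ.jet σ) :=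
  hφ.1.jet.comp (isOpen_jetDom hdom) hF hφ.jet_mem

theorem isTorusFun_fderiv_density (hdom : IsOpen m.dom) {F : Jet d r n → ℝ} (hF : IsDensity m F)
    {φ : Fields d r n} (hφ : IsField m φ) : IsTorusFun fun σ => fderiv ℝ F (φ.jet σ) :=
  hφ.1.jet.comp (isOpen_jetDom hdom)
    (hF.fderiv_of_isOpen (isOpen_jetDom hdom) (m := ∞) (by simp)) hφ.jet_mem

theorem isTorusFun_smul_fderiv (hdom : IsOpen m.dom) {F : Jet d r n → ℝ} (hF : IsDensity m F)
    {φ : Fields d r n} (hφ : IsField m φ) {f : Sp n → ℝ} (hf : IsTorusFun f) :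
    IsTorusFun fun σ => f σ • fderiv ℝ F (φ.jet σ) :=
  hf.smul (isTorusFun_fderiv_density hdom hF hφ)

theorem smooth_grad (hdom : IsOpen m.dom) {F : Jet d r n → ℝ} (hF : IsDensity m F)
    {φ : Fields d r n} (hφ : IsField m φ) {f : Sp n → ℝ} (hf : IsTorusFun f) :
    (grad F φ f).Smooth :=
  smooth_euler (isTorusFun_smul_fderiv hdom hF hφ hf)

/-- A small variation of a path in an open set stays in it, uniformly on the torus. -/
theorem eventually_forall_mem_path {W : Type*} [NormedAddCommGroup W] [NormedSpace ℝ W]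
    {O : Set W} (hO : IsOpen O) {u w : Sp n → W} (hu : Continuous u) (hw : Continuous w)
    (hm : ∀ σ, u σ ∈ O) :
    ∀ᶠ t : ℝ in nhds 0, ∀ σ ∈ Set.Icc (0 : Sp n) 1, u σ + t • w σ ∈ O := by
  refine isCompact_Icc.eventually_forall_of_forall_eventually fun σ _ => ?_
  have hc : Continuous fun p : ℝ × Sp n => u p.2 + p.1 • w p.2 := by fun_prop
  refine hc.continuousAt.eventually (hO.mem_nhds ?_)
  simpa using hm σ

/-- Differentiation under the integral sign. -/
theorem hasDerivAt_torusInt_path {W : Type*} [NormedAddCommGroup W] [NormedSpace ℝ W]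
    {O : Set W} (hO : IsOpen O) {F : W → ℝ} (hF : ContDiffOn ℝ ∞ F O) {u w : Sp n → W}
    (hu : Continuous u) (hw : Continuous w) (hm : ∀ σ, u σ ∈ O) {f : Sp n → ℝ}
    (hf : Continuous f) :
    HasDerivAt (fun t : ℝ => torusInt fun σ => f σ * F (u σ + t • w σ))
      (torusInt fun σ => f σ * fderiv ℝ F (u σ) (w σ)) 0 := by
  have hjc : Continuous fun p : ℝ × Sp n => u p.2 + p.1 • w p.2 := by fun_prop
  obtain ⟨ε, hε, hball⟩ := Metric.eventually_nhds_iff.1 (eventually_forall_mem_path hO hu hw hm)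
  have hin : ∀ t ∈ Set.Icc (-(ε / 2)) (ε / 2), ∀ σ ∈ Set.Icc (0 : Sp n) 1,
      u σ + t • w σ ∈ O := fun t ht σ hσ => by
    refine hball ?_ σ hσ
    rw [Real.dist_eq, sub_zero]
    exact lt_of_le_of_lt (abs_le.2 ht) (by linarith)
  have hs : Set.Icc (-(ε / 2)) (ε / 2) ∈ nhds (0 : ℝ) := Icc_mem_nhds (by linarith) (by linarith)
  have hDF : ContinuousOn (fderiv ℝ F) O := hF.continuousOn_fderiv_of_isOpen hO (by simp)
  have hcont : ContinuousOn (fun p : ℝ × Sp n => f p.2 * fderiv ℝ F (u p.2 + p.1 • w p.2) (w p.2))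
      (Set.Icc (-(ε / 2)) (ε / 2) ×ˢ Set.Icc (0 : Sp n) 1) :=
    (hf.comp continuous_snd).continuousOn.mul
      ((hDF.comp hjc.continuousOn fun p hp => hin p.1 hp.1 p.2 hp.2).clm_apply
        (hw.comp continuous_snd).continuousOn)
  obtain ⟨C, hC⟩ := (isCompact_Icc.prod isCompact_Icc).exists_bound_of_continuousOn hcont
  have hslice : ∀ t ∈ Set.Icc (-(ε / 2)) (ε / 2),
      ContinuousOn (fun σ => f σ * F (u σ + t • w σ)) (Set.Icc (0 : Sp n) 1) := fun t ht =>
    hf.continuousOn.mul (hF.continuousOn.comp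
      (by fun_prop : Continuous fun σ => u σ + t • w σ).continuousOn fun σ hσ => hin t ht σ hσ)
  have h0 := mem_of_mem_nhds hs
  have hdiff : ∀ σ ∈ Set.Icc (0 : Sp n) 1, ∀ t ∈ Set.Icc (-(ε / 2)) (ε / 2),
      HasDerivAt (fun t : ℝ => f σ * F (u σ + t • w σ))
        (f σ * fderiv ℝ F (u σ + t • w σ) (w σ)) t := by
    intro σ hσ t ht
    have h1 : HasFDerivAt F (fderiv ℝ F (u σ + t • w σ)) (u σ + t • w σ) :=
      ((hF.contDiffAt (hO.mem_nhds (hin t ht σ hσ))).differentiableAt (by simp)).hasFDerivAt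
    have h2 : HasDerivAt (fun t : ℝ => u σ + t • w σ) (w σ) t := by
      simpa using ((hasDerivAt_id t).smul_const (w σ)).const_add (u σ)
    exact (h1.comp_hasDerivAt t h2).const_mul (f σ)
  have hmeas : MeasureTheory.AEStronglyMeasurable
      (fun σ => f σ * fderiv ℝ F (u σ + (0 : ℝ) • w σ) (w σ))
      (MeasureTheory.volume.restrict (Set.Icc (0 : Sp n) 1)) :=
    ContinuousOn.aestronglyMeasurable (hcont.comp
      (continuous_const.prodMk continuous_id).continuousOn fun σ hσ => ⟨h0, hσ⟩)
      isCompact_Icc.measurableSet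
  have key := (hasDerivAt_integral_of_dominated_loc_of_deriv_le
    (F := fun (t : ℝ) σ => f σ * F (u σ + t • w σ))
    (F' := fun (t : ℝ) σ => f σ * fderiv ℝ F (u σ + t • w σ) (w σ)) (bound := fun _ => C) hs
    (Filter.eventually_of_mem hs fun t ht =>
      (hslice t ht).aestronglyMeasurable isCompact_Icc.measurableSet)
    ((hslice 0 h0).integrableOn_compact isCompact_Icc) hmeas
    ((MeasureTheory.ae_restrict_iff' isCompact_Icc.measurableSet).2
      (MeasureTheory.ae_of_all _ fun σ hσ t ht => hC (t, σ) ⟨ht, hσ⟩))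
    (continuousOn_const.integrableOn_compact isCompact_Icc)
    ((MeasureTheory.ae_restrict_iff' isCompact_Icc.measurableSet).2
      (MeasureTheory.ae_of_all _ hdiff))).2
  simp only [zero_smul, add_zero] at key
  exact key

/-- The first variation of a smeared local density. -/
theorem hasDerivAt_smear (hdom : IsOpen m.dom) {F : Jet d r n → ℝ} (hF : IsDensity m F)
    {D : Fields d r n → Sp n → ℝ} (hD : Represents m F D)
    {φ ψ : Fields d r n} (hφ : IsField m φ) (hψ : ψ.Smooth) {f : Sp n → ℝ} (hf : IsTorusFun f) :
    HasDerivAt (fun t : ℝ => smear D f (φ.vary ψ t))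
      (torusInt fun σ => f σ * fderiv ℝ F (φ.jet σ) (ψ.jet σ)) 0 := by
  have hO := isOpen_jetDom hdom
  refine (hasDerivAt_torusInt_path hO hF hφ.1.jet.continuous hψ.jet.continuous hφ.jet_mem
    hf.continuous).congr_of_eventuallyEq ?_
  filter_upwards [eventually_forall_mem_path hO hφ.1.jet.continuous hψ.jet.continuous
    hφ.jet_mem] with t ht
  refine MeasureTheory.setIntegral_congr_fun isCompact_Icc.measurableSet fun σ hσ => ?_
  have hm := ht σ hσ
  rw [← jet_vary hφ.1 hψ] at hm
  have e : D (φ.vary ψ t) σ = F (φ.jet σ + t • ψ.jet σ) := by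
    rw [hD (φ.vary ψ t) σ hm, jet_vary hφ.1 hψ]
  simp only [e]

/-- A smeared local density has a functional derivative, its Euler–Lagrange expression. -/
theorem hasGradient_smear (hdom : IsOpen m.dom) {F : Jet d r n → ℝ} (hF : IsDensity m F)
    {D : Fields d r n → Sp n → ℝ} (hD : Represents m F D)
    {φ : Fields d r n} (hφ : IsField m φ) {f : Sp n → ℝ} (hf : IsTorusFun f) :
    HasGradient (smear D f) φ (grad F φ f) :=
  ⟨smooth_grad hdom hF hφ hf, fun ψ hψ => by
    rw [grad, torusInt_euler_pairing (isTorusFun_smul_fderiv hdom hF hφ hf) hψ]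
    exact hasDerivAt_smear hdom hF hD hφ hψ hf⟩

end Poisson

/-! ### Ultralocal brackets of densities -/

section DensityBracket

variable {d r n : ℕ} {m : LocalTarget d r n}

/-- `{F₁(σ), F₂(σ')} = B(σ) δ(σ - σ')` for local densities, with a smooth function `B`. In contrast
to `LocalBracket` the gradients are those of `grad`, so that brackets can be added and multiplied. -/
structure DensityBracket (m : LocalTarget d r n) (φ : Fields d r n) (F₁ F₂ : Jet d r n → ℝ)
    (B : Sp n → ℝ) : Prop where
  smooth : IsTorusFun B
  eq : ∀ f g : Sp n → ℝ, IsTorusFun f → IsTorusFun g →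
    torusInt (bivector m φ (grad F₁ φ f) (grad F₂ φ g)) = torusInt (fun σ => f σ * g σ * B σ)

/-- The bracket of two densities is the bracket of the functions of the fields which they
represent. -/
theorem DensityBracket.localBracket (hdom : IsOpen m.dom) {φ : Fields d r n} (hφ : IsField m φ)
    {F₁ F₂ : Jet d r n → ℝ} {B : Sp n → ℝ} (h : DensityBracket m φ F₁ F₂ B)
    (h₁ : IsDensity m F₁) (h₂ : IsDensity m F₂) {D₁ D₂ : Fields d r n → Sp n → ℝ}
    (hD₁ : Represents m F₁ D₁) (hD₂ : Represents m F₂ D₂) : LocalBracket m D₁ D₂ φ B :=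
  fun f g hf hg => ⟨grad F₁ φ f, grad F₂ φ g, hasGradient_smear hdom h₁ hD₁ hφ hf,
    hasGradient_smear hdom h₂ hD₂ hφ hg, h.eq f g hf hg⟩

theorem DensityBracket.congr {φ : Fields d r n} {F₁ F₂ : Jet d r n → ℝ} {B B' : Sp n → ℝ}
    (h : DensityBracket m φ F₁ F₂ B) (e : ∀ σ, B σ = B' σ) : DensityBracket m φ F₁ F₂ B' := by
  rwa [← show B = B' from funext e]

theorem DensityBracket.symm {φ : Fields d r n} {F₁ F₂ : Jet d r n → ℝ} {B : Sp n → ℝ}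
    (h : DensityBracket m φ F₁ F₂ B) : DensityBracket m φ F₂ F₁ (fun σ => -B σ) := by
  refine ⟨h.smooth.neg, fun f g hf hg => ?_⟩
  rw [torusInt_congr (bivector_antisymm m φ (grad F₁ φ g) (grad F₂ φ f)), torusInt_neg,
    h.eq g f hg hf, ← torusInt_neg]
  exact torusInt_congr fun σ => by ring

/-- The bracket is the variation of `F₁` along the Hamiltonian vector field of `F₂`. -/
theorem densityBracket_of_variation (hdom : IsOpen m.dom) (hH : ContDiffOn ℝ ∞ m.H m.dom)
    {φ : Fields d r n} (hφ : IsField m φ) {F₁ F₂ : Jet d r n → ℝ} {B : Sp n → ℝ}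
    (h₁ : IsDensity m F₁) (h₂ : IsDensity m F₂)
    (h : ∀ g, IsTorusFun g → ∀ σ,
      fderiv ℝ F₁ (φ.jet σ) ((ham m φ (grad F₂ φ g)).jet σ) = g σ * B σ) :
    DensityBracket m φ F₁ F₂ B := by
  refine ⟨?_, fun f g hf hg => ?_⟩
  · have h1 := isTorusFun_const (n := n) (1 : ℝ)
    rw [show B = fun σ => fderiv ℝ F₁ (φ.jet σ) ((ham m φ (grad F₂ φ fun _ => 1)).jet σ) from
      funext fun σ => by rw [h _ h1, one_mul]]
    exact (isTorusFun_fderiv_density hdom h₁ hφ).clm_apply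
      (smooth_ham hdom hH hφ (smooth_grad hdom h₂ hφ h1)).jet
  rw [torusInt_bivector, grad, torusInt_euler_pairing (isTorusFun_smul_fderiv hdom h₁ hφ hf)
    (smooth_ham hdom hH hφ (smooth_grad hdom h₂ hφ hg))]
  refine torusInt_congr fun σ => ?_
  rw [smul_apply, h g hg σ, smul_eq_mul, mul_assoc]

theorem isTorusFun_pairing {g ψ : Fields d r n} (hg : g.Smooth) (hψ : ψ.Smooth) :
    IsTorusFun (g.pairing ψ) := by
  rw [show g.pairing ψ = fun σ => ∑ k, g.coord k σ * ψ.coord k σ from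
    funext (pairing_eq_sum g ψ)]
  exact IsTorusFun.sum fun k _ => (smooth_iff_coord.1 hg k).mul (smooth_iff_coord.1 hψ k)

/-- Additivity of the bracket in its first argument, for a density whose smeared differential is the
sum of two smeared differentials. -/
theorem torusInt_bivector_add (hdom : IsOpen m.dom) (hH : ContDiffOn ℝ ∞ m.H m.dom)
    {φ : Fields d r n} (hφ : IsField m φ) {F F₁ F₂ : Jet d r n → ℝ}
    (h₁ : IsDensity m F₁) (h₂ : IsDensity m F₂) {f f₁ f₂ : Sp n → ℝ}
    (hf₁ : IsTorusFun f₁) (hf₂ : IsTorusFun f₂)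
    (h : ∀ σ, f σ • fderiv ℝ F (φ.jet σ)
      = f₁ σ • fderiv ℝ F₁ (φ.jet σ) + f₂ σ • fderiv ℝ F₂ (φ.jet σ))
    {k : Fields d r n} (hk : k.Smooth) :
    torusInt (bivector m φ (grad F φ f) k)
      = torusInt (bivector m φ (grad F₁ φ f₁) k) + torusInt (bivector m φ (grad F₂ φ f₂) k) := by
  have hs := smooth_ham hdom hH hφ hk
  simp only [torusInt_bivector]
  rw [← torusInt_add (isTorusFun_pairing (smooth_grad hdom h₁ hφ hf₁) hs)
    (isTorusFun_pairing (smooth_grad hdom h₂ hφ hf₂) hs)]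
  refine torusInt_congr fun σ => ?_
  simp only [pairing_eq_sum, ← Finset.sum_add_distrib, ← add_mul, grad, euler, coord_ofCoord]
  refine Finset.sum_congr rfl fun c _ => ?_
  rw [show (fun σ => f σ • fderiv ℝ F (φ.jet σ)) = _ from funext h,
    eulerComp_add (isTorusFun_smul_fderiv hdom h₁ hφ hf₁)
      (isTorusFun_smul_fderiv hdom h₂ hφ hf₂)]

theorem IsDensity.differentiableAt (hdom : IsOpen m.dom) {F : Jet d r n → ℝ} (hF : IsDensity m F)
    {w : Jet d r n} (hw : w ∈ jetDom m) : DifferentiableAt ℝ F w :=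
  (ContDiffOn.contDiffAt hF ((isOpen_jetDom hdom).mem_nhds hw)).differentiableAt (by simp)

theorem IsDensity.sub {F₁ F₂ : Jet d r n → ℝ} (h₁ : IsDensity m F₁) (h₂ : IsDensity m F₂) :
    IsDensity m (fun w => F₁ w - F₂ w) := ContDiffOn.sub h₁ h₂

theorem IsDensity.neg {F₁ : Jet d r n → ℝ} (h₁ : IsDensity m F₁) :
    IsDensity m (fun w => -F₁ w) := ContDiffOn.neg h₁

theorem IsDensity.mul {F₁ F₂ : Jet d r n → ℝ} (h₁ : IsDensity m F₁) (h₂ : IsDensity m F₂) :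
    IsDensity m (fun w => F₁ w * F₂ w) := ContDiffOn.mul h₁ h₂

theorem IsDensity.sum {ι : Type*} {s : Finset ι} {F : ι → Jet d r n → ℝ}
    (h : ∀ i ∈ s, IsDensity m (F i)) : IsDensity m (fun w => ∑ i ∈ s, F i w) := ContDiffOn.sum h

theorem DensityBracket.add_left (hdom : IsOpen m.dom) (hH : ContDiffOn ℝ ∞ m.H m.dom)
    {φ : Fields d r n} (hφ : IsField m φ) {F₁ F₂ F₃ : Jet d r n → ℝ} {B₁ B₂ : Sp n → ℝ}
    (h₁ : IsDensity m F₁) (h₂ : IsDensity m F₂) (h₃ : IsDensity m F₃)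
    (b₁ : DensityBracket m φ F₁ F₃ B₁) (b₂ : DensityBracket m φ F₂ F₃ B₂) :
    DensityBracket m φ (fun w => F₁ w + F₂ w) F₃ (fun σ => B₁ σ + B₂ σ) := by
  refine ⟨b₁.smooth.add b₂.smooth, fun f g hf hg => ?_⟩
  rw [torusInt_bivector_add hdom hH hφ h₁ h₂ hf hf (fun σ => ?_) (smooth_grad hdom h₃ hφ hg),
    b₁.eq f g hf hg, b₂.eq f g hf hg,
    ← torusInt_add ((hf.mul hg).mul b₁.smooth) ((hf.mul hg).mul b₂.smooth)]
  · exact torusInt_congr fun σ => by ring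
  · rw [fderiv_fun_add (h₁.differentiableAt hdom (hφ.jet_mem σ))
      (h₂.differentiableAt hdom (hφ.jet_mem σ)), smul_add]

/-- The Leibniz rule. The factors `F₁`, `F₂` are absorbed in the smearing functions. -/
theorem DensityBracket.mul_left (hdom : IsOpen m.dom) (hH : ContDiffOn ℝ ∞ m.H m.dom)
    {φ : Fields d r n} (hφ : IsField m φ) {F₁ F₂ F₃ : Jet d r n → ℝ} {B₁ B₂ : Sp n → ℝ}
    (h₁ : IsDensity m F₁) (h₂ : IsDensity m F₂) (h₃ : IsDensity m F₃)
    (b₁ : DensityBracket m φ F₁ F₃ B₁) (b₂ : DensityBracket m φ F₂ F₃ B₂) :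
    DensityBracket m φ (fun w => F₁ w * F₂ w) F₃
      (fun σ => B₁ σ * F₂ (φ.jet σ) + F₁ (φ.jet σ) * B₂ σ) := by
  have t₁ := isTorusFun_density hdom h₁ hφ
  have t₂ := isTorusFun_density hdom h₂ hφ
  refine ⟨(b₁.smooth.mul t₂).add (t₁.mul b₂.smooth), fun f g hf hg => ?_⟩
  rw [torusInt_bivector_add hdom hH hφ h₁ h₂ (hf.mul t₂) (hf.mul t₁) (fun σ => ?_)
      (smooth_grad hdom h₃ hφ hg),
    b₁.eq _ g (hf.mul t₂) hg, b₂.eq _ g (hf.mul t₁) hg,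
    ← torusInt_add (((hf.mul t₂).mul hg).mul b₁.smooth) (((hf.mul t₁).mul hg).mul b₂.smooth)]
  · exact torusInt_congr fun σ => by ring
  · rw [fderiv_fun_mul (h₁.differentiableAt hdom (hφ.jet_mem σ))
      (h₂.differentiableAt hdom (hφ.jet_mem σ)), smul_add, smul_smul, smul_smul, add_comm]

theorem DensityBracket.neg_left {φ : Fields d r n} {F₁ F₂ : Jet d r n → ℝ} {B : Sp n → ℝ}
    (b : DensityBracket m φ F₁ F₂ B) :
    DensityBracket m φ (fun w => -F₁ w) F₂ (fun σ => -B σ) := by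
  have e : ∀ f, grad (fun w => -F₁ w) φ f = grad F₁ φ (fun σ => -f σ) := fun f => by
    simp only [grad, fderiv_fun_neg, smul_neg]
    exact congrArg euler (funext fun σ => (neg_smul _ _).symm)
  refine ⟨b.smooth.neg, fun f g hf hg => ?_⟩
  rw [e, b.eq _ g hf.neg hg]
  exact torusInt_congr fun σ => by ring

theorem DensityBracket.sub_left (hdom : IsOpen m.dom) (hH : ContDiffOn ℝ ∞ m.H m.dom)
    {φ : Fields d r n} (hφ : IsField m φ) {F₁ F₂ F₃ : Jet d r n → ℝ} {B₁ B₂ : Sp n → ℝ}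
    (h₁ : IsDensity m F₁) (h₂ : IsDensity m F₂) (h₃ : IsDensity m F₃)
    (b₁ : DensityBracket m φ F₁ F₃ B₁) (b₂ : DensityBracket m φ F₂ F₃ B₂) :
    DensityBracket m φ (fun w => F₁ w - F₂ w) F₃ (fun σ => B₁ σ - B₂ σ) := by
  simpa only [sub_eq_add_neg] using
    b₁.add_left hdom hH hφ h₁ h₂.neg h₃ b₂.neg_left

theorem densityBracket_const_zero (hdom : IsOpen m.dom) (hH : ContDiffOn ℝ ∞ m.H m.dom)
    {φ : Fields d r n} (hφ : IsField m φ) {F₃ : Jet d r n → ℝ} (h₃ : IsDensity m F₃) :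
    DensityBracket m φ (fun _ => 0) F₃ (fun _ => 0) :=
  densityBracket_of_variation hdom hH hφ contDiffOn_const h₃ fun g hg σ => by simp

theorem DensityBracket.sum_left (hdom : IsOpen m.dom) (hH : ContDiffOn ℝ ∞ m.H m.dom)
    {φ : Fields d r n} (hφ : IsField m φ) {ι : Type*} {s : Finset ι} {F : ι → Jet d r n → ℝ}
    {F₃ : Jet d r n → ℝ} {B : ι → Sp n → ℝ}
    (h : ∀ i ∈ s, IsDensity m (F i)) (h₃ : IsDensity m F₃)
    (b : ∀ i ∈ s, DensityBracket m φ (F i) F₃ (B i)) :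
    DensityBracket m φ (fun w => ∑ i ∈ s, F i w) F₃ (fun σ => ∑ i ∈ s, B i σ) := by
  classical
  induction s using Finset.induction_on with
  | empty => simpa using densityBracket_const_zero hdom hH hφ h₃
  | insert a s ha ih =>
    have h' : ∀ i ∈ s, IsDensity m (F i) := fun i hi => h i (Finset.mem_insert_of_mem hi)
    simp only [Finset.sum_insert ha]
    exact (b a (Finset.mem_insert_self a s)).add_left hdom hH hφ (h a (Finset.mem_insert_self a s))
      (IsDensity.sum h') h₃
      (ih h' fun i hi => b i (Finset.mem_insert_of_mem hi))

/-- The density `F` does not involve the component `k` of the fields. -/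
def Omits (m : LocalTarget d r n) (F : Jet d r n → ℝ) (k : Comp d r n) : Prop :=
  ∀ w ∈ jetDom m, fderiv ℝ F w (compVec k, 0) = 0 ∧
    ∀ μ, fderiv ℝ F w (0, Pi.single μ (compVec k)) = 0

theorem Omits.coord_grad {F : Jet d r n → ℝ} {k : Comp d r n} (h : Omits m F k)
    {φ : Fields d r n} (hφ : IsField m φ) (f : Sp n → ℝ) (σ : Sp n) :
    (grad F φ f).coord k σ = 0 := by
  rw [grad, euler, coord_ofCoord, eulerComp]
  have h1 : ∀ μ, (fun τ => (f τ • fderiv ℝ F (φ.jet τ)) (0, Pi.single μ (compVec k)))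
      = fun _ => (0 : ℝ) := fun μ => funext fun τ => by
    rw [smul_apply, (h _ (hφ.jet_mem τ)).2 μ, smul_zero]
  simp only [h1, dd]
  simp [(h _ (hφ.jet_mem σ)).1]

/-- Densities of `(X, A)` Poisson commute. -/
theorem densityBracket_eq_zero_of_omits_Y {φ : Fields d r n} (hφ : IsField m φ)
    {F₁ F₂ : Jet d r n → ℝ}
    (hY₁ : ∀ p, Omits m F₁ (.inr (.inr (.inl p)))) (hZ₁ : ∀ i, Omits m F₁ (.inr (.inr (.inr i))))
    (hY₂ : ∀ p, Omits m F₂ (.inr (.inr (.inl p)))) (hZ₂ : ∀ i, Omits m F₂ (.inr (.inr (.inr i)))) :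
    DensityBracket m φ F₁ F₂ 0 := by
  refine ⟨isTorusFun_const 0, fun f g _ _ => ?_⟩
  refine torusInt_congr fun σ => ?_
  have y₁ : ∀ μ a, (grad F₁ φ f).Y σ μ a = 0 := fun μ a => (hY₁ (μ, a)).coord_grad hφ f σ
  have z₁ : ∀ i, (grad F₁ φ f).Z σ i = 0 := fun i => (hZ₁ i).coord_grad hφ f σ
  have y₂ : ∀ μ a, (grad F₂ φ g).Y σ μ a = 0 := fun μ a => (hY₂ (μ, a)).coord_grad hφ g σ
  have z₂ : ∀ i, (grad F₂ φ g).Z σ i = 0 := fun i => (hZ₂ i).coord_grad hφ g σ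
  simp [bivector, y₁, z₁, y₂, z₂]

/-- Densities of `(X, Y)` Poisson commute. -/
theorem densityBracket_eq_zero_of_omits_A {φ : Fields d r n} (hφ : IsField m φ)
    {F₁ F₂ : Jet d r n → ℝ}
    (hA₁ : ∀ p, Omits m F₁ (.inr (.inl p))) (hZ₁ : ∀ i, Omits m F₁ (.inr (.inr (.inr i))))
    (hA₂ : ∀ p, Omits m F₂ (.inr (.inl p))) (hZ₂ : ∀ i, Omits m F₂ (.inr (.inr (.inr i)))) :
    DensityBracket m φ F₁ F₂ 0 := by
  refine ⟨isTorusFun_const 0, fun f g _ _ => ?_⟩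
  refine torusInt_congr fun σ => ?_
  have y₁ : ∀ μ a, (grad F₁ φ f).A σ μ a = 0 := fun μ a => (hA₁ (μ, a)).coord_grad hφ f σ
  have z₁ : ∀ i, (grad F₁ φ f).Z σ i = 0 := fun i => (hZ₁ i).coord_grad hφ f σ
  have y₂ : ∀ μ a, (grad F₂ φ g).A σ μ a = 0 := fun μ a => (hA₂ (μ, a)).coord_grad hφ g σ
  have z₂ : ∀ i, (grad F₂ φ g).Z σ i = 0 := fun i => (hZ₂ i).coord_grad hφ g σ
  simp [bivector, y₁, z₁, y₂, z₂]

end DensityBracket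

/-! ### Directional derivatives of composite expressions -/

section Variation

variable {W V V' : Type*} [NormedAddCommGroup W] [NormedSpace ℝ W]
  [NormedAddCommGroup V] [NormedSpace ℝ V] [NormedAddCommGroup V'] [NormedSpace ℝ V']

/-- `F` is differentiable at `w`, with derivative `h ↦ F' h`. The derivative is recorded as a bare
function, so that it can be computed by rewriting. -/
def HasVar (F : W → V) (w : W) (F' : W → V) : Prop :=
  ∃ D : W →L[ℝ] V, HasFDerivAt F D w ∧ ∀ h, D h = F' h

theorem HasVar.fderiv_apply {F : W → V} {w : W} {F' : W → V} (h : HasVar F w F') (x : W) :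
    fderiv ℝ F w x = F' x := by
  obtain ⟨D, hD, e⟩ := h
  rw [hD.fderiv, e]

theorem DifferentiableAt.hasVar {F : W → V} {w : W} (h : DifferentiableAt ℝ F w) :
    HasVar F w (fun x => fderiv ℝ F w x) := ⟨_, h.hasFDerivAt, fun _ => rfl⟩

theorem HasVar.clm (L : W →L[ℝ] V) (w : W) : HasVar (fun x => L x) w (fun x => L x) :=
  ⟨L, L.hasFDerivAt, fun _ => rfl⟩

theorem HasVar.const (v : V) (w : W) : HasVar (fun _ => v) w (fun _ => 0) :=
  ⟨0, hasFDerivAt_const v w, fun _ => rfl⟩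

theorem HasVar.add {F G F' G' : W → V} {w : W} (hF : HasVar F w F') (hG : HasVar G w G') :
    HasVar (fun x => F x + G x) w (fun x => F' x + G' x) := by
  obtain ⟨D, hD, e⟩ := hF
  obtain ⟨D', hD', e'⟩ := hG
  exact ⟨D + D', hD.add hD', fun h => by rw [add_apply, e, e']⟩

theorem HasVar.sub {F G F' G' : W → V} {w : W} (hF : HasVar F w F') (hG : HasVar G w G') :
    HasVar (fun x => F x - G x) w (fun x => F' x - G' x) := by
  obtain ⟨D, hD, e⟩ := hF
  obtain ⟨D', hD', e'⟩ := hG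
  exact ⟨D - D', hD.sub hD', fun h => by rw [sub_apply, e, e']⟩

theorem HasVar.neg {F F' : W → V} {w : W} (hF : HasVar F w F') :
    HasVar (fun x => -F x) w (fun x => -F' x) := by
  obtain ⟨D, hD, e⟩ := hF
  exact ⟨-D, hD.neg, fun h => by rw [neg_apply, e]⟩

theorem HasVar.sum {ι : Type*} {s : Finset ι} {F F' : ι → W → V} {w : W}
    (h : ∀ i, HasVar (F i) w (F' i)) :
    HasVar (fun x => ∑ i ∈ s, F i x) w (fun x => ∑ i ∈ s, F' i x) := by
  choose D hD e using h
  refine ⟨∑ i ∈ s, D i, HasFDerivAt.fun_sum fun i _ => hD i, fun x => ?_⟩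
  rw [sum_apply]
  exact Finset.sum_congr rfl fun i _ => e i x

theorem HasVar.comp_clm (L : V →L[ℝ] V') {F F' : W → V} {w : W} (hF : HasVar F w F') :
    HasVar (fun x => L (F x)) w (fun x => L (F' x)) := by
  obtain ⟨D, hD, e⟩ := hF
  exact ⟨L.comp D, L.hasFDerivAt.comp w hD, fun h => by rw [ContinuousLinearMap.comp_apply, e]⟩

theorem HasVar.comp {Φ : V → V'} {F F' : W → V} {w : W} (hF : HasVar F w F')
    (hΦ : DifferentiableAt ℝ Φ (F w)) :
    HasVar (fun x => Φ (F x)) w (fun x => fderiv ℝ Φ (F w) (F' x)) := by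
  obtain ⟨D, hD, e⟩ := hF
  exact ⟨(fderiv ℝ Φ (F w)).comp D, hΦ.hasFDerivAt.comp w hD, fun h => by
    rw [ContinuousLinearMap.comp_apply, e]⟩

theorem HasVar.clm_apply {L L' : W → V →L[ℝ] V'} {F F' : W → V} {w : W} (hL : HasVar L w L')
    (hF : HasVar F w F') :
    HasVar (fun x => L x (F x)) w (fun x => L' x (F w) + L w (F' x)) := by
  obtain ⟨D, hD, e⟩ := hF
  obtain ⟨D', hD', e'⟩ := hL
  refine ⟨_, hD'.clm_apply hD, fun h => ?_⟩
  simp [e, e', add_comm]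

theorem HasVar.smul {f f' : W → ℝ} {F F' : W → V} {w : W} (hf : HasVar f w f')
    (hF : HasVar F w F') :
    HasVar (fun x => f x • F x) w (fun x => f' x • F w + f w • F' x) := by
  obtain ⟨D, hD, e⟩ := hF
  obtain ⟨D', hD', e'⟩ := hf
  refine ⟨_, hD'.smul hD, fun h => ?_⟩
  simp [e, e', add_comm]

theorem HasVar.mul {f f' : W → ℝ} {F F' : W → ℝ} {w : W} (hf : HasVar f w f')
    (hF : HasVar F w F') :
    HasVar (fun x => f x * F x) w (fun x => f' x * F w + f w * F' x) :=
  hf.smul hF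

theorem HasVar.apply {ι : Type*} [Fintype ι] {F F' : W → ι → V} {w : W} (hF : HasVar F w F')
    (i : ι) : HasVar (fun x => F x i) w (fun x => F' x i) :=
  hF.comp_clm (ContinuousLinearMap.proj (R := ℝ) (φ := fun _ : ι => V) i)

theorem HasVar.euclidean_apply {d : ℕ} {F F' : W → Pt d} {w : W} (hF : HasVar F w F')
    (i : Fin d) : HasVar (fun x => F x i) w (fun x => F' x i) :=
  hF.comp_clm (EuclideanSpace.proj (𝕜 := ℝ) i)

theorem HasVar.dotProduct {k : ℕ} {F F' G G' : W → Fin k → ℝ} {w : W} (hF : HasVar F w F')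
    (hG : HasVar G w G') :
    HasVar (fun x => F x ⬝ᵥ G x) w (fun x => F' x ⬝ᵥ G w + F w ⬝ᵥ G' x) := by
  simp only [_root_.dotProduct, ← Finset.sum_add_distrib]
  exact HasVar.sum fun i => (hF.apply i).mul (hG.apply i)

theorem HasVar.multilinear_apply {ι : Type*} [Fintype ι] [DecidableEq ι]
    {L L' : W → ContinuousMultilinearMap ℝ (fun _ : ι => V) V'} {F F' : ι → W → V} {w : W}
    (hL : HasVar L w L') (hF : ∀ i, HasVar (F i) w (F' i)) :
    HasVar (fun x => L x (fun i => F i x)) w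
      (fun x => L' x (fun i => F i w) + ∑ i, L w (Function.update (fun i => F i w) i (F' i x))) := by
  obtain ⟨D', hD', e'⟩ := hL
  choose D hD e using hF
  refine ⟨_, hD'.continuousMultilinearMap_apply hD, fun h => ?_⟩
  simp [e, e']

theorem HasVar.id (w : W) : HasVar (fun x => x) w (fun x => x) :=
  HasVar.clm (ContinuousLinearMap.id ℝ W) w

theorem HasVar.fst {F F' : W → V × V'} {w : W} (h : HasVar F w F') :
    HasVar (fun x => (F x).1) w (fun x => (F' x).1) :=
  h.comp_clm (ContinuousLinearMap.fst ℝ V V')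

theorem HasVar.snd {F F' : W → V × V'} {w : W} (h : HasVar F w F') :
    HasVar (fun x => (F x).2) w (fun x => (F' x).2) :=
  h.comp_clm (ContinuousLinearMap.snd ℝ V V')

theorem HasVar.congr {F F' F'' : W → V} {w : W} (h : HasVar F w F') (e : ∀ x, F' x = F'' x) :
    HasVar F w F'' := by
  rwa [← show F' = F'' from funext e]

theorem HasVar.vecCons {k : ℕ} (a : V) {F F' : W → Fin k → V} {w : W} (h : HasVar F w F')
    (i : Fin (k + 1)) :
    HasVar (fun x => Matrix.vecCons a (F x) i) w (fun x => Matrix.vecCons 0 (F' x) i) := by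
  refine Fin.cases ?_ (fun i => ?_) i
  · exact HasVar.const a w
  · exact h.apply i

theorem HasVar.update {k : ℕ} (a : V) {F F' : W → Fin k → V} {w : W} (h : HasVar F w F')
    (μ i : Fin k) :
    HasVar (fun x => Function.update (F x) μ a i) w (fun x => Function.update (F' x) μ 0 i) := by
  by_cases hi : i = μ
  · subst hi
    simpa using HasVar.const a w
  · simpa [Function.update_of_ne hi] using h.apply i

theorem HasVar.pi {ι : Type*} [Fintype ι] {F F' : W → ι → V} {w : W}
    (h : ∀ i, HasVar (fun x => F x i) w (fun x => F' x i)) : HasVar F w F' := by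
  choose D hD e using h
  exact ⟨ContinuousLinearMap.pi D, hasFDerivAt_pi.2 hD, fun x => funext fun i => e i x⟩

theorem HasVar.ofLp {d : ℕ} {F F' : W → Pt d} {w : W} (h : HasVar F w F') :
    HasVar (fun x => (F x).ofLp) w (fun x => (F' x).ofLp) :=
  h.comp_clm (PiLp.continuousLinearEquiv 2 ℝ (fun _ : Fin d => ℝ)).toContinuousLinearMap

end Variation

theorem IsTorusFun.hasVar {n : ℕ} {V : Type*} [NormedAddCommGroup V] [NormedSpace ℝ V]
    {f : Sp n → V} (hf : IsTorusFun f) (σ : Sp n) : HasVar f σ (fun x => fderiv ℝ f σ x) :=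
  DifferentiableAt.hasVar (hf.differentiable σ)

/-! ### The structure functions as smooth families of linear maps -/

section Bundled

variable {d r n : ℕ} (m : LocalTarget d r n) (w : LocalConnection d r)

-- Shortcuts: the search for these instances is slow.
instance : NormedAddCommGroup ((Fin r → ℝ) →L[ℝ] (Fin r → ℝ) →L[ℝ] (Fin r → ℝ)) :=
  ContinuousLinearMap.toNormedAddCommGroup

instance : NormedAddCommGroup ((Fin r → ℝ) →L[ℝ] Pt d →L[ℝ] (Fin r → ℝ)) :=
  ContinuousLinearMap.toNormedAddCommGroup

instance : NormedSpace ℝ ((Fin r → ℝ) →L[ℝ] (Fin r → ℝ) →L[ℝ] (Fin r → ℝ)) :=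
  ContinuousLinearMap.toNormedSpace

instance : NormedSpace ℝ ((Fin r → ℝ) →L[ℝ] Pt d →L[ℝ] (Fin r → ℝ)) :=
  ContinuousLinearMap.toNormedSpace

/-- The anchor `ρ(v) = v^a ρ_a`. -/
def LocalTarget.rhoL (y : Pt d) : (Fin r → ℝ) →L[ℝ] Pt d :=
  ∑ a, (ContinuousLinearMap.proj a : (Fin r → ℝ) →L[ℝ] ℝ).smulRight (m.rho y a)

/-- The bracket of sections with constant coefficients, `C(u, v)^c = C_{ab}^c u^a v^b`. -/
def LocalTarget.CL (y : Pt d) : (Fin r → ℝ) →L[ℝ] (Fin r → ℝ) →L[ℝ] (Fin r → ℝ) :=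
  ∑ a, ∑ b, (ContinuousLinearMap.proj a : (Fin r → ℝ) →L[ℝ] ℝ).smulRight
    ((ContinuousLinearMap.proj b : (Fin r → ℝ) →L[ℝ] ℝ).smulRight (m.C y a b))

/-- The form `J` as a continuous multilinear map, so that it can be differentiated in `y`. -/
def LocalTarget.JL (y : Pt d) :
    ContinuousMultilinearMap ℝ (fun _ : Fin (n + 1) => Fin r → ℝ) ℝ :=
  ∑ a : Fin (n + 1) → Fin r, m.J y (fun k => Pi.single (a k) 1) •
    (ContinuousMultilinearMap.mkPiAlgebra ℝ (Fin (n + 1)) ℝ).compContinuousLinearMap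
      (fun k => ContinuousLinearMap.proj (a k))

/-- The connection coefficients, `ω(v, x)^c = ω^c_{bi} v^b x^i`. -/
def LocalConnection.omL (y : Pt d) : (Fin r → ℝ) →L[ℝ] Pt d →L[ℝ] (Fin r → ℝ) :=
  ∑ b, ∑ i, (ContinuousLinearMap.proj b : (Fin r → ℝ) →L[ℝ] ℝ).smulRight
    ((EuclideanSpace.proj i : Pt d →L[ℝ] ℝ).smulRight (w.om y b i))

theorem LocalTarget.rhoL_apply (y : Pt d) (v : Fin r → ℝ) :
    m.rhoL y v = ∑ a, v a • m.rho y a := by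
  simp [rhoL]

theorem LocalTarget.CL_apply (y : Pt d) (u v : Fin r → ℝ) :
    m.CL y u v = ∑ a, ∑ b, (u a * v b) • m.C y a b := by
  simp [CL, smul_smul]

theorem LocalTarget.JL_apply (y : Pt d) (v : Fin (n + 1) → Fin r → ℝ) :
    m.JL y v = m.J y v := by
  have h : v = fun k => ∑ a, v k a • (Pi.single a 1 : Fin r → ℝ) := funext fun k => pi_eq_sum (v k)
  conv_rhs => rw [h]
  rw [← AlternatingMap.coe_multilinearMap, MultilinearMap.map_sum]
  simp only [JL, sum_apply, MultilinearMap.map_smul_univ]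
  refine Finset.sum_congr rfl fun a _ => ?_
  simp [mul_comm]

theorem LocalConnection.omL_apply (y : Pt d) (v : Fin r → ℝ) (x : Pt d) :
    w.omL y v x = ∑ b, ∑ i, (v b * x i) • w.om y b i := by
  simp [omL, smul_smul]

theorem LocalTarget.rhoL_single (y : Pt d) (a : Fin r) : m.rhoL y (Pi.single a 1) = m.rho y a := by
  simp [rhoL_apply, Pi.single_apply]

theorem LocalTarget.CL_single (y : Pt d) (a b : Fin r) :
    m.CL y (Pi.single a 1) (Pi.single b 1) = m.C y a b := by
  simp [CL_apply, Pi.single_apply]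

theorem LocalConnection.omL_single (y : Pt d) (b : Fin r) (i : Fin d) :
    w.omL y (Pi.single b 1) (EuclideanSpace.single i 1) = w.om y b i := by
  simp [omL_apply, Pi.single_apply]

/-- The coordinate domain is open and the structure functions are smooth on it. -/
structure LocalTarget.IsSmooth : Prop where
  isOpen : IsOpen m.dom
  rho_smooth : ∀ a, ContDiffOn ℝ ∞ (fun y => m.rho y a) m.dom
  C_smooth : ∀ a b, ContDiffOn ℝ ∞ (fun y => m.C y a b) m.dom
  J_smooth : ∀ v, ContDiffOn ℝ ∞ (fun y => m.J y v) m.dom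
  H_smooth : ContDiffOn ℝ ∞ m.H m.dom

/-- The local form of a Lie algebroid with smooth structure functions: `ρ` is a homomorphism and
the bracket satisfies the Jacobi identity, both evaluated on sections with constant coefficients. -/
structure LocalTarget.IsLieAlgebroid : Prop extends m.IsSmooth where
  antisymm : ∀ y ∈ m.dom, ∀ u v, m.CL y v u = -m.CL y u v
  anchor_hom : ∀ y ∈ m.dom, ∀ u v, m.rhoL y (m.CL y u v)
    = fderiv ℝ m.rhoL y (m.rhoL y u) v - fderiv ℝ m.rhoL y (m.rhoL y v) u
  jacobi : ∀ y ∈ m.dom, ∀ u v w,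
    m.CL y u (m.CL y v w) + fderiv ℝ m.CL y (m.rhoL y u) v w
      + (m.CL y v (m.CL y w u) + fderiv ℝ m.CL y (m.rhoL y v) w u)
      + (m.CL y w (m.CL y u v) + fderiv ℝ m.CL y (m.rhoL y w) u v) = 0

variable {m} {w}

theorem LocalTarget.IsSmooth.contDiffOn_rhoL (h : m.IsSmooth) :
    ContDiffOn ℝ ∞ m.rhoL m.dom :=
  ContDiffOn.sum fun a _ => by
    exact (ContinuousLinearMap.smulRightL ℝ (Fin r → ℝ) (Pt d)
      (ContinuousLinearMap.proj a)).contDiff.comp_contDiffOn (h.rho_smooth a)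

theorem LocalTarget.IsSmooth.contDiffOn_CL (h : m.IsSmooth) :
    ContDiffOn ℝ ∞ m.CL m.dom :=
  ContDiffOn.sum fun a _ => ContDiffOn.sum fun b _ => by
    exact (ContinuousLinearMap.smulRightL ℝ (Fin r → ℝ) ((Fin r → ℝ) →L[ℝ] (Fin r → ℝ))
      (ContinuousLinearMap.proj a)).contDiff.comp_contDiffOn
      ((ContinuousLinearMap.smulRightL ℝ (Fin r → ℝ) (Fin r → ℝ)
        (ContinuousLinearMap.proj b)).contDiff.comp_contDiffOn (h.C_smooth a b))

theorem LocalTarget.IsSmooth.contDiffOn_JL (h : m.IsSmooth) :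
    ContDiffOn ℝ ∞ m.JL m.dom :=
  ContDiffOn.sum fun _ _ => (h.J_smooth _).smul contDiffOn_const

theorem LocalConnection.contDiffOn_omL {s : Set (Pt d)}
    (h : ∀ b i, ContDiffOn ℝ ∞ (fun y => w.om y b i) s) : ContDiffOn ℝ ∞ w.omL s :=
  ContDiffOn.sum fun b _ => ContDiffOn.sum fun i _ => by
    exact (ContinuousLinearMap.smulRightL ℝ (Fin r → ℝ) (Pt d →L[ℝ] (Fin r → ℝ))
      (ContinuousLinearMap.proj b)).contDiff.comp_contDiffOn
      ((ContinuousLinearMap.smulRightL ℝ (Pt d) (Fin r → ℝ)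
        (EuclideanSpace.proj i)).contDiff.comp_contDiffOn (h b i))

theorem LocalTarget.IsSmooth.differentiableAt_rhoL (h : m.IsSmooth) {y : Pt d}
    (hy : y ∈ m.dom) : DifferentiableAt ℝ m.rhoL y :=
  (h.contDiffOn_rhoL.contDiffAt (h.isOpen.mem_nhds hy)).differentiableAt (by simp)

theorem LocalTarget.IsSmooth.differentiableAt_CL (h : m.IsSmooth) {y : Pt d}
    (hy : y ∈ m.dom) : DifferentiableAt ℝ m.CL y :=
  (h.contDiffOn_CL.contDiffAt (h.isOpen.mem_nhds hy)).differentiableAt (by simp)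

theorem LocalTarget.IsSmooth.differentiableAt_JL (h : m.IsSmooth) {y : Pt d}
    (hy : y ∈ m.dom) : DifferentiableAt ℝ m.JL y :=
  (h.contDiffOn_JL.contDiffAt (h.isOpen.mem_nhds hy)).differentiableAt (by simp)

theorem pd_eq_of_hasVar {f : Pt d → ℝ} {y : Pt d} {f' : Pt d → ℝ} (h : HasVar f y f')
    (i : Fin d) : pd i f y = f' (EuclideanSpace.single i 1) :=
  h.fderiv_apply _

theorem LocalTarget.IsSmooth.pd_rho (h : m.IsSmooth) {y : Pt d} (hy : y ∈ m.dom)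
    (j : Fin d) (a : Fin r) (i : Fin d) :
    pd j (fun z => m.rho z a i) y
      = fderiv ℝ m.rhoL y (EuclideanSpace.single j 1) (Pi.single a 1) i := by
  have e : (fun z => m.rho z a i) = fun z => m.rhoL z (Pi.single a 1) i := by
    simp only [LocalTarget.rhoL_single]
  rw [e, pd_eq_of_hasVar (((DifferentiableAt.hasVar (h.differentiableAt_rhoL hy)).clm_apply
    (HasVar.const _ y)).euclidean_apply i)]
  simp

theorem LocalTarget.IsSmooth.pd_C (h : m.IsSmooth) {y : Pt d} (hy : y ∈ m.dom)
    (j : Fin d) (a b c : Fin r) :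
    pd j (fun z => m.C z a b c) y
      = fderiv ℝ m.CL y (EuclideanSpace.single j 1) (Pi.single a 1) (Pi.single b 1) c := by
  have e : (fun z => m.C z a b c) = fun z => m.CL z (Pi.single a 1) (Pi.single b 1) c := by
    simp only [LocalTarget.CL_single]
  rw [e, pd_eq_of_hasVar ((((DifferentiableAt.hasVar (h.differentiableAt_CL hy)).clm_apply
    (HasVar.const _ y)).clm_apply (HasVar.const _ y)).apply c)]
  simp

theorem LocalTarget.IsSmooth.pd_J (h : m.IsSmooth) {y : Pt d} (hy : y ∈ m.dom)
    (j : Fin d) (v : Fin (n + 1) → Fin r → ℝ) :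
    pd j (fun z => m.J z v) y = fderiv ℝ m.JL y (EuclideanSpace.single j 1) v := by
  have e : (fun z => m.J z v) = fun z => m.JL z v := by simp only [LocalTarget.JL_apply]
  rw [e, pd_eq_of_hasVar ((DifferentiableAt.hasVar (h.differentiableAt_JL hy)).multilinear_apply
    fun i => HasVar.const (v i) y)]
  rw [add_eq_left]
  exact Finset.sum_eq_zero fun i _ => (m.JL y).map_coord_zero i (by simp)

/-- The derivatives of `J` are alternating. -/
theorem LocalTarget.IsSmooth.fderiv_JL_eq (h : m.IsSmooth) {y : Pt d} (hy : y ∈ m.dom)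
    (x : Pt d) (v : Fin (n + 1) → Fin r → ℝ) :
    fderiv ℝ m.JL y x v = fderiv ℝ (fun z => m.J z v) y x := by
  have e : (fun z => m.J z v) = fun z => m.JL z v := by simp only [LocalTarget.JL_apply]
  rw [e, ((DifferentiableAt.hasVar (h.differentiableAt_JL hy)).multilinear_apply
    fun i => HasVar.const (v i) y).fderiv_apply]
  rw [left_eq_add]
  exact Finset.sum_eq_zero fun i _ => (m.JL y).map_coord_zero i (by simp)

/-- Contraction of a linear function with a vector in coordinates. -/
theorem sum_single_mul (L : Pt d →ₗ[ℝ] ℝ) (x : Pt d) :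
    ∑ i, L (EuclideanSpace.single i 1) * x i = L x := by
  conv_rhs => rw [euclidean_eq_sum x]
  rw [map_sum]
  exact Finset.sum_congr rfl fun i _ => by rw [map_smul, smul_eq_mul, mul_comm]

end Bundled

/-! ### The constraints as densities, and their variations -/

theorem contDiff_multilinear_apply {E F : Type*} [NormedAddCommGroup E] [NormedSpace ℝ E]
    [NormedAddCommGroup F] [NormedSpace ℝ F] {k : ℕ} :
    ContDiff ℝ ∞ (fun p : ContinuousMultilinearMap ℝ (fun _ : Fin k => E) F × (Fin k → E) =>
      p.1 p.2) :=
  contDiffOn_univ.1 ((ContinuousLinearMap.analyticOnNhd_uncurry_of_multilinear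
    (ContinuousLinearMap.id ℝ (ContinuousMultilinearMap ℝ (fun _ : Fin k => E) F))
    (s := Set.univ)).contDiffOn uniqueDiffOn_univ)

section Densities

variable {d r n : ℕ} (m : LocalTarget d r n)

/-- The density of the constraint `G_X`. -/
def densX (μ : Fin n) (i : Fin d) (w : Jet d r n) : ℝ :=
  ((w.2 μ).1 - m.rhoL w.1.1 (w.1.2.1 μ)) i

/-- The density of the constraint `G_A`. -/
def densA (μ ν : Fin n) (a : Fin r) (w : Jet d r n) : ℝ :=
  ((w.2 μ).2.1 ν - (w.2 ν).2.1 μ + m.CL w.1.1 (w.1.2.1 μ) (w.1.2.1 ν)) a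

/-- The density of the constraint `G_Y`. -/
def densY (a : Fin r) (w : Jet d r n) : ℝ :=
  (∑ μ, (w.2 μ).2.2.1 μ a)
    + (-1 : ℝ) ^ (n + 1) * ((m.rhoL w.1.1 (Pi.single a 1)).ofLp ⬝ᵥ w.1.2.2.2)
    + (∑ μ, w.1.2.2.1 μ ⬝ᵥ m.CL w.1.1 (Pi.single a 1) (w.1.2.1 μ))
    + m.JL w.1.1 (Matrix.vecCons (Pi.single a 1) w.1.2.1)

theorem GX_eq (φ : Fields d r n) (σ : Sp n) (μ : Fin n) :
    GX m φ σ μ = dd μ φ.X σ - m.rhoL (φ.X σ) (φ.A σ μ) := by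
  rw [GX, m.rhoL_apply]

theorem GA_eq (φ : Fields d r n) (σ : Sp n) (μ ν : Fin n) :
    GA m φ σ μ ν = dd μ φ.A σ ν - dd ν φ.A σ μ + m.CL (φ.X σ) (φ.A σ μ) (φ.A σ ν) := by
  funext a
  simp only [GA, m.CL_apply, Pi.add_apply, Pi.sub_apply, Finset.sum_apply, Pi.smul_apply,
    smul_eq_mul]
  congr 1
  exact Finset.sum_congr rfl fun b _ => Finset.sum_congr rfl fun c _ => by ring

theorem CL_single_apply (y : Pt d) (a : Fin r) (v : Fin r → ℝ) (c : Fin r) :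
    m.CL y (Pi.single a 1) v c = ∑ b, v b * m.C y a b c := by
  simp only [m.CL_apply, Finset.sum_apply, Pi.smul_apply, smul_eq_mul]
  rw [Finset.sum_eq_single a (fun e _ he => by simp [Pi.single_eq_of_ne he]) (by simp)]
  simp

theorem represents_densX (μ : Fin n) (i : Fin d) :
    Represents m (densX m μ i) (fun φ σ => GX m φ σ μ i) := fun φ σ _ => by
  simp only [GX_eq]; rfl

theorem represents_densA (μ ν : Fin n) (a : Fin r) :
    Represents m (densA m μ ν a) (fun φ σ => GA m φ σ μ ν a) := fun φ σ _ => by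
  simp only [GA_eq]; rfl

theorem GY_eq (φ : Fields d r n) (σ : Sp n) (a : Fin r) :
    GY m φ σ a = (∑ μ, dd μ φ.Y σ μ a)
      + (-1 : ℝ) ^ (n + 1) * ((m.rhoL (φ.X σ) (Pi.single a 1)).ofLp ⬝ᵥ φ.Z σ)
      + (∑ μ, φ.Y σ μ ⬝ᵥ m.CL (φ.X σ) (Pi.single a 1) (φ.A σ μ))
      + m.JL (φ.X σ) (Matrix.vecCons (Pi.single a 1) (φ.A σ)) := by
  rw [GY, m.rhoL_single, m.JL_apply]
  congr 2
  refine Finset.sum_congr rfl fun μ _ => ?_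
  simp only [dotProduct, CL_single_apply, Finset.mul_sum]
  rw [Finset.sum_comm]
  exact Finset.sum_congr rfl fun b _ => Finset.sum_congr rfl fun c _ => by ring

theorem represents_densY (a : Fin r) :
    Represents m (densY m a) (fun φ σ => GY m φ σ a) := fun φ σ _ => by
  simp only [GY_eq]; rfl

variable {m}

theorem contDiffOn_comp_X {V : Type*} [NormedAddCommGroup V] [NormedSpace ℝ V] {f : Pt d → V}
    (hf : ContDiffOn ℝ ∞ f m.dom) : ContDiffOn ℝ ∞ (fun w : Jet d r n => f w.1.1) (jetDom m) :=
  hf.comp (by fun_prop : ContDiff ℝ ∞ fun w : Jet d r n => w.1.1).contDiffOn fun _ hw => hw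

theorem isDensity_densX (h : m.IsLieAlgebroid) (μ : Fin n) (i : Fin d) :
    IsDensity m (densX m μ i) := by
  have e : ContDiff ℝ ∞ (fun w : Jet d r n => (w.2 μ).1) := by fun_prop
  have e1 : ContDiff ℝ ∞ (fun w : Jet d r n => w.1.2.1 μ) := by fun_prop
  exact (EuclideanSpace.proj (𝕜 := ℝ) i).contDiff.comp_contDiffOn (e.contDiffOn.sub
    ((contDiffOn_comp_X h.contDiffOn_rhoL).clm_apply e1.contDiffOn))

theorem isDensity_densA (h : m.IsLieAlgebroid) (μ ν : Fin n) (a : Fin r) :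
    IsDensity m (densA m μ ν a) := by
  have e : ContDiff ℝ ∞ (fun w : Jet d r n => (w.2 μ).2.1 ν - (w.2 ν).2.1 μ) := by fun_prop
  have e1 : ∀ μ, ContDiff ℝ ∞ (fun w : Jet d r n => w.1.2.1 μ) := fun μ => by fun_prop
  exact contDiffOn_pi.1 (e.contDiffOn.add
    (((contDiffOn_comp_X h.contDiffOn_CL).clm_apply (e1 μ).contDiffOn).clm_apply
      (e1 ν).contDiffOn)) a

theorem contDiffOn_dotProduct {V : Type*} [NormedAddCommGroup V] [NormedSpace ℝ V] {k : ℕ}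
    {s : Set V} {f g : V → Fin k → ℝ} (hf : ContDiffOn ℝ ∞ f s) (hg : ContDiffOn ℝ ∞ g s) :
    ContDiffOn ℝ ∞ (fun x => f x ⬝ᵥ g x) s :=
  ContDiffOn.sum fun i _ => (contDiffOn_pi.1 hf i).mul (contDiffOn_pi.1 hg i)

theorem isDensity_densY (h : m.IsLieAlgebroid) (a : Fin r) : IsDensity m (densY m a) := by
  have e : ContDiff ℝ ∞ (fun w : Jet d r n => ∑ μ, (w.2 μ).2.2.1 μ a) := by fun_prop
  have eA : ContDiff ℝ ∞ (fun w : Jet d r n => w.1.2.1) := by fun_prop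
  have eA' : ∀ μ, ContDiff ℝ ∞ (fun w : Jet d r n => w.1.2.1 μ) := fun μ => by fun_prop
  have eY : ∀ μ, ContDiff ℝ ∞ (fun w : Jet d r n => w.1.2.2.1 μ) := fun μ => by fun_prop
  have eZ : ContDiff ℝ ∞ (fun w : Jet d r n => w.1.2.2.2) := by fun_prop
  have e1 : ContDiffOn ℝ ∞ (fun w : Jet d r n => (m.rhoL w.1.1 (Pi.single a 1)).ofLp)
      (jetDom m) :=
    (PiLp.continuousLinearEquiv 2 ℝ (fun _ : Fin d => ℝ)).contDiff.comp_contDiffOn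
      ((contDiffOn_comp_X h.contDiffOn_rhoL).clm_apply contDiffOn_const)
  refine ((e.contDiffOn.add (contDiffOn_const.mul (contDiffOn_dotProduct e1 eZ.contDiffOn))).add
    (ContDiffOn.sum fun μ _ => contDiffOn_dotProduct (eY μ).contDiffOn
      (((contDiffOn_comp_X h.contDiffOn_CL).clm_apply contDiffOn_const).clm_apply
        (eA' μ).contDiffOn))).add ?_
  have e2 : ContDiffOn ℝ ∞ (fun w : Jet d r n =>
      (Matrix.vecCons (Pi.single a 1) w.1.2.1 : Fin (n + 1) → Fin r → ℝ)) (jetDom m) := by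
    refine contDiffOn_pi.2 fun i => ?_
    refine Fin.cases ?_ (fun i => ?_) i
    · exact contDiffOn_const
    · exact (eA' i).contDiffOn
  exact contDiff_multilinear_apply.comp_contDiffOn
    ((contDiffOn_comp_X h.contDiffOn_JL).prodMk e2)

theorem hasVar_comp_X {V : Type*} [NormedAddCommGroup V] [NormedSpace ℝ V] {f : Pt d → V}
    {w : Jet d r n} (hf : DifferentiableAt ℝ f w.1.1) :
    HasVar (fun w : Jet d r n => f w.1.1) w (fun h => fderiv ℝ f w.1.1 h.1.1) :=
  (HasVar.id w).fst.fst.comp hf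

theorem var_densX (h : m.IsLieAlgebroid) (μ : Fin n) (i : Fin d) {w : Jet d r n}
    (hw : w ∈ jetDom m) :
    HasVar (densX m μ i) w (fun k => ((k.2 μ).1 -
      (fderiv ℝ m.rhoL w.1.1 k.1.1 (w.1.2.1 μ) + m.rhoL w.1.1 (k.1.2.1 μ))) i) :=
  ((((HasVar.id w).snd.apply μ).fst).sub
    ((hasVar_comp_X (h.differentiableAt_rhoL hw)).clm_apply
      ((HasVar.id w).fst.snd.fst.apply μ))).euclidean_apply i

theorem var_densA (h : m.IsLieAlgebroid) (μ ν : Fin n) (a : Fin r) {w : Jet d r n}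
    (hw : w ∈ jetDom m) :
    HasVar (densA m μ ν a) w (fun k => ((k.2 μ).2.1 ν - (k.2 ν).2.1 μ +
      ((fderiv ℝ m.CL w.1.1 k.1.1 (w.1.2.1 μ) + m.CL w.1.1 (k.1.2.1 μ)) (w.1.2.1 ν)
        + m.CL w.1.1 (w.1.2.1 μ) (k.1.2.1 ν))) a) :=
  ((((((HasVar.id w).snd.apply μ).snd.fst.apply ν).sub
    (((HasVar.id w).snd.apply ν).snd.fst.apply μ))).add
    (((hasVar_comp_X (h.differentiableAt_CL hw)).clm_apply
      ((HasVar.id w).fst.snd.fst.apply μ)).clm_apply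
      ((HasVar.id w).fst.snd.fst.apply ν))).apply a

theorem sum_update_vecCons (f : ContinuousMultilinearMap ℝ (fun _ : Fin (n + 1) => Fin r → ℝ) ℝ)
    (a : Fin r → ℝ) (A B : Fin n → Fin r → ℝ) :
    ∑ i, f (Function.update (Matrix.vecCons a A) i (Matrix.vecCons 0 B i))
      = ∑ μ, f (Matrix.vecCons a (Function.update A μ (B μ))) := by
  rw [Fin.sum_univ_succ]
  have h0 : f (Function.update (Matrix.vecCons a A) 0 (Matrix.vecCons 0 B 0)) = 0 :=
    f.map_coord_zero 0 (by simp)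
  rw [h0, zero_add]
  refine Finset.sum_congr rfl fun μ _ => congrArg f ?_
  rw [Matrix.cons_val_succ, Matrix.vecCons, Matrix.vecCons, Fin.cons_update]

theorem var_densY (h : m.IsLieAlgebroid) (a : Fin r) {w : Jet d r n} (hw : w ∈ jetDom m) :
    HasVar (densY m a) w (fun k =>
      (∑ μ, (k.2 μ).2.2.1 μ a)
      + (-1 : ℝ) ^ (n + 1) * ((fderiv ℝ m.rhoL w.1.1 k.1.1 (Pi.single a 1)).ofLp ⬝ᵥ w.1.2.2.2
          + (m.rhoL w.1.1 (Pi.single a 1)).ofLp ⬝ᵥ k.1.2.2.2)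
      + (∑ μ, (k.1.2.2.1 μ ⬝ᵥ m.CL w.1.1 (Pi.single a 1) (w.1.2.1 μ)
          + w.1.2.2.1 μ ⬝ᵥ (fderiv ℝ m.CL w.1.1 k.1.1 (Pi.single a 1) (w.1.2.1 μ)
            + m.CL w.1.1 (Pi.single a 1) (k.1.2.1 μ))))
      + (fderiv ℝ m.JL w.1.1 k.1.1 (Matrix.vecCons (Pi.single a 1) w.1.2.1)
          + ∑ μ, m.JL w.1.1 (Matrix.vecCons (Pi.single a 1)
              (Function.update w.1.2.1 μ (k.1.2.1 μ))))) := by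
  have v1 := HasVar.sum (s := Finset.univ) fun μ : Fin n =>
    (((HasVar.id w).snd.apply μ).snd.snd.fst.apply μ).apply a
  have v2 := ((HasVar.const ((-1 : ℝ) ^ (n + 1)) w).mul
    (((hasVar_comp_X (h.differentiableAt_rhoL hw)).clm_apply
      (HasVar.const (Pi.single a 1 : Fin r → ℝ) w)).ofLp.dotProduct (HasVar.id w).fst.snd.snd.snd))
  have v3 := HasVar.sum (s := Finset.univ) fun μ : Fin n =>
    ((HasVar.id w).fst.snd.snd.fst.apply μ).dotProduct
      (((hasVar_comp_X (h.differentiableAt_CL hw)).clm_apply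
        (HasVar.const (Pi.single a 1 : Fin r → ℝ) w)).clm_apply
        ((HasVar.id w).fst.snd.fst.apply μ))
  have v4 := (hasVar_comp_X (h.differentiableAt_JL hw)).multilinear_apply
    (HasVar.vecCons (Pi.single a 1 : Fin r → ℝ) (HasVar.id w).fst.snd.fst)
  refine (((v1.add v2).add v3).add v4).congr fun k => ?_
  simp only [zero_mul, zero_add, map_zero, add_zero]
  rw [← sum_update_vecCons]

end Densities

/-! ### The Hamiltonian vector field of `G_Y` -/

section Ham

variable {d r n : ℕ} {m : LocalTarget d r n}

theorem JL_update_zero (y : Pt d) (a : Fin r → ℝ) (A : Fin n → Fin r → ℝ) (μ : Fin n) :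
    m.JL y (Matrix.vecCons a (Function.update A μ 0)) = 0 :=
  (m.JL y).map_coord_zero μ.succ (by simp)

/-- Since `G_Y` contains derivatives only of `Y`, linearly and with constant coefficients, only the
components along `Y` involve a derivative of the smearing function. -/
theorem eulerComp_densY (h : m.IsLieAlgebroid) {φ : Fields d r n} (hφ : IsField m φ) (b : Fin r)
    {g : Sp n → ℝ} (hg : IsTorusFun g) (v : Val d r n) (σ : Sp n) :
    eulerComp (fun σ => g σ • fderiv ℝ (densY m b) (φ.jet σ)) v σ
      = g σ * ((-1 : ℝ) ^ (n + 1) * ((fderiv ℝ m.rhoL (φ.X σ) v.1 (Pi.single b 1)).ofLp ⬝ᵥ φ.Z σ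
          + (m.rhoL (φ.X σ) (Pi.single b 1)).ofLp ⬝ᵥ v.2.2.2)
      + (∑ μ, (v.2.2.1 μ ⬝ᵥ m.CL (φ.X σ) (Pi.single b 1) (φ.A σ μ)
          + φ.Y σ μ ⬝ᵥ (fderiv ℝ m.CL (φ.X σ) v.1 (Pi.single b 1) (φ.A σ μ)
            + m.CL (φ.X σ) (Pi.single b 1) (v.2.1 μ))))
      + (fderiv ℝ m.JL (φ.X σ) v.1 (Matrix.vecCons (Pi.single b 1) (φ.A σ))
          + ∑ μ, m.JL (φ.X σ) (Matrix.vecCons (Pi.single b 1)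
              (Function.update (φ.A σ) μ (v.2.1 μ)))))
        - ∑ μ, dd μ g σ * v.2.2.1 μ b := by
  rw [eulerComp]
  congr 1
  · rw [smul_apply, (var_densY h b (hφ.jet_mem σ)).fderiv_apply, smul_eq_mul]
    simp [Fields.jet]
  · refine Finset.sum_congr rfl fun μ _ => ?_
    have e : (fun τ => (g τ • fderiv ℝ (densY m b) (φ.jet τ)) (0, Pi.single μ v))
        = fun τ => g τ * v.2.2.1 μ b := by
      funext τ
      rw [smul_apply, (var_densY h b (hφ.jet_mem τ)).fderiv_apply, smul_eq_mul]
      congr 1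
      simp only [Prod.fst_zero, Prod.snd_zero, map_zero, zero_apply, Pi.zero_apply,
        zero_dotProduct, dotProduct_zero, JL_update_zero, Finset.sum_const_zero, add_zero,
        mul_zero, WithLp.ofLp_zero]
      rw [Finset.sum_eq_single μ (fun ν _ hν => by simp [Pi.single_eq_of_ne hν]) (by simp)]
      simp
    rw [e, dd_mul hg (isTorusFun_const _)]
    simp [dd]

theorem neg_one_pow_mul_succ (n : ℕ) : (-1 : ℝ) ^ n * (-1) ^ (n + 1) = -1 := by
  rw [pow_succ, ← mul_assoc, ← mul_pow]; simp

theorem ham_densY_X (h : m.IsLieAlgebroid) {φ : Fields d r n} (hφ : IsField m φ) (b : Fin r)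
    {g : Sp n → ℝ} (hg : IsTorusFun g) (σ : Sp n) :
    (ham m φ (grad (densY m b) φ g)).X σ = -(g σ • m.rhoL (φ.X σ) (Pi.single b 1)) := by
  ext i
  have e : (grad (densY m b) φ g).Z σ i
      = g σ * ((-1 : ℝ) ^ (n + 1) * (m.rhoL (φ.X σ) (Pi.single b 1)) i) := by
    refine (eulerComp_densY h hφ b hg (compVec (.inr (.inr (.inr i)))) σ).trans ?_
    simp [compVec, JL_update_zero]
  have s := neg_one_pow_mul_succ n
  simp only [ham, e, PiLp.neg_apply, PiLp.smul_apply, smul_eq_mul]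
  linear_combination (g σ * (m.rhoL (φ.X σ) (Pi.single b 1)) i) * s

theorem sum_single_dotProduct {k l : ℕ} (μ : Fin k) (c : Fin l) (f : Fin k → Fin l → ℝ) :
    ∑ ν, (Pi.single μ (Pi.single c 1) : Fin k → Fin l → ℝ) ν ⬝ᵥ f ν = f μ c := by
  rw [Finset.sum_eq_single μ (fun ν _ hν => by simp [Pi.single_eq_of_ne hν]) (by simp)]
  simp

theorem ham_densY_A (h : m.IsLieAlgebroid) {φ : Fields d r n} (hφ : IsField m φ) (b : Fin r)
    {g : Sp n → ℝ} (hg : IsTorusFun g) (σ : Sp n) (μ : Fin n) :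
    (ham m φ (grad (densY m b) φ g)).A σ μ
      = g σ • m.CL (φ.X σ) (Pi.single b 1) (φ.A σ μ) - dd μ g σ • Pi.single b 1 := by
  funext c
  refine (eulerComp_densY h hφ b hg (compVec (.inr (.inr (.inl (μ, c))))) σ).trans ?_
  simp only [compVec, map_zero, zero_apply, Pi.zero_apply, zero_dotProduct, dotProduct_zero,
    JL_update_zero, Finset.sum_const_zero, add_zero, mul_zero, zero_add, WithLp.ofLp_zero,
    sum_single_dotProduct, Pi.sub_apply, Pi.smul_apply,
    smul_eq_mul]
  congr 1
  rw [Finset.sum_eq_single μ (fun ν _ hν => by simp [Pi.single_eq_of_ne hν]) (by simp)]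
  simp [Pi.single_apply, eq_comm]

theorem ham_densY_Y (h : m.IsLieAlgebroid) {φ : Fields d r n} (hφ : IsField m φ) (b : Fin r)
    {g : Sp n → ℝ} (hg : IsTorusFun g) (σ : Sp n) (μ : Fin n) (c : Fin r) :
    (ham m φ (grad (densY m b) φ g)).Y σ μ c
      = -(g σ * (φ.Y σ μ ⬝ᵥ m.CL (φ.X σ) (Pi.single b 1) (Pi.single c 1)
          + m.JL (φ.X σ) (Matrix.vecCons (Pi.single b 1)
              (Function.update (φ.A σ) μ (Pi.single c 1))))) := by
  refine neg_inj.2 ?_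
  refine (eulerComp_densY h hφ b hg (compVec (.inr (.inl (μ, c)))) σ).trans ?_
  simp only [compVec, map_zero, zero_apply, Pi.zero_apply, zero_dotProduct, dotProduct_zero,
    Finset.sum_const_zero, add_zero, mul_zero, zero_add, WithLp.ofLp_zero,
    sub_zero]
  congr 2
  · rw [Finset.sum_eq_single μ (fun ν _ hν => by simp [Pi.single_eq_of_ne hν]) (by simp)]
    simp
  · rw [Finset.sum_eq_single μ (fun ν _ hν => by
      rw [Pi.single_eq_of_ne hν, JL_update_zero]) (by simp)]
    simp

theorem map_single_eq_dotProduct (L : Pt d →ₗ[ℝ] ℝ) (x : Pt d) :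
    (x.ofLp ⬝ᵥ fun i => L (EuclideanSpace.single i 1)) = L x := by
  rw [← sum_single_mul L x]
  exact Finset.sum_congr rfl fun i _ => mul_comm _ _

/-- The `Z` component, contracted with `x`. The `H` term of the bivector contributes since `G_Y`
depends on `Z`. -/
theorem ham_densY_Z (h : m.IsLieAlgebroid) {φ : Fields d r n} (hφ : IsField m φ) (b : Fin r)
    {g : Sp n → ℝ} (hg : IsTorusFun g) (σ : Sp n) (x : Pt d) :
    (-1 : ℝ) ^ (n + 1) * (x.ofLp ⬝ᵥ (ham m φ (grad (densY m b) φ g)).Z σ)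
      = g σ * ((-1 : ℝ) ^ (n + 1) * ((fderiv ℝ m.rhoL (φ.X σ) x (Pi.single b 1)).ofLp ⬝ᵥ φ.Z σ)
        + (∑ μ, φ.Y σ μ ⬝ᵥ fderiv ℝ m.CL (φ.X σ) x (Pi.single b 1) (φ.A σ μ))
        + fderiv ℝ m.JL (φ.X σ) x (Matrix.vecCons (Pi.single b 1) (φ.A σ))
        + m.H (φ.X σ) (Matrix.vecCons x (Matrix.vecCons (m.rhoL (φ.X σ) (Pi.single b 1))
            (fun μ => dd μ φ.X σ)))) := by
  have e : ∀ i, (grad (densY m b) φ g).X σ i = g σ * ((-1 : ℝ) ^ (n + 1)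
      * ((fderiv ℝ m.rhoL (φ.X σ) (EuclideanSpace.single i 1) (Pi.single b 1)).ofLp ⬝ᵥ φ.Z σ)
      + (∑ μ, φ.Y σ μ ⬝ᵥ fderiv ℝ m.CL (φ.X σ) (EuclideanSpace.single i 1) (Pi.single b 1)
          (φ.A σ μ))
      + fderiv ℝ m.JL (φ.X σ) (EuclideanSpace.single i 1)
          (Matrix.vecCons (Pi.single b 1) (φ.A σ))) := by
    intro i
    refine (eulerComp_densY h hφ b hg (compVec (.inl i)) σ).trans ?_
    simp [compVec, JL_update_zero]
  have e' : ∀ i, (grad (densY m b) φ g).Z σ i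
      = g σ * ((-1 : ℝ) ^ (n + 1) * (m.rhoL (φ.X σ) (Pi.single b 1)) i) := by
    intro i
    refine (eulerComp_densY h hφ b hg (compVec (.inr (.inr (.inr i)))) σ).trans ?_
    simp [compVec, JL_update_zero]
  have s := neg_one_pow_mul_succ n
  have s2 : (-1 : ℝ) ^ (n + 1) * (-1 : ℝ) ^ (n + 1) = 1 := by rw [← mul_pow]; simp
  -- the `H` term of the Hamiltonian vector field, contracted in its second slot
  have hk : ∀ j, (∑ k, (grad (densY m b) φ g).Z σ k *
      m.H (φ.X σ) (Matrix.vecCons (EuclideanSpace.single j 1)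
        (Matrix.vecCons (EuclideanSpace.single k 1) (fun μ => dd μ φ.X σ))))
      = g σ * (-1 : ℝ) ^ (n + 1) * m.H (φ.X σ) (Matrix.vecCons (EuclideanSpace.single j 1)
        (Matrix.vecCons (m.rhoL (φ.X σ) (Pi.single b 1)) (fun μ => dd μ φ.X σ))) := by
    intro j
    have := sum_single_mul ((((m.H (φ.X σ)).toAlternatingMap.curryLeft
      (EuclideanSpace.single j 1)).toMultilinearMap.toLinearMap
      (Matrix.vecCons 0 (fun μ => dd μ φ.X σ)) 0)) (m.rhoL (φ.X σ) (Pi.single b 1))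
    have u : ∀ z : Pt d, (((m.H (φ.X σ)).toAlternatingMap.curryLeft
      (EuclideanSpace.single j 1)).toMultilinearMap.toLinearMap
      (Matrix.vecCons 0 (fun μ => dd μ φ.X σ)) 0) z
        = m.H (φ.X σ) (Matrix.vecCons (EuclideanSpace.single j 1)
        (Matrix.vecCons z (fun μ => dd μ φ.X σ))) := by
      intro z
      simp only [MultilinearMap.toLinearMap_apply]
      change m.H (φ.X σ) (Matrix.vecCons (EuclideanSpace.single j 1) _) = _
      congr 2
      exact Fin.update_cons_zero _ _ _
    simp only [u] at this
    rw [← this, Finset.mul_sum]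
    refine Finset.sum_congr rfl fun k _ => ?_
    rw [e']; ring
  have hj : ∑ j, x j * m.H (φ.X σ) (Matrix.vecCons (EuclideanSpace.single j 1)
        (Matrix.vecCons (m.rhoL (φ.X σ) (Pi.single b 1)) (fun μ => dd μ φ.X σ)))
      = m.H (φ.X σ) (Matrix.vecCons x (Matrix.vecCons (m.rhoL (φ.X σ) (Pi.single b 1))
            (fun μ => dd μ φ.X σ))) := by
    have := map_single_eq_dotProduct ((m.H (φ.X σ)).toAlternatingMap.toMultilinearMap.toLinearMap
      (Matrix.vecCons 0 (Matrix.vecCons (m.rhoL (φ.X σ) (Pi.single b 1))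
            (fun μ => dd μ φ.X σ))) 0) x
    have u : ∀ z : Pt d, ((m.H (φ.X σ)).toAlternatingMap.toMultilinearMap.toLinearMap
      (Matrix.vecCons 0 (Matrix.vecCons (m.rhoL (φ.X σ) (Pi.single b 1))
            (fun μ => dd μ φ.X σ))) 0) z = m.H (φ.X σ) (Matrix.vecCons z
        (Matrix.vecCons (m.rhoL (φ.X σ) (Pi.single b 1)) (fun μ => dd μ φ.X σ))) := by
      intro z
      simp only [MultilinearMap.toLinearMap_apply]
      change m.H (φ.X σ) _ = _
      congr 1
      exact Fin.update_cons_zero _ _ _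
    simp only [u] at this
    exact this
  have l1 : ∑ i, x i * ((fderiv ℝ m.rhoL (φ.X σ) (EuclideanSpace.single i 1)
      (Pi.single b 1)).ofLp ⬝ᵥ φ.Z σ)
      = (fderiv ℝ m.rhoL (φ.X σ) x (Pi.single b 1)).ofLp ⬝ᵥ φ.Z σ := by
    conv_rhs => rw [euclidean_eq_sum x]
    simp [sum_dotProduct, sum_apply, WithLp.ofLp_sum]
  have l2 : ∑ i, x i * (∑ μ, φ.Y σ μ ⬝ᵥ fderiv ℝ m.CL (φ.X σ) (EuclideanSpace.single i 1)
      (Pi.single b 1) (φ.A σ μ))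
      = ∑ μ, φ.Y σ μ ⬝ᵥ fderiv ℝ m.CL (φ.X σ) x (Pi.single b 1) (φ.A σ μ) := by
    conv_rhs => rw [euclidean_eq_sum x]
    simp only [map_sum, map_smul, sum_apply, smul_apply, dotProduct_sum, dotProduct_smul,
      smul_eq_mul, Finset.mul_sum]
    exact Finset.sum_comm
  have l3 : ∑ i, x i * fderiv ℝ m.JL (φ.X σ) (EuclideanSpace.single i 1)
          (Matrix.vecCons (Pi.single b 1) (φ.A σ))
      = fderiv ℝ m.JL (φ.X σ) x (Matrix.vecCons (Pi.single b 1) (φ.A σ)) := by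
    conv_rhs => rw [euclidean_eq_sum x]
    simp [sum_apply]
  have hZ : ∀ i, (-1 : ℝ) ^ (n + 1) * (ham m φ (grad (densY m b) φ g)).Z σ i = g σ * ((-1 : ℝ) ^ (n + 1)
      * ((fderiv ℝ m.rhoL (φ.X σ) (EuclideanSpace.single i 1) (Pi.single b 1)).ofLp ⬝ᵥ φ.Z σ)
      + (∑ μ, φ.Y σ μ ⬝ᵥ fderiv ℝ m.CL (φ.X σ) (EuclideanSpace.single i 1) (Pi.single b 1)
          (φ.A σ μ))
      + fderiv ℝ m.JL (φ.X σ) (EuclideanSpace.single i 1)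
          (Matrix.vecCons (Pi.single b 1) (φ.A σ))
      + m.H (φ.X σ) (Matrix.vecCons (EuclideanSpace.single i 1)
        (Matrix.vecCons (m.rhoL (φ.X σ) (Pi.single b 1)) (fun μ => dd μ φ.X σ)))) := by
    intro i
    simp only [ham, hk]
    have := e i
    set Q := (grad (densY m b) φ g).X σ i
    set T := m.H (φ.X σ) (Matrix.vecCons (EuclideanSpace.single i 1)
        (Matrix.vecCons (m.rhoL (φ.X σ) (Pi.single b 1)) (fun μ => dd μ φ.X σ)))
    linear_combination this - Q * s + g σ * T * s2
  have hsum : (-1 : ℝ) ^ (n + 1) * (x.ofLp ⬝ᵥ (ham m φ (grad (densY m b) φ g)).Z σ)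
      = ∑ i, x i * ((-1 : ℝ) ^ (n + 1) * (ham m φ (grad (densY m b) φ g)).Z σ i) := by
    rw [dotProduct, Finset.mul_sum]
    exact Finset.sum_congr rfl fun i _ => by ring
  rw [hsum, ← l1, ← l2, ← l3, ← hj]
  simp only [hZ]
  rw [Finset.mul_sum _ _ ((-1 : ℝ) ^ (n + 1)), ← Finset.sum_add_distrib, ← Finset.sum_add_distrib,
    ← Finset.sum_add_distrib, Finset.mul_sum]
  exact Finset.sum_congr rfl fun i _ => by ring

end Ham

/-! ### Combinatorics of alternating forms -/

section Alternating

variable {V W : Type*} [AddCommGroup V] [Module ℝ V] [AddCommGroup W] [Module ℝ W] {k : ℕ}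

theorem map_vecCons_update_swap (f : V [⋀^Fin (k + 1)]→ₗ[ℝ] W) (a b : V) (A : Fin k → V)
    (μ : Fin k) :
    f (Matrix.vecCons b (Function.update A μ a)) = -f (Matrix.vecCons a (Function.update A μ b)) := by
  rw [← AlternatingMap.map_swap f _ (show (0 : Fin (k + 1)) ≠ μ.succ from (Fin.succ_ne_zero μ).symm)]
  refine congrArg f (funext fun i => ?_)
  refine Fin.cases ?_ (fun ν => ?_) i
  · simp
  · by_cases h : ν = μ
    · subst h; simp
    · rw [Function.comp_apply, Equiv.swap_apply_of_ne_of_ne (Fin.succ_ne_zero _)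
        (fun e => h (Fin.succ_injective _ e))]
      simp [h]

theorem map_update_update_swap (f : V [⋀^Fin (k + 1)]→ₗ[ℝ] W) (a b c : V) (A : Fin k → V)
    {μ ν : Fin k} (h : μ ≠ ν) :
    f (Matrix.vecCons a (Function.update (Function.update A ν b) μ c))
      = -f (Matrix.vecCons a (Function.update (Function.update A μ b) ν c)) := by
  rw [← AlternatingMap.map_swap f _ (show (μ.succ : Fin (k + 1)) ≠ ν.succ from
    fun e => h (Fin.succ_injective _ e))]
  refine congrArg f (funext fun i => ?_)
  refine Fin.cases ?_ (fun l => ?_) i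
  · rw [Function.comp_apply, Equiv.swap_apply_of_ne_of_ne (Fin.succ_ne_zero _).symm
      (Fin.succ_ne_zero _).symm]
    rfl
  · by_cases h1 : l = μ
    · subst h1; simp
    · by_cases h2 : l = ν
      · subst h2; simp [h, h1]
      · rw [Function.comp_apply, Equiv.swap_apply_of_ne_of_ne
          (fun e => h1 (Fin.succ_injective _ e)) (fun e => h2 (Fin.succ_injective _ e))]
        simp [h1, h2]

theorem sum_sum_eq_sum_Ioi {M : Type*} [AddCommMonoid M] (F : Fin k → Fin k → M)
    (h : ∀ μ, F μ μ = 0) :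
    ∑ μ, ∑ ν, F μ ν = ∑ μ, ∑ ν ∈ Finset.Ioi μ, (F μ ν + F ν μ) := by
  have e : ∀ μ, ∑ ν, F μ ν = ∑ ν ∈ Finset.Ioi μ, F μ ν + ∑ ν ∈ Finset.Iio μ, F μ ν := by
    intro μ
    have : (Finset.univ : Finset (Fin k)) = (Finset.Ioi μ ∪ Finset.Iio μ) ∪ {μ} := by
      ext ν; simp only [Finset.mem_univ, Finset.mem_union, Finset.mem_Ioi, Finset.mem_Iio,
        Finset.mem_singleton, true_iff]
      rcases lt_trichotomy μ ν with h | h | h <;> simp [h]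
    rw [this, Finset.sum_union (by simp), Finset.sum_union, Finset.sum_singleton, h, add_zero]
    rw [Finset.disjoint_left]
    intro ν h1 h2
    exact lt_asymm (Finset.mem_Ioi.1 h1) (Finset.mem_Iio.1 h2)
  simp only [e, Finset.sum_add_distrib]
  congr 1
  exact Finset.sum_comm' fun μ ν => by simp

/-- A double sum over distinct slots of an alternating form is a sum over pairs of slots, with the
arguments antisymmetrized. -/
theorem sum_update_update (f : V [⋀^Fin (k + 1)]→ₗ[ℝ] W) (a b : V) (A : Fin k → V)
    (θ : Fin k → Fin k → V) :
    ∑ μ, ∑ ν, (if ν = μ then 0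
        else f (Matrix.vecCons a (Function.update (Function.update A μ b) ν (θ μ ν))))
      = ∑ μ, ∑ ν ∈ Finset.Ioi μ,
        f (Matrix.vecCons a (Function.update (Function.update A μ b) ν (θ μ ν - θ ν μ))) := by
  rw [sum_sum_eq_sum_Ioi (fun μ ν => if ν = μ then 0
    else f (Matrix.vecCons a (Function.update (Function.update A μ b) ν (θ μ ν))))
      fun μ => if_pos rfl]
  refine Finset.sum_congr rfl fun μ _ => Finset.sum_congr rfl fun ν hν => ?_
  have hlt : μ ≠ ν := (Finset.mem_Ioi.1 hν).ne
  rw [if_neg hlt.symm, if_neg hlt, map_update_update_swap f a b (θ ν μ) A hlt, ← sub_eq_add_neg]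
  have key : ∀ x, f (Matrix.vecCons a (Function.update (Function.update A μ b) ν x))
      = f (Function.update (Matrix.vecCons a (Function.update A μ b)) ν.succ x) := fun x => by
    rw [Matrix.vecCons, Matrix.vecCons, Fin.cons_update]
  rw [key, key, key, ← f.map_update_sub]

/-- The telescoping expansion of the difference of two values of a multilinear map. -/
theorem map_sub_map_eq_sum (f : V [⋀^Fin k]→ₗ[ℝ] W) (x z : Fin k → V) :
    f x - f z = ∑ μ, f (fun ν => if ν < μ then x ν else if ν = μ then x μ - z μ else z ν) := by
  have e : ∀ μ : Fin k, f (fun ν => if ν < μ then x ν else if ν = μ then x μ - z μ else z ν)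
      = f (fun ν => if (ν : ℕ) < (μ : ℕ) + 1 then x ν else z ν)
        - f (fun ν => if (ν : ℕ) < (μ : ℕ) then x ν else z ν) := by
    intro μ
    have u : ∀ y, (fun ν => if ν < μ then x ν else if ν = μ then y else z ν)
        = Function.update (fun ν => if ν < μ then x ν else z ν) μ y := by
      intro y; funext ν
      by_cases h : ν = μ
      · subst h; simp
      · simp [h]
    rw [u, f.map_update_sub, ← u, ← u]
    congr 2
    · funext ν
      rcases lt_trichotomy ν μ with h | h | h
      · simp [h, Nat.lt_succ_of_lt (Fin.lt_def.1 h)]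
      · subst h; simp
      · rw [if_neg (lt_asymm h), if_neg h.ne', if_neg (by have := Fin.lt_def.1 h; omega)]
    · funext ν
      rcases lt_trichotomy ν μ with h | h | h
      · simp [h]
      · subst h; simp
      · rw [if_neg (lt_asymm h), if_neg h.ne', if_neg (by have := Fin.lt_def.1 h; omega)]
  simp only [e]
  rw [Fin.sum_univ_eq_sum_range
    (fun j => f (fun ν => if (ν : ℕ) < j + 1 then x ν else z ν)
      - f (fun ν => if (ν : ℕ) < j then x ν else z ν)) k,
    Finset.sum_range_sub (fun j => f (fun ν => if (ν : ℕ) < j then x ν else z ν)) k]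
  simp

end Alternating

/-! ### The Poisson algebra of the constraints -/

section Algebra

variable {d r n : ℕ} {m : LocalTarget d r n}

namespace LocalTarget.IsLieAlgebroid

theorem fderiv_CL_antisymm (h : m.IsLieAlgebroid) {y : Pt d} (hy : y ∈ m.dom) (x : Pt d)
    (u v : Fin r → ℝ) : fderiv ℝ m.CL y x v u = -fderiv ℝ m.CL y x u v := by
  have e : ∀ u v, fderiv ℝ (fun z => m.CL z u v) y x = fderiv ℝ m.CL y x u v := fun u v => by
    have := (((DifferentiableAt.hasVar (h.differentiableAt_CL hy)).clm_apply
      (HasVar.const u y)).clm_apply (HasVar.const v y)).fderiv_apply x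
    simpa using this
  have he : (fun z => m.CL z v u) =ᶠ[nhds y] fun z => -m.CL z u v := by
    filter_upwards [h.isOpen.mem_nhds hy] with z hz using h.antisymm z hz u v
  rw [← e, ← e, he.fderiv_eq, fderiv_fun_neg]
  rfl

/-- The derivative of `J` as an alternating form. -/
def dJ (h : m.IsLieAlgebroid) {y : Pt d} (hy : y ∈ m.dom) (x : Pt d) :
    (Fin r → ℝ) [⋀^Fin (n + 1)]→ₗ[ℝ] ℝ where
  toMultilinearMap := (fderiv ℝ m.JL y x).toMultilinearMap
  map_eq_zero_of_eq' v i j hv hij := by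
    change fderiv ℝ m.JL y x v = 0
    rw [h.fderiv_JL_eq hy]
    have : (fun z => m.J z v) = fun _ => 0 := funext fun z => (m.J z).map_eq_zero_of_eq v hv hij
    simp [this]

theorem fderiv_JL_swap (h : m.IsLieAlgebroid) {y : Pt d} (hy : y ∈ m.dom) (x : Pt d)
    (a b : Fin r → ℝ) (A : Fin n → Fin r → ℝ) (μ : Fin n) :
    fderiv ℝ m.JL y x (Matrix.vecCons b (Function.update A μ a))
      = -fderiv ℝ m.JL y x (Matrix.vecCons a (Function.update A μ b)) :=
  map_vecCons_update_swap (h.dJ hy x) a b A μ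

end LocalTarget.IsLieAlgebroid

theorem JL_swap (y : Pt d) (a b : Fin r → ℝ) (A : Fin n → Fin r → ℝ) (μ : Fin n) :
    m.JL y (Matrix.vecCons b (Function.update A μ a))
      = -m.JL y (Matrix.vecCons a (Function.update A μ b)) := by
  simp only [m.JL_apply]
  exact map_vecCons_update_swap (m.J y) a b A μ

theorem dd_ham_densY_X (h : m.IsLieAlgebroid) {φ : Fields d r n} (hφ : IsField m φ) (b : Fin r)
    {g : Sp n → ℝ} (hg : IsTorusFun g) (σ : Sp n) (μ : Fin n) :
    dd μ (ham m φ (grad (densY m b) φ g)).X σ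
      = -(dd μ g σ • m.rhoL (φ.X σ) (Pi.single b 1)
        + g σ • fderiv ℝ m.rhoL (φ.X σ) (dd μ φ.X σ) (Pi.single b 1)) := by
  rw [show (ham m φ (grad (densY m b) φ g)).X
    = fun σ => -(g σ • m.rhoL (φ.X σ) (Pi.single b 1)) from funext (ham_densY_X h hφ b hg)]
  have v := ((hg.hasVar σ).smul (((hφ.1.1.hasVar σ).comp
    (h.differentiableAt_rhoL (hφ.2 σ))).clm_apply (HasVar.const (Pi.single b 1) σ))).neg
  refine (v.fderiv_apply _).trans ?_
  simp [dd]

theorem dd_ham_densY_A (h : m.IsLieAlgebroid) {φ : Fields d r n} (hφ : IsField m φ) (b : Fin r)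
    {g : Sp n → ℝ} (hg : IsTorusFun g) (σ : Sp n) (μ ν : Fin n) :
    dd μ (ham m φ (grad (densY m b) φ g)).A σ ν
      = dd μ g σ • m.CL (φ.X σ) (Pi.single b 1) (φ.A σ ν)
        + g σ • (fderiv ℝ m.CL (φ.X σ) (dd μ φ.X σ) (Pi.single b 1) (φ.A σ ν)
          + m.CL (φ.X σ) (Pi.single b 1) (dd μ φ.A σ ν))
        - dd μ (dd ν g) σ • Pi.single b 1 := by
  have hs := (smooth_ham h.isOpen h.H_smooth hφ
    (smooth_grad h.isOpen (isDensity_densY h b) hφ hg)).2.1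
  rw [← dd_apply hs ν μ σ, show (fun τ => (ham m φ (grad (densY m b) φ g)).A τ ν)
    = fun σ => g σ • m.CL (φ.X σ) (Pi.single b 1) (φ.A σ ν) - dd ν g σ • Pi.single b 1 from
      funext fun σ => ham_densY_A h hφ b hg σ ν]
  have v := ((hg.hasVar σ).smul ((((hφ.1.1.hasVar σ).comp
    (h.differentiableAt_CL (hφ.2 σ))).clm_apply (HasVar.const (Pi.single b 1) σ)).clm_apply
      ((hφ.1.2.1.hasVar σ).apply ν))).sub
      (((hg.dd ν).hasVar σ).smul (HasVar.const (Pi.single b (1 : ℝ) : Fin r → ℝ) σ))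
  refine (v.fderiv_apply _).trans ?_
  simp [dd]

theorem jet_fst_fst (φ : Fields d r n) (σ : Sp n) : (φ.jet σ).1.1 = φ.X σ := rfl
theorem jet_fst_A (φ : Fields d r n) (σ : Sp n) : (φ.jet σ).1.2.1 = φ.A σ := rfl
theorem jet_fst_Y (φ : Fields d r n) (σ : Sp n) : (φ.jet σ).1.2.2.1 = φ.Y σ := rfl
theorem jet_fst_Z (φ : Fields d r n) (σ : Sp n) : (φ.jet σ).1.2.2.2 = φ.Z σ := rfl
theorem jet_snd_X (φ : Fields d r n) (σ : Sp n) (μ : Fin n) : ((φ.jet σ).2 μ).1 = dd μ φ.X σ := rfl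
theorem jet_snd_A (φ : Fields d r n) (σ : Sp n) (μ : Fin n) :
    ((φ.jet σ).2 μ).2.1 = dd μ φ.A σ := rfl
theorem jet_snd_Y (φ : Fields d r n) (σ : Sp n) (μ : Fin n) :
    ((φ.jet σ).2 μ).2.2.1 = dd μ φ.Y σ := rfl

/-- `{G_X, G_Y}`; the terms without `G_X` cancel since the anchor is a homomorphism. -/
theorem densityBracket_XY (h : m.IsLieAlgebroid) {φ : Fields d r n} (hφ : IsField m φ) (μ : Fin n)
    (i : Fin d) (b : Fin r) :
    DensityBracket m φ (densX m μ i) (densY m b)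
      (fun σ => -(fderiv ℝ m.rhoL (φ.X σ) (GX m φ σ μ) (Pi.single b 1)) i) := by
  refine densityBracket_of_variation h.isOpen h.H_smooth hφ (isDensity_densX h μ i)
    (isDensity_densY h b) fun g hg σ => ?_
  rw [(var_densX h μ i (hφ.jet_mem σ)).fderiv_apply]
  simp only [jet_fst_fst, jet_fst_A, jet_snd_X, dd_ham_densY_X h hφ b hg,
    ham_densY_X h hφ b hg, ham_densY_A h hφ b hg, GX_eq, map_sub, map_neg, map_smul, smul_apply,
    neg_apply, sub_apply, h.anchor_hom _ (hφ.2 σ), PiLp.sub_apply, PiLp.add_apply, PiLp.neg_apply,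
    PiLp.smul_apply, smul_eq_mul]
  ring

/-- `{G_A, G_Y}`; the terms quadratic in `A` cancel by the Jacobi identity. -/
theorem densityBracket_AY (h : m.IsLieAlgebroid) {φ : Fields d r n} (hφ : IsField m φ)
    (μ ν : Fin n) (a b : Fin r) :
    DensityBracket m φ (densA m μ ν a) (densY m b)
      (fun σ => (m.CL (φ.X σ) (Pi.single b 1) (GA m φ σ μ ν)
        + fderiv ℝ m.CL (φ.X σ) (GX m φ σ μ) (Pi.single b 1) (φ.A σ ν)
        - fderiv ℝ m.CL (φ.X σ) (GX m φ σ ν) (Pi.single b 1) (φ.A σ μ)) a) := by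
  refine densityBracket_of_variation h.isOpen h.H_smooth hφ (isDensity_densA h μ ν a)
    (isDensity_densY h b) fun g hg σ => ?_
  have hy := hφ.2 σ
  have jac := h.jacobi _ hy (Pi.single b 1) (φ.A σ μ) (φ.A σ ν)
  rw [h.antisymm _ hy (Pi.single b 1) (φ.A σ ν), h.fderiv_CL_antisymm hy _ (Pi.single b 1) (φ.A σ ν),
    h.antisymm _ hy (m.CL (φ.X σ) (Pi.single b 1) (φ.A σ μ)) (φ.A σ ν)] at jac
  have key : dd μ (ham m φ (grad (densY m b) φ g)).A σ ν - dd ν (ham m φ (grad (densY m b) φ g)).A σ μ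
      + ((fderiv ℝ m.CL (φ.X σ) ((ham m φ (grad (densY m b) φ g)).X σ) (φ.A σ μ)
        + m.CL (φ.X σ) ((ham m φ (grad (densY m b) φ g)).A σ μ)) (φ.A σ ν)
        + m.CL (φ.X σ) (φ.A σ μ) ((ham m φ (grad (densY m b) φ g)).A σ ν))
      = g σ • (m.CL (φ.X σ) (Pi.single b 1) (GA m φ σ μ ν)
        + fderiv ℝ m.CL (φ.X σ) (GX m φ σ μ) (Pi.single b 1) (φ.A σ ν)
        - fderiv ℝ m.CL (φ.X σ) (GX m φ σ ν) (Pi.single b 1) (φ.A σ μ)) := by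
    simp only [dd_ham_densY_A h hφ b hg,
      ham_densY_X h hφ b hg, ham_densY_A h hφ b hg, GX_eq, GA_eq, map_sub, map_add, map_neg,
      map_smul, smul_apply, neg_apply, sub_apply, add_apply, dd_comm hg ν μ,
      h.antisymm _ hy (Pi.single b 1) (φ.A σ μ)] at jac ⊢
    linear_combination (norm := module) (-g σ) • jac
  rw [(var_densA h μ ν a (hφ.jet_mem σ)).fderiv_apply]
  exact congrFun key a

end Algebra

section Algebra

variable {d r n : ℕ} {m : LocalTarget d r n}

theorem ham_densY_Y_dotProduct (h : m.IsLieAlgebroid) {φ : Fields d r n} (hφ : IsField m φ)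
    (b : Fin r) {g : Sp n → ℝ} (hg : IsTorusFun g) (σ : Sp n) (μ : Fin n) (v : Fin r → ℝ) :
    (ham m φ (grad (densY m b) φ g)).Y σ μ ⬝ᵥ v
      = -(g σ * (φ.Y σ μ ⬝ᵥ m.CL (φ.X σ) (Pi.single b 1) v
          + m.JL (φ.X σ) (Matrix.vecCons (Pi.single b 1) (Function.update (φ.A σ) μ v)))) := by
  have key : ∀ v, m.JL (φ.X σ) (Matrix.vecCons (Pi.single b 1) (Function.update (φ.A σ) μ v))
      = (m.JL (φ.X σ)).toMultilinearMap.toLinearMap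
        (Matrix.vecCons (Pi.single b 1) (φ.A σ)) μ.succ v := fun v => by
    rw [MultilinearMap.toLinearMap_apply, Matrix.vecCons, Matrix.vecCons, ← Fin.cons_update]
    rfl
  have hsum : ∀ v : Fin r → ℝ, φ.Y σ μ ⬝ᵥ m.CL (φ.X σ) (Pi.single b 1) v
      = ∑ c, v c * (φ.Y σ μ ⬝ᵥ m.CL (φ.X σ) (Pi.single b 1) (Pi.single c 1)) := fun v => by
    conv_lhs => rw [pi_eq_sum v]
    simp only [map_sum, map_smul, dotProduct_sum, dotProduct_smul, smul_eq_mul]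
  have hsum' : m.JL (φ.X σ) (Matrix.vecCons (Pi.single b 1) (Function.update (φ.A σ) μ v))
      = ∑ c, v c * m.JL (φ.X σ) (Matrix.vecCons (Pi.single b 1)
          (Function.update (φ.A σ) μ (Pi.single c 1))) := by
    simp only [key]
    conv_lhs => rw [pi_eq_sum v]
    simp only [map_sum, map_smul, smul_eq_mul]
  rw [hsum, hsum', ← Finset.sum_add_distrib, Finset.mul_sum, ← Finset.sum_neg_distrib]
  refine Finset.sum_congr rfl fun c _ => ?_
  rw [ham_densY_Y h hφ b hg]
  ring

/-- The divergence of the `Y` component of the flow of `G_Y` enters the variation of `G_Y`. -/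
theorem dd_ham_densY_Y (h : m.IsLieAlgebroid) {φ : Fields d r n} (hφ : IsField m φ) (b : Fin r)
    {g : Sp n → ℝ} (hg : IsTorusFun g) (σ : Sp n) (μ : Fin n) (a : Fin r) :
    dd μ (ham m φ (grad (densY m b) φ g)).Y σ μ a
      = -(dd μ g σ * (φ.Y σ μ ⬝ᵥ m.CL (φ.X σ) (Pi.single b 1) (Pi.single a 1)
          + m.JL (φ.X σ) (Matrix.vecCons (Pi.single b 1)
              (Function.update (φ.A σ) μ (Pi.single a 1))))
        + g σ * (dd μ φ.Y σ μ ⬝ᵥ m.CL (φ.X σ) (Pi.single b 1) (Pi.single a 1)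
          + φ.Y σ μ ⬝ᵥ fderiv ℝ m.CL (φ.X σ) (dd μ φ.X σ) (Pi.single b 1) (Pi.single a 1)
          + fderiv ℝ m.JL (φ.X σ) (dd μ φ.X σ) (Matrix.vecCons (Pi.single b 1)
              (Function.update (φ.A σ) μ (Pi.single a 1)))
          + ∑ ν, if ν = μ then 0 else m.JL (φ.X σ) (Matrix.vecCons (Pi.single b 1)
              (Function.update (Function.update (φ.A σ) μ (Pi.single a 1)) ν
                (dd μ φ.A σ ν))))) := by
  have hs := (smooth_ham h.isOpen h.H_smooth hφ
    (smooth_grad h.isOpen (isDensity_densY h b) hφ hg)).2.2.1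
  have e0 : dd μ (ham m φ (grad (densY m b) φ g)).Y σ μ a
      = dd μ (fun τ => (ham m φ (grad (densY m b) φ g)).Y τ μ a) σ := by
    refine (((hs.hasVar σ).apply μ).apply a |>.fderiv_apply _).symm
  rw [e0, show (fun τ => (ham m φ (grad (densY m b) φ g)).Y τ μ a) = _ from
    funext fun τ => ham_densY_Y h hφ b hg τ μ a]
  have hX := hφ.1.1.hasVar σ
  have v1 := ((hφ.1.2.2.1.hasVar σ).apply μ).dotProduct
    (((hX.comp (h.differentiableAt_CL (hφ.2 σ))).clm_apply
      (HasVar.const (Pi.single b 1 : Fin r → ℝ) σ)).clm_apply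
      (HasVar.const (Pi.single a 1 : Fin r → ℝ) σ))
  have v2 := (hX.comp (h.differentiableAt_JL (hφ.2 σ))).multilinear_apply
    (HasVar.vecCons (Pi.single b 1 : Fin r → ℝ) (HasVar.pi
      (HasVar.update (Pi.single a 1 : Fin r → ℝ) (hφ.1.2.1.hasVar σ) μ)))
  refine (((hg.hasVar σ).mul (v1.add v2)).neg.fderiv_apply _).trans ?_
  simp only [sum_update_vecCons, map_zero, add_zero]
  congr 3
  rw [← add_assoc]
  congr 1
  refine Finset.sum_congr rfl fun ν _ => ?_
  by_cases hν : ν = μ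
  · subst hν
    rw [if_pos rfl, Function.update_self, JL_update_zero]
  · rw [if_neg hν, Function.update_of_ne hν]
    rfl

/-- The anomaly of the bracket of `G_{Ya}` and `G_{Yb}`: the value of `ᴱdJ + ⟨⊗ρ, H⟩` on the sections
`a`, `b`, `A_1, …, A_n` with constant coefficients. -/
def defect (m : LocalTarget d r n) (y : Pt d) (a b : Fin r → ℝ) (A : Fin n → Fin r → ℝ) : ℝ :=
  fderiv ℝ m.JL y (m.rhoL y a) (Matrix.vecCons b A)
    - fderiv ℝ m.JL y (m.rhoL y b) (Matrix.vecCons a A)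
    + (∑ μ, fderiv ℝ m.JL y (m.rhoL y (A μ)) (Matrix.vecCons a (Function.update A μ b)))
    - m.JL y (Matrix.vecCons (m.CL y a b) A)
    - (∑ μ, m.JL y (Matrix.vecCons b (Function.update A μ (m.CL y a (A μ)))))
    + (∑ μ, m.JL y (Matrix.vecCons a (Function.update A μ (m.CL y b (A μ)))))
    - (∑ μ, ∑ ν ∈ Finset.Ioi μ, m.JL y (Matrix.vecCons a
        (Function.update (Function.update A μ b) ν (m.CL y (A μ) (A ν)))))
    + m.H y (Matrix.vecCons (m.rhoL y a) (Matrix.vecCons (m.rhoL y b) fun μ => m.rhoL y (A μ)))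

/-- The sum over `G_X` telescopes. -/
theorem HTerm_eq (φ : Fields d r n) (σ : Sp n) (a b : Fin r) :
    HTerm m φ σ a b = m.H (φ.X σ) (Matrix.vecCons (m.rhoL (φ.X σ) (Pi.single a 1))
        (Matrix.vecCons (m.rhoL (φ.X σ) (Pi.single b 1)) fun μ => dd μ φ.X σ))
      - m.H (φ.X σ) (Matrix.vecCons (m.rhoL (φ.X σ) (Pi.single a 1))
        (Matrix.vecCons (m.rhoL (φ.X σ) (Pi.single b 1)) fun μ => m.rhoL (φ.X σ) (φ.A σ μ))) := by
  refine Eq.trans ?_ (map_sub_map_eq_sum (((m.H (φ.X σ)).toAlternatingMap.curryLeft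
    (m.rhoL (φ.X σ) (Pi.single a 1))).curryLeft (m.rhoL (φ.X σ) (Pi.single b 1)))
    (fun μ => dd μ φ.X σ) (fun μ => m.rhoL (φ.X σ) (φ.A σ μ))).symm
  simp only [HTerm, ← m.rhoL_apply, GX_eq]
  simp only [← m.rhoL_single]
  rfl

/-- The part of `J(G_A)` with derivatives of `A` is the one produced by the Hamiltonian flow. -/
theorem JTerm_GA (φ : Fields d r n) (σ : Sp n) (a b : Fin r) :
    JTerm m φ σ a b (GA m φ σ)
      = -(∑ μ, ∑ ν, if ν = μ then 0 else m.JL (φ.X σ) (Matrix.vecCons (Pi.single b 1)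
              (Function.update (Function.update (φ.A σ) μ (Pi.single a 1)) ν (dd μ φ.A σ ν))))
        + ∑ μ, ∑ ν ∈ Finset.Ioi μ, m.JL (φ.X σ) (Matrix.vecCons (Pi.single a 1)
          (Function.update (Function.update (φ.A σ) μ (Pi.single b 1)) ν
            (m.CL (φ.X σ) (φ.A σ μ) (φ.A σ ν)))) := by
  have e1 : ∀ μ ν, (if ν = μ then 0 else m.JL (φ.X σ) (Matrix.vecCons (Pi.single b 1)
        (Function.update (Function.update (φ.A σ) μ (Pi.single a 1)) ν (dd μ φ.A σ ν))))
      = -(if ν = μ then 0 else m.J (φ.X σ) (Matrix.vecCons (Pi.single a 1)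
        (Function.update (Function.update (φ.A σ) μ (Pi.single b 1)) ν (dd μ φ.A σ ν)))) := by
    intro μ ν
    split_ifs with hν
    · simp
    · rw [Function.update_comm (Ne.symm hν), JL_swap, Function.update_comm hν, m.JL_apply]
  simp only [e1, Finset.sum_neg_distrib, neg_neg]
  rw [sum_update_update, JTerm, ← Finset.sum_add_distrib]
  refine Finset.sum_congr rfl fun μ _ => ?_
  rw [← Finset.sum_add_distrib]
  refine Finset.sum_congr rfl fun ν _ => ?_
  have key : ∀ v, m.J (φ.X σ) (Matrix.vecCons (Pi.single a 1)
      (Function.update (Function.update (φ.A σ) μ (Pi.single b 1)) ν v))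
      = m.J (φ.X σ) (Function.update (Matrix.vecCons (Pi.single a 1)
        (Function.update (φ.A σ) μ (Pi.single b 1))) ν.succ v) := fun v => by
    rw [Matrix.vecCons, Matrix.vecCons, Fin.cons_update]
  rw [m.JL_apply, GA_eq, key, key, key, ← AlternatingMap.map_update_add]

theorem sum_CL_GY (φ : Fields d r n) (σ : Sp n) (v : Fin r → ℝ) :
    ∑ c, v c * GY m φ σ c = (∑ μ, dd μ φ.Y σ μ ⬝ᵥ v)
      + (-1 : ℝ) ^ (n + 1) * ((m.rhoL (φ.X σ) v).ofLp ⬝ᵥ φ.Z σ)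
      + (∑ μ, φ.Y σ μ ⬝ᵥ m.CL (φ.X σ) v (φ.A σ μ))
      + m.JL (φ.X σ) (Matrix.vecCons v (φ.A σ)) := by
  simp only [GY_eq, mul_add, Finset.sum_add_distrib]
  congr 1
  · congr 1
    · congr 1
      · simp only [Finset.mul_sum, dotProduct]
        rw [Finset.sum_comm]
        exact Finset.sum_congr rfl fun μ _ => Finset.sum_congr rfl fun c _ => mul_comm _ _
      · conv_rhs => rw [pi_eq_sum v]
        simp only [map_sum, map_smul, WithLp.ofLp_sum, WithLp.ofLp_smul, sum_dotProduct,
          smul_dotProduct, smul_eq_mul, Finset.mul_sum]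
        exact Finset.sum_congr rfl fun c _ => by ring
    · conv_rhs => rw [pi_eq_sum v]
      simp only [map_sum, map_smul, sum_apply, smul_apply, dotProduct_sum, dotProduct_smul,
        smul_eq_mul, Finset.mul_sum]
      exact Finset.sum_comm
  · have key : ∀ v, m.JL (φ.X σ) (Matrix.vecCons v (φ.A σ))
        = (m.JL (φ.X σ)).toMultilinearMap.toLinearMap
          (Matrix.vecCons 0 (φ.A σ)) 0 v := fun v => by
      rw [MultilinearMap.toLinearMap_apply]
      change _ = m.JL (φ.X σ) _
      rw [show Function.update (Matrix.vecCons 0 (φ.A σ)) 0 v = Matrix.vecCons v (φ.A σ) from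
        Fin.update_cons_zero _ _ _]
    simp only [key]
    conv_rhs => rw [pi_eq_sum v]
    simp only [map_sum, map_smul, smul_eq_mul]

/-- `{G_Y, G_Y}`, without any assumption on `J`: the derivatives of `A` and `X` are absorbed in `G_A`
and `G_X`, and what is left is the anomaly. -/
theorem densityBracket_YY (h : m.IsLieAlgebroid) {φ : Fields d r n} (hφ : IsField m φ)
    (a b : Fin r) :
    DensityBracket m φ (densY m a) (densY m b)
      (fun σ => (∑ c, m.CL (φ.X σ) (Pi.single a 1) (Pi.single b 1) c * GY m φ σ c)
        + (∑ μ, (φ.Y σ μ ⬝ᵥ fderiv ℝ m.CL (φ.X σ) (GX m φ σ μ) (Pi.single a 1) (Pi.single b 1)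
          + fderiv ℝ m.JL (φ.X σ) (GX m φ σ μ) (slot φ σ a b μ)))
        + JTerm m φ σ a b (GA m φ σ) + HTerm m φ σ a b
        + defect m (φ.X σ) (Pi.single a 1) (Pi.single b 1) (φ.A σ)) := by
  refine densityBracket_of_variation h.isOpen h.H_smooth hφ (isDensity_densY h a)
    (isDensity_densY h b) fun g hg σ => ?_
  have hy := hφ.2 σ
  rw [(var_densY h a (hφ.jet_mem σ)).fderiv_apply]
  simp only [jet_fst_fst, jet_fst_A, jet_fst_Y, jet_fst_Z, jet_snd_Y]
  have hZ := ham_densY_Z h hφ b hg σ (m.rhoL (φ.X σ) (Pi.single a 1))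
  -- the terms of `J` with one slot replaced
  have key : ∀ (μ : Fin n) (v w : Fin r → ℝ) (s t : ℝ), m.JL (φ.X σ) (Matrix.vecCons (Pi.single a 1)
      (Function.update (φ.A σ) μ (s • v - t • w)))
      = s * m.JL (φ.X σ) (Matrix.vecCons (Pi.single a 1) (Function.update (φ.A σ) μ v))
        - t * m.JL (φ.X σ) (Matrix.vecCons (Pi.single a 1) (Function.update (φ.A σ) μ w)) := by
    intro μ v w s t
    have k : ∀ v, m.JL (φ.X σ) (Matrix.vecCons (Pi.single a 1) (Function.update (φ.A σ) μ v))
        = m.JL (φ.X σ) (Function.update (Matrix.vecCons (Pi.single a 1) (φ.A σ)) μ.succ v) :=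
      fun v => by rw [Matrix.vecCons, Matrix.vecCons, Fin.cons_update]
    rw [k, k v, k w, (m.JL (φ.X σ)).map_update_sub, (m.JL (φ.X σ)).map_update_smul,
      (m.JL (φ.X σ)).map_update_smul, smul_eq_mul, smul_eq_mul]
  -- the Jacobi identity, for the terms with `Y` and two factors `C`
  have jac : ∀ μ, φ.Y σ μ ⬝ᵥ m.CL (φ.X σ) (m.CL (φ.X σ) (Pi.single a 1) (Pi.single b 1)) (φ.A σ μ)
      = φ.Y σ μ ⬝ᵥ m.CL (φ.X σ) (Pi.single a 1) (m.CL (φ.X σ) (Pi.single b 1) (φ.A σ μ))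
        + φ.Y σ μ ⬝ᵥ fderiv ℝ m.CL (φ.X σ) (m.rhoL (φ.X σ) (Pi.single a 1)) (Pi.single b 1)
          (φ.A σ μ)
        - φ.Y σ μ ⬝ᵥ m.CL (φ.X σ) (Pi.single b 1) (m.CL (φ.X σ) (Pi.single a 1) (φ.A σ μ))
        - φ.Y σ μ ⬝ᵥ fderiv ℝ m.CL (φ.X σ) (m.rhoL (φ.X σ) (Pi.single b 1)) (Pi.single a 1)
          (φ.A σ μ)
        + φ.Y σ μ ⬝ᵥ fderiv ℝ m.CL (φ.X σ) (m.rhoL (φ.X σ) (φ.A σ μ)) (Pi.single a 1)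
          (Pi.single b 1) := by
    intro μ
    have j := congrArg (fun z => φ.Y σ μ ⬝ᵥ z)
      (h.jacobi _ hy (Pi.single a 1) (Pi.single b 1) (φ.A σ μ))
    rw [h.antisymm _ hy (Pi.single a 1) (φ.A σ μ), h.fderiv_CL_antisymm hy _ (Pi.single a 1) (φ.A σ μ),
      h.antisymm _ hy (m.CL (φ.X σ) (Pi.single a 1) (Pi.single b 1)) (φ.A σ μ)] at j
    simp only [map_neg, dotProduct_add, dotProduct_neg, dotProduct_zero] at j
    linarith
  have anti : m.CL (φ.X σ) (Pi.single b 1) (Pi.single a 1)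
      = -m.CL (φ.X σ) (Pi.single a 1) (Pi.single b 1) := h.antisymm _ hy _ _
  simp only [dd_ham_densY_Y h hφ b hg, ham_densY_Y_dotProduct h hφ b hg, ham_densY_X h hφ b hg,
    ham_densY_A h hφ b hg, key, mul_add, hZ, sum_CL_GY, JTerm_GA, HTerm_eq, defect, slot, GX_eq,
    map_sub, map_neg, map_smul, sub_apply, neg_apply, smul_apply, dotProduct_add, dotProduct_sub,
    dotProduct_neg, dotProduct_smul, smul_eq_mul, h.anchor_hom _ hy, jac, WithLp.ofLp_neg,
    WithLp.ofLp_smul, WithLp.ofLp_sub, neg_dotProduct, smul_dotProduct, sub_dotProduct, anti,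
    h.fderiv_CL_antisymm hy _ (Pi.single a 1) (Pi.single b 1), h.fderiv_JL_swap hy _ (Pi.single a 1) (Pi.single b 1),
    JL_swap (m := m) (φ.X σ) (Pi.single a 1) (Pi.single b 1),
    Finset.sum_add_distrib, Finset.sum_sub_distrib, Finset.sum_neg_distrib, neg_add, mul_neg, neg_neg,
    ← Finset.mul_sum]
  ring

end Algebra

/-! ### The explicit algebra -/

section Explicit

variable {d r n : ℕ} {m : LocalTarget d r n}

theorem omits_densX_Y (h : m.IsLieAlgebroid) (μ : Fin n) (i : Fin d) (p : Fin n × Fin r) :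
    Omits m (densX m μ i) (.inr (.inr (.inl p))) := fun w hw => by
  simp only [(var_densX h μ i hw).fderiv_apply]
  refine ⟨by simp [compVec], fun ν => ?_⟩
  by_cases hν : μ = ν
  · subst hν; simp [compVec]
  · simp [compVec, Pi.single_eq_of_ne hν]

theorem omits_densX_Z (h : m.IsLieAlgebroid) (μ : Fin n) (i : Fin d) (p : Fin d) :
    Omits m (densX m μ i) (.inr (.inr (.inr p))) := fun w hw => by
  simp only [(var_densX h μ i hw).fderiv_apply]
  refine ⟨by simp [compVec], fun ν => ?_⟩
  by_cases hν : μ = ν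
  · subst hν; simp [compVec]
  · simp [compVec, Pi.single_eq_of_ne hν]

theorem omits_densA_Y (h : m.IsLieAlgebroid) (μ ν : Fin n) (a : Fin r) (p : Fin n × Fin r) :
    Omits m (densA m μ ν a) (.inr (.inr (.inl p))) := fun w hw => by
  simp only [(var_densA h μ ν a hw).fderiv_apply]
  refine ⟨by simp [compVec], fun κ => ?_⟩
  have e : ∀ l, (Pi.single κ (compVec (.inr (.inr (.inl p)))) : Fin n → Val d r n) l
      = if l = κ then compVec (.inr (.inr (.inl p))) else 0 := fun l => by
    rw [Pi.single_apply]
  simp only [e]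
  split_ifs <;> simp [compVec]

theorem omits_densA_Z (h : m.IsLieAlgebroid) (μ ν : Fin n) (a : Fin r) (p : Fin d) :
    Omits m (densA m μ ν a) (.inr (.inr (.inr p))) := fun w hw => by
  simp only [(var_densA h μ ν a hw).fderiv_apply]
  refine ⟨by simp [compVec], fun κ => ?_⟩
  have e : ∀ l, (Pi.single κ (compVec (.inr (.inr (.inr p)))) : Fin n → Val d r n) l
      = if l = κ then compVec (.inr (.inr (.inr p))) else 0 := fun l => by
    rw [Pi.single_apply]
  simp only [e]
  split_ifs <;> simp [compVec]

theorem sum_pd_rho (h : m.IsLieAlgebroid) {y : Pt d} (hy : y ∈ m.dom) (a : Fin r) (i : Fin d)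
    (x : Pt d) : ∑ j, pd j (fun z => m.rho z a i) y * x j
      = fderiv ℝ m.rhoL y x (Pi.single a 1) i := by
  simp only [h.pd_rho hy]
  conv_rhs => rw [euclidean_eq_sum x, map_sum]
  simp [sum_apply, mul_comm]

theorem sum_pd_C (h : m.IsLieAlgebroid) {y : Pt d} (hy : y ∈ m.dom) (a b c : Fin r)
    (x : Pt d) : ∑ j, pd j (fun z => m.C z a b c) y * x j
      = fderiv ℝ m.CL y x (Pi.single a 1) (Pi.single b 1) c := by
  simp only [h.pd_C hy]
  conv_rhs => rw [euclidean_eq_sum x, map_sum]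
  simp [sum_apply, mul_comm]

theorem sum_pd_J (h : m.IsLieAlgebroid) {y : Pt d} (hy : y ∈ m.dom)
    (v : Fin (n + 1) → Fin r → ℝ) (x : Pt d) : ∑ j, pd j (fun z => m.J z v) y * x j
      = fderiv ℝ m.JL y x v := by
  simp only [h.pd_J hy]
  conv_rhs => rw [euclidean_eq_sum x, map_sum]
  simp [sum_apply, mul_comm]

theorem sum_mul_bilin {k : ℕ} (B : (Fin r → ℝ) →L[ℝ] (Fin k → ℝ)) (v : Fin r → ℝ) (a : Fin k) :
    ∑ c, B (Pi.single c 1) a * v c = B v a := by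
  conv_rhs => rw [pi_eq_sum v]
  rw [map_sum, Finset.sum_apply]
  exact Finset.sum_congr rfl fun c _ => by rw [map_smul, Pi.smul_apply, smul_eq_mul, mul_comm]

/-- The contraction of the structure functions of the bracket in `{G_A, G_Y}`. -/
theorem sum_sum_pd_C (h : m.IsLieAlgebroid) {y : Pt d} (hy : y ∈ m.dom) (a b : Fin r)
    (v : Fin r → ℝ) (x : Pt d) : ∑ i, ∑ c, pd i (fun z => m.C z b c a) y * (v c * x i)
      = fderiv ℝ m.CL y x (Pi.single b 1) v a := by
  rw [Finset.sum_comm]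
  refine Eq.trans ?_ (sum_mul_bilin (fderiv ℝ m.CL y x (Pi.single b 1)) v a)
  refine Finset.sum_congr rfl fun c _ => ?_
  rw [← sum_pd_C h hy, Finset.sum_mul]
  exact Finset.sum_congr rfl fun i _ => by ring

theorem YY_coord (h : m.IsLieAlgebroid) {φ : Fields d r n} (hφ : IsField m φ) (σ : Sp n)
    (a b : Fin r) :
    ∑ μ, ∑ i, ((∑ c, pd i (fun y => m.C y a b c) (φ.X σ) * φ.Y σ μ c)
          + pd i (fun y => m.J y (slot φ σ a b μ)) (φ.X σ)) * GX m φ σ μ i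
      = ∑ μ, (φ.Y σ μ ⬝ᵥ fderiv ℝ m.CL (φ.X σ) (GX m φ σ μ) (Pi.single a 1) (Pi.single b 1)
          + fderiv ℝ m.JL (φ.X σ) (GX m φ σ μ) (slot φ σ a b μ)) := by
  refine Finset.sum_congr rfl fun μ _ => ?_
  simp only [add_mul, Finset.sum_add_distrib, sum_pd_J h (hφ.2 σ), Finset.sum_mul]
  congr 1
  rw [Finset.sum_comm]
  refine Finset.sum_congr rfl fun c _ => ?_
  rw [← sum_pd_C h (hφ.2 σ), Finset.mul_sum]
  exact Finset.sum_congr rfl fun i _ => by ring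

theorem densityBracket_XX (h : m.IsLieAlgebroid) {φ : Fields d r n} (hφ : IsField m φ)
    (μ ν : Fin n) (i j : Fin d) : DensityBracket m φ (densX m μ i) (densX m ν j) 0 :=
  densityBracket_eq_zero_of_omits_Y hφ (omits_densX_Y h μ i) (omits_densX_Z h μ i)
    (omits_densX_Y h ν j) (omits_densX_Z h ν j)

theorem densityBracket_XA (h : m.IsLieAlgebroid) {φ : Fields d r n} (hφ : IsField m φ)
    (μ κ ν : Fin n) (i : Fin d) (a : Fin r) :
    DensityBracket m φ (densX m μ i) (densA m κ ν a) 0 :=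
  densityBracket_eq_zero_of_omits_Y hφ (omits_densX_Y h μ i) (omits_densX_Z h μ i)
    (omits_densA_Y h κ ν a) (omits_densA_Z h κ ν a)

theorem densityBracket_AA (h : m.IsLieAlgebroid) {φ : Fields d r n} (hφ : IsField m φ)
    (μ ν κ τ : Fin n) (a b : Fin r) :
    DensityBracket m φ (densA m μ ν a) (densA m κ τ b) 0 :=
  densityBracket_eq_zero_of_omits_Y hφ (omits_densA_Y h μ ν a) (omits_densA_Z h μ ν a)
    (omits_densA_Y h κ τ b) (omits_densA_Z h κ τ b)

/-- The constraint algebra in components, where the anomaly vanishes. -/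
theorem explicitAlgebra (h : m.IsLieAlgebroid)
    (hd : ∀ y ∈ m.dom, ∀ a b A, defect m y (Pi.single a 1) (Pi.single b 1) A = 0)
    {φ : Fields d r n} (hφ : IsField m φ) : ExplicitAlgebra m φ where
  XX μ ν i j := (densityBracket_XX h hφ μ ν i j).localBracket h.isOpen hφ (isDensity_densX h μ i)
    (isDensity_densX h ν j) (represents_densX m μ i) (represents_densX m ν j)
  XA μ κ ν i a := (densityBracket_XA h hφ μ κ ν i a).localBracket h.isOpen hφ
    (isDensity_densX h μ i) (isDensity_densA h κ ν a) (represents_densX m μ i)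
    (represents_densA m κ ν a)
  XY μ i a := ((densityBracket_XY h hφ μ i a).congr fun σ => by
    rw [sum_pd_rho h (hφ.2 σ)]).localBracket h.isOpen hφ
    (isDensity_densX h μ i) (isDensity_densY h a) (represents_densX m μ i) (represents_densY m a)
  AA μ ν κ τ a b := (densityBracket_AA h hφ μ ν κ τ a b).localBracket h.isOpen hφ
    (isDensity_densA h μ ν a) (isDensity_densA h κ τ b) (represents_densA m μ ν a)
    (represents_densA m κ τ b)
  AY μ ν a b := ((densityBracket_AY h hφ μ ν a b).congr fun σ => by
    simp only [mul_sub, Finset.sum_sub_distrib, sum_sum_pd_C h (hφ.2 σ)]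
    simp only [← LocalTarget.CL_single]
    rw [sum_mul_bilin (m.CL (φ.X σ) (Pi.single b 1))]
    simp only [Pi.add_apply, Pi.sub_apply]
    ring).localBracket h.isOpen hφ
    (isDensity_densA h μ ν a) (isDensity_densY h b) (represents_densA m μ ν a)
    (represents_densY m b)
  YY a b := ((densityBracket_YY h hφ a b).congr fun σ => by
    rw [YY_coord h hφ, hd _ (hφ.2 σ), add_zero, LocalTarget.CL_single]).localBracket h.isOpen hφ
    (isDensity_densY h a) (isDensity_densY h b) (represents_densY m a) (represents_densY m b)

end Explicit

/-! ### Covariantized constraints -/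

/-- The local form of a smooth connection, with `T` its `E`-torsion. -/
structure LocalConnection.IsConnection {d r n : ℕ} (w : LocalConnection d r)
    (m : LocalTarget d r n) : Prop where
  om_smooth : ∀ b i, ContDiffOn ℝ ∞ (fun y => w.om y b i) m.dom
  torsion : ∀ y ∈ m.dom, ∀ a b, w.T y a b = w.omL y (Pi.single b 1) (m.rho y a)
    - w.omL y (Pi.single a 1) (m.rho y b) - m.C y a b

section Covariant

variable {d r n : ℕ} (m : LocalTarget d r n) (w : LocalConnection d r)

/-- The `E`-torsion on sections with constant coefficients. -/
def torL (y : Pt d) (u v : Fin r → ℝ) : Fin r → ℝ :=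
  w.omL y v (m.rhoL y u) - w.omL y u (m.rhoL y v) - m.CL y u v

theorem bilin_eq_sum {V : Type*} [AddCommGroup V] [Module ℝ V]
    (B : (Fin r → ℝ) →ₗ[ℝ] (Fin r → ℝ) →ₗ[ℝ] V) (u v : Fin r → ℝ) :
    B u v = ∑ a, ∑ b, (u a * v b) • B (Pi.single a 1) (Pi.single b 1) := by
  conv_lhs => rw [pi_eq_sum u, pi_eq_sum v]
  simp only [map_sum, map_smul, LinearMap.sum_apply, LinearMap.smul_apply, Finset.smul_sum,
    smul_smul]
  rw [Finset.sum_comm]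
  simp only [mul_comm]

variable {m w}

theorem LocalConnection.IsConnection.sum_T (hw : w.IsConnection m) {y : Pt d} (hy : y ∈ m.dom)
    (u v : Fin r → ℝ) : ∑ a, ∑ b, (u a * v b) • w.T y a b = torL m w y u v := by
  have := bilin_eq_sum (LinearMap.mk₂ ℝ (torL m w y)
    (fun a b c => by simp only [torL, map_add, add_apply]; module)
    (fun c a b => by simp only [torL, map_smul, smul_apply]; module)
    (fun a b c => by simp only [torL, map_add, add_apply]; module)
    (fun c a b => by simp only [torL, map_smul, smul_apply]; module)) u v
  simp only [LinearMap.mk₂_apply] at this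
  rw [this]
  simp only [hw.torsion y hy, torL, LocalTarget.rhoL_single, LocalTarget.CL_single]

theorem LocalConnection.IsConnection.torL_single_left (hw : w.IsConnection m) {y : Pt d}
    (hy : y ∈ m.dom) (a : Fin r) (v : Fin r → ℝ) :
    torL m w y (Pi.single a 1) v = ∑ b, v b • w.T y a b := by
  rw [← hw.sum_T hy, Finset.sum_eq_single a (fun e _ he => by simp [Pi.single_eq_of_ne he])
    (by simp)]
  simp

theorem LocalConnection.IsConnection.differentiableAt_omL (hw : w.IsConnection m)
    (hm : m.IsLieAlgebroid) {y : Pt d} (hy : y ∈ m.dom) : DifferentiableAt ℝ w.omL y :=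
  ((LocalConnection.contDiffOn_omL hw.om_smooth).contDiffAt
    (hm.isOpen.mem_nhds hy)).differentiableAt (by simp)

/-- `G_A^∇` differs from `G_A` by a multiple of `G_X`. -/
theorem GAcov_eq (hw : w.IsConnection m) {φ : Fields d r n} {σ : Sp n}
    (hx : φ.X σ ∈ m.dom) (μ ν : Fin n) :
    GAcov w φ σ μ ν = GA m φ σ μ ν - w.omL (φ.X σ) (φ.A σ μ) (GX m φ σ ν)
      + w.omL (φ.X σ) (φ.A σ ν) (GX m φ σ μ) := by
  have e1 : GAcov w φ σ μ ν = dd μ φ.A σ ν - dd ν φ.A σ μ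
      - (w.omL (φ.X σ) (φ.A σ μ) (dd ν φ.X σ) - w.omL (φ.X σ) (φ.A σ ν) (dd μ φ.X σ))
      - torL m w (φ.X σ) (φ.A σ μ) (φ.A σ ν) := by
    rw [← hw.sum_T hx]
    funext a
    simp only [GAcov, w.omL_apply, Pi.sub_apply, Finset.sum_apply, Pi.smul_apply, smul_eq_mul,
      ← Finset.sum_sub_distrib]
    congr 1
    · congr 1
      exact Finset.sum_congr rfl fun b _ => Finset.sum_congr rfl fun c _ => by ring
    · exact Finset.sum_congr rfl fun b _ => Finset.sum_congr rfl fun c _ => by ring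
  rw [e1, torL, GA_eq, GX_eq, GX_eq, map_sub, map_sub]
  abel

theorem omL_single_left (y : Pt d) (a : Fin r) (x : Pt d) :
    w.omL y (Pi.single a 1) x = ∑ i, x i • w.om y a i := by
  rw [w.omL_apply, Finset.sum_eq_single a (fun e _ he => by simp [Pi.single_eq_of_ne he])
    (by simp)]
  simp

theorem sum_om_dotProduct (y : Pt d) (a : Fin r) (v : Fin r → ℝ) (x : Pt d) :
    ∑ c, ∑ i, w.om y a i c * v c * x i = v ⬝ᵥ w.omL y (Pi.single a 1) x := by
  rw [omL_single_left]
  simp only [dotProduct, Finset.sum_apply, Pi.smul_apply, smul_eq_mul, Finset.mul_sum]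
  exact Finset.sum_congr rfl fun c _ => Finset.sum_congr rfl fun i _ => by ring

/-- `G_Y^∇` differs from `G_Y` by a multiple of `G_X`: the connection terms of `Z^∇` and of the torsion
cancel. -/
theorem GYcov_eq (hw : w.IsConnection m) {φ : Fields d r n} {σ : Sp n}
    (hx : φ.X σ ∈ m.dom) (a : Fin r) :
    GYcov m w φ σ a = GY m φ σ a
      - ∑ μ, φ.Y σ μ ⬝ᵥ w.omL (φ.X σ) (Pi.single a 1) (GX m φ σ μ) := by
  have s2 : (-1 : ℝ) ^ (n + 1) * (-1 : ℝ) ^ (n + 1) = 1 := by rw [← mul_pow]; simp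
  have eT : ∀ μ, ∑ b, ∑ c, w.T (φ.X σ) a b c * φ.Y σ μ c * φ.A σ μ b
      = φ.Y σ μ ⬝ᵥ torL m w (φ.X σ) (Pi.single a 1) (φ.A σ μ) := by
    intro μ
    rw [hw.torL_single_left hx]
    simp only [dotProduct, Finset.sum_apply, Pi.smul_apply, smul_eq_mul, Finset.mul_sum]
    rw [Finset.sum_comm]
    exact Finset.sum_congr rfl fun c _ => Finset.sum_congr rfl fun b _ => by ring
  have eZ : ∑ i, m.rho (φ.X σ) a i * Zcov w φ σ i
      = (∑ i, m.rho (φ.X σ) a i * φ.Z σ i)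
        + (-1 : ℝ) ^ (n + 1) * ∑ μ, φ.Y σ μ ⬝ᵥ w.omL (φ.X σ) (φ.A σ μ) (m.rho (φ.X σ) a) := by
    simp only [Zcov, mul_add, Finset.sum_add_distrib, w.omL_apply, dotProduct, Finset.sum_apply,
      Pi.smul_apply, smul_eq_mul, Finset.mul_sum]
    congr 1
    rw [Finset.sum_comm]
    refine Finset.sum_congr rfl fun μ _ => ?_
    rw [Finset.sum_comm]
    refine Eq.trans (Finset.sum_congr rfl fun b _ => ?_) Finset.sum_comm
    rw [Finset.sum_comm]
    exact Finset.sum_congr rfl fun c _ => Finset.sum_congr rfl fun i _ => by ring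
  have eT' : ∑ μ, φ.Y σ μ ⬝ᵥ torL m w (φ.X σ) (Pi.single a 1) (φ.A σ μ)
      = (∑ μ, φ.Y σ μ ⬝ᵥ w.omL (φ.X σ) (φ.A σ μ) (m.rho (φ.X σ) a))
        - (∑ μ, φ.Y σ μ ⬝ᵥ w.omL (φ.X σ) (Pi.single a 1) (m.rhoL (φ.X σ) (φ.A σ μ)))
        - ∑ μ, φ.Y σ μ ⬝ᵥ m.CL (φ.X σ) (Pi.single a 1) (φ.A σ μ) := by
    simp only [torL, dotProduct_sub, Finset.sum_sub_distrib, LocalTarget.rhoL_single]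
  have eG : ∑ μ, φ.Y σ μ ⬝ᵥ w.omL (φ.X σ) (Pi.single a 1) (GX m φ σ μ)
      = (∑ μ, φ.Y σ μ ⬝ᵥ w.omL (φ.X σ) (Pi.single a 1) (dd μ φ.X σ))
        - ∑ μ, φ.Y σ μ ⬝ᵥ w.omL (φ.X σ) (Pi.single a 1) (m.rhoL (φ.X σ) (φ.A σ μ)) := by
    simp only [GX_eq, map_sub, dotProduct_sub, Finset.sum_sub_distrib]
  have eC : ∑ i, m.rho (φ.X σ) a i * φ.Z σ i
      = (m.rhoL (φ.X σ) (Pi.single a 1)).ofLp ⬝ᵥ φ.Z σ := by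
    rw [m.rhoL_single]; rfl
  simp only [GYcov, sum_om_dotProduct, eT, Finset.sum_sub_distrib]
  rw [eZ, GY_eq, eT', eG, eC, m.JL_apply]
  linear_combination (∑ μ, φ.Y σ μ ⬝ᵥ w.omL (φ.X σ) (φ.A σ μ) (m.rho (φ.X σ) a)) * s2

/-! ### The covariantized constraints as densities -/

variable (m) (w)

/-- `G_X` as a function on jets. -/
def jetX (μ : Fin n) (k : Jet d r n) : Pt d := (k.2 μ).1 - m.rhoL k.1.1 (k.1.2.1 μ)

/-- The coefficient of `G_X` in the covariantized `G_Y`. -/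
def densK (a : Fin r) (μ : Fin n) (i : Fin d) (k : Jet d r n) : ℝ :=
  k.1.2.2.1 μ ⬝ᵥ w.omL k.1.1 (Pi.single a 1) (EuclideanSpace.single i 1)

/-- The density of the covariantized `G_A`. -/
def densAcov (μ ν : Fin n) (a : Fin r) (k : Jet d r n) : ℝ :=
  ((k.2 μ).2.1 ν - (k.2 ν).2.1 μ + m.CL k.1.1 (k.1.2.1 μ) (k.1.2.1 ν)
    - w.omL k.1.1 (k.1.2.1 μ) (jetX m ν k) + w.omL k.1.1 (k.1.2.1 ν) (jetX m μ k)) a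

/-- The density of the covariantized `G_Y`. -/
def densYcov (a : Fin r) (k : Jet d r n) : ℝ :=
  densY m a k - ∑ μ, ∑ i, densK w a μ i k * densX m μ i k

variable {m w}

theorem sum_densK_densX (a : Fin r) (k : Jet d r n) (μ : Fin n) :
    ∑ i, densK w a μ i k * densX m μ i k
      = k.1.2.2.1 μ ⬝ᵥ w.omL k.1.1 (Pi.single a 1) (jetX m μ k) := by
  conv_rhs => rw [euclidean_eq_sum (jetX m μ k)]
  simp only [map_sum, map_smul, dotProduct_sum, dotProduct_smul, smul_eq_mul]
  exact Finset.sum_congr rfl fun i _ => mul_comm _ _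

theorem jetX_jet (φ : Fields d r n) (σ : Sp n) (μ : Fin n) : jetX m μ (φ.jet σ) = GX m φ σ μ := by
  rw [GX_eq]; rfl

theorem represents_densAcov (hw : w.IsConnection m) (μ ν : Fin n) (a : Fin r) :
    Represents m (densAcov m w μ ν a) (fun φ σ => GAcov w φ σ μ ν a) := fun φ σ hx => by
  change GAcov w φ σ μ ν a = _
  rw [GAcov_eq hw hx, densAcov, jetX_jet, jetX_jet, GA_eq]
  rfl

theorem represents_densYcov (hw : w.IsConnection m) (a : Fin r) :
    Represents m (densYcov m w a) (fun φ σ => GYcov m w φ σ a) := fun φ σ hx => by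
  change GYcov m w φ σ a = _
  simp only [GYcov_eq hw hx, densYcov, sum_densK_densX, jetX_jet]
  rw [← represents_densY m a φ σ hx]
  rfl

theorem isDensity_densK (hw : w.IsConnection m) (a : Fin r) (μ : Fin n)
    (i : Fin d) : IsDensity m (densK (n := n) w a μ i) := by
  have eY : ContDiff ℝ ∞ (fun w : Jet d r n => w.1.2.2.1 μ) := by fun_prop
  exact contDiffOn_dotProduct eY.contDiffOn
    (((contDiffOn_comp_X (LocalConnection.contDiffOn_omL hw.om_smooth)).clm_apply
      contDiffOn_const).clm_apply contDiffOn_const)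

theorem contDiffOn_jetX (h : m.IsLieAlgebroid) (μ : Fin n) :
    ContDiffOn ℝ ∞ (jetX m μ) (jetDom m) := by
  have e : ContDiff ℝ ∞ (fun w : Jet d r n => (w.2 μ).1) := by fun_prop
  have e1 : ContDiff ℝ ∞ (fun w : Jet d r n => w.1.2.1 μ) := by fun_prop
  exact e.contDiffOn.sub ((contDiffOn_comp_X h.contDiffOn_rhoL).clm_apply e1.contDiffOn)

theorem isDensity_densAcov (h : m.IsLieAlgebroid) (hw : w.IsConnection m) (μ ν : Fin n)
    (a : Fin r) : IsDensity m (densAcov m w μ ν a) := by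
  have e : ContDiff ℝ ∞ (fun w : Jet d r n => (w.2 μ).2.1 ν - (w.2 ν).2.1 μ) := by fun_prop
  have e1 : ∀ μ, ContDiff ℝ ∞ (fun w : Jet d r n => w.1.2.1 μ) := fun μ => by fun_prop
  have eo := contDiffOn_comp_X (n := n) (LocalConnection.contDiffOn_omL hw.om_smooth)
  exact contDiffOn_pi.1 (((e.contDiffOn.add
    (((contDiffOn_comp_X h.contDiffOn_CL).clm_apply (e1 μ).contDiffOn).clm_apply
      (e1 ν).contDiffOn)).sub
    ((eo.clm_apply (e1 μ).contDiffOn).clm_apply (contDiffOn_jetX h ν))).add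
    ((eo.clm_apply (e1 ν).contDiffOn).clm_apply (contDiffOn_jetX h μ))) a

theorem isDensity_densYcov (h : m.IsLieAlgebroid) (hw : w.IsConnection m) (a : Fin r) :
    IsDensity m (densYcov m w a) :=
  (isDensity_densY h a).sub (IsDensity.sum fun μ _ => IsDensity.sum fun i _ =>
    (isDensity_densK hw a μ i).mul (isDensity_densX h μ i))

theorem var_jetX (h : m.IsLieAlgebroid) (μ : Fin n) {k : Jet d r n} (hk : k ∈ jetDom m) :
    HasVar (jetX m μ) k (fun l => (l.2 μ).1 -
      (fderiv ℝ m.rhoL k.1.1 l.1.1 (k.1.2.1 μ) + m.rhoL k.1.1 (l.1.2.1 μ))) :=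
  (((HasVar.id k).snd.apply μ).fst).sub
    ((hasVar_comp_X (h.differentiableAt_rhoL hk)).clm_apply ((HasVar.id k).fst.snd.fst.apply μ))

theorem var_densK (h : m.IsLieAlgebroid) (hw : w.IsConnection m) (a : Fin r) (μ : Fin n)
    (i : Fin d) {k : Jet d r n} (hk : k ∈ jetDom m) :
    HasVar (densK w a μ i) k (fun l =>
      l.1.2.2.1 μ ⬝ᵥ w.omL k.1.1 (Pi.single a 1) (EuclideanSpace.single i 1)
        + k.1.2.2.1 μ ⬝ᵥ fderiv ℝ w.omL k.1.1 l.1.1 (Pi.single a 1) (EuclideanSpace.single i 1)) :=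
  (((HasVar.id k).fst.snd.snd.fst.apply μ).dotProduct
    (((hasVar_comp_X (hw.differentiableAt_omL h hk)).clm_apply
      (HasVar.const (Pi.single a 1 : Fin r → ℝ) k)).clm_apply
      (HasVar.const (EuclideanSpace.single i 1 : Pt d) k))).congr fun l => by simp

theorem var_densAcov (h : m.IsLieAlgebroid) (hw : w.IsConnection m) (μ ν : Fin n) (a : Fin r)
    {k : Jet d r n} (hk : k ∈ jetDom m) :
    HasVar (densAcov m w μ ν a) k (fun l => ((l.2 μ).2.1 ν - (l.2 ν).2.1 μ +
      ((fderiv ℝ m.CL k.1.1 l.1.1 (k.1.2.1 μ) + m.CL k.1.1 (l.1.2.1 μ)) (k.1.2.1 ν)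
        + m.CL k.1.1 (k.1.2.1 μ) (l.1.2.1 ν))
      - ((fderiv ℝ w.omL k.1.1 l.1.1 (k.1.2.1 μ) + w.omL k.1.1 (l.1.2.1 μ)) (jetX m ν k)
        + w.omL k.1.1 (k.1.2.1 μ) ((l.2 ν).1 -
      (fderiv ℝ m.rhoL k.1.1 l.1.1 (k.1.2.1 ν) + m.rhoL k.1.1 (l.1.2.1 ν))))
      + ((fderiv ℝ w.omL k.1.1 l.1.1 (k.1.2.1 ν) + w.omL k.1.1 (l.1.2.1 ν)) (jetX m μ k)
        + w.omL k.1.1 (k.1.2.1 ν) ((l.2 μ).1 -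
      (fderiv ℝ m.rhoL k.1.1 l.1.1 (k.1.2.1 μ) + m.rhoL k.1.1 (l.1.2.1 μ))))) a) := by
  have vA : ∀ μ, HasVar (fun k : Jet d r n => k.1.2.1 μ) k (fun l => l.1.2.1 μ) := fun μ =>
    (HasVar.id k).fst.snd.fst.apply μ
  have vo := hasVar_comp_X (hw.differentiableAt_omL h hk)
  exact ((((((((HasVar.id k).snd.apply μ).snd.fst.apply ν).sub
    (((HasVar.id k).snd.apply ν).snd.fst.apply μ))).add
    (((hasVar_comp_X (h.differentiableAt_CL hk)).clm_apply (vA μ)).clm_apply (vA ν))).sub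
    ((vo.clm_apply (vA μ)).clm_apply (var_jetX h ν hk))).add
    ((vo.clm_apply (vA ν)).clm_apply (var_jetX h μ hk))).apply a

theorem var_densYcov (h : m.IsLieAlgebroid) (hw : w.IsConnection m) (a : Fin r)
    {k : Jet d r n} (hk : k ∈ jetDom m) :
    HasVar (densYcov m w a) k (fun l => fderiv ℝ (densY m a) k l
      - ∑ μ, ((l.1.2.2.1 μ ⬝ᵥ w.omL k.1.1 (Pi.single a 1) (jetX m μ k)
        + k.1.2.2.1 μ ⬝ᵥ (fderiv ℝ w.omL k.1.1 l.1.1 (Pi.single a 1) (jetX m μ k)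
          + w.omL k.1.1 (Pi.single a 1) ((l.2 μ).1 -
            (fderiv ℝ m.rhoL k.1.1 l.1.1 (k.1.2.1 μ) + m.rhoL k.1.1 (l.1.2.1 μ))))))) := by
  have e : densYcov m w a = fun k => densY m a k
      - ∑ μ, k.1.2.2.1 μ ⬝ᵥ w.omL k.1.1 (Pi.single a 1) (jetX m μ k) := by
    funext k
    simp only [densYcov, sum_densK_densX]
  rw [e]
  refine ((DifferentiableAt.hasVar ((isDensity_densY h a).differentiableAt h.isOpen hk)).sub (HasVar.sum fun μ : Fin n =>
    ((HasVar.id k).fst.snd.snd.fst.apply μ).dotProduct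
    (((hasVar_comp_X (hw.differentiableAt_omL h hk)).clm_apply
      (HasVar.const (Pi.single a 1 : Fin r → ℝ) k)).clm_apply (var_jetX h μ hk)))).congr fun l => ?_
  simp

/-- The components of the gradient of `G_Y^∇` along `Y` and `Z`. -/
theorem eulerComp_densYcov (h : m.IsLieAlgebroid) (hw : w.IsConnection m) {φ : Fields d r n}
    (hφ : IsField m φ) (b : Fin r) (g : Sp n → ℝ) (v : Val d r n) (hX : v.1 = 0) (hA : v.2.1 = 0)
    (σ : Sp n) :
    eulerComp (fun σ => g σ • fderiv ℝ (densYcov m w b) (φ.jet σ)) v σ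
      = eulerComp (fun σ => g σ • fderiv ℝ (densY m b) (φ.jet σ)) v σ
        - g σ * ∑ μ, v.2.2.1 μ ⬝ᵥ w.omL (φ.X σ) (Pi.single b 1) (GX m φ σ μ) := by
  have e : ∀ μ τ, (g τ • fderiv ℝ (densYcov m w b) (φ.jet τ)) (0, Pi.single μ v)
      = (g τ • fderiv ℝ (densY m b) (φ.jet τ)) (0, Pi.single μ v) := by
    intro μ τ
    have hs : ∀ ν, (Pi.single μ v : Fin n → Val d r n) ν = if ν = μ then v else 0 := fun ν => by
      rw [Pi.single_apply]
    have hs1 : ∀ ν, ((Pi.single μ v : Fin n → Val d r n) ν).1 = 0 := fun ν => by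
      rw [hs]; split_ifs <;> simp [hX]
    rw [smul_apply, smul_apply, (var_densYcov h hw b (hφ.jet_mem τ)).fderiv_apply]
    simp [hs1]
  simp only [eulerComp, e]
  rw [smul_apply, smul_apply, (var_densYcov h hw b (hφ.jet_mem σ)).fderiv_apply]
  simp only [hX, hA, jetX_jet, jet_fst_fst, Pi.zero_apply, Prod.fst_zero, map_zero, zero_apply,
    add_zero, sub_zero, dotProduct_zero, smul_eq_mul]
  ring

theorem ham_densYcov_X (h : m.IsLieAlgebroid) (hw : w.IsConnection m) {φ : Fields d r n}
    (hφ : IsField m φ) (b : Fin r) (g : Sp n → ℝ) (σ : Sp n) :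
    (ham m φ (grad (densYcov m w b) φ g)).X σ = (ham m φ (grad (densY m b) φ g)).X σ := by
  ext i
  have e : (grad (densYcov m w b) φ g).Z σ i = (grad (densY m b) φ g).Z σ i := by
    refine (eulerComp_densYcov h hw hφ b g (compVec (.inr (.inr (.inr i)))) rfl rfl σ).trans ?_
    simp [compVec, grad, euler, ofCoord]
  simp only [ham, e]

theorem ham_densYcov_A (h : m.IsLieAlgebroid) (hw : w.IsConnection m) {φ : Fields d r n}
    (hφ : IsField m φ) (b : Fin r) (g : Sp n → ℝ) (σ : Sp n) (μ : Fin n) :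
    (ham m φ (grad (densYcov m w b) φ g)).A σ μ = (ham m φ (grad (densY m b) φ g)).A σ μ
      - g σ • w.omL (φ.X σ) (Pi.single b 1) (GX m φ σ μ) := by
  funext c
  refine (eulerComp_densYcov h hw hφ b g (compVec (.inr (.inr (.inl (μ, c))))) rfl rfl σ).trans ?_
  simp only [compVec, sum_single_dotProduct, Pi.sub_apply, Pi.smul_apply, smul_eq_mul]
  rfl

end Covariant

/-! ### The brackets of the covariantized constraints -/

section Covariant

variable {d r n : ℕ} (m : LocalTarget d r n) (w : LocalConnection d r)

/-- The curvature `R(x, x')v` on a section with constant coefficients `v`. -/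
def curvL (y : Pt d) (x x' : Pt d) (v : Fin r → ℝ) : Fin r → ℝ :=
  fderiv ℝ w.omL y x v x' - fderiv ℝ w.omL y x' v x + w.omL y (w.omL y v x') x
    - w.omL y (w.omL y v x) x'

/-- The basic curvature `S(x; u, v)`, expanded in terms of `ω`, `ρ` and `C`. -/
def basicL (y : Pt d) (x : Pt d) (u v : Fin r → ℝ) : Fin r → ℝ :=
  fderiv ℝ w.omL y x v (m.rhoL y u) + w.omL y v (fderiv ℝ m.rhoL y x u)
    - fderiv ℝ w.omL y x u (m.rhoL y v) - w.omL y u (fderiv ℝ m.rhoL y x v)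
    - fderiv ℝ m.CL y x u v + w.omL y (torL m w y u v) x
    - torL m w y (w.omL y u x) v - torL m w y u (w.omL y v x)
    + curvL w y x (m.rhoL y v) u - curvL w y x (m.rhoL y u) v

variable {m w}

theorem dd_X_eq (φ : Fields d r n) (σ : Sp n) (μ : Fin n) :
    dd μ φ.X σ = GX m φ σ μ + m.rhoL (φ.X σ) (φ.A σ μ) := by
  rw [GX_eq, sub_add_cancel]

theorem isTorusFun_GX (h : m.IsLieAlgebroid) {φ : Fields d r n} (hφ : IsField m φ) (μ : Fin n) :
    IsTorusFun fun σ => GX m φ σ μ := by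
  simp only [GX_eq]
  exact (hφ.1.1.dd μ).sub ((hφ.1.1.comp h.isOpen h.contDiffOn_rhoL hφ.2).clm_apply
    (isTorusFun_pi.1 hφ.1.2.1 μ))

theorem dd_GX (h : m.IsLieAlgebroid) {φ : Fields d r n} (hφ : IsField m φ) (μ ν : Fin n)
    (σ : Sp n) : dd μ (fun τ => GX m φ τ ν) σ = dd μ (dd ν φ.X) σ
      - (fderiv ℝ m.rhoL (φ.X σ) (dd μ φ.X σ) (φ.A σ ν) + m.rhoL (φ.X σ) (dd μ φ.A σ ν)) := by
  simp only [GX_eq]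
  exact (((hφ.1.1.dd ν).hasVar σ).sub (((hφ.1.1.hasVar σ).comp
    (h.differentiableAt_rhoL (hφ.2 σ))).clm_apply ((hφ.1.2.1.hasVar σ).apply ν))).fderiv_apply _

theorem dd_ham_densYcov_A (h : m.IsLieAlgebroid) (hw : w.IsConnection m) {φ : Fields d r n}
    (hφ : IsField m φ) (b : Fin r) {g : Sp n → ℝ} (hg : IsTorusFun g) (σ : Sp n) (μ ν : Fin n) :
    dd μ (ham m φ (grad (densYcov m w b) φ g)).A σ ν
      = dd μ (ham m φ (grad (densY m b) φ g)).A σ ν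
        - (dd μ g σ • w.omL (φ.X σ) (Pi.single b 1) (GX m φ σ ν)
          + g σ • (fderiv ℝ w.omL (φ.X σ) (dd μ φ.X σ) (Pi.single b 1) (GX m φ σ ν)
            + w.omL (φ.X σ) (Pi.single b 1) (dd μ (fun τ => GX m φ τ ν) σ))) := by
  have hs := (smooth_ham h.isOpen h.H_smooth hφ
    (smooth_grad h.isOpen (isDensity_densYcov h hw b) hφ hg)).2.1
  have hs' := (smooth_ham h.isOpen h.H_smooth hφ
    (smooth_grad h.isOpen (isDensity_densY h b) hφ hg)).2.1
  rw [← dd_apply hs ν μ σ, ← dd_apply hs' ν μ σ,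
    show (fun τ => (ham m φ (grad (densYcov m w b) φ g)).A τ ν) = _ from
      funext fun σ => ham_densYcov_A h hw hφ b g σ ν]
  have v := ((hs'.hasVar σ).apply ν).sub ((hg.hasVar σ).smul ((((hφ.1.1.hasVar σ).comp
    (hw.differentiableAt_omL h (hφ.2 σ))).clm_apply (HasVar.const (Pi.single b 1) σ)).clm_apply
      ((isTorusFun_GX h hφ ν).hasVar σ)))
  refine (v.fderiv_apply _).trans ?_
  rw [dd_apply hs']
  simp [dd]

theorem dd_ham_densYcov_X (h : m.IsLieAlgebroid) (hw : w.IsConnection m) {φ : Fields d r n}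
    (hφ : IsField m φ) (b : Fin r) (g : Sp n → ℝ) (σ : Sp n) (μ : Fin n) :
    dd μ (ham m φ (grad (densYcov m w b) φ g)).X σ
      = dd μ (ham m φ (grad (densY m b) φ g)).X σ := by
  rw [show (ham m φ (grad (densYcov m w b) φ g)).X = _ from
    funext fun σ => ham_densYcov_X h hw hφ b g σ]

/-- The variation of `G_X` along the Hamiltonian vector field of the covariantized `G_Y`. -/
theorem variation_jetX (h : m.IsLieAlgebroid) (hw : w.IsConnection m) {φ : Fields d r n}
    (hφ : IsField m φ) (b : Fin r) {g : Sp n → ℝ} (hg : IsTorusFun g) (σ : Sp n) (μ : Fin n) :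
    dd μ (ham m φ (grad (densYcov m w b) φ g)).X σ
      - (fderiv ℝ m.rhoL (φ.X σ) ((ham m φ (grad (densYcov m w b) φ g)).X σ) (φ.A σ μ)
        + m.rhoL (φ.X σ) ((ham m φ (grad (densYcov m w b) φ g)).A σ μ))
      = -(g σ • (fderiv ℝ m.rhoL (φ.X σ) (GX m φ σ μ) (Pi.single b 1)
        - m.rhoL (φ.X σ) (w.omL (φ.X σ) (Pi.single b 1) (GX m φ σ μ)))) := by
  simp only [dd_ham_densYcov_X h hw hφ, ham_densYcov_X h hw hφ, ham_densYcov_A h hw hφ,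
    dd_ham_densY_X h hφ b hg, ham_densY_X h hφ b hg, ham_densY_A h hφ b hg, dd_X_eq (m := m),
    map_sub, map_add, map_neg, map_smul, smul_apply, neg_apply, add_apply,
    h.anchor_hom _ (hφ.2 σ)]
  module

/-- `{G_X, G_Y^∇}`. -/
theorem densityBracket_XYcov (h : m.IsLieAlgebroid) (hw : w.IsConnection m) {φ : Fields d r n}
    (hφ : IsField m φ) (μ : Fin n) (i : Fin d) (b : Fin r) :
    DensityBracket m φ (densX m μ i) (densYcov m w b)
      (fun σ => -(fderiv ℝ m.rhoL (φ.X σ) (GX m φ σ μ) (Pi.single b 1)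
        - m.rhoL (φ.X σ) (w.omL (φ.X σ) (Pi.single b 1) (GX m φ σ μ))) i) := by
  refine densityBracket_of_variation h.isOpen h.H_smooth hφ (isDensity_densX h μ i)
    (isDensity_densYcov h hw b) fun g hg σ => ?_
  rw [(var_densX h μ i (hφ.jet_mem σ)).fderiv_apply]
  simp only [jet_fst_fst, jet_fst_A, jet_snd_X]
  rw [variation_jetX h hw hφ b hg]
  simp only [PiLp.neg_apply, PiLp.smul_apply, PiLp.sub_apply, smul_eq_mul]
  ring

set_option maxHeartbeats 2000000 in
/-- `{G_A^∇, G_Y^∇}`, with the curvature and the basic curvature as multilinear expressions. -/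
theorem densityBracket_AYcov (h : m.IsLieAlgebroid) (hw : w.IsConnection m) {φ : Fields d r n}
    (hφ : IsField m φ) (μ ν : Fin n) (a b : Fin r) :
    DensityBracket m φ (densAcov m w μ ν a) (densYcov m w b)
      (fun σ => (m.CL (φ.X σ) (Pi.single b 1) (GAcov w φ σ μ ν)
        + w.omL (φ.X σ) (Pi.single b 1) (m.rhoL (φ.X σ) (GAcov w φ σ μ ν))
        + basicL m w (φ.X σ) (GX m φ σ ν) (Pi.single b 1) (φ.A σ μ)
        - basicL m w (φ.X σ) (GX m φ σ μ) (Pi.single b 1) (φ.A σ ν)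
        - curvL w (φ.X σ) (GX m φ σ μ) (GX m φ σ ν) (Pi.single b 1)) a) := by
  refine densityBracket_of_variation h.isOpen h.H_smooth hφ (isDensity_densAcov h hw μ ν a)
    (isDensity_densYcov h hw b) fun g hg σ => ?_
  have hy := hφ.2 σ
  have jac := h.jacobi _ hy (Pi.single b 1) (φ.A σ μ) (φ.A σ ν)
  rw [h.antisymm _ hy (Pi.single b 1) (φ.A σ ν), h.fderiv_CL_antisymm hy _ (Pi.single b 1) (φ.A σ ν),
    h.antisymm _ hy (m.CL (φ.X σ) (Pi.single b 1) (φ.A σ μ)) (φ.A σ ν)] at jac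
  rw [(var_densAcov h hw μ ν a (hφ.jet_mem σ)).fderiv_apply]
  simp only [jet_fst_fst, jet_fst_A, jet_snd_X, jet_snd_A, jetX_jet]
  rw [variation_jetX h hw hφ b hg, variation_jetX h hw hφ b hg]
  refine congrFun (?_ : _ = g σ • (m.CL (φ.X σ) (Pi.single b 1) (GAcov w φ σ μ ν)
        + w.omL (φ.X σ) (Pi.single b 1) (m.rhoL (φ.X σ) (GAcov w φ σ μ ν))
        + basicL m w (φ.X σ) (GX m φ σ ν) (Pi.single b 1) (φ.A σ μ)
        - basicL m w (φ.X σ) (GX m φ σ μ) (Pi.single b 1) (φ.A σ ν)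
        - curvL w (φ.X σ) (GX m φ σ μ) (GX m φ σ ν) (Pi.single b 1))) a
  rw [GAcov_eq hw hy, GA_eq]
  simp only [dd_ham_densYcov_A h hw hφ b hg, ham_densYcov_X h hw hφ, ham_densYcov_A h hw hφ,
    dd_ham_densY_A h hφ b hg, ham_densY_X h hφ b hg, ham_densY_A h hφ b hg, dd_GX h hφ,
    dd_comm hφ.1.1 ν μ, dd_comm hg ν μ]
  simp only [dd_X_eq (m := m), basicL, curvL, torL,
    map_sub, map_add, map_neg, map_smul, smul_apply, neg_apply, add_apply, sub_apply,
    h.anchor_hom _ hy, h.antisymm _ hy (Pi.single b 1) (φ.A σ μ),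
    h.antisymm _ hy (φ.A σ μ) (w.omL (φ.X σ) (Pi.single b 1) (GX m φ σ ν))] at jac ⊢
  linear_combination (norm := module) (-g σ) • jac

end Covariant

section Covariant

variable {d r n : ℕ} {m : LocalTarget d r n} {w : LocalConnection d r}

theorem sum_map_single_mul {f : Pt d → ℝ} (hf : IsLinearMap ℝ f) (x : Pt d) :
    ∑ i, f (EuclideanSpace.single i 1) * x i = f x := sum_single_mul hf.mk' x

theorem JL_update_add (y : Pt d) (a : Fin r → ℝ) (A : Fin n → Fin r → ℝ) (μ : Fin n)
    (u v : Fin r → ℝ) : m.JL y (Matrix.vecCons a (Function.update A μ (u + v)))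
      = m.JL y (Matrix.vecCons a (Function.update A μ u))
        + m.JL y (Matrix.vecCons a (Function.update A μ v)) := by
  have k : ∀ v, m.JL y (Matrix.vecCons a (Function.update A μ v))
      = m.JL y (Function.update (Matrix.vecCons a A) μ.succ v) :=
    fun v => by rw [Matrix.vecCons, Matrix.vecCons, Fin.cons_update]
  rw [k, k u, k v, (m.JL y).map_update_add]

theorem JL_update_smul (y : Pt d) (a : Fin r → ℝ) (A : Fin n → Fin r → ℝ) (μ : Fin n)
    (c : ℝ) (v : Fin r → ℝ) : m.JL y (Matrix.vecCons a (Function.update A μ (c • v)))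
      = c * m.JL y (Matrix.vecCons a (Function.update A μ v)) := by
  have k : ∀ v, m.JL y (Matrix.vecCons a (Function.update A μ v))
      = m.JL y (Function.update (Matrix.vecCons a A) μ.succ v) :=
    fun v => by rw [Matrix.vecCons, Matrix.vecCons, Fin.cons_update]
  rw [k, k v, (m.JL y).map_update_smul, smul_eq_mul]

/-- The bracket of the coefficient of `G_X` in `G_Y^∇` with `G_Y`. -/
theorem densityBracket_KY (h : m.IsLieAlgebroid) (hw : w.IsConnection m) {φ : Fields d r n}
    (hφ : IsField m φ) (μ : Fin n) (i : Fin d) (a b : Fin r) :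
    DensityBracket m φ (densK w a μ i) (densY m b) (fun σ =>
      -(φ.Y σ μ ⬝ᵥ m.CL (φ.X σ) (Pi.single b 1)
          (w.omL (φ.X σ) (Pi.single a 1) (EuclideanSpace.single i 1))
        + m.JL (φ.X σ) (Matrix.vecCons (Pi.single b 1) (Function.update (φ.A σ) μ
          (w.omL (φ.X σ) (Pi.single a 1) (EuclideanSpace.single i 1))))
        + φ.Y σ μ ⬝ᵥ fderiv ℝ w.omL (φ.X σ) (m.rhoL (φ.X σ) (Pi.single b 1)) (Pi.single a 1)
          (EuclideanSpace.single i 1))) := by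
  refine densityBracket_of_variation h.isOpen h.H_smooth hφ (isDensity_densK hw a μ i)
    (isDensity_densY h b) fun g hg σ => ?_
  rw [(var_densK h hw a μ i (hφ.jet_mem σ)).fderiv_apply]
  simp only [jet_fst_fst, jet_fst_Y, ham_densY_Y_dotProduct h hφ b hg, ham_densY_X h hφ b hg,
    map_neg, map_smul, neg_apply, smul_apply, dotProduct_neg, dotProduct_smul, smul_eq_mul]
  ring

theorem eulerComp_densK (h : m.IsLieAlgebroid) (hw : w.IsConnection m) {φ : Fields d r n}
    (hφ : IsField m φ) (b : Fin r) (ν : Fin n) (j : Fin d) (g : Sp n → ℝ) (v : Val d r n)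
    (hX : v.1 = 0) (σ : Sp n) :
    eulerComp (fun σ => g σ • fderiv ℝ (densK w b ν j) (φ.jet σ)) v σ
      = g σ * (v.2.2.1 ν ⬝ᵥ w.omL (φ.X σ) (Pi.single b 1) (EuclideanSpace.single j 1)) := by
  have e : ∀ μ, (fun τ => (g τ • fderiv ℝ (densK w b ν j) (φ.jet τ)) (0, Pi.single μ v))
      = fun _ => (0 : ℝ) := by
    intro μ
    funext τ
    rw [smul_apply, (var_densK h hw b ν j (hφ.jet_mem τ)).fderiv_apply]
    simp
  simp only [eulerComp, e]
  rw [smul_apply, (var_densK h hw b ν j (hφ.jet_mem σ)).fderiv_apply]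
  simp [hX, dd, jet_fst_fst]

theorem densityBracket_XK (h : m.IsLieAlgebroid) (hw : w.IsConnection m) {φ : Fields d r n}
    (hφ : IsField m φ) (μ ν : Fin n) (i j : Fin d) (b : Fin r) :
    DensityBracket m φ (densX m μ i) (densK w b ν j) (fun σ => if μ = ν then
      -(m.rhoL (φ.X σ) (w.omL (φ.X σ) (Pi.single b 1) (EuclideanSpace.single j 1))) i else 0) := by
  refine densityBracket_of_variation h.isOpen h.H_smooth hφ (isDensity_densX h μ i)
    (isDensity_densK hw b ν j) fun g hg σ => ?_
  have hZ : ∀ σ i, (grad (densK w b ν j) φ g).Z σ i = 0 := fun σ i => by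
    refine (eulerComp_densK h hw hφ b ν j g (compVec (.inr (.inr (.inr i)))) rfl σ).trans ?_
    simp [compVec]
  have hX : (ham m φ (grad (densK w b ν j) φ g)).X = fun _ => 0 := by
    funext σ; ext i; simp [ham, hZ]
  have hA : (ham m φ (grad (densK w b ν j) φ g)).A σ μ = if μ = ν then
      g σ • w.omL (φ.X σ) (Pi.single b 1) (EuclideanSpace.single j 1) else 0 := by
    funext c
    refine (eulerComp_densK h hw hφ b ν j g (compVec (.inr (.inr (.inl (μ, c))))) rfl σ).trans ?_
    split_ifs with hμ
    · subst hμ; simp [compVec]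
    · simp [compVec, Pi.single_eq_of_ne' hμ]
  rw [(var_densX h μ i (hφ.jet_mem σ)).fderiv_apply]
  simp only [jet_fst_fst, jet_snd_X, jet_fst_A, hA]
  split_ifs
  · simp [hX, dd]
  · simp [hX, dd]

theorem densityBracket_KK (h : m.IsLieAlgebroid) (hw : w.IsConnection m) {φ : Fields d r n}
    (hφ : IsField m φ) (μ ν : Fin n) (i j : Fin d) (a b : Fin r) :
    DensityBracket m φ (densK w a μ i) (densK w b ν j) 0 := by
  refine densityBracket_eq_zero_of_omits_A hφ (fun p k hk => ?_) (fun p k hk => ?_)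
    (fun p k hk => ?_) (fun p k hk => ?_) <;>
  · simp only [(var_densK h hw _ _ _ hk).fderiv_apply]
    simp [compVec]

/-- Brackets with `G_Y^∇ = G_Y - ∑ K G_X` by the Leibniz rule. -/
theorem DensityBracket.densYcov_left (h : m.IsLieAlgebroid) (hw : w.IsConnection m)
    {φ : Fields d r n} (hφ : IsField m φ) {a : Fin r} {F : Jet d r n → ℝ} (hF : IsDensity m F)
    {B₀ : Sp n → ℝ} {BK BX : Fin n → Fin d → Sp n → ℝ}
    (b₀ : DensityBracket m φ (densY m a) F B₀)
    (bK : ∀ μ i, DensityBracket m φ (densK w a μ i) F (BK μ i))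
    (bX : ∀ μ i, DensityBracket m φ (densX m μ i) F (BX μ i)) :
    DensityBracket m φ (densYcov m w a) F (fun σ => B₀ σ
      - ∑ μ, ∑ i, (BK μ i σ * GX m φ σ μ i + densK w a μ i (φ.jet σ) * BX μ i σ)) := by
  have hKX : ∀ μ i, IsDensity m (fun k => densK w a μ i k * densX m μ i k) := fun μ i =>
    (isDensity_densK hw a μ i).mul (isDensity_densX h μ i)
  refine (b₀.sub_left h.isOpen h.H_smooth hφ (isDensity_densY h a)
    (IsDensity.sum fun μ _ => IsDensity.sum fun i _ => hKX μ i) hF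
    (DensityBracket.sum_left h.isOpen h.H_smooth hφ (fun μ _ => IsDensity.sum fun i _ => hKX μ i) hF
      fun μ _ => DensityBracket.sum_left h.isOpen h.H_smooth hφ (fun i _ => hKX μ i) hF
        fun i _ => (bK μ i).mul_left h.isOpen h.H_smooth hφ (isDensity_densK hw a μ i)
          (isDensity_densX h μ i) hF (bX μ i))).congr fun σ => ?_
  congr 1
  refine Finset.sum_congr rfl fun μ _ => Finset.sum_congr rfl fun i _ => ?_
  rw [show densX m μ i (φ.jet σ) = GX m φ σ μ i by rw [← jetX_jet]; rfl]

theorem sum_densK_mul (φ : Fields d r n) (σ : Sp n) (a : Fin r) (μ : Fin n) (x : Pt d) :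
    ∑ i, densK w a μ i (φ.jet σ) * x i = φ.Y σ μ ⬝ᵥ w.omL (φ.X σ) (Pi.single a 1) x :=
  sum_map_single_mul (f := fun x => φ.Y σ μ ⬝ᵥ w.omL (φ.X σ) (Pi.single a 1) x)
    ⟨fun x y => by simp only [map_add, dotProduct_add],
      fun c x => by simp only [map_smul, dotProduct_smul]⟩ x

theorem densityBracket_YcovY (h : m.IsLieAlgebroid) (hw : w.IsConnection m) {φ : Fields d r n}
    (hφ : IsField m φ) {B : Sp n → ℝ} (a b : Fin r)
    (hB : DensityBracket m φ (densY m a) (densY m b) B) :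
    DensityBracket m φ (densYcov m w b) (densY m a) (fun σ => -B σ
      + ∑ μ, (φ.Y σ μ ⬝ᵥ m.CL (φ.X σ) (Pi.single a 1)
            (w.omL (φ.X σ) (Pi.single b 1) (GX m φ σ μ))
          + m.JL (φ.X σ) (Matrix.vecCons (Pi.single a 1) (Function.update (φ.A σ) μ
            (w.omL (φ.X σ) (Pi.single b 1) (GX m φ σ μ))))
          + φ.Y σ μ ⬝ᵥ fderiv ℝ w.omL (φ.X σ) (m.rhoL (φ.X σ) (Pi.single a 1)) (Pi.single b 1)
            (GX m φ σ μ)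
          + φ.Y σ μ ⬝ᵥ w.omL (φ.X σ) (Pi.single b 1)
            (fderiv ℝ m.rhoL (φ.X σ) (GX m φ σ μ) (Pi.single a 1)))) := by
  refine (hB.symm.densYcov_left h hw hφ (isDensity_densY h a)
    (fun μ i => densityBracket_KY h hw hφ μ i b a)
    (fun μ i => densityBracket_XY h hφ μ i a)).congr fun σ => ?_
  rw [sub_eq_add_neg, ← Finset.sum_neg_distrib]
  congr 1
  refine Finset.sum_congr rfl fun μ _ => ?_
  rw [Finset.sum_add_distrib]
  simp only [mul_neg, Finset.sum_neg_distrib, sum_densK_mul, neg_mul]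
  rw [sum_map_single_mul (f := fun x => φ.Y σ μ ⬝ᵥ m.CL (φ.X σ) (Pi.single a 1)
            (w.omL (φ.X σ) (Pi.single b 1) x)
          + m.JL (φ.X σ) (Matrix.vecCons (Pi.single a 1) (Function.update (φ.A σ) μ
            (w.omL (φ.X σ) (Pi.single b 1) x)))
          + φ.Y σ μ ⬝ᵥ fderiv ℝ w.omL (φ.X σ) (m.rhoL (φ.X σ) (Pi.single a 1)) (Pi.single b 1)
            x) ⟨fun x y => by simp only [map_add, dotProduct_add, JL_update_add]; ring,
              fun c x => by simp only [map_smul, dotProduct_smul, JL_update_smul, smul_eq_mul]; ring⟩]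
  ring

theorem densityBracket_YcovK (h : m.IsLieAlgebroid) (hw : w.IsConnection m) {φ : Fields d r n}
    (hφ : IsField m φ) (μ : Fin n) (i : Fin d) (a b : Fin r) :
    DensityBracket m φ (densYcov m w b) (densK w a μ i) (fun σ =>
      φ.Y σ μ ⬝ᵥ m.CL (φ.X σ) (Pi.single b 1)
          (w.omL (φ.X σ) (Pi.single a 1) (EuclideanSpace.single i 1))
        + m.JL (φ.X σ) (Matrix.vecCons (Pi.single b 1) (Function.update (φ.A σ) μ
          (w.omL (φ.X σ) (Pi.single a 1) (EuclideanSpace.single i 1))))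
        + φ.Y σ μ ⬝ᵥ fderiv ℝ w.omL (φ.X σ) (m.rhoL (φ.X σ) (Pi.single b 1)) (Pi.single a 1)
          (EuclideanSpace.single i 1)
        + φ.Y σ μ ⬝ᵥ w.omL (φ.X σ) (Pi.single b 1) (m.rhoL (φ.X σ)
          (w.omL (φ.X σ) (Pi.single a 1) (EuclideanSpace.single i 1)))) := by
  refine ((densityBracket_KY h hw hφ μ i a b).symm.densYcov_left h hw hφ (isDensity_densK hw a μ i)
    (fun ν j => densityBracket_KK h hw hφ ν μ j i b a)
    (fun ν j => densityBracket_XK h hw hφ ν μ j i a)).congr fun σ => ?_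
  rw [Finset.sum_eq_single μ (fun ν _ hν => by simp [hν]) (by simp)]
  simp only [if_true, Pi.zero_apply, zero_mul, zero_add, mul_neg, Finset.sum_neg_distrib,
    sum_densK_mul]
  ring

/-- The correction of `{G_Y, G_Y}` by the covariantization. -/
theorem densityBracket_YYcov_of_YY (h : m.IsLieAlgebroid) (hw : w.IsConnection m) {φ : Fields d r n}
    (hφ : IsField m φ) {B : Sp n → ℝ} (a b : Fin r)
    (hB : DensityBracket m φ (densY m a) (densY m b) B) :
    DensityBracket m φ (densYcov m w a) (densYcov m w b) (fun σ => B σ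
      - ∑ μ, (φ.Y σ μ ⬝ᵥ (m.CL (φ.X σ) (Pi.single a 1)
            (w.omL (φ.X σ) (Pi.single b 1) (GX m φ σ μ))
          + fderiv ℝ w.omL (φ.X σ) (m.rhoL (φ.X σ) (Pi.single a 1)) (Pi.single b 1)
            (GX m φ σ μ)
          + w.omL (φ.X σ) (Pi.single b 1)
            (fderiv ℝ m.rhoL (φ.X σ) (GX m φ σ μ) (Pi.single a 1))
          - m.CL (φ.X σ) (Pi.single b 1) (w.omL (φ.X σ) (Pi.single a 1) (GX m φ σ μ))
          - fderiv ℝ w.omL (φ.X σ) (m.rhoL (φ.X σ) (Pi.single b 1)) (Pi.single a 1) (GX m φ σ μ)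
          - w.omL (φ.X σ) (Pi.single b 1) (m.rhoL (φ.X σ)
            (w.omL (φ.X σ) (Pi.single a 1) (GX m φ σ μ)))
          - w.omL (φ.X σ) (Pi.single a 1)
            (fderiv ℝ m.rhoL (φ.X σ) (GX m φ σ μ) (Pi.single b 1)
              - m.rhoL (φ.X σ) (w.omL (φ.X σ) (Pi.single b 1) (GX m φ σ μ))))
          + m.JL (φ.X σ) (Matrix.vecCons (Pi.single a 1) (Function.update (φ.A σ) μ
            (w.omL (φ.X σ) (Pi.single b 1) (GX m φ σ μ))))
          - m.JL (φ.X σ) (Matrix.vecCons (Pi.single b 1) (Function.update (φ.A σ) μ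
            (w.omL (φ.X σ) (Pi.single a 1) (GX m φ σ μ)))))) := by
  refine ((densityBracket_YcovY h hw hφ a b hB).symm.densYcov_left h hw hφ
    (isDensity_densYcov h hw b)
    (fun μ i => (densityBracket_YcovK h hw hφ μ i a b).symm)
    (fun μ i => densityBracket_XYcov h hw hφ μ i b)).congr fun σ => ?_
  rw [neg_add, neg_neg, add_sub_assoc, sub_eq_add_neg (B σ)]
  congr 1
  rw [← neg_add', neg_inj, ← Finset.sum_add_distrib]
  refine Finset.sum_congr rfl fun μ _ => ?_
  rw [Finset.sum_add_distrib]
  simp only [mul_neg, Finset.sum_neg_distrib, sum_densK_mul, neg_mul]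
  rw [sum_map_single_mul (f := fun x => φ.Y σ μ ⬝ᵥ m.CL (φ.X σ) (Pi.single b 1)
            (w.omL (φ.X σ) (Pi.single a 1) x)
          + m.JL (φ.X σ) (Matrix.vecCons (Pi.single b 1) (Function.update (φ.A σ) μ
            (w.omL (φ.X σ) (Pi.single a 1) x)))
          + φ.Y σ μ ⬝ᵥ fderiv ℝ w.omL (φ.X σ) (m.rhoL (φ.X σ) (Pi.single b 1)) (Pi.single a 1)
            x + φ.Y σ μ ⬝ᵥ w.omL (φ.X σ) (Pi.single b 1) (m.rhoL (φ.X σ)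
          (w.omL (φ.X σ) (Pi.single a 1) x)))
            ⟨fun x y => by simp only [map_add, dotProduct_add, JL_update_add]; ring,
              fun c x => by simp only [map_smul, dotProduct_smul, JL_update_smul, smul_eq_mul]; ring⟩]
  simp only [dotProduct_add, dotProduct_sub, map_sub]
  ring

theorem JTerm_GAcov (hw : w.IsConnection m) {φ : Fields d r n} {σ : Sp n} (hx : φ.X σ ∈ m.dom)
    (a b : Fin r) :
    JTerm m φ σ a b (GAcov w φ σ) = JTerm m φ σ a b (GA m φ σ)
      + ∑ μ, ∑ ν, if ν = μ then 0 else m.JL (φ.X σ) (Matrix.vecCons (Pi.single a 1)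
          (Function.update (Function.update (φ.A σ) μ (Pi.single b 1)) ν
            (w.omL (φ.X σ) (φ.A σ ν) (GX m φ σ μ)))) := by
  simp only [m.JL_apply]
  rw [sum_update_update (m.J (φ.X σ)) _ _ _ fun μ ν => w.omL (φ.X σ) (φ.A σ ν) (GX m φ σ μ),
    JTerm, JTerm, ← Finset.sum_add_distrib]
  refine Finset.sum_congr rfl fun μ _ => ?_
  rw [← Finset.sum_add_distrib]
  refine Finset.sum_congr rfl fun ν _ => ?_
  simp only [← m.JL_apply]
  rw [← JL_update_add, GAcov_eq hw hx]
  congr 3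
  abel

/-- `{G_Y, G_Y}` for the covariantized constraints. -/
theorem densityBracket_YYcov (h : m.IsLieAlgebroid) (hw : w.IsConnection m)
    {φ : Fields d r n} (hφ : IsField m φ)
    (hd : ∀ y ∈ m.dom, ∀ a b A, defect m y (Pi.single a 1) (Pi.single b 1) A = 0) (a b : Fin r) :
    DensityBracket m φ (densYcov m w a) (densYcov m w b) (fun σ =>
      (∑ c, m.CL (φ.X σ) (Pi.single a 1) (Pi.single b 1) c * GYcov m w φ σ c)
        + (∑ μ, (-(φ.Y σ μ ⬝ᵥ basicL m w (φ.X σ) (GX m φ σ μ) (Pi.single a 1) (Pi.single b 1))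
          + (fderiv ℝ m.JL (φ.X σ) (GX m φ σ μ) (slot φ σ a b μ)
            - m.JL (φ.X σ) (Matrix.vecCons (w.omL (φ.X σ) (Pi.single a 1) (GX m φ σ μ))
                (Function.update (φ.A σ) μ (Pi.single b 1)))
            - m.JL (φ.X σ) (Matrix.vecCons (Pi.single a 1) (Function.update (φ.A σ) μ
                (w.omL (φ.X σ) (Pi.single b 1) (GX m φ σ μ))))
            - ∑ ν, if ν = μ then 0 else m.JL (φ.X σ) (Matrix.vecCons (Pi.single a 1)
                (Function.update (Function.update (φ.A σ) μ (Pi.single b 1)) ν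
                  (w.omL (φ.X σ) (φ.A σ ν) (GX m φ σ μ)))))))
        + JTerm m φ σ a b (GAcov w φ σ) + HTerm m φ σ a b) := by
  refine (densityBracket_YYcov_of_YY h hw hφ a b (densityBracket_YY h hφ a b)).congr fun σ => ?_
  have hy := hφ.2 σ
  have e1 : ∑ c, m.CL (φ.X σ) (Pi.single a 1) (Pi.single b 1) c * GYcov m w φ σ c
      = (∑ c, m.CL (φ.X σ) (Pi.single a 1) (Pi.single b 1) c * GY m φ σ c)
        - ∑ μ, φ.Y σ μ ⬝ᵥ w.omL (φ.X σ) (m.CL (φ.X σ) (Pi.single a 1) (Pi.single b 1))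
            (GX m φ σ μ) := by
    simp only [GYcov_eq hw hy, mul_sub, Finset.sum_sub_distrib]
    congr 1
    simp only [Finset.mul_sum]
    rw [Finset.sum_comm]
    refine Finset.sum_congr rfl fun μ _ => ?_
    conv_rhs => rw [pi_eq_sum (m.CL (φ.X σ) (Pi.single a 1) (Pi.single b 1))]
    simp only [map_sum, map_smul, sum_apply, smul_apply, dotProduct_sum, dotProduct_smul,
      smul_eq_mul]
  rw [e1, JTerm_GAcov hw hy, hd _ hy]
  simp only [basicL, curvL, torL, map_sub, sub_apply, dotProduct_add, dotProduct_sub,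
    JL_swap (m := m) (φ.X σ) (w.omL (φ.X σ) (Pi.single a 1) _) (Pi.single b 1),
    h.antisymm _ hy (Pi.single b 1) (w.omL (φ.X σ) (Pi.single a 1) _), dotProduct_neg,
    Finset.sum_add_distrib, Finset.sum_sub_distrib, Finset.sum_neg_distrib]
  ring

end Covariant

/-! ### Components of the covariant structure functions -/

section Covariant

variable {d r n : ℕ} {m : LocalTarget d r n} {w : LocalConnection d r}

theorem LocalConnection.IsConnection.pd_om (hw : w.IsConnection m) (h : m.IsLieAlgebroid)
    {y : Pt d} (hy : y ∈ m.dom) (i j : Fin d) (a c : Fin r) :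
    pd i (fun z => w.om z a j c) y
      = fderiv ℝ w.omL y (EuclideanSpace.single i 1) (Pi.single a 1)
          (EuclideanSpace.single j 1) c := by
  have e : (fun z => w.om z a j c)
      = fun z => w.omL z (Pi.single a 1) (EuclideanSpace.single j 1) c := by
    simp only [LocalConnection.omL_single]
  rw [e, pd_eq_of_hasVar ((((DifferentiableAt.hasVar (hw.differentiableAt_omL h hy)).clm_apply
    (HasVar.const _ y)).clm_apply (HasVar.const _ y)).apply c)]
  simp

theorem sum_mul_om (y : Pt d) (v : Fin r → ℝ) (i : Fin d) (c : Fin r) :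
    ∑ e, v e * w.om y e i c = w.omL y v (EuclideanSpace.single i 1) c := by
  rw [w.omL_apply, Finset.sum_apply]
  refine Finset.sum_congr rfl fun e _ => ?_
  rw [Finset.sum_eq_single i (fun j _ hj => by simp [hj]) (by simp)]
  simp

theorem curv_eq (hw : w.IsConnection m) (h : m.IsLieAlgebroid) {y : Pt d} (hy : y ∈ m.dom)
    (i j : Fin d) (a c : Fin r) : curv w y i j a c
      = curvL w y (EuclideanSpace.single i 1) (EuclideanSpace.single j 1) (Pi.single a 1) c := by
  rw [curv, hw.pd_om h hy, hw.pd_om h hy, Finset.sum_sub_distrib, sum_mul_om, sum_mul_om]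
  simp only [curvL, LocalConnection.omL_single, Pi.add_apply, Pi.sub_apply]
  ring

theorem LocalConnection.IsConnection.pd_T (hw : w.IsConnection m) (h : m.IsLieAlgebroid)
    {y : Pt d} (hy : y ∈ m.dom) (i : Fin d) (a b c : Fin r) :
    pd i (fun z => w.T z a b c) y
      = (fderiv ℝ w.omL y (EuclideanSpace.single i 1) (Pi.single b 1) (m.rhoL y (Pi.single a 1))
        + w.omL y (Pi.single b 1) (fderiv ℝ m.rhoL y (EuclideanSpace.single i 1) (Pi.single a 1))
        - (fderiv ℝ w.omL y (EuclideanSpace.single i 1) (Pi.single a 1) (m.rhoL y (Pi.single b 1))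
        + w.omL y (Pi.single a 1) (fderiv ℝ m.rhoL y (EuclideanSpace.single i 1) (Pi.single b 1)))
        - fderiv ℝ m.CL y (EuclideanSpace.single i 1) (Pi.single a 1) (Pi.single b 1)) c := by
  have e : (fun z => w.T z a b c) =ᶠ[nhds y] fun z =>
      (w.omL z (Pi.single b 1) (m.rhoL z (Pi.single a 1))
        - w.omL z (Pi.single a 1) (m.rhoL z (Pi.single b 1))
        - m.CL z (Pi.single a 1) (Pi.single b 1)) c := by
    filter_upwards [h.isOpen.mem_nhds hy] with z hz
    rw [hw.torsion z hz, LocalTarget.rhoL_single, LocalTarget.rhoL_single, LocalTarget.CL_single]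
  have vo := DifferentiableAt.hasVar (hw.differentiableAt_omL h hy)
  have vr := DifferentiableAt.hasVar (h.differentiableAt_rhoL hy)
  have vC := DifferentiableAt.hasVar (h.differentiableAt_CL hy)
  have vs : ∀ a : Fin r, HasVar (fun _ : Pt d => (Pi.single a 1 : Fin r → ℝ)) y (fun _ => 0) :=
    fun a => HasVar.const _ y
  rw [pd, e.fderiv_eq, (((((vo.clm_apply (vs b)).clm_apply (vr.clm_apply (vs a))).sub
    ((vo.clm_apply (vs a)).clm_apply (vr.clm_apply (vs b)))).sub
    ((vC.clm_apply (vs a)).clm_apply (vs b))).apply c).fderiv_apply]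
  simp

theorem sum_rho_curv (hw : w.IsConnection m) (h : m.IsLieAlgebroid) {y : Pt d} (hy : y ∈ m.dom)
    (i : Fin d) (a b c : Fin r) : ∑ j, m.rho y b j * curv w y i j a c
      = curvL w y (EuclideanSpace.single i 1) (m.rhoL y (Pi.single b 1)) (Pi.single a 1) c := by
  simp only [curv_eq hw h hy]
  rw [LocalTarget.rhoL_single, ← sum_map_single_mul (f := fun x => curvL w y
    (EuclideanSpace.single i 1) x (Pi.single a 1) c)
    ⟨fun x y => by simp only [curvL, map_add, add_apply, Pi.add_apply, Pi.sub_apply]; ring,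
      fun c x => by
        simp only [curvL, map_smul, smul_apply, Pi.add_apply, Pi.sub_apply, Pi.smul_apply,
          smul_eq_mul]
        ring⟩]
  exact Finset.sum_congr rfl fun j _ => mul_comm _ _

theorem basicCurv_eq (hw : w.IsConnection m) (h : m.IsLieAlgebroid) {y : Pt d} (hy : y ∈ m.dom)
    (i : Fin d) (a b c : Fin r) : basicCurv m w y i a b c
      = basicL m w y (EuclideanSpace.single i 1) (Pi.single a 1) (Pi.single b 1) c := by
  have eT : ∀ a b, w.T y a b = torL m w y (Pi.single a 1) (Pi.single b 1) := fun a b => by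
    rw [hw.torL_single_left hy, Finset.sum_eq_single b (fun e _ he => by simp [he]) (by simp)]
    simp
  have e1 : ∑ e, w.om y e i c * w.T y a b e
      = w.omL y (torL m w y (Pi.single a 1) (Pi.single b 1)) (EuclideanSpace.single i 1) c := by
    rw [← sum_mul_om, ← eT]
    exact Finset.sum_congr rfl fun j _ => mul_comm _ _
  have e2 : ∑ e, w.om y a i e * w.T y e b c
      = torL m w y (w.omL y (Pi.single a 1) (EuclideanSpace.single i 1)) (Pi.single b 1) c := by
    rw [LocalConnection.omL_single, ← hw.sum_T hy, Finset.sum_apply]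
    refine Finset.sum_congr rfl fun e _ => ?_
    rw [Finset.sum_eq_single b (fun e _ he => by simp [he]) (by simp)]
    simp
  have e3 : ∑ e, w.om y b i e * w.T y a e c
      = torL m w y (Pi.single a 1) (w.omL y (Pi.single b 1) (EuclideanSpace.single i 1)) c := by
    rw [LocalConnection.omL_single, hw.torL_single_left hy, Finset.sum_apply]
    rfl
  rw [basicCurv, nablaT, Finset.sum_sub_distrib, Finset.sum_sub_distrib, e1, e2, e3,
    Finset.sum_sub_distrib, sum_rho_curv hw h hy, sum_rho_curv hw h hy, hw.pd_T h hy]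
  simp only [basicL, Pi.add_apply, Pi.sub_apply]
  ring

theorem nablaRho_eq (h : m.IsLieAlgebroid) {y : Pt d} (hy : y ∈ m.dom) (j i : Fin d) (b : Fin r) :
    nablaRho m w y j b i = (fderiv ℝ m.rhoL y (EuclideanSpace.single j 1) (Pi.single b 1)
      - m.rhoL y (w.omL y (Pi.single b 1) (EuclideanSpace.single j 1))) i := by
  rw [nablaRho, h.pd_rho hy, w.omL_single, m.rhoL_apply]
  simp

theorem nablaJ_slot (h : m.IsLieAlgebroid) {φ : Fields d r n} {σ : Sp n} (hy : φ.X σ ∈ m.dom)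
    (i : Fin d) (a b : Fin r) (μ : Fin n) :
    nablaJ m w (φ.X σ) i (slot φ σ a b μ)
      = fderiv ℝ m.JL (φ.X σ) (EuclideanSpace.single i 1) (slot φ σ a b μ)
        - m.JL (φ.X σ) (Matrix.vecCons
            (w.omL (φ.X σ) (Pi.single a 1) (EuclideanSpace.single i 1))
            (Function.update (φ.A σ) μ (Pi.single b 1)))
        - m.JL (φ.X σ) (Matrix.vecCons (Pi.single a 1) (Function.update (φ.A σ) μ
            (w.omL (φ.X σ) (Pi.single b 1) (EuclideanSpace.single i 1))))
        - ∑ ν, if ν = μ then 0 else m.JL (φ.X σ) (Matrix.vecCons (Pi.single a 1)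
            (Function.update (Function.update (φ.A σ) μ (Pi.single b 1)) ν
              (w.omL (φ.X σ) (φ.A σ ν) (EuclideanSpace.single i 1)))) := by
  have e0 : ∀ k, (fun c => ∑ e, slot φ σ a b μ k e * w.om (φ.X σ) e i c)
      = w.omL (φ.X σ) (slot φ σ a b μ k) (EuclideanSpace.single i 1) := fun k =>
    funext fun c => sum_mul_om _ _ _ _
  have hsplit : ∑ ν : Fin n, m.J (φ.X σ) (Matrix.vecCons (Pi.single a 1) (Function.update
      (Function.update (φ.A σ) μ (Pi.single b 1)) ν (w.omL (φ.X σ)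
        (Function.update (φ.A σ) μ (Pi.single b 1) ν) (EuclideanSpace.single i 1))))
      = m.J (φ.X σ) (Matrix.vecCons (Pi.single a 1) (Function.update (φ.A σ) μ
            (w.omL (φ.X σ) (Pi.single b 1) (EuclideanSpace.single i 1))))
        + ∑ ν, if ν = μ then 0 else m.J (φ.X σ) (Matrix.vecCons (Pi.single a 1)
            (Function.update (Function.update (φ.A σ) μ (Pi.single b 1)) ν
              (w.omL (φ.X σ) (φ.A σ ν) (EuclideanSpace.single i 1)))) := by
    set c := m.J (φ.X σ) (Matrix.vecCons (Pi.single a 1)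
      (Function.update (φ.A σ) μ (w.omL (φ.X σ) (Pi.single b 1) (EuclideanSpace.single i 1))))
      with hc
    have hs : c = ∑ ν, if ν = μ then c else 0 := by simp
    conv_rhs => rw [hs]
    rw [← Finset.sum_add_distrib]
    refine Finset.sum_congr rfl fun ν _ => ?_
    by_cases hν : ν = μ
    · subst hν; simp [hc]
    · rw [if_neg hν, if_neg hν, Function.update_of_ne hν, zero_add]
  rw [nablaJ, h.pd_J hy]
  simp only [e0, m.JL_apply]
  rw [Fin.sum_univ_succ]
  have e1 : ∀ x, Function.update (slot φ σ a b μ) 0 x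
      = Matrix.vecCons x (Function.update (φ.A σ) μ (Pi.single b 1)) := fun x =>
    Fin.update_cons_zero _ _ _
  have e2 : ∀ (ν : Fin n) x, Function.update (slot φ σ a b μ) ν.succ x
      = Matrix.vecCons (Pi.single a 1) (Function.update
        (Function.update (φ.A σ) μ (Pi.single b 1)) ν x) := fun ν x => by
    exact (Fin.cons_update _ _ _ _).symm
  simp only [e1, e2]
  change _ - (m.J (φ.X σ) (Matrix.vecCons (w.omL (φ.X σ) (Pi.single a 1) _) _)
    + ∑ ν : Fin n, m.J (φ.X σ) (Matrix.vecCons (Pi.single a 1) (Function.update _ ν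
      (w.omL (φ.X σ) (Function.update (φ.A σ) μ (Pi.single b 1) ν) _)))) = _
  rw [hsplit]
  ring

theorem sum_nablaJ_mul (h : m.IsLieAlgebroid) {φ : Fields d r n} {σ : Sp n} (hy : φ.X σ ∈ m.dom)
    (a b : Fin r) (μ : Fin n) (x : Pt d) :
    ∑ i, nablaJ m w (φ.X σ) i (slot φ σ a b μ) * x i
      = fderiv ℝ m.JL (φ.X σ) x (slot φ σ a b μ)
        - m.JL (φ.X σ) (Matrix.vecCons (w.omL (φ.X σ) (Pi.single a 1) x)
            (Function.update (φ.A σ) μ (Pi.single b 1)))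
        - m.JL (φ.X σ) (Matrix.vecCons (Pi.single a 1) (Function.update (φ.A σ) μ
            (w.omL (φ.X σ) (Pi.single b 1) x)))
        - ∑ ν, if ν = μ then 0 else m.JL (φ.X σ) (Matrix.vecCons (Pi.single a 1)
            (Function.update (Function.update (φ.A σ) μ (Pi.single b 1)) ν
              (w.omL (φ.X σ) (φ.A σ ν) x))) := by
  simp only [nablaJ_slot h hy]
  simp only [JL_swap (m := m) (φ.X σ) (Pi.single b 1) (w.omL (φ.X σ) (Pi.single a 1) _)]
  refine sum_map_single_mul (f := fun x => fderiv ℝ m.JL (φ.X σ) x (slot φ σ a b μ)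
        - -m.JL (φ.X σ) (Matrix.vecCons (Pi.single b 1)
            (Function.update (φ.A σ) μ (w.omL (φ.X σ) (Pi.single a 1) x)))
        - m.JL (φ.X σ) (Matrix.vecCons (Pi.single a 1) (Function.update (φ.A σ) μ
            (w.omL (φ.X σ) (Pi.single b 1) x)))
        - ∑ ν, if ν = μ then 0 else m.JL (φ.X σ) (Matrix.vecCons (Pi.single a 1)
            (Function.update (Function.update (φ.A σ) μ (Pi.single b 1)) ν
              (w.omL (φ.X σ) (φ.A σ ν) x)))) ⟨fun x y => ?_, fun c x => ?_⟩ x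
  · have e : ∀ ν, (if ν = μ then 0 else m.JL (φ.X σ) (Matrix.vecCons (Pi.single a 1)
            (Function.update (Function.update (φ.A σ) μ (Pi.single b 1)) ν
              (w.omL (φ.X σ) (φ.A σ ν) (x + y)))))
        = (if ν = μ then 0 else m.JL (φ.X σ) (Matrix.vecCons (Pi.single a 1)
            (Function.update (Function.update (φ.A σ) μ (Pi.single b 1)) ν
              (w.omL (φ.X σ) (φ.A σ ν) x))))
          + (if ν = μ then 0 else m.JL (φ.X σ) (Matrix.vecCons (Pi.single a 1)
            (Function.update (Function.update (φ.A σ) μ (Pi.single b 1)) ν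
              (w.omL (φ.X σ) (φ.A σ ν) y)))) := fun ν => by
      split_ifs
      · simp
      · rw [map_add, JL_update_add]
    beta_reduce
    rw [Finset.sum_congr rfl fun ν _ => e ν, Finset.sum_add_distrib]
    simp only [map_add, JL_update_add, add_apply]
    ring
  · have e : ∀ ν, (if ν = μ then 0 else m.JL (φ.X σ) (Matrix.vecCons (Pi.single a 1)
            (Function.update (Function.update (φ.A σ) μ (Pi.single b 1)) ν
              (w.omL (φ.X σ) (φ.A σ ν) (c • x)))))
        = c * (if ν = μ then 0 else m.JL (φ.X σ) (Matrix.vecCons (Pi.single a 1)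
            (Function.update (Function.update (φ.A σ) μ (Pi.single b 1)) ν
              (w.omL (φ.X σ) (φ.A σ ν) x)))) := fun ν => by
      split_ifs
      · simp
      · rw [map_smul, JL_update_smul]
    beta_reduce
    rw [Finset.sum_congr rfl fun ν _ => e ν, ← Finset.mul_sum]
    simp only [map_smul, JL_update_smul, smul_apply, smul_eq_mul]
    ring

theorem sum_basicCurv (hw : w.IsConnection m) (h : m.IsLieAlgebroid) {y : Pt d} (hy : y ∈ m.dom)
    (a b c : Fin r) (x : Pt d) :
    ∑ i, basicCurv m w y i a b c * x i = basicL m w y x (Pi.single a 1) (Pi.single b 1) c := by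
  simp only [basicCurv_eq hw h hy]
  exact sum_map_single_mul (f := fun x => basicL m w y x (Pi.single a 1) (Pi.single b 1) c)
    ⟨fun x y => by
      simp only [basicL, curvL, torL, map_add, add_apply, Pi.add_apply, Pi.sub_apply]; ring,
     fun c x => by
      simp only [basicL, curvL, torL, map_smul, smul_apply, Pi.add_apply, Pi.sub_apply,
        Pi.smul_apply, smul_eq_mul]
      ring⟩ x

theorem isLinearMap_basicL (y x : Pt d) (u : Fin r → ℝ) :
    IsLinearMap ℝ (fun v => basicL m w y x u v) where
  map_add v v' := by simp only [basicL, curvL, torL, map_add, map_sub, add_apply, sub_apply]; module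
  map_smul c v := by simp only [basicL, curvL, torL, map_smul, map_sub, smul_apply, sub_apply]; module

theorem sum_sum_basicCurv (hw : w.IsConnection m) (h : m.IsLieAlgebroid) {y : Pt d}
    (hy : y ∈ m.dom) (a b : Fin r) (v : Fin r → ℝ) (x : Pt d) :
    ∑ i, ∑ c, basicCurv m w y i b c a * (v c * x i) = basicL m w y x (Pi.single b 1) v a := by
  rw [Finset.sum_comm]
  have := congrFun (map_sum (isLinearMap_basicL (m := m) (w := w) y x (Pi.single b 1)).mk'
    (fun c => v c • (Pi.single c 1 : Fin r → ℝ)) Finset.univ) a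
  rw [← pi_eq_sum v] at this
  simp only [map_smul, IsLinearMap.mk'_apply, Finset.sum_apply, Pi.smul_apply, smul_eq_mul] at this
  rw [this]
  refine Finset.sum_congr rfl fun c _ => ?_
  rw [← sum_basicCurv hw h hy, Finset.mul_sum]
  exact Finset.sum_congr rfl fun i _ => by ring

theorem sum_sum_curv (hw : w.IsConnection m) (h : m.IsLieAlgebroid) {y : Pt d}
    (hy : y ∈ m.dom) (a b : Fin r) (x x' : Pt d) :
    ∑ i, ∑ j, curv w y i j b a * x i * x' j = curvL w y x x' (Pi.single b 1) a := by
  simp only [curv_eq hw h hy]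
  have e1 : ∀ i, ∑ j, curvL w y (EuclideanSpace.single i 1) (EuclideanSpace.single j 1)
      (Pi.single b 1) a * x i * x' j
      = curvL w y (EuclideanSpace.single i 1) x' (Pi.single b 1) a * x i := by
    intro i
    rw [← sum_map_single_mul (f := fun x' => curvL w y (EuclideanSpace.single i 1) x'
      (Pi.single b 1) a)
      ⟨fun x y => by simp only [curvL, map_add, add_apply, Pi.add_apply, Pi.sub_apply]; ring,
        fun c x => by
          simp only [curvL, map_smul, smul_apply, Pi.add_apply, Pi.sub_apply, Pi.smul_apply,
            smul_eq_mul]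
          ring⟩ x', Finset.sum_mul]
    exact Finset.sum_congr rfl fun j _ => by ring
  simp only [e1]
  exact sum_map_single_mul (f := fun x => curvL w y x x' (Pi.single b 1) a)
    ⟨fun x y => by simp only [curvL, map_add, add_apply, Pi.add_apply, Pi.sub_apply]; ring,
      fun c x => by
        simp only [curvL, map_smul, smul_apply, Pi.add_apply, Pi.sub_apply, Pi.smul_apply,
          smul_eq_mul]
        ring⟩ x

/-- `G_A^∇` involves `X` and `A` only. -/
theorem omits_densAcov (h : m.IsLieAlgebroid) (hw : w.IsConnection m) (μ ν : Fin n) (a : Fin r)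
    (v : Val d r n) (hX : v.1 = 0) (hA : v.2.1 = 0) (k : Jet d r n) (hk : k ∈ jetDom m) :
    fderiv ℝ (densAcov m w μ ν a) k (v, 0) = 0 ∧
      ∀ κ, fderiv ℝ (densAcov m w μ ν a) k (0, Pi.single κ v) = 0 := by
  simp only [(var_densAcov h hw μ ν a hk).fderiv_apply]
  refine ⟨by simp [hX, hA], fun κ => ?_⟩
  have hs : ∀ ν, (Pi.single κ v : Fin n → Val d r n) ν = if ν = κ then v else 0 := fun ν => by
    rw [Pi.single_apply]
  have hs1 : ∀ ν, ((Pi.single κ v : Fin n → Val d r n) ν).1 = 0 := fun ν => by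
    rw [hs]; split_ifs <;> simp [hX]
  have hs2 : ∀ ν, ((Pi.single κ v : Fin n → Val d r n) ν).2.1 = 0 := fun ν => by
    rw [hs]; split_ifs <;> simp [hA]
  simp [hs1, hs2]

/-- The constraint algebra in terms of a connection. -/
theorem covariantAlgebra (h : m.IsLieAlgebroid) (hw : w.IsConnection m)
    (hd : ∀ y ∈ m.dom, ∀ a b A, defect m y (Pi.single a 1) (Pi.single b 1) A = 0)
    {φ : Fields d r n} (hφ : IsField m φ) : CovariantAlgebra m w φ where
  A_eq σ μ ν a := by
    rw [GAcov_eq hw (hφ.2 σ)]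
    simp only [Pi.add_apply, Pi.sub_apply, w.omL_apply, Finset.sum_apply, Pi.smul_apply,
      smul_eq_mul, mul_sub, Finset.sum_sub_distrib]
    rw [sub_add]
    congr 2 <;>
    exact Finset.sum_congr rfl fun b _ => Finset.sum_congr rfl fun i _ => by ring
  Y_eq σ a := by
    rw [GYcov_eq hw (hφ.2 σ)]
    simp only [sum_om_dotProduct]
  XX μ ν i j := (densityBracket_XX h hφ μ ν i j).localBracket h.isOpen hφ (isDensity_densX h μ i)
    (isDensity_densX h ν j) (represents_densX m μ i) (represents_densX m ν j)
  XA μ κ ν i a := (densityBracket_eq_zero_of_omits_Y hφ (omits_densX_Y h μ i)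
    (omits_densX_Z h μ i) (fun p => omits_densAcov h hw κ ν a _ rfl rfl)
    (fun p => omits_densAcov h hw κ ν a _ rfl rfl)).localBracket h.isOpen hφ
    (isDensity_densX h μ i) (isDensity_densAcov h hw κ ν a) (represents_densX m μ i)
    (represents_densAcov hw κ ν a)
  XY μ i b := ((densityBracket_XYcov h hw hφ μ i b).congr fun σ => by
    simp only [nablaRho_eq h (hφ.2 σ)]
    rw [sum_map_single_mul (f := fun x => (fderiv ℝ m.rhoL (φ.X σ) x (Pi.single b 1)
      - m.rhoL (φ.X σ) (w.omL (φ.X σ) (Pi.single b 1) x)) i)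
      ⟨fun x y => by
        simp only [map_add, add_apply, PiLp.add_apply, PiLp.sub_apply]; ring,
       fun c x => by
        simp only [map_smul, smul_apply, PiLp.smul_apply, PiLp.sub_apply, smul_eq_mul]
        ring⟩]).localBracket h.isOpen hφ
    (isDensity_densX h μ i) (isDensity_densYcov h hw b) (represents_densX m μ i)
    (represents_densYcov hw b)
  AA μ ν κ τ a b := (densityBracket_eq_zero_of_omits_Y hφ
    (fun p => omits_densAcov h hw μ ν a _ rfl rfl) (fun p => omits_densAcov h hw μ ν a _ rfl rfl)
    (fun p => omits_densAcov h hw κ τ b _ rfl rfl)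
    (fun p => omits_densAcov h hw κ τ b _ rfl rfl)).localBracket h.isOpen hφ
    (isDensity_densAcov h hw μ ν a) (isDensity_densAcov h hw κ τ b) (represents_densAcov hw μ ν a)
    (represents_densAcov hw κ τ b)
  AY μ ν a b := ((densityBracket_AYcov h hw hφ μ ν a b).congr fun σ => by
    have hy := hφ.2 σ
    have e1 : ∀ c, -w.T (φ.X σ) b c a + ∑ i, m.rho (φ.X σ) b i * w.om (φ.X σ) c i a
        = (m.CL (φ.X σ) (Pi.single b 1) (Pi.single c 1)
          + w.omL (φ.X σ) (Pi.single b 1) (m.rhoL (φ.X σ) (Pi.single c 1))) a := by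
      intro c
      have e2 : ∑ i, m.rho (φ.X σ) b i * w.om (φ.X σ) c i a
          = w.omL (φ.X σ) (Pi.single c 1) (m.rho (φ.X σ) b) a := by
        rw [omL_single_left, Finset.sum_apply]; rfl
      rw [e2, hw.torsion _ hy, LocalTarget.CL_single, LocalTarget.rhoL_single]
      simp only [Pi.add_apply, Pi.sub_apply]
      ring
    simp only [e1, mul_sub, Finset.sum_sub_distrib, sum_sum_basicCurv hw h hy,
      sum_sum_curv hw h hy]
    have e2 := sum_mul_bilin (m.CL (φ.X σ) (Pi.single b 1)
      + (w.omL (φ.X σ) (Pi.single b 1)).comp (m.rhoL (φ.X σ))) (GAcov w φ σ μ ν) a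
    simp only [add_apply, ContinuousLinearMap.comp_apply] at e2
    rw [e2]
    simp only [Pi.add_apply, Pi.sub_apply]
    ring).localBracket h.isOpen hφ
    (isDensity_densAcov h hw μ ν a) (isDensity_densYcov h hw b) (represents_densAcov hw μ ν a)
    (represents_densYcov hw b)
  YY a b := ((densityBracket_YYcov h hw hφ hd a b).congr fun σ => by
    have hy := hφ.2 σ
    have e1 : ∀ c, -w.T (φ.X σ) a b c + ∑ i, (m.rho (φ.X σ) a i * w.om (φ.X σ) b i c
        - m.rho (φ.X σ) b i * w.om (φ.X σ) a i c)
        = m.CL (φ.X σ) (Pi.single a 1) (Pi.single b 1) c := by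
      intro c
      have e2 : ∀ a b, ∑ i, m.rho (φ.X σ) b i * w.om (φ.X σ) a i c
          = w.omL (φ.X σ) (Pi.single a 1) (m.rho (φ.X σ) b) c := fun a b => by
        rw [omL_single_left, Finset.sum_apply]; rfl
      rw [Finset.sum_sub_distrib, e2, e2, hw.torsion _ hy, LocalTarget.CL_single]
      simp only [Pi.sub_apply]
      ring
    have e3 : ∀ μ, ∑ i, (∑ c, basicCurv m w (φ.X σ) i a b c * φ.Y σ μ c) * GX m φ σ μ i
        = φ.Y σ μ ⬝ᵥ basicL m w (φ.X σ) (GX m φ σ μ) (Pi.single a 1) (Pi.single b 1) := by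
      intro μ
      simp only [Finset.sum_mul]
      rw [Finset.sum_comm]
      refine Finset.sum_congr rfl fun c _ => ?_
      rw [← sum_basicCurv hw h hy, Finset.mul_sum]
      exact Finset.sum_congr rfl fun i _ => by ring
    simp only [e1, add_mul, neg_mul, Finset.sum_add_distrib, Finset.sum_neg_distrib, e3,
      sum_nablaJ_mul h hy]).localBracket h.isOpen hφ
    (isDensity_densYcov h hw a) (isDensity_densYcov h hw b) (represents_densYcov hw a)
    (represents_densYcov hw b)

end Covariant

/-! ### Closure of the local algebra and the anomaly -/

section Closed

variable {d r n : ℕ} {m : LocalTarget d r n}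

/-- `B` is a combination of the constraints with coefficients in the smooth functions on `Tⁿ`. -/
def InIdeal (m : LocalTarget d r n) (φ : Fields d r n) (B : Sp n → ℝ) : Prop :=
  ∃ c : Label d r n → Sp n → ℝ, (∀ N, IsTorusFun (c N)) ∧
    ∀ σ, B σ = ∑ N, c N σ * constraint m N φ σ

variable {φ : Fields d r n}

theorem InIdeal.constraint (N : Label d r n) : InIdeal m φ (constraint m N φ) := by
  classical
  refine ⟨fun K _ => if K = N then 1 else 0, fun K => isTorusFun_const _, fun σ => ?_⟩
  simp

theorem InIdeal.zero : InIdeal m φ (fun _ => 0) :=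
  ⟨fun _ _ => 0, fun _ => isTorusFun_const _, fun σ => by simp⟩

theorem InIdeal.add {B B' : Sp n → ℝ} (h : InIdeal m φ B) (h' : InIdeal m φ B') :
    InIdeal m φ (fun σ => B σ + B' σ) := by
  obtain ⟨c, hc, e⟩ := h
  obtain ⟨c', hc', e'⟩ := h'
  exact ⟨fun N σ => c N σ + c' N σ, fun N => (hc N).add (hc' N), fun σ => by
    simp only [e, e', add_mul, Finset.sum_add_distrib]⟩

theorem InIdeal.mul {f B : Sp n → ℝ} (hf : IsTorusFun f) (h : InIdeal m φ B) :
    InIdeal m φ (fun σ => f σ * B σ) := by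
  obtain ⟨c, hc, e⟩ := h
  exact ⟨fun N σ => f σ * c N σ, fun N => hf.mul (hc N), fun σ => by
    simp only [e, Finset.mul_sum, mul_assoc]⟩

theorem InIdeal.neg {B : Sp n → ℝ} (h : InIdeal m φ B) : InIdeal m φ (fun σ => -B σ) := by
  simpa using InIdeal.mul (isTorusFun_const (-1)) h

theorem InIdeal.sub {B B' : Sp n → ℝ} (h : InIdeal m φ B) (h' : InIdeal m φ B') :
    InIdeal m φ (fun σ => B σ - B' σ) := by
  simpa only [sub_eq_add_neg] using h.add h'.neg

theorem InIdeal.sum {ι : Type*} {s : Finset ι} {B : ι → Sp n → ℝ}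
    (h : ∀ i ∈ s, InIdeal m φ (B i)) : InIdeal m φ (fun σ => ∑ i ∈ s, B i σ) := by
  classical
  induction s using Finset.induction_on with
  | empty => simpa using InIdeal.zero
  | insert a s ha ih =>
    simp only [Finset.sum_insert ha]
    exact (h a (Finset.mem_insert_self a s)).add
      (ih fun i hi => h i (Finset.mem_insert_of_mem hi))

theorem InIdeal.map_GX {f : Sp n → Pt d → ℝ} (hf : ∀ σ, IsLinearMap ℝ (f σ))
    (ht : ∀ x, IsTorusFun fun σ => f σ x) (μ : Fin n) :
    InIdeal m φ (fun σ => f σ (GX m φ σ μ)) := by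
  have e : (fun σ => f σ (GX m φ σ μ)) = fun σ => ∑ i, f σ (EuclideanSpace.single i 1)
      * LASM.constraint m (.inl (μ, i)) φ σ :=
    funext fun σ => (sum_map_single_mul (hf σ) _).symm
  rw [e]
  exact InIdeal.sum fun i _ => (InIdeal.constraint _).mul (ht _)

theorem InIdeal.map_GA {f : Sp n → (Fin r → ℝ) → ℝ} (hf : ∀ σ, IsLinearMap ℝ (f σ))
    (ht : ∀ x, IsTorusFun fun σ => f σ x) (μ ν : Fin n) :
    InIdeal m φ (fun σ => f σ (GA m φ σ μ ν)) := by
  have e : (fun σ => f σ (GA m φ σ μ ν)) = fun σ => ∑ a, f σ (Pi.single a 1)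
      * LASM.constraint m (.inr (.inl (μ, ν, a))) φ σ := by
    funext σ
    have := congrArg (hf σ).mk' (pi_eq_sum (GA m φ σ μ ν))
    rw [map_sum] at this
    refine Eq.trans this (Finset.sum_congr rfl fun a _ => ?_)
    rw [map_smul, smul_eq_mul, mul_comm]
    rfl
  rw [e]
  exact InIdeal.sum fun i _ => (InIdeal.constraint _).mul (ht _)

theorem IsTorusFun.multilinear_apply {k : ℕ}
    {L : Sp n → ContinuousMultilinearMap ℝ (fun _ : Fin k => Fin r → ℝ) ℝ}
    {F : Sp n → Fin k → Fin r → ℝ} (hL : IsTorusFun L) (hF : IsTorusFun F) :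
    IsTorusFun fun σ => L σ (F σ) :=
  (hL.prodMk hF).comp isOpen_univ contDiff_multilinear_apply.contDiffOn fun _ => trivial

theorem IsTorusFun.vecCons {k : ℕ} {V : Type*} [NormedAddCommGroup V] [NormedSpace ℝ V]
    {F : Sp n → Fin k → V} {v : Sp n → V} (hv : IsTorusFun v) (hF : IsTorusFun F) :
    IsTorusFun fun σ => (Matrix.vecCons (v σ) (F σ) : Fin (k + 1) → V) := by
  refine isTorusFun_pi.2 fun i => ?_
  refine Fin.cases ?_ (fun i => ?_) i
  · exact hv
  · exact isTorusFun_pi.1 hF i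

theorem IsTorusFun.update {k : ℕ} {V : Type*} [NormedAddCommGroup V] [NormedSpace ℝ V]
    {F : Sp n → Fin k → V} (hF : IsTorusFun F) (μ : Fin k) (v : V) :
    IsTorusFun fun σ => Function.update (F σ) μ v := by
  refine isTorusFun_pi.2 fun i => ?_
  by_cases hi : i = μ
  · subst hi; simpa using isTorusFun_const v
  · simpa [Function.update_of_ne hi] using isTorusFun_pi.1 hF i

/-- The part of `{G_Y, G_Y}` besides the anomaly is a combination of the constraints. -/
theorem inIdeal_YY (h : m.IsLieAlgebroid) (hφ : IsField m φ) (a b : Fin r) :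
    InIdeal m φ (fun σ => (∑ c, m.CL (φ.X σ) (Pi.single a 1) (Pi.single b 1) c * GY m φ σ c)
        + (∑ μ, (φ.Y σ μ ⬝ᵥ fderiv ℝ m.CL (φ.X σ) (GX m φ σ μ) (Pi.single a 1) (Pi.single b 1)
          + fderiv ℝ m.JL (φ.X σ) (GX m φ σ μ) (slot φ σ a b μ)))
        + JTerm m φ σ a b (GA m φ σ) + HTerm m φ σ a b) := by
  have tC : IsTorusFun fun σ => m.CL (φ.X σ) := hφ.1.1.comp h.isOpen h.contDiffOn_CL hφ.2
  have tJ : IsTorusFun fun σ => m.JL (φ.X σ) := hφ.1.1.comp h.isOpen h.contDiffOn_JL hφ.2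
  have tr : IsTorusFun fun σ => m.rhoL (φ.X σ) := hφ.1.1.comp h.isOpen h.contDiffOn_rhoL hφ.2
  have tH : IsTorusFun fun σ => m.H (φ.X σ) := hφ.1.1.comp h.isOpen h.H_smooth hφ.2
  have tdC : IsTorusFun fun σ => fderiv ℝ m.CL (φ.X σ) := hφ.1.1.comp h.isOpen
    (h.contDiffOn_CL.fderiv_of_isOpen h.isOpen (m := ∞) (by simp)) hφ.2
  have tdJ : IsTorusFun fun σ => fderiv ℝ m.JL (φ.X σ) := hφ.1.1.comp h.isOpen
    (h.contDiffOn_JL.fderiv_of_isOpen h.isOpen (m := ∞) (by simp)) hφ.2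
  have tslot : ∀ μ, IsTorusFun fun σ => slot φ σ a b μ := fun μ =>
    (isTorusFun_const _).vecCons (hφ.1.2.1.update μ _)
  have tY : ∀ μ c, IsTorusFun fun σ => φ.Y σ μ c := fun μ c =>
    isTorusFun_pi.1 (isTorusFun_pi.1 hφ.1.2.2.1 μ) c
  refine InIdeal.add (InIdeal.add (InIdeal.add (InIdeal.sum fun c _ => ?_)
    (InIdeal.sum fun μ _ => InIdeal.add ?_ ?_)) ?_) ?_
  · exact (InIdeal.constraint (.inr (.inr c))).mul (isTorusFun_pi.1 ((tC.clm_apply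
      (isTorusFun_const _)).clm_apply (isTorusFun_const _)) c)
  · refine InIdeal.map_GX (f := fun σ x => φ.Y σ μ ⬝ᵥ fderiv ℝ m.CL (φ.X σ) x (Pi.single a 1)
      (Pi.single b 1)) (fun σ => ⟨fun x y => ?_, fun c x => ?_⟩) (fun x => ?_) μ
    · simp only [map_add, add_apply, dotProduct_add]
    · simp only [map_smul, smul_apply, dotProduct_smul]
    · exact IsTorusFun.sum fun c _ => (tY μ c).mul (isTorusFun_pi.1 (((tdC.clm_apply
        (isTorusFun_const x)).clm_apply (isTorusFun_const _)).clm_apply (isTorusFun_const _)) c)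
  · refine InIdeal.map_GX (f := fun σ x => fderiv ℝ m.JL (φ.X σ) x (slot φ σ a b μ))
      (fun σ => ⟨fun x y => ?_, fun c x => ?_⟩) (fun x => ?_) μ
    · simp only [map_add, add_apply]
    · simp only [map_smul, smul_apply]
    · exact (tdJ.clm_apply (isTorusFun_const x)).multilinear_apply (tslot μ)
  · refine InIdeal.sum fun μ _ => InIdeal.sum fun ν _ => ?_
    simp only [← m.JL_apply]
    refine InIdeal.map_GA (f := fun σ v => m.JL (φ.X σ) (Matrix.vecCons (Pi.single a 1)
      (Function.update (Function.update (φ.A σ) μ (Pi.single b 1)) ν v)))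
      (fun σ => ⟨fun x y => ?_, fun c x => ?_⟩) (fun x => ?_) μ ν
    · exact JL_update_add _ _ _ _ _ _
    · exact JL_update_smul _ _ _ _ _ _
    · exact tJ.multilinear_apply ((isTorusFun_const _).vecCons ((hφ.1.2.1.update μ _).update ν x))
  · simp only [HTerm, ← m.rhoL_apply]
    refine InIdeal.sum fun μ _ => ?_
    have e : ∀ σ x, (fun ν => if ν < μ then dd ν φ.X σ else if ν = μ then x
        else m.rhoL (φ.X σ) (φ.A σ ν))
        = Function.update (fun ν => if ν < μ then dd ν φ.X σ else m.rhoL (φ.X σ) (φ.A σ ν)) μ x := by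
      intro σ x; funext ν
      by_cases hν : ν = μ
      · subst hν; simp
      · simp [hν]
    have e' : ∀ σ x, (Matrix.vecCons (m.rho (φ.X σ) a) (Matrix.vecCons (m.rho (φ.X σ) b)
        fun ν => if ν < μ then dd ν φ.X σ else if ν = μ then x else m.rhoL (φ.X σ) (φ.A σ ν)))
        = Function.update (Matrix.vecCons (m.rho (φ.X σ) a) (Matrix.vecCons (m.rho (φ.X σ) b)
          fun ν => if ν < μ then dd ν φ.X σ else m.rhoL (φ.X σ) (φ.A σ ν))) μ.succ.succ x := by
      intro σ x
      rw [e]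
      simp only [Matrix.vecCons, Fin.cons_update]
    refine InIdeal.map_GX (f := fun σ x => m.H (φ.X σ) (Matrix.vecCons (m.rho (φ.X σ) a)
      (Matrix.vecCons (m.rho (φ.X σ) b) fun ν => if ν < μ then dd ν φ.X σ else if ν = μ then x
        else m.rhoL (φ.X σ) (φ.A σ ν))))
      (fun σ => ⟨fun x y => ?_, fun c x => ?_⟩) (fun x => ?_) μ
    · simp only [e', (m.H (φ.X σ)).map_update_add]
    · simp only [e', (m.H (φ.X σ)).map_update_smul]
    · simp only [e']
      simp only [← m.rhoL_single]
      refine (tH.prodMk (IsTorusFun.update ((tr.clm_apply (isTorusFun_const _)).vecCons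
        ((tr.clm_apply (isTorusFun_const _)).vecCons (isTorusFun_pi.2 fun ν => ?_))) _ x)).comp
        isOpen_univ contDiff_alternating_apply.contDiffOn fun _ => trivial
      split_ifs
      · exact hφ.1.1.dd ν
      · exact tr.clm_apply (isTorusFun_pi.1 hφ.1.2.1 ν)

/-- The density of a constraint. -/
def dens (m : LocalTarget d r n) : Label d r n → Jet d r n → ℝ
  | .inl (μ, i) => densX m μ i
  | .inr (.inl (μ, ν, a)) => densA m μ ν a
  | .inr (.inr a) => densY m a

theorem isDensity_dens (h : m.IsLieAlgebroid) : ∀ K, IsDensity m (dens m K)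
  | .inl (μ, i) => isDensity_densX h μ i
  | .inr (.inl (μ, ν, a)) => isDensity_densA h μ ν a
  | .inr (.inr a) => isDensity_densY h a

theorem represents_dens : ∀ K, Represents m (dens m K) (constraint m K)
  | .inl (μ, i) => represents_densX m μ i
  | .inr (.inl (μ, ν, a)) => represents_densA m μ ν a
  | .inr (.inr a) => represents_densY m a

/-- Where the anomaly vanishes, all brackets of constraints are combinations of constraints. -/
theorem exists_bracket (h : m.IsLieAlgebroid)
    (hd : ∀ y ∈ m.dom, ∀ a b A, defect m y (Pi.single a 1) (Pi.single b 1) A = 0)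
    (hφ : IsField m φ) : ∀ K L : Label d r n,
      ∃ B, DensityBracket m φ (dens m K) (dens m L) B ∧ InIdeal m φ B := by
  have tdr : IsTorusFun fun σ => fderiv ℝ m.rhoL (φ.X σ) := hφ.1.1.comp h.isOpen
    (h.contDiffOn_rhoL.fderiv_of_isOpen h.isOpen (m := ∞) (by simp)) hφ.2
  have tC : IsTorusFun fun σ => m.CL (φ.X σ) := hφ.1.1.comp h.isOpen h.contDiffOn_CL hφ.2
  have tdC : IsTorusFun fun σ => fderiv ℝ m.CL (φ.X σ) := hφ.1.1.comp h.isOpen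
    (h.contDiffOn_CL.fderiv_of_isOpen h.isOpen (m := ∞) (by simp)) hφ.2
  have tA : ∀ μ, IsTorusFun fun σ => φ.A σ μ := fun μ => isTorusFun_pi.1 hφ.1.2.1 μ
  have iXY : ∀ μ i b, InIdeal m φ
      (fun σ => -(fderiv ℝ m.rhoL (φ.X σ) (GX m φ σ μ) (Pi.single b 1)) i) := fun μ i b => by
    refine InIdeal.neg (InIdeal.map_GX (f := fun σ x => fderiv ℝ m.rhoL (φ.X σ) x
      (Pi.single b 1) i) (fun σ => ⟨fun x y => ?_, fun c x => ?_⟩) (fun x => ?_) μ)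
    · simp only [map_add, add_apply, PiLp.add_apply]
    · simp only [map_smul, smul_apply, PiLp.smul_apply]
    · exact isTorusFun_euclidean.1 ((tdr.clm_apply (isTorusFun_const x)).clm_apply
        (isTorusFun_const _)) i
  have iA : ∀ μ ν a b, InIdeal m φ (fun σ => fderiv ℝ m.CL (φ.X σ) (GX m φ σ μ) (Pi.single b 1)
      (φ.A σ ν) a) := fun μ ν a b => by
    refine InIdeal.map_GX (f := fun σ x => fderiv ℝ m.CL (φ.X σ) x (Pi.single b 1)
      (φ.A σ ν) a) (fun σ => ⟨fun x y => ?_, fun c x => ?_⟩) (fun x => ?_) μ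
    · simp only [map_add, add_apply, Pi.add_apply]
    · simp only [map_smul, smul_apply, Pi.smul_apply]
    · exact isTorusFun_pi.1 (((tdC.clm_apply (isTorusFun_const x)).clm_apply
        (isTorusFun_const _)).clm_apply (tA ν)) a
  have iAY : ∀ μ ν a b, InIdeal m φ (fun σ => (m.CL (φ.X σ) (Pi.single b 1) (GA m φ σ μ ν)
        + fderiv ℝ m.CL (φ.X σ) (GX m φ σ μ) (Pi.single b 1) (φ.A σ ν)
        - fderiv ℝ m.CL (φ.X σ) (GX m φ σ ν) (Pi.single b 1) (φ.A σ μ)) a) := fun μ ν a b => by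
    refine InIdeal.sub (InIdeal.add (InIdeal.map_GA (f := fun σ v => m.CL (φ.X σ) (Pi.single b 1) v a)
      (fun σ => ⟨fun x y => ?_, fun c x => ?_⟩) (fun x => ?_) μ ν) (iA μ ν a b)) (iA ν μ a b)
    · simp only [map_add, Pi.add_apply]
    · simp only [map_smul, Pi.smul_apply]
    · exact isTorusFun_pi.1 ((tC.clm_apply (isTorusFun_const _)).clm_apply (isTorusFun_const x)) a
  have iYY := fun a b => inIdeal_YY h hφ a b
  rintro (⟨μ, i⟩ | ⟨μ, ν, a⟩ | a) (⟨κ, j⟩ | ⟨κ, τ, b⟩ | b)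
  · exact ⟨_, densityBracket_XX h hφ μ κ i j, InIdeal.zero⟩
  · exact ⟨_, densityBracket_XA h hφ μ κ τ i b, InIdeal.zero⟩
  · exact ⟨_, densityBracket_XY h hφ μ i b, iXY μ i b⟩
  · exact ⟨_, (densityBracket_XA h hφ κ μ ν j a).symm, InIdeal.zero.neg⟩
  · exact ⟨_, densityBracket_AA h hφ μ ν κ τ a b, InIdeal.zero⟩
  · exact ⟨_, densityBracket_AY h hφ μ ν a b, iAY μ ν a b⟩
  · exact ⟨_, (densityBracket_XY h hφ κ j a).symm, (iXY κ j a).neg⟩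
  · exact ⟨_, (densityBracket_AY h hφ κ τ b a).symm, (iAY κ τ b a).neg⟩
  · exact ⟨_, (densityBracket_YY h hφ a b).congr fun σ => by rw [hd _ (hφ.2 σ), add_zero],
      iYY a b⟩

theorem closedAlgebra_of_defect (h : m.IsLieAlgebroid)
    (hd : ∀ y ∈ m.dom, ∀ a b A, defect m y (Pi.single a 1) (Pi.single b 1) A = 0) :
    ClosedAlgebra m := by
  intro K L
  have key : ∀ φ : Fields d r n, ∃ c : Label d r n → Sp n → ℝ, IsField m φ →
      (∀ N, IsTorusFun (c N)) ∧ LocalBracket m (constraint m K) (constraint m L) φ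
        (fun σ => ∑ N, c N σ * constraint m N φ σ) := by
    intro φ
    by_cases hφ : IsField m φ
    · obtain ⟨B, hB, c, hc, e⟩ := exists_bracket h hd hφ K L
      exact ⟨c, fun _ => ⟨hc, (hB.congr e).localBracket h.isOpen hφ (isDensity_dens h K)
        (isDensity_dens h L) (represents_dens K) (represents_dens L)⟩⟩
    · exact ⟨fun _ _ => 0, fun h => absurd h hφ⟩
  choose c hc using key
  exact ⟨c, hc⟩

/-- The bracket of two densities at an interior point of the fundamental domain is unique. -/
theorem DensityBracket.eq_of_localBracket (h : m.IsLieAlgebroid) (hφ : IsField m φ)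
    {F₁ F₂ : Jet d r n → ℝ} {B B' : Sp n → ℝ} (hB : DensityBracket m φ F₁ F₂ B)
    (h₁ : IsDensity m F₁) (h₂ : IsDensity m F₂) {D₁ D₂ : Fields d r n → Sp n → ℝ}
    (hD₁ : Represents m F₁ D₁) (hD₂ : Represents m F₂ D₂) (hB' : IsTorusFun B')
    (hL : LocalBracket m D₁ D₂ φ B') {σ : Sp n} (hσ : ∀ μ, σ μ ∈ Set.Ioo (0 : ℝ) 1) :
    B σ = B' σ := by
  have hs := hB.smooth.sub hB'
  have h1 := isTorusFun_const (n := n) (1 : ℝ)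
  -- smearing with `B - B'` shows that `(B - B')²` has integral zero
  have e := (hL _ _ hs h1).eq_of_hasGradient h.isOpen h.H_smooth hφ
    (hasGradient_smear h.isOpen h₁ hD₁ hφ hs) (hasGradient_smear h.isOpen h₂ hD₂ hφ h1)
  rw [hB.eq _ _ hs h1] at e
  refine sub_eq_zero.1 (eq_zero_of_torusInt_sq hs ?_ hσ)
  have e2 := torusInt_add ((hs.mul h1).mul hB.smooth) ((hs.mul h1).mul hB').neg
  rw [torusInt_neg, e, add_neg_cancel] at e2
  rw [← e2]
  exact torusInt_congr fun σ => by ring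

/-! ### A field on which the constraints vanish at a point -/

/-- A periodic function of size at most `1 / N` with a zero of slope one in the middle of the
period. -/
def wave (N : ℕ) (t : ℝ) : ℝ := Real.sin (2 * Real.pi * N * (t - 1 / 2)) / (2 * Real.pi * N)

/-- The vector valued function `∑_ν wave(σ^ν) v_ν`. -/
def waves {V : Type*} [AddCommGroup V] [Module ℝ V] (N : ℕ) (v : Fin n → V) (σ : Sp n) : V :=
  ∑ ν, wave N (σ ν) • v ν

theorem hasDerivAt_wave {N : ℕ} (hN : N ≠ 0) : HasDerivAt (wave N) 1 (1 / 2) := by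
  have hN' : (2 * Real.pi * N : ℝ) ≠ 0 := by positivity
  have h1 : HasDerivAt (fun t : ℝ => 2 * Real.pi * N * (t - 1 / 2)) (2 * Real.pi * N) (1 / 2) :=
    (((hasDerivAt_id' (1 / 2 : ℝ)).sub_const (1 / 2)).const_mul _).congr_deriv (mul_one _)
  have h2 := (h1.sin).div_const (2 * Real.pi * N)
  have h3 : HasDerivAt (wave N) _ (1 / 2) := h2
  exact h3.congr_deriv (by simp [hN'])

theorem wave_half (N : ℕ) : wave N (1 / 2) = 0 := by simp [wave]

theorem contDiff_wave (N : ℕ) : ContDiff ℝ ∞ (wave N) := by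
  unfold wave
  fun_prop

theorem wave_periodic (N : ℕ) (t : ℝ) (k : ℤ) : wave N (t + k) = wave N t := by
  unfold wave
  have : 2 * Real.pi * N * (t + k - 1 / 2)
      = 2 * Real.pi * N * (t - 1 / 2) + ((N * k : ℤ) : ℝ) * (2 * Real.pi) := by
    push_cast; ring
  rw [this, Real.sin_add_int_mul_two_pi]

theorem abs_wave_le (N : ℕ) (t : ℝ) : |wave N t| ≤ 1 / N := by
  rcases Nat.eq_zero_or_pos N with rfl | hN
  · simp [wave]
  have hN' : (0 : ℝ) < N := by exact_mod_cast hN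
  have hp : (1 : ℝ) ≤ 2 * Real.pi := by have := Real.pi_gt_three; linarith
  rw [wave, abs_div, abs_of_pos (by positivity : (0 : ℝ) < 2 * Real.pi * N)]
  refine div_le_div₀ zero_le_one (Real.abs_sin_le_one _) hN' ?_
  nlinarith

variable {V : Type*} [NormedAddCommGroup V] [NormedSpace ℝ V]

theorem isTorusFun_waves (N : ℕ) (v : Fin n → V) : IsTorusFun (waves N v) :=
  IsTorusFun.sum fun ν _ => IsTorusFun.smul
    ⟨(contDiff_wave N).comp (contDiff_apply ℝ ℝ ν), fun _ _ => wave_periodic N _ _⟩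
    (isTorusFun_const _)

theorem waves_half (N : ℕ) (v : Fin n → V) : waves N v (fun _ => 1 / 2) = 0 := by
  simp only [waves, wave_half, zero_smul, Finset.sum_const_zero]

theorem norm_waves_le (N : ℕ) (v : Fin n → V) (σ : Sp n) :
    ‖waves N v σ‖ ≤ (1 / N) * ∑ ν, ‖v ν‖ := by
  rw [Finset.mul_sum]
  refine (norm_sum_le _ _).trans (Finset.sum_le_sum fun ν _ => ?_)
  rw [norm_smul, Real.norm_eq_abs]
  exact mul_le_mul_of_nonneg_right (abs_wave_le N _) (norm_nonneg _)

theorem dd_const_add_waves {N : ℕ} (hN : N ≠ 0) (x : V) (v : Fin n → V) (μ : Fin n) :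
    dd μ (fun σ => x + waves N v σ) (fun _ => 1 / 2) = v μ := by
  have hw : ∀ ν, HasFDerivAt (fun σ : Sp n => wave N (σ ν))
      ((1 : ℝ) • ContinuousLinearMap.proj (R := ℝ) (φ := fun _ : Fin n => ℝ) ν)
      (fun _ => 1 / 2) := fun ν =>
    HasDerivAt.comp_hasFDerivAt (h₂ := wave N) (fun _ : Fin n => (1 / 2 : ℝ)) (hasDerivAt_wave hN)
      (ContinuousLinearMap.proj (R := ℝ) (φ := fun _ : Fin n => ℝ) ν).hasFDerivAt
  have h := (HasFDerivAt.fun_sum (u := Finset.univ) fun ν _ => (hw ν).smul_const (v ν)).const_add x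
  have h' : HasFDerivAt (fun σ => x + waves N v σ) _ (fun _ : Fin n => (1 / 2 : ℝ)) := h
  rw [dd, h'.fderiv, sum_apply, Finset.sum_eq_single μ (fun ν _ hν => by simp [hν]) (by simp)]
  simp

/-- If the algebra is closed the anomaly vanishes: for given `y` and `A` there is a field through them
on which all the constraints vanish at one point, and there the bracket of `G_{Ya}` and `G_{Yb}` is
the anomaly. -/
theorem defect_eq_zero_of_closedAlgebra (hn : 1 ≤ n) (h : m.IsLieAlgebroid)
    (hc : ClosedAlgebra m) (y : Pt d) (hy : y ∈ m.dom) (a b : Fin r) (A : Fin n → Fin r → ℝ) :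
    defect m y (Pi.single a 1) (Pi.single b 1) A = 0 := by
  obtain ⟨ε, hε, hball⟩ := Metric.isOpen_iff.1 h.isOpen y hy
  -- a high frequency, so that the field stays in the coordinate domain
  obtain ⟨N, hN⟩ := exists_nat_gt ((∑ μ, ‖m.rhoL y (A μ)‖) / ε)
  have hN0 : N ≠ 0 := by
    rintro rfl
    have : 0 ≤ (∑ μ, ‖m.rhoL y (A μ)‖) / ε := by positivity
    simp at hN; linarith
  have hNp : (0 : ℝ) < N := by exact_mod_cast Nat.pos_of_ne_zero hN0
  let z : Fin n := ⟨0, hn⟩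
  let σ₀ : Sp n := fun _ => 1 / 2
  -- the first derivatives at `σ₀` solve the constraints for `dX`, `dA` and `dY`
  let φ : Fields d r n :=
    { X := fun σ => y + waves N (fun μ => m.rhoL y (A μ)) σ
      A := fun σ => A + waves N (fun μ ν => -(1 / 2 : ℝ) • m.CL y (A μ) (A ν)) σ
      Y := fun σ => 0 + waves N (fun μ => if μ = z then
        (Pi.single z fun c => -m.JL y (Matrix.vecCons (Pi.single c 1) A)) else 0) σ
      Z := fun _ => 0 }
  have hφ : IsField m φ := by
    refine ⟨⟨(isTorusFun_const _).add (isTorusFun_waves _ _),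
      (isTorusFun_const _).add (isTorusFun_waves _ _),
      (isTorusFun_const _).add (isTorusFun_waves _ _), isTorusFun_const _⟩, fun σ => hball ?_⟩
    rw [mem_ball_iff_norm]
    refine lt_of_le_of_lt ?_ (?_ : (1 / N : ℝ) * (∑ μ, ‖m.rhoL y (A μ)‖) < ε)
    · simpa [φ] using norm_waves_le N (fun μ => m.rhoL y (A μ)) σ
    · rw [div_lt_iff₀ hε] at hN
      rw [one_div, inv_mul_lt_iff₀ hNp]
      exact hN
  have eX : φ.X σ₀ = y := by
    change y + waves N _ (fun _ => 1 / 2) = _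
    rw [waves_half, add_zero]
  have eA : φ.A σ₀ = A := by
    change A + waves N _ (fun _ => 1 / 2) = _
    rw [waves_half, add_zero]
  have eY : φ.Y σ₀ = 0 := by
    change (0 : Fin n → Fin r → ℝ) + waves N _ (fun _ => 1 / 2) = _
    rw [waves_half, add_zero]
  have gX : ∀ μ, GX m φ σ₀ μ = 0 := fun μ => by
    rw [GX_eq, eX, eA, show dd μ φ.X σ₀ = _ from dd_const_add_waves hN0 _ _ μ, sub_self]
  have gA : ∀ μ ν, GA m φ σ₀ μ ν = 0 := fun μ ν => by
    rw [GA_eq, eX, eA, show dd μ φ.A σ₀ = _ from dd_const_add_waves hN0 _ _ μ,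
      show dd ν φ.A σ₀ = _ from dd_const_add_waves hN0 _ _ ν]
    beta_reduce
    rw [h.antisymm _ hy (A μ) (A ν)]
    module
  have gY : ∀ c, GY m φ σ₀ c = 0 := fun c => by
    rw [GY_eq, eX, eA, eY, show φ.Z σ₀ = 0 from rfl]
    have : ∀ μ, dd μ φ.Y σ₀ = _ := fun μ => dd_const_add_waves hN0 _ _ μ
    simp only [this, Pi.zero_apply, zero_dotProduct, dotProduct_zero, Finset.sum_const_zero,
      mul_zero, add_zero]
    rw [Finset.sum_eq_single z (fun ν _ hν => by simp [hν]) (by simp)]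
    simp
  have hz : ∀ K, constraint m K φ σ₀ = 0 := by
    rintro (⟨μ, i⟩ | ⟨μ, ν, c⟩ | c)
    · simp [constraint, gX]
    · simp [constraint, gA]
    · simp [constraint, gY]
  obtain ⟨c, hc⟩ := hc (.inr (.inr a)) (.inr (.inr b))
  obtain ⟨hct, hcb⟩ := hc φ hφ
  have hsm : ∀ K, IsTorusFun (constraint m K φ) := fun K => by
    rw [show constraint m K φ = fun σ => dens m K (φ.jet σ) from
      funext fun σ => represents_dens K φ σ (hφ.2 σ)]
    exact isTorusFun_density h.isOpen (isDensity_dens h K) hφ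
  have e := (densityBracket_YY h hφ a b).eq_of_localBracket h hφ (isDensity_densY h a)
    (isDensity_densY h b) (represents_dens (.inr (.inr a))) (represents_dens (.inr (.inr b)))
    (IsTorusFun.sum fun K _ => (hct K).mul (hsm K)) hcb
    (σ := σ₀) (fun μ => ⟨by norm_num [σ₀], by norm_num [σ₀]⟩)
  obtain ⟨c', -, e'⟩ := inIdeal_YY h hφ a b
  have e'' := e' σ₀
  simp only [hz, mul_zero, Finset.sum_const_zero] at e e''
  rw [e'', zero_add, eX, eA] at e
  exact e

end Closed

/-! ### The algebra of the Chevalley–Eilenberg differential -/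

section ChevalleyEilenberg

variable {V : Type*} [AddCommGroup V] [Module ℝ V] {k : ℕ}

theorem map_update_eq_removeNth (f : V [⋀^Fin (k + 1)]→ₗ[ℝ] ℝ) (A : Fin (k + 1) → V)
    (μ : Fin (k + 1)) (b : V) :
    f (Function.update A μ b) = (-1) ^ (μ : ℕ) * f (Matrix.vecCons b (μ.removeNth A)) := by
  rw [← Fin.insertNth_removeNth, AlternatingMap.map_insertNth]
  simp

theorem map_update_update_eq_removeNth (f : V [⋀^Fin (k + 2)]→ₗ[ℝ] ℝ) (A : Fin (k + 2) → V)
    {i j : Fin (k + 1)} (hij : i ≤ j) (b c : V) :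
    f (Function.update (Function.update A i.castSucc b) j.succ c) = (-1) ^ ((i : ℕ) + (j : ℕ))
      * f (Matrix.vecCons b (Matrix.vecCons c (j.removeNth (i.castSucc.removeNth A)))) := by
  have hs : i.castSucc.succAbove j = j.succ := Fin.succAbove_castSucc_of_le i j hij
  have hne : i.castSucc ≠ j.succ := by
    rw [← hs]; exact (Fin.succAbove_ne _ _).symm
  have hr : i.castSucc.removeNth (Function.update A j.succ c)
      = Function.update (i.castSucc.removeNth A) j c := by
    rw [← hs]; exact Fin.removeNth_update_succAbove _ _ _ _
  rw [Function.update_comm hne, map_update_eq_removeNth, hr]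
  have := map_update_eq_removeNth (f.curryLeft b) (i.castSucc.removeNth A) j c
  simp only [AlternatingMap.curryLeft_apply_apply] at this
  rw [this, pow_add, mul_assoc]
  simp

theorem sum_Ioi_castSucc_succ (F : Fin (k + 2) → Fin (k + 2) → ℝ) :
    ∑ μ, ∑ ν ∈ Finset.Ioi μ, F μ ν
      = ∑ i : Fin (k + 1), ∑ j ∈ Finset.Ici i, F i.castSucc j.succ := by
  rw [Fin.sum_univ_castSucc]
  have h0 : Finset.Ioi (Fin.last (k + 1)) = ∅ := by
    ext x; simp [Fin.le_last]
  rw [h0, Finset.sum_empty, add_zero]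
  refine Finset.sum_congr rfl fun i _ => ?_
  have : Finset.Ioi i.castSucc = (Finset.Ici i).map (Fin.succEmb (k + 1)) := by
    ext x
    refine Fin.cases ?_ (fun x => ?_) x
    · simp
    · simp
  rw [this, Finset.sum_map]
  rfl

/-- The part `∑_{i<j} (-1)^{i+j} f([sᵢ,sⱼ],…,ŝᵢ,…,ŝⱼ,…)` of the Chevalley–Eilenberg differential,
with the convention of `LieAlgebroid.differential` for the pairs `i < j`. -/
def bracketSum (b : V →ₗ[ℝ] V →ₗ[ℝ] V) (f : V [⋀^Fin (k + 1)]→ₗ[ℝ] ℝ) (s : Fin (k + 2) → V) : ℝ :=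
  ∑ i : Fin (k + 1), ∑ j ∈ Finset.Ici i, (-1 : ℝ) ^ ((i : ℕ) + (j : ℕ) + 1) *
    f (Matrix.vecCons (b (s i.castSucc) (s j.succ)) (j.removeNth (i.castSucc.removeNth s)))

variable {b : V →ₗ[ℝ] V →ₗ[ℝ] V}

/-- The bracket part of the differential is half of an iterated alternatization, hence alternating. -/
theorem exists_alternating_bracketSum (hb : ∀ s, b s s = 0) (f : V [⋀^Fin (k + 1)]→ₗ[ℝ] ℝ) :
    ∃ Q : V [⋀^Fin (k + 2)]→ₗ[ℝ] ℝ, ∀ s, Q s = bracketSum b f s := by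
  have anti : ∀ s t, b t s = -b s t := fun s t => by
    have := hb (s + t)
    simp only [map_add, LinearMap.add_apply, hb, zero_add, add_zero] at this
    exact eq_neg_of_add_eq_zero_left this
  refine ⟨(-(1 / 2 : ℝ)) • AlternatingMap.alternatizeUncurryFin
    (AlternatingMap.alternatizeUncurryFinLM ∘ₗ (b.compr₂ f.curryLeft)), fun s => ?_⟩
  rw [AlternatingMap.smul_apply,
    AlternatingMap.alternatizeUncurryFin_alternatizeUncurryFinLM_comp_apply, bracketSum,
    Finset.smul_sum]
  refine Finset.sum_congr rfl fun i _ => ?_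
  rw [Finset.smul_sum]
  refine Finset.sum_congr rfl fun j _ => ?_
  rw [LinearMap.compr₂_apply, LinearMap.compr₂_apply, anti (s i.castSucc) (s j.succ), map_neg,
    AlternatingMap.neg_apply, AlternatingMap.curryLeft_apply_apply, pow_succ]
  simp only [smul_eq_mul, zsmul_eq_mul]
  push_cast
  ring

theorem sum_Ici_succ (i : Fin k) (F : Fin (k + 1) → ℝ) :
    ∑ j ∈ Finset.Ici i.succ, F j = ∑ j ∈ Finset.Ici i, F j.succ := by
  have : Finset.Ici i.succ = (Finset.Ici i).map (Fin.succEmb k) := by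
    ext x
    refine Fin.cases ?_ (fun x => ?_) x
    · simp
    · simp
  rw [this, Finset.sum_map]
  rfl

theorem removeNth_succ_vecCons {V : Type*} (j : Fin (k + 1)) (a : V) (s : Fin (k + 1) → V) :
    j.succ.removeNth (Matrix.vecCons a s : Fin (k + 2) → V)
      = Matrix.vecCons a (j.removeNth s) := by
  funext l
  refine Fin.cases ?_ (fun l => ?_) l
  · simp [Fin.removeNth]
  · simp [Fin.removeNth]

theorem bracketSum_vecCons (f : V [⋀^Fin (k + 2)]→ₗ[ℝ] ℝ) (a : V) (s : Fin (k + 2) → V) :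
    bracketSum b f (Matrix.vecCons a s)
      = (∑ j : Fin (k + 2), (-1 : ℝ) ^ ((j : ℕ) + 1) * f (Matrix.vecCons (b a (s j)) (j.removeNth s)))
        - bracketSum b (f.curryLeft a) s := by
  rw [bracketSum, Fin.sum_univ_succ, sub_eq_add_neg]
  congr 1
  · rw [show Finset.Ici (0 : Fin (k + 2)) = Finset.univ by ext; simp]
    refine Finset.sum_congr rfl fun j _ => ?_
    simp only [Fin.castSucc_zero, Matrix.cons_val_zero, Matrix.cons_val_succ, Fin.val_zero, zero_add]
    rfl
  · rw [bracketSum, ← Finset.sum_neg_distrib]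
    refine Finset.sum_congr rfl fun i _ => ?_
    rw [sum_Ici_succ, ← Finset.sum_neg_distrib]
    refine Finset.sum_congr rfl fun j _ => ?_
    rw [← Fin.succ_castSucc, removeNth_succ_vecCons, removeNth_succ_vecCons,
      map_vecCons_swap]
    simp only [Matrix.cons_val_succ, Fin.val_succ, AlternatingMap.curryLeft_apply_apply]
    ring

theorem bracketSum_vecCons_eq_update (f : V [⋀^Fin (k + 1)]→ₗ[ℝ] ℝ) (a : V)
    (A : Fin (k + 1) → V) :
    bracketSum b f (Matrix.vecCons a A) = -(∑ μ, f (Function.update A μ (b a (A μ))))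
      + ∑ μ, ∑ ν ∈ Finset.Ioi μ,
        f (Function.update (Function.update A μ a) ν (b (A μ) (A ν))) := by
  cases k with
  | zero =>
    rw [bracketSum, Fin.sum_univ_one, Fin.sum_univ_one, Fin.sum_univ_one,
      show Finset.Ici (0 : Fin (0 + 1)) = {0} by decide,
      show Finset.Ioi (0 : Fin (0 + 1)) = ∅ by decide,
      Finset.sum_singleton, Finset.sum_empty, add_zero]
    simp only [Fin.val_zero, add_zero, zero_add, pow_one, neg_mul, one_mul]
    congr 2
    funext l
    rw [Subsingleton.elim l 0]
    simp
  | succ k =>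
    rw [bracketSum_vecCons, sum_Ioi_castSucc_succ, sub_eq_add_neg]
    congr 1
    · rw [← Finset.sum_neg_distrib]
      refine Finset.sum_congr rfl fun j _ => ?_
      rw [map_update_eq_removeNth]
      ring
    · rw [bracketSum, ← Finset.sum_neg_distrib]
      refine Finset.sum_congr rfl fun i _ => ?_
      rw [← Finset.sum_neg_distrib]
      refine Finset.sum_congr rfl fun j hj => ?_
      rw [map_update_update_eq_removeNth _ _ (Finset.mem_Ici.1 hj),
        AlternatingMap.curryLeft_apply_apply]
      ring

/-- The bracket part of the differential on arguments `(a, c, A_1, …)`. -/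
theorem bracketSum_vecCons_vecCons (f : V [⋀^Fin (k + 2)]→ₗ[ℝ] ℝ) (a c : V)
    (A : Fin (k + 1) → V) :
    bracketSum b f (Matrix.vecCons a (Matrix.vecCons c A)) = -f (Matrix.vecCons (b a c) A)
      - (∑ μ, f (Matrix.vecCons c (Function.update A μ (b a (A μ)))))
      + (∑ μ, f (Matrix.vecCons a (Function.update A μ (b c (A μ)))))
      - ∑ μ, ∑ ν ∈ Finset.Ioi μ,
        f (Matrix.vecCons a (Function.update (Function.update A μ c) ν (b (A μ) (A ν)))) := by
  rw [bracketSum_vecCons, bracketSum_vecCons_eq_update, Fin.sum_univ_succ]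
  simp only [AlternatingMap.curryLeft_apply_apply, removeNth_succ_vecCons, Matrix.cons_val_zero,
    Matrix.cons_val_succ, Fin.val_zero, Fin.val_succ]
  have h : ∀ μ : Fin (k + 1), (-1 : ℝ) ^ ((μ : ℕ) + 1 + 1) * f (Matrix.vecCons (b a (A μ))
      (Matrix.vecCons c (μ.removeNth A)))
      = -f (Matrix.vecCons c (Function.update A μ (b a (A μ)))) := fun μ => by
    have := map_update_eq_removeNth (f.curryLeft c) A μ (b a (A μ))
    simp only [AlternatingMap.curryLeft_apply_apply] at this
    rw [this, map_vecCons_swap]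
    ring
  simp only [h, Finset.sum_neg_distrib]
  have h0 : (0 : Fin (k + 2)).removeNth (Matrix.vecCons c A : Fin (k + 2) → V) = A := rfl
  rw [h0]
  ring

/-- The part `∑ᵢ (-1)ⁱ D(sᵢ)(…,ŝᵢ,…)` of the differential on arguments `(a, c, A_1, …)`. -/
theorem alternatizeUncurryFin_vecCons_vecCons (D : V →ₗ[ℝ] V [⋀^Fin (k + 2)]→ₗ[ℝ] ℝ) (a c : V)
    (A : Fin (k + 1) → V) :
    AlternatingMap.alternatizeUncurryFin D (Matrix.vecCons a (Matrix.vecCons c A))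
      = D a (Matrix.vecCons c A) - D c (Matrix.vecCons a A)
        + ∑ μ, D (A μ) (Matrix.vecCons a (Function.update A μ c)) := by
  rw [AlternatingMap.alternatizeUncurryFin_apply, Fin.sum_univ_succ, Fin.sum_univ_succ]
  simp only [removeNth_succ_vecCons, Matrix.cons_val_zero,
    Matrix.cons_val_succ, Fin.val_zero, Fin.val_succ]
  have h : ∀ μ : Fin (k + 1), (-1 : ℤ) ^ ((μ : ℕ) + 1 + 1) • D (A μ) (Matrix.vecCons a
      (Matrix.vecCons c (μ.removeNth A))) = D (A μ) (Matrix.vecCons a (Function.update A μ c)) :=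
    fun μ => by
      have := map_update_eq_removeNth ((D (A μ)).curryLeft a) A μ c
      simp only [AlternatingMap.curryLeft_apply_apply] at this
      rw [this, zsmul_eq_mul]
      push_cast
      ring
  simp only [h]
  have h0 : ∀ c : V, (0 : Fin (k + 2)).removeNth (Matrix.vecCons c A : Fin (k + 2) → V) = A :=
    fun _ => rfl
  have h1 : (0 : Fin (k + 3)).removeNth (Matrix.vecCons a (Matrix.vecCons c A) : Fin (k + 3) → V)
    = Matrix.vecCons c A := rfl
  rw [h0, h1]
  simp
  ring

end ChevalleyEilenberg

set_option linter.unusedSectionVars false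


/-! ### Sections and functions in a patch -/

section Manifold

variable {d : ℕ} {M : Type*} [TopologicalSpace M] [ChartedSpace (Pt d) M]
  [IsManifold (𝓡 d) ∞ M]

theorem exists_cutoff [T2Space M] {U : Set M} (hU : IsOpen U) {x : M} (hx : x ∈ U) :
    ∃ χ : M → ℝ, ContMDiff (𝓡 d) 𝓘(ℝ, ℝ) ∞ χ ∧ χ =ᶠ[nhds x] 1 ∧ tsupport χ ⊆ U := by
  obtain ⟨χ, -, h⟩ := ((SmoothBumpFunction.nhds_basis_tsupport (I := 𝓡 d) x).mem_iff).1
    (hU.mem_nhds hx)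
  exact ⟨χ, χ.contMDiff, χ.eventuallyEq_one, h⟩

theorem contMDiff_mul_of_tsupport {U : Set M} (hU : IsOpen U) {χ g : M → ℝ}
    (hχ : ContMDiff (𝓡 d) 𝓘(ℝ, ℝ) ∞ χ) (hs : tsupport χ ⊆ U)
    (hg : ContMDiffOn (𝓡 d) 𝓘(ℝ, ℝ) ∞ g U) :
    ContMDiff (𝓡 d) 𝓘(ℝ, ℝ) ∞ (fun x => χ x * g x) := by
  refine contMDiff_of_tsupport fun x hx => ?_
  have hx' : x ∈ U := hs ((tsupport_mul_subset_left (f := χ) (g := g)) hx)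
  exact hχ.contMDiffAt.mul (hg.contMDiffAt (hU.mem_nhds hx'))

theorem contMDiffOn_mvfderiv_apply {V : Type*} [NormedAddCommGroup V] [NormedSpace ℝ V]
    {U : Set M} (hU : IsOpen U) {f : M → V} (hf : ContMDiffOn (𝓡 d) 𝓘(ℝ, V) ∞ f U)
    {X : ∀ x : M, TangentSpace (𝓡 d) x}
    (hX : ContMDiffOn (𝓡 d) (𝓡 d).tangent ∞ (fun x => (⟨x, X x⟩ : TangentBundle (𝓡 d) M)) U) :
    ContMDiffOn (𝓡 d) 𝓘(ℝ, V) ∞ (fun x => mvfderiv (𝓡 d) f x (X x)) U := by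
  have : IsManifold (𝓡 d) 1 M := IsManifold.of_le (n := ∞) (by simp)
  have h1 := hf.contMDiffOn_tangentMapWithin (m := ∞) (by simp) hU.uniqueMDiffOn
  have h2 := (contMDiff_snd_tangentBundle_modelSpace V 𝓘(ℝ, V) (n := ∞)).comp_contMDiffOn
    (h1.comp hX fun x hx => hx)
  refine h2.congr fun x hx => ?_
  change mfderiv (𝓡 d) 𝓘(ℝ, V) f x (X x) = mfderivWithin (𝓡 d) 𝓘(ℝ, V) f U x (X x)
  rw [mfderivWithin_of_isOpen hU hx]

theorem contMDiff_mvfderiv_apply {f : M → ℝ} (hf : ContMDiff (𝓡 d) 𝓘(ℝ, ℝ) ∞ f)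
    {X : ∀ x : M, TangentSpace (𝓡 d) x}
    (hX : ContMDiff (𝓡 d) (𝓡 d).tangent ∞ (fun x => (⟨x, X x⟩ : TangentBundle (𝓡 d) M))) :
    ContMDiff (𝓡 d) 𝓘(ℝ, ℝ) ∞ (fun x => mvfderiv (𝓡 d) f x (X x)) :=
  contMDiffOn_univ.1 (contMDiffOn_mvfderiv_apply isOpen_univ hf.contMDiffOn hX.contMDiffOn)

theorem mvfderiv_congr {f g : M → ℝ} {x : M} (h : f =ᶠ[nhds x] g) :
    mvfderiv (𝓡 d) f x = mvfderiv (𝓡 d) g x := by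
  have e := h.mfderiv_eq (I := 𝓡 d) (I' := 𝓘(ℝ, ℝ))
  ext v
  exact congrArg (fun L => L v) e

theorem contDiffOn_comp_symm {c : OpenPartialHomeomorph M (Pt d)}
    (hc : c ∈ IsManifold.maximalAtlas (𝓡 d) ∞ M) {V : Type*} [NormedAddCommGroup V]
    [NormedSpace ℝ V] {f : M → V} (hf : ContMDiffOn (𝓡 d) 𝓘(ℝ, V) ∞ f c.source) :
    ContDiffOn ℝ ∞ (fun y => f (c.symm y)) c.target :=
  contMDiffOn_iff_contDiffOn.1 (hf.comp (contMDiffOn_symm_of_mem_maximalAtlas hc)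
    fun _ hy => c.map_target hy)

theorem mdifferentiable_chart {c : OpenPartialHomeomorph M (Pt d)}
    (hc : c ∈ IsManifold.maximalAtlas (𝓡 d) ∞ M) : c.MDifferentiable (𝓡 d) (𝓡 d) :=
  ⟨(contMDiffOn_of_mem_maximalAtlas hc).mdifferentiableOn (by simp),
    (contMDiffOn_symm_of_mem_maximalAtlas hc).mdifferentiableOn (by simp)⟩

/-- The chain rule for a function read in a chart. -/
theorem fderiv_comp_symm {c : OpenPartialHomeomorph M (Pt d)}
    (hc : c ∈ IsManifold.maximalAtlas (𝓡 d) ∞ M) {V : Type*} [NormedAddCommGroup V]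
    [NormedSpace ℝ V] {f : M → V} {y : Pt d} (hy : y ∈ c.target)
    (hf : MDifferentiableAt (𝓡 d) 𝓘(ℝ, V) f (c.symm y)) (u : TangentSpace (𝓡 d) (c.symm y)) :
    fderiv ℝ (fun y => f (c.symm y)) y (mfderiv (𝓡 d) (𝓡 d) c (c.symm y) u)
      = mvfderiv (𝓡 d) f (c.symm y) u := by
  have hd := mdifferentiable_chart hc
  have h1 := mfderiv_comp y hf (hd.symm.mdifferentiableAt hy)
  have h2 := hd.symm_comp_deriv (c.map_target hy)
  rw [← mfderiv_eq_fderiv]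
  have h3 : mfderiv 𝓘(ℝ, Pt d) 𝓘(ℝ, V) (fun y => f (c.symm y)) y
    = (mfderiv (𝓡 d) 𝓘(ℝ, V) f (c.symm y)).comp (mfderiv (𝓡 d) (𝓡 d) c.symm y) := h1
  rw [h3]
  rw [c.right_inv hy] at h2
  have h4 := congrArg (fun L => mfderiv (𝓡 d) 𝓘(ℝ, V) f (c.symm y) (L u)) h2
  exact h4

end Manifold

section Sections

variable {d r : ℕ} {M : Type*} [TopologicalSpace M] [ChartedSpace (Pt d) M]
  [IsManifold (𝓡 d) ∞ M]
  {E : M → Type*} [TopologicalSpace (TotalSpace (EuclideanSpace ℝ (Fin r)) E)]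
  [∀ x, AddCommGroup (E x)] [∀ x, Module ℝ (E x)] [∀ x, TopologicalSpace (E x)]
  [FiberBundle (EuclideanSpace ℝ (Fin r)) E] [VectorBundle ℝ (EuclideanSpace ℝ (Fin r)) E]

/-- The product of a smooth function and a smooth section. -/
def fsmul (f : M → ℝ) (hf : ContMDiff (𝓡 d) 𝓘(ℝ, ℝ) ∞ f) (s : Sec (d := d) (r := r) E) :
    Sec (d := d) (r := r) E :=
  ⟨fun x => f x • s x, hf.smul_section s.contMDiff⟩

theorem fsmul_apply (f : M → ℝ) (hf : ContMDiff (𝓡 d) 𝓘(ℝ, ℝ) ∞ f)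
    (s : Sec (d := d) (r := r) E) (x : M) : fsmul f hf s x = f x • s x := rfl

/-- Evaluation of sections at a point. -/
def evalSec (x : M) : Sec (d := d) (r := r) E →ₗ[ℝ] E x where
  toFun s := s x
  map_add' _ _ := rfl
  map_smul' _ _ := rfl

theorem LieAlgebroid.leibniz_apply (L : LieAlgebroid (d := d) (r := r) E) {f : M → ℝ}
    (hf : ContMDiff (𝓡 d) 𝓘(ℝ, ℝ) ∞ f) (s t : Sec (d := d) (r := r) E) (x : M) :
    L.bracket s (fsmul f hf t) x
      = f x • L.bracket s t x + mvfderiv (𝓡 d) f x (L.anchor x (s x)) • t x :=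
  L.leibniz f hf s t _ (fun _ => rfl) x

theorem LieAlgebroid.bracket_swap (L : LieAlgebroid (d := d) (r := r) E)
    (s t : Sec (d := d) (r := r) E) : L.bracket t s = -L.bracket s t := by
  have h := L.bracket_self (s + t)
  simp only [map_add, LinearMap.add_apply, L.bracket_self, zero_add, add_zero] at h
  exact eq_neg_of_add_eq_zero_left h

/-- The anchor is a homomorphism of brackets; this follows from the Leibniz rule and the Jacobi
identity for `s`, `t` and `f u`. -/
theorem LieAlgebroid.anchor_bracket (L : LieAlgebroid (d := d) (r := r) E) {f : M → ℝ}
    (hf : ContMDiff (𝓡 d) 𝓘(ℝ, ℝ) ∞ f) (s t u : Sec (d := d) (r := r) E) {x : M}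
    (hu : u x ≠ 0) :
    mvfderiv (𝓡 d) f x (L.anchor x (L.bracket s t x))
      = mvfderiv (𝓡 d) (fun z => mvfderiv (𝓡 d) f z (L.anchor z (t z))) x (L.anchor x (s x))
        - mvfderiv (𝓡 d) (fun z => mvfderiv (𝓡 d) f z (L.anchor z (s z))) x
          (L.anchor x (t x)) := by
  have hD : ∀ s : Sec (d := d) (r := r) E, ContMDiff (𝓡 d) 𝓘(ℝ, ℝ) ∞
      (fun z => mvfderiv (𝓡 d) f z (L.anchor z (s z))) := fun s =>
    contMDiff_mvfderiv_apply hf (L.anchor_smooth s)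
  have e : ∀ s : Sec (d := d) (r := r) E, L.bracket s (fsmul f hf u)
      = fsmul f hf (L.bracket s u) + fsmul _ (hD s) u := fun s => by
    ext z
    exact L.leibniz_apply hf s u z
  have J := L.jacobi s t (fsmul f hf u)
  rw [L.bracket_swap s (fsmul f hf u), L.bracket_swap (L.bracket s t) (fsmul f hf u), map_neg,
    e t, e s, e (L.bracket s t), map_add, map_add] at J
  have J' := congrArg (evalSec x) J
  have J0 := congrArg (evalSec x) (L.jacobi s t u)
  rw [L.bracket_swap s u, L.bracket_swap (L.bracket s t) u, map_neg] at J0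
  simp only [map_add, map_neg, map_zero] at J' J0
  simp only [evalSec, LinearMap.coe_mk, AddHom.coe_mk, L.leibniz_apply, fsmul_apply] at J' J0
  have key : (mvfderiv (𝓡 d) (fun z => mvfderiv (𝓡 d) f z (L.anchor z (t z))) x (L.anchor x (s x))
        - mvfderiv (𝓡 d) (fun z => mvfderiv (𝓡 d) f z (L.anchor z (s z))) x
          (L.anchor x (t x)) - mvfderiv (𝓡 d) f x (L.anchor x (L.bracket s t x))) • u x = 0 := by
    linear_combination (norm := module) J' - f x • J0
  exact (sub_eq_zero.1 ((smul_eq_zero.1 key).resolve_right hu)).symm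

end Sections

section PatchSections

variable {d r : ℕ} {M : Type*} [TopologicalSpace M] [ChartedSpace (Pt d) M]
  [IsManifold (𝓡 d) ∞ M]
  {E : M → Type*} [TopologicalSpace (TotalSpace (EuclideanSpace ℝ (Fin r)) E)]
  [∀ x, AddCommGroup (E x)] [∀ x, Module ℝ (E x)] [∀ x, TopologicalSpace (E x)]
  [FiberBundle (EuclideanSpace ℝ (Fin r)) E] [VectorBundle ℝ (EuclideanSpace ℝ (Fin r)) E]
  (P : Patch (d := d) (r := r) E)

/-- The components of a smooth section in a smooth frame are smooth: in a trivialization the frame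
is a smooth family of invertible linear maps. -/
theorem Patch.contMDiffOn_coeff [ContMDiffVectorBundle ∞ (EuclideanSpace ℝ (Fin r)) E (𝓡 d)]
    {s : ∀ x, E x} (hs : ContMDiffOn (𝓡 d) ((𝓡 d).prod 𝓘(ℝ, EuclideanSpace ℝ (Fin r))) ∞
      (fun x => TotalSpace.mk' (EuclideanSpace ℝ (Fin r)) x (s x)) P.chart.source) :
    ContMDiffOn (𝓡 d) 𝓘(ℝ, Fin r → ℝ) ∞ (fun x c => P.isFrame.coeff c x (s x))
      P.chart.source := by
  intro x₀ hx₀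
  refine ContMDiffAt.contMDiffWithinAt ?_
  let e := trivializationAt (EuclideanSpace ℝ (Fin r)) E x₀
  have he : x₀ ∈ e.baseSet := FiberBundle.mem_baseSet_trivializationAt' x₀
  have hnhds : P.chart.source ∈ nhds x₀ := P.chart.open_source.mem_nhds hx₀
  let Θ : M → (Fin r → ℝ) →L[ℝ] EuclideanSpace ℝ (Fin r) := fun x =>
    ∑ a, (ContinuousLinearMap.proj (R := ℝ) (φ := fun _ : Fin r => ℝ) a).smulRight
      (e (TotalSpace.mk' (EuclideanSpace ℝ (Fin r)) x (P.frame a x))).2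
  have hΘ : ContMDiffAt (𝓡 d) 𝓘(ℝ, (Fin r → ℝ) →L[ℝ] EuclideanSpace ℝ (Fin r)) ∞ Θ x₀ := by
    refine ContMDiffAt.sum fun a _ => ?_
    have h1 : ContMDiffAt (𝓡 d) 𝓘(ℝ, EuclideanSpace ℝ (Fin r)) ∞
        (fun x => (e (TotalSpace.mk' (EuclideanSpace ℝ (Fin r)) x (P.frame a x))).2) x₀ :=
      (e.contMDiffAt_section_iff he).1 (P.frame a).contMDiff.contMDiffAt
    exact ((ContinuousLinearMap.smulRightL ℝ (Fin r → ℝ) (EuclideanSpace ℝ (Fin r))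
      (ContinuousLinearMap.proj a)).contMDiff.contMDiffAt).comp x₀ h1
  have hS : ContMDiffAt (𝓡 d) 𝓘(ℝ, EuclideanSpace ℝ (Fin r)) ∞
        (fun x => (e (TotalSpace.mk' (EuclideanSpace ℝ (Fin r)) x (s x))).2) x₀ :=
    (e.contMDiffAt_section_iff he).1 (hs.contMDiffAt hnhds)
  have key : ∀ x ∈ P.chart.source ∩ e.baseSet,
      ∃ Φ : (Fin r → ℝ) ≃L[ℝ] EuclideanSpace ℝ (Fin r), (Φ : _ →L[ℝ] _) = Θ x ∧
        ∀ v : E x, (fun c => P.isFrame.coeff c x v)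
          = Φ.symm (e (TotalSpace.mk' (EuclideanSpace ℝ (Fin r)) x v)).2 := by
    rintro x ⟨hx, hxe⟩
    let B := P.isFrame.toBasisAt hx
    let Φ := (B.equivFun.symm.trans (e.linearEquivAt ℝ x hxe)).toContinuousLinearEquiv
    refine ⟨Φ, ?_, fun v => ?_⟩
    · ext1 v
      change e.linearEquivAt ℝ x hxe (B.equivFun.symm v) = Θ x v
      rw [Module.Basis.equivFun_symm_apply, map_sum]
      simp only [Θ, sum_apply, ContinuousLinearMap.smulRight_apply, map_smul]
      refine Finset.sum_congr rfl fun a _ => ?_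
      rw [IsLocalFrameOn.toBasisAt_coe]
      rfl
    · have : Φ (B.equivFun v) = (e (TotalSpace.mk' (EuclideanSpace ℝ (Fin r)) x v)).2 := by
        change e.linearEquivAt ℝ x hxe (B.equivFun.symm (B.equivFun v)) = _
        rw [LinearEquiv.symm_apply_apply]
        rfl
      rw [← this, ContinuousLinearEquiv.symm_apply_apply]
      funext c
      rw [IsLocalFrameOn.coeff, dif_pos hx]
      rfl
  have hmem : P.chart.source ∩ e.baseSet ∈ nhds x₀ :=
    Filter.inter_mem hnhds (e.open_baseSet.mem_nhds he)
  obtain ⟨Φ, hΦ, -⟩ := key x₀ ⟨hx₀, he⟩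
  have hinv : ContMDiffAt (𝓡 d) 𝓘(ℝ, EuclideanSpace ℝ (Fin r) →L[ℝ] (Fin r → ℝ)) ∞
      (fun x => (Θ x).inverse) x₀ := by
    have h1 : ContDiffAt ℝ ∞ ContinuousLinearMap.inverse (Θ x₀) := by
      rw [← hΦ]; exact contDiffAt_map_inverse Φ
    exact h1.contMDiffAt.comp x₀ hΘ
  refine (hinv.clm_apply hS).congr_of_eventuallyEq ?_
  filter_upwards [hmem] with x hx
  obtain ⟨Φ, hΦ, h⟩ := key x hx
  rw [h, ← hΦ, ContinuousLinearMap.inverse_equiv]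
  rfl

end PatchSections


/-! ### The coordinate expressions of a Lie algebroid -/

section PatchTarget

variable {d r n : ℕ} {M : Type*} [TopologicalSpace M] [ChartedSpace (Pt d) M]
  [IsManifold (𝓡 d) ∞ M]
  {E : M → Type*} [TopologicalSpace (TotalSpace (EuclideanSpace ℝ (Fin r)) E)]
  [∀ x, AddCommGroup (E x)] [∀ x, Module ℝ (E x)] [∀ x, TopologicalSpace (E x)]
  [FiberBundle (EuclideanSpace ℝ (Fin r)) E] [VectorBundle ℝ (EuclideanSpace ℝ (Fin r)) E]
  (P : Patch (d := d) (r := r) E)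

/-- The section `v^a e_a` with constant coefficients. -/
def Patch.sec : (Fin r → ℝ) →ₗ[ℝ] Sec (d := d) (r := r) E :=
  Fintype.linearCombination ℝ P.frame

/-- The components of a vector in the frame. -/
def Patch.comp (x : M) : E x →ₗ[ℝ] (Fin r → ℝ) :=
  LinearMap.pi fun c => P.isFrame.coeff c x

theorem Patch.sec_single (a : Fin r) : P.sec (Pi.single a 1) = P.frame a := by
  simp [sec, Fintype.linearCombination_apply_single]

theorem Patch.sec_apply (v : Fin r → ℝ) (x : M) : P.sec v x = ∑ a, v a • P.frame a x := by
  have h := congrArg (evalSec x) (Fintype.linearCombination_apply ℝ P.frame v)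
  rw [map_sum] at h
  exact h

theorem Patch.sec_comp {x : M} (hx : x ∈ P.chart.source) (t : ∀ x, E x) :
    P.sec (P.comp x (t x)) x = t x := by
  rw [sec_apply]
  exact (P.isFrame.coeff_sum_eq t hx).symm

theorem Patch.comp_frame {x : M} (hx : x ∈ P.chart.source) (a : Fin r) :
    P.comp x (P.frame a x) = Pi.single a 1 := by
  funext c
  change P.isFrame.coeff c x (P.frame a x) = _
  rw [IsLocalFrameOn.coeff, dif_pos hx, Module.Basis.coord_apply,
    ← P.isFrame.toBasisAt_coe hx a, Module.Basis.repr_self, Finsupp.single_apply, Pi.single_apply]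
  simp only [eq_comm]

variable (L : LieAlgebroid (d := d) (r := r) E) (J : ∀ x : M, E x [⋀^Fin (n + 1)]→ₗ[ℝ] ℝ)
  (H : ∀ x : M, TangentSpace (𝓡 d) x [⋀^Fin (n + 2)]→L[ℝ] ℝ)

theorem Patch.rhoL_localTarget (y : Pt d) (v : Fin r → ℝ) :
    (P.localTarget L J H).rhoL y v = mfderiv (𝓡 d) (𝓡 d) P.chart (P.chart.symm y)
      (L.anchor (P.chart.symm y) (P.sec v (P.chart.symm y))) := by
  rw [LocalTarget.rhoL_apply, sec_apply, map_sum, map_sum]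
  simp only [map_smul]
  rfl

theorem Patch.CL_localTarget (y : Pt d) (u v : Fin r → ℝ) :
    (P.localTarget L J H).CL y u v
      = P.comp (P.chart.symm y) (L.bracket (P.sec u) (P.sec v) (P.chart.symm y)) := by
  have h : P.comp (P.chart.symm y) (L.bracket (P.sec u) (P.sec v) (P.chart.symm y))
      = (((L.bracket.compl₁₂ P.sec P.sec).compr₂ (evalSec (P.chart.symm y))).compr₂
        (P.comp (P.chart.symm y))) u v := rfl
  rw [h, LocalTarget.CL_apply]
  conv_rhs => rw [pi_eq_sum u, pi_eq_sum v]
  simp only [map_sum, LinearMap.sum_apply, map_smul, LinearMap.smul_apply, Finset.smul_sum]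
  rw [Finset.sum_comm]
  refine Finset.sum_congr rfl fun b _ => Finset.sum_congr rfl fun a _ => ?_
  rw [smul_smul, mul_comm]
  simp only [LinearMap.compr₂_apply, LinearMap.compl₁₂_apply, sec_single]
  rfl

theorem Patch.J_localTarget (y : Pt d) (v : Fin (n + 1) → Fin r → ℝ) :
    (P.localTarget L J H).J y v = J (P.chart.symm y) fun i => P.sec (v i) (P.chart.symm y) := by
  simp only [sec_apply]
  rfl

variable [ContMDiffVectorBundle ∞ (EuclideanSpace ℝ (Fin r)) E (𝓡 d)]

theorem Patch.contDiffOn_comp (t : Sec (d := d) (r := r) E) :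
    ContDiffOn ℝ ∞ (fun y => P.comp (P.chart.symm y) (t (P.chart.symm y))) P.chart.target :=
  contDiffOn_comp_symm (f := fun x => P.comp x (t x)) P.chart_mem
    (P.contMDiffOn_coeff t.contMDiff.contMDiffOn)

variable {L J H}

theorem Patch.isSmooth (hJ : IsSmoothEForm (d := d) (r := r) J) (hH : IsSmoothForm H) :
    (P.localTarget L J H).IsSmooth where
  isOpen := P.chart.open_target
  rho_smooth a := by
    refine contDiffOn_comp_symm (f := fun x => mfderiv (𝓡 d) (𝓡 d) P.chart x
      (L.anchor x (P.frame a x))) P.chart_mem ?_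
    exact contMDiffOn_mvfderiv_apply P.chart.open_source
      (contMDiffOn_of_mem_maximalAtlas P.chart_mem) (L.anchor_smooth (P.frame a)).contMDiffOn
  C_smooth a b := P.contDiffOn_comp (L.bracket (P.frame a) (P.frame b))
  J_smooth v := by
    have e : (fun y => (P.localTarget L J H).J y v)
        = fun y => J (P.chart.symm y) fun i => P.sec (v i) (P.chart.symm y) :=
      funext fun y => P.J_localTarget L J H y v
    rw [e]
    exact contDiffOn_comp_symm (f := fun x => J x fun i => P.sec (v i) x) P.chart_mem
      (hJ fun i => P.sec (v i)).contMDiffOn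
  H_smooth := hH P.chart P.chart_mem

/-- Near a point of the patch `t = t^c e_c`. After multiplication by a cutoff function `χ` this is
an identity of global sections with global smooth coefficients. -/
theorem Patch.exists_cutoff_expansion [T2Space M] (t : Sec (d := d) (r := r) E) {x : M}
    (hx : x ∈ P.chart.source) :
    ∃ (χ : M → ℝ) (hχ : ContMDiff (𝓡 d) 𝓘(ℝ, ℝ) ∞ χ)
      (hg : ∀ c, ContMDiff (𝓡 d) 𝓘(ℝ, ℝ) ∞ (fun z => χ z * P.comp z (t z) c)),
      χ =ᶠ[nhds x] 1 ∧ fsmul χ hχ t = ∑ c, fsmul _ (hg c) (P.frame c) := by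
  obtain ⟨χ, hχ, h1, hs⟩ := exists_cutoff (d := d) P.chart.open_source hx
  have hg : ∀ c, ContMDiff (𝓡 d) 𝓘(ℝ, ℝ) ∞ (fun z => χ z * P.comp z (t z) c) := fun c =>
    contMDiff_mul_of_tsupport P.chart.open_source hχ hs
      (contMDiffOn_pi_space.1 (P.contMDiffOn_coeff t.contMDiff.contMDiffOn) c)
  refine ⟨χ, hχ, hg, h1, ?_⟩
  ext z
  have h := map_sum (evalSec z) (fun c => fsmul _ (hg c) (P.frame c)) Finset.univ
  refine Eq.trans ?_ h.symm
  change χ z • t z = ∑ c, (χ z * P.comp z (t z) c) • P.frame c z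
  by_cases hz : z ∈ P.chart.source
  · simp only [mul_smul, ← Finset.smul_sum]
    rw [← P.sec_apply, P.sec_comp hz]
  · have : χ z = 0 := image_eq_zero_of_notMem_tsupport fun h => hz (hs h)
    simp [this]

/-- The bracket with `t = t^c e_c` near a point of the patch, by the Leibniz rule. -/
theorem Patch.bracket_eq [T2Space M] (s t : Sec (d := d) (r := r) E) {x : M}
    (hx : x ∈ P.chart.source) :
    L.bracket s t x = (∑ c, P.comp x (t x) c • L.bracket s (P.frame c) x)
      + ∑ c, mvfderiv (𝓡 d) (fun z => P.comp z (t z) c) x (L.anchor x (s x)) • P.frame c x := by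
  obtain ⟨χ, hχ, hg, h1, e⟩ := P.exists_cutoff_expansion t hx
  have h := congrArg (evalSec x) (congrArg (L.bracket s) e)
  rw [map_sum, map_sum] at h
  simp only [evalSec, LinearMap.coe_mk, AddHom.coe_mk, L.leibniz_apply] at h
  have hχx : χ x = 1 := h1.eq_of_nhds
  have hdχ : mvfderiv (𝓡 d) χ x = 0 := (mvfderiv_congr h1).trans (mvfderiv_const (1 : ℝ))
  have hdg : ∀ c, mvfderiv (𝓡 d) (fun z => χ z * P.comp z (t z) c) x
      = mvfderiv (𝓡 d) (fun z => P.comp z (t z) c) x := fun c => by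
    refine mvfderiv_congr ?_
    filter_upwards [h1] with z hz
    rw [hz]
    simp
  simp only [hdg, hχx, hdχ, one_smul, one_mul] at h
  rw [← Finset.sum_add_distrib]
  simpa using h

/-- The derivative of the components of a section along the anchor, in coordinates. -/
theorem Patch.mvfderiv_comp (t : Sec (d := d) (r := r) E) {y : Pt d} (hy : y ∈ P.chart.target)
    (u : Fin r → ℝ) (c : Fin r) :
    mvfderiv (𝓡 d) (fun z => P.comp z (t z) c) (P.chart.symm y)
        (L.anchor (P.chart.symm y) (P.sec u (P.chart.symm y)))
      = fderiv ℝ (fun y => P.comp (P.chart.symm y) (t (P.chart.symm y)) c) y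
        ((P.localTarget L J H).rhoL y u) := by
  rw [P.rhoL_localTarget]
  refine (fderiv_comp_symm (f := fun z => P.comp z (t z) c) P.chart_mem hy ?_ _).symm
  exact ((contMDiffOn_pi_space.1 (P.contMDiffOn_coeff t.contMDiff.contMDiffOn) c).contMDiffAt
    (P.chart.open_source.mem_nhds (P.chart.map_target hy))).mdifferentiableAt (by simp)

/-- A double bracket of sections with constant coefficients, in components. -/
theorem Patch.comp_bracket_bracket [T2Space M] (hJ : IsSmoothEForm (d := d) (r := r) J)
    (hH : IsSmoothForm H) {y : Pt d} (hy : y ∈ P.chart.target) (u v w : Fin r → ℝ) :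
    P.comp (P.chart.symm y) (L.bracket (P.sec u) (L.bracket (P.sec v) (P.sec w)) (P.chart.symm y))
      = (P.localTarget L J H).CL y u ((P.localTarget L J H).CL y v w)
        + fderiv ℝ (P.localTarget L J H).CL y ((P.localTarget L J H).rhoL y u) v w := by
  have hx := P.chart.map_target hy
  rw [P.bracket_eq _ _ hx, map_add]
  congr 1
  · conv_rhs => rw [pi_eq_sum ((P.localTarget L J H).CL y v w)]
    rw [map_sum, map_sum]
    refine Finset.sum_congr rfl fun c _ => ?_
    rw [map_smul, map_smul, P.CL_localTarget, P.CL_localTarget, P.sec_single]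
  · funext c
    simp only [map_sum, map_smul, P.comp_frame hx, P.mvfderiv_comp (J := J) (H := H) _ hy]
    have h := (((DifferentiableAt.hasVar ((P.isSmooth (L := L) hJ hH).differentiableAt_CL hy)).clm_apply
      (HasVar.const v y)).clm_apply (HasVar.const w y)).apply c
    have h2 := h.fderiv_apply ((P.localTarget L J H).rhoL y u)
    simp only [P.CL_localTarget] at h2
    rw [← pi_eq_sum, h2]
    simp

theorem Patch.contMDiffOn_anchor (s : Sec (d := d) (r := r) E) :
    ContMDiffOn (𝓡 d) (𝓡 d) ∞ (fun x => (mfderiv (𝓡 d) (𝓡 d) P.chart x (L.anchor x (s x)) : Pt d))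
      P.chart.source :=
  contMDiffOn_mvfderiv_apply P.chart.open_source
      (contMDiffOn_of_mem_maximalAtlas P.chart_mem) (L.anchor_smooth s).contMDiffOn

theorem Patch.mvfderiv_chart_apply {x : M} (hx : x ∈ P.chart.source) (i : Fin d)
    (w : TangentSpace (𝓡 d) x) :
    mvfderiv (𝓡 d) (fun z => P.chart z i) x w
      = EuclideanSpace.proj (𝕜 := ℝ) i (mfderiv (𝓡 d) (𝓡 d) P.chart x w : Pt d) := by
  have hd := (mdifferentiable_chart P.chart_mem).mdifferentiableAt hx
  have h := mfderiv_comp x ((EuclideanSpace.proj (𝕜 := ℝ) i).mdifferentiableAt (x := P.chart x)) hd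
  rw [ContinuousLinearMap.mfderiv_eq] at h
  exact congrArg (fun L => L w) h

/-- Near a given point, a coordinate agrees with a global smooth function. -/
theorem Patch.exists_function [T2Space M] {x : M} (hx : x ∈ P.chart.source) (i : Fin d) :
    ∃ f : M → ℝ, ContMDiff (𝓡 d) 𝓘(ℝ, ℝ) ∞ f ∧ ∀ᶠ z in nhds x, ∀ w,
      mvfderiv (𝓡 d) f z w = EuclideanSpace.proj (𝕜 := ℝ) i (mfderiv (𝓡 d) (𝓡 d) P.chart z w : Pt d) := by
  obtain ⟨χ, hχ, h1, hs⟩ := exists_cutoff (d := d) P.chart.open_source hx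
  refine ⟨fun z => χ z * P.chart z i, contMDiff_mul_of_tsupport P.chart.open_source hχ hs
    ((EuclideanSpace.proj (𝕜 := ℝ) i).contMDiff.comp_contMDiffOn
      (contMDiffOn_of_mem_maximalAtlas P.chart_mem)), ?_⟩
  filter_upwards [h1.eventuallyEq_nhds, P.chart.open_source.mem_nhds hx] with z hz hzs w
  rw [← P.mvfderiv_chart_apply hzs]
  refine congrArg (fun L => L w) (mvfderiv_congr ?_)
  filter_upwards [hz] with z hz
  rw [hz]
  simp

/-- The identities of a Lie algebroid, evaluated on the frame of a patch. -/
theorem Patch.isLieAlgebroid [T2Space M] (hJ : IsSmoothEForm (d := d) (r := r) J)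
    (hH : IsSmoothForm H) : (P.localTarget L J H).IsLieAlgebroid where
  toIsSmooth := P.isSmooth hJ hH
  antisymm y _ u v := by
    rw [P.CL_localTarget, P.CL_localTarget, L.bracket_swap (P.sec u) (P.sec v)]
    exact map_neg (P.comp _) _
  jacobi y hy u v w := by
    rw [← P.comp_bracket_bracket hJ hH hy, ← P.comp_bracket_bracket hJ hH hy,
      ← P.comp_bracket_bracket hJ hH hy, ← map_add, ← map_add]
    have h := congrArg (evalSec (P.chart.symm y)) (L.jacobi (P.sec u) (P.sec v) (P.sec w))
    simp only [map_add, map_zero] at h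
    exact (congrArg (P.comp (P.chart.symm y)) h).trans (map_zero _)
  anchor_hom y hy u v := by
    have hx := P.chart.map_target hy
    rcases isEmpty_or_nonempty (Fin r) with hr | ⟨⟨a⟩⟩
    · rw [Subsingleton.elim u 0, Subsingleton.elim v 0]
      simp
    refine PiLp.ext fun i => ?_
    obtain ⟨f, hf, hfx⟩ := P.exists_function hx i
    have key := L.anchor_bracket hf (P.sec u) (P.sec v) (P.frame a)
      ((P.isFrame.linearIndependent hx).ne_zero a)
    have hD : ∀ u v, mvfderiv (𝓡 d) (fun z => mvfderiv (𝓡 d) f z (L.anchor z (P.sec v z)))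
        (P.chart.symm y) (L.anchor (P.chart.symm y) (P.sec u (P.chart.symm y)))
        = fderiv ℝ (P.localTarget L J H).rhoL y ((P.localTarget L J H).rhoL y u) v i := by
      intro u v
      have e : (fun z => mvfderiv (𝓡 d) f z (L.anchor z (P.sec v z))) =ᶠ[nhds (P.chart.symm y)]
          fun z => EuclideanSpace.proj (𝕜 := ℝ) i
            (mfderiv (𝓡 d) (𝓡 d) P.chart z (L.anchor z (P.sec v z)) : Pt d) := by
        filter_upwards [hfx] with z hz using hz _
      have hsm := (((EuclideanSpace.proj (𝕜 := ℝ) i).contMDiff.comp_contMDiffOn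
        (P.contMDiffOn_anchor (L := L) (P.sec v))).contMDiffAt
          (P.chart.open_source.mem_nhds hx)).mdifferentiableAt (by simp)
      rw [mvfderiv_congr e]
      refine (fderiv_comp_symm P.chart_mem hy hsm _).symm.trans ?_
      have h := (((DifferentiableAt.hasVar ((P.isSmooth (L := L) hJ hH).differentiableAt_rhoL hy)
        ).clm_apply (HasVar.const v y)).euclidean_apply i).fderiv_apply
          ((P.localTarget L J H).rhoL y u)
      simp only [map_zero, add_zero] at h
      rw [← h, ← P.rhoL_localTarget L J H]
      refine congrArg (fun F => fderiv ℝ F y ((P.localTarget L J H).rhoL y u)) ?_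
      funext y'
      rw [P.rhoL_localTarget]
      rfl
    rw [hD, hD, hfx.self_of_nhds] at key
    rw [P.rhoL_localTarget, P.CL_localTarget, P.sec_comp hx fun x => L.bracket (P.sec u) (P.sec v) x]
    exact key

end PatchTarget


/-! ### The coordinate expressions of a connection -/

section PatchConnection

variable {d r n : ℕ} {M : Type*} [TopologicalSpace M] [ChartedSpace (Pt d) M]
  [IsManifold (𝓡 d) ∞ M]
  {E : M → Type*} [TopologicalSpace (TotalSpace (EuclideanSpace ℝ (Fin r)) E)]
  [∀ x, AddCommGroup (E x)] [∀ x, Module ℝ (E x)] [∀ x, TopologicalSpace (E x)]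
  [∀ x, IsTopologicalAddGroup (E x)] [∀ x, ContinuousSMul ℝ (E x)]
  [FiberBundle (EuclideanSpace ℝ (Fin r)) E] [VectorBundle ℝ (EuclideanSpace ℝ (Fin r)) E]
  (P : Patch (d := d) (r := r) E)
  (L : LieAlgebroid (d := d) (r := r) E) (J : ∀ x : M, E x [⋀^Fin (n + 1)]→ₗ[ℝ] ℝ)
  (H : ∀ x : M, TangentSpace (𝓡 d) x [⋀^Fin (n + 2)]→L[ℝ] ℝ)
  (D : CovariantDerivative (𝓡 d) (EuclideanSpace ℝ (Fin r)) E)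

theorem Patch.contMDiffOn_coordinateField (u : Pt d) :
    ContMDiffOn (𝓡 d) (𝓡 d).tangent ∞ (fun x => (⟨x, mfderiv (𝓡 d) (𝓡 d) P.chart.symm (P.chart x) u⟩ :
      TangentBundle (𝓡 d) M)) P.chart.source := by
  have : IsManifold (𝓡 d) 1 M := IsManifold.of_le (n := ∞) (by simp)
  have h1 := (contMDiffOn_symm_of_mem_maximalAtlas P.chart_mem).contMDiffOn_tangentMapWithin
    (m := ∞) (by simp) P.chart.open_target.uniqueMDiffOn
  have h2 : ContMDiff (𝓡 d) (𝓡 d).tangent ∞ (fun y : Pt d => (⟨y, u⟩ : TangentBundle (𝓡 d) (Pt d))) :=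
    fun y => contMDiffAt_vectorSpace_iff_contDiffAt.2 contDiffAt_const
  have h3 := h1.comp (h2.comp_contMDiffOn (contMDiffOn_of_mem_maximalAtlas P.chart_mem))
    (fun x hx => P.chart.map_source hx)
  refine h3.congr fun x hx => ?_
  have hy := P.chart.map_source hx
  change _ = (⟨P.chart.symm (P.chart x), mfderivWithin (𝓡 d) (𝓡 d) P.chart.symm P.chart.target
    (P.chart x) u⟩ : TangentBundle (𝓡 d) M)
  rw [mfderivWithin_of_isOpen P.chart.open_target hy]
  have key : ∀ x' : M, x' = x → ∀ v : Pt d, (⟨x, v⟩ : TangentBundle (𝓡 d) M) = ⟨x', v⟩ := by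
    rintro _ rfl v
    rfl
  exact key _ (P.chart.left_inv hx) _

variable [ContMDiffVectorBundle ∞ (EuclideanSpace ℝ (Fin r)) E (𝓡 d)] {D}

theorem Patch.omL_localConnection {y : Pt d} (hy : y ∈ P.chart.target) (b : Fin r)
    (w : TangentSpace (𝓡 d) (P.chart.symm y)) :
    (P.localConnection L D).omL y (Pi.single b 1) (mfderiv (𝓡 d) (𝓡 d) P.chart (P.chart.symm y) w)
      = P.comp (P.chart.symm y) (D (fun x => P.frame b x) (P.chart.symm y) w) := by
  have h2 := (mdifferentiable_chart P.chart_mem).symm_comp_deriv (P.chart.map_target hy)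
  rw [P.chart.right_inv hy] at h2
  let u : Pt d := mfderiv (𝓡 d) (𝓡 d) P.chart (P.chart.symm y) w
  have e : w = mfderiv (𝓡 d) (𝓡 d) P.chart.symm y u := (congrArg (fun L => L w) h2).symm
  let F : Pt d →ₗ[ℝ] (Fin r → ℝ) := (P.comp (P.chart.symm y)).comp
    ((D (fun x => P.frame b x) (P.chart.symm y)).toLinearMap.comp
      (mfderiv (𝓡 d) (𝓡 d) P.chart.symm y).toLinearMap)
  change (P.localConnection L D).omL y (Pi.single b 1) u = _
  conv_rhs => rw [e]
  change _ = F u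
  conv_rhs => rw [euclidean_eq_sum u]
  rw [LocalConnection.omL_apply, map_sum, Finset.sum_eq_single b]
  · refine Finset.sum_congr rfl fun i _ => ?_
    rw [map_smul, Pi.single_eq_same, one_mul]
    rfl
  · intro c _ hc
    simp [Pi.single_eq_of_ne hc]
  · simp

theorem Patch.isConnection (hD : CovariantDerivative.ContMDiffCovariantDerivative D ∞) :
    (P.localConnection L D).IsConnection (P.localTarget L J H) where
  om_smooth b i := by
    have h1 := hD.contMDiff.contMDiff (σ := fun x => P.frame b x)
      (by simpa using (P.frame b).contMDiff.contMDiffOn)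
    have h2 := (h1.mono (Set.subset_univ P.chart.source)).clm_bundle_apply
      (P.contMDiffOn_coordinateField (EuclideanSpace.single i 1))
    have h3 := contDiffOn_comp_symm P.chart_mem (P.contMDiffOn_coeff h2)
    refine h3.congr fun y hy => ?_
    rw [P.chart.right_inv hy]
    rfl
  torsion y hy a b := by
    have h : ∀ a, (P.localTarget L J H).rho y a = mfderiv (𝓡 d) (𝓡 d) P.chart (P.chart.symm y)
      (L.anchor (P.chart.symm y) (P.frame a (P.chart.symm y))) := fun _ => rfl
    rw [h, h, P.omL_localConnection L hy, P.omL_localConnection L hy]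
    change P.comp (P.chart.symm y) _ = _ - _ - P.comp (P.chart.symm y) _
    rw [← map_sub, ← map_sub]
    rfl

end PatchConnection


/-! ### The anomaly as a tensor -/

section Anomaly

variable {d r k n : ℕ} {M : Type*} [TopologicalSpace M] [ChartedSpace (Pt d) M]
  [IsManifold (𝓡 d) ∞ M]
  {E : M → Type*} [TopologicalSpace (TotalSpace (EuclideanSpace ℝ (Fin r)) E)]
  [∀ x, AddCommGroup (E x)] [∀ x, Module ℝ (E x)] [∀ x, TopologicalSpace (E x)]
  [FiberBundle (EuclideanSpace ℝ (Fin r)) E] [VectorBundle ℝ (EuclideanSpace ℝ (Fin r)) E]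

/-- The value of an `E`-form at `x` as an alternating map on sections. -/
def formAt (J : ∀ x : M, E x [⋀^Fin k]→ₗ[ℝ] ℝ) (x : M) : Sec (d := d) (r := r) E [⋀^Fin k]→ₗ[ℝ] ℝ :=
  (J x).compLinearMap (evalSec x)

theorem formAt_congr {J : ∀ x : M, E x [⋀^Fin k]→ₗ[ℝ] ℝ} {x : M}
    {s t : Fin k → Sec (d := d) (r := r) E} (h : ∀ l, s l x = t l x) :
    formAt J x s = formAt J x t :=
  congrArg (J x) (funext h)

theorem mdifferentiableAt_formAt {J : ∀ x : M, E x [⋀^Fin k]→ₗ[ℝ] ℝ}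
    (hJ : IsSmoothEForm (d := d) (r := r) J) (s : Fin k → Sec (d := d) (r := r) E) (x : M) :
    MDifferentiableAt (𝓡 d) 𝓘(ℝ, ℝ) (fun y => formAt J y s) x :=
  (hJ s).contMDiffAt.mdifferentiableAt (by simp)

/-- The derivative of the function `J(s_1, …)` in the direction `w`, as an alternating map on
sections. -/
def derivForm {J : ∀ x : M, E x [⋀^Fin k]→ₗ[ℝ] ℝ} (hJ : IsSmoothEForm (d := d) (r := r) J) (x : M)
    (w : TangentSpace (𝓡 d) x) : Sec (d := d) (r := r) E [⋀^Fin k]→ₗ[ℝ] ℝ where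
  toFun s := mvfderiv (𝓡 d) (fun y => formAt J y s) x w
  map_update_add' m i a b := by
    simp only [AlternatingMap.map_update_add]
    rw [mvfderiv_fun_add (mdifferentiableAt_formAt hJ _ x) (mdifferentiableAt_formAt hJ _ x)]
    rfl
  map_update_smul' m i c a := by
    simp only [AlternatingMap.map_update_smul, smul_eq_mul]
    rw [mvfderiv_fun_mul mdifferentiableAt_const (mdifferentiableAt_formAt hJ _ x),
      mvfderiv_const, smul_zero, add_zero]
    rfl
  map_eq_zero_of_eq' v i j h hij := by
    simp only [AlternatingMap.map_eq_zero_of_eq _ v h hij, mvfderiv_const]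
    rfl

variable (L : LieAlgebroid (d := d) (r := r) E)

/-- `(s, t_1, …) ↦ ρ(s) J(t_1, …)` at the point `x`. -/
def anchorForm {J : ∀ x : M, E x [⋀^Fin k]→ₗ[ℝ] ℝ} (hJ : IsSmoothEForm (d := d) (r := r) J)
    (x : M) : Sec (d := d) (r := r) E →ₗ[ℝ] Sec (d := d) (r := r) E [⋀^Fin k]→ₗ[ℝ] ℝ where
  toFun s := derivForm hJ x (L.anchor x (s x))
  map_add' s t := by
    ext u
    change mvfderiv (𝓡 d) (fun y => formAt J y u) x (L.anchor x (s x + t x)) = _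
    rw [map_add, map_add]
    rfl
  map_smul' c s := by
    ext u
    change mvfderiv (𝓡 d) (fun y => formAt J y u) x (L.anchor x (c • s x)) = _
    rw [map_smul, map_smul]
    rfl

theorem differential_eq {J : ∀ x : M, E x [⋀^Fin (n + 1)]→ₗ[ℝ] ℝ}
    (hJ : IsSmoothEForm (d := d) (r := r) J) (x : M) (s : Fin (n + 2) → Sec (d := d) (r := r) E) :
    L.differential J s x = AlternatingMap.alternatizeUncurryFin (anchorForm L hJ x) s
      + bracketSum L.bracket (formAt J x) s := by
  rw [LieAlgebroid.differential, AlternatingMap.alternatizeUncurryFin_apply]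
  congr 1
  · refine Finset.sum_congr rfl fun i _ => ?_
    rw [zsmul_eq_mul]
    push_cast
    rfl
  · refine Finset.sum_congr rfl fun i _ => Finset.sum_congr rfl fun j _ => ?_
    congr 1
    refine congrArg (J x) (funext fun l => ?_)
    refine Fin.cases ?_ (fun l => ?_) l
    · rfl
    · rfl

/-- The anomaly `ᴱdJ + ⟨⊗ρ, H⟩` at a point, as an alternating map on sections. -/
theorem exists_anomaly {J : ∀ x : M, E x [⋀^Fin (n + 1)]→ₗ[ℝ] ℝ}
    (hJ : IsSmoothEForm (d := d) (r := r) J)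
    (H : ∀ x : M, TangentSpace (𝓡 d) x [⋀^Fin (n + 2)]→L[ℝ] ℝ) (x : M) :
    ∃ K : Sec (d := d) (r := r) E [⋀^Fin (n + 2)]→ₗ[ℝ] ℝ, ∀ s,
      K s = L.differential J s x + H x (fun i => L.anchor x (s i x)) := by
  obtain ⟨Q, hQ⟩ := exists_alternating_bracketSum (b := L.bracket) L.bracket_self (formAt J x)
  refine ⟨AlternatingMap.alternatizeUncurryFin (anchorForm L hJ x) + Q
    + (H x).toAlternatingMap.compLinearMap ((L.anchor x).comp (evalSec x)), fun s => ?_⟩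
  rw [differential_eq L hJ, ← hQ]
  rfl

/-- The differential is linear over functions in the first argument: the derivatives of `f` from the
anchor part and from the Leibniz rule in the bracket part cancel. -/
theorem differential_fsmul {J : ∀ x : M, E x [⋀^Fin (k + 2)]→ₗ[ℝ] ℝ}
    (hJ : IsSmoothEForm (d := d) (r := r) J) {f : M → ℝ} (hf : ContMDiff (𝓡 d) 𝓘(ℝ, ℝ) ∞ f)
    (s : Sec (d := d) (r := r) E) (t : Fin (k + 2) → Sec (d := d) (r := r) E) (x : M) :
    L.differential J (Matrix.vecCons (fsmul f hf s) t) x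
      = f x * L.differential J (Matrix.vecCons s t) x := by
  have hc : ∀ (y : M) (u : Fin (k + 1) → Sec (d := d) (r := r) E),
      formAt J y (Matrix.vecCons (fsmul f hf s) u) = f y * formAt J y (Matrix.vecCons s u) := by
    intro y u
    have h1 : formAt J y (Matrix.vecCons (fsmul f hf s) u)
        = formAt J y (Matrix.vecCons (f y • s) u) :=
      formAt_congr fun l => by
        refine Fin.cases ?_ (fun l => ?_) l
        · rfl
        · rfl
    rw [h1]
    exact congrArg (fun F => F u) (map_smul (formAt J y).curryLeft (f y) s)
  have hB : ∀ j, formAt J x (Matrix.vecCons (L.bracket (fsmul f hf s) (t j)) (j.removeNth t))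
      = f x * formAt J x (Matrix.vecCons (L.bracket s (t j)) (j.removeNth t))
        - mvfderiv (𝓡 d) f x (L.anchor x (t j x))
          * formAt J x (Matrix.vecCons s (j.removeNth t)) := by
    intro j
    have h1 : formAt J x (Matrix.vecCons (L.bracket (fsmul f hf s) (t j)) (j.removeNth t))
        = formAt J x (Matrix.vecCons (f x • L.bracket s (t j)
          - mvfderiv (𝓡 d) f x (L.anchor x (t j x)) • s) (j.removeNth t)) :=
      formAt_congr fun l => by
        refine Fin.cases ?_ (fun l => ?_) l
        · rw [L.bracket_swap (t j) (fsmul f hf s), L.bracket_swap (t j) s]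
          change -(L.bracket (t j) (fsmul f hf s) x) = f x • -(L.bracket (t j) s x)
            - mvfderiv (𝓡 d) f x (L.anchor x (t j x)) • s x
          rw [L.leibniz_apply]
          module
        · rfl
    rw [h1]
    have h2 := congrArg (fun F => F (j.removeNth t)) (map_sub (formAt J x).curryLeft
      (f x • L.bracket s (t j)) (mvfderiv (𝓡 d) f x (L.anchor x (t j x)) • s))
    refine h2.trans ?_
    rw [map_smul, map_smul]
    rfl
  have hD : ∀ j, anchorForm L hJ x (t j) (Matrix.vecCons (fsmul f hf s) (j.removeNth t))
      = f x * anchorForm L hJ x (t j) (Matrix.vecCons s (j.removeNth t))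
        + mvfderiv (𝓡 d) f x (L.anchor x (t j x))
          * formAt J x (Matrix.vecCons s (j.removeNth t)) := by
    intro j
    change mvfderiv (𝓡 d) (fun y => formAt J y (Matrix.vecCons (fsmul f hf s) (j.removeNth t))) x
      (L.anchor x (t j x)) = _
    simp only [hc]
    rw [mvfderiv_fun_mul (hf.contMDiffAt.mdifferentiableAt (by simp))
      (mdifferentiableAt_formAt hJ _ x), mul_comm (mvfderiv (𝓡 d) f x _)]
    rfl
  have hD0 : anchorForm L hJ x (fsmul f hf s) t = f x * anchorForm L hJ x s t := by
    change mvfderiv (𝓡 d) (fun y => formAt J y t) x (L.anchor x (f x • s x)) = _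
    rw [map_smul, map_smul]
    rfl
  have hC : bracketSum L.bracket ((formAt J x).curryLeft (fsmul f hf s)) t
      = f x * bracketSum L.bracket ((formAt J x).curryLeft s) t := by
    simp only [bracketSum, AlternatingMap.curryLeft_apply_apply, hc, Finset.mul_sum]
    exact Finset.sum_congr rfl fun _ _ => Finset.sum_congr rfl fun _ _ => by ring
  have hA : ∀ s : Sec (d := d) (r := r) E,
      AlternatingMap.alternatizeUncurryFin (anchorForm L hJ x) (Matrix.vecCons s t)
        = anchorForm L hJ x s t + ∑ j : Fin (k + 2), (-1 : ℝ) ^ ((j : ℕ) + 1)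
          * anchorForm L hJ x (t j) (Matrix.vecCons s (j.removeNth t)) := by
    intro s
    rw [AlternatingMap.alternatizeUncurryFin_apply, Fin.sum_univ_succ]
    congr 1
    · simp
    · refine Finset.sum_congr rfl fun j _ => ?_
      rw [removeNth_succ_vecCons, zsmul_eq_mul]
      push_cast
      rfl
  rw [differential_eq L hJ, differential_eq L hJ, bracketSum_vecCons, bracketSum_vecCons, hA, hA,
    hD0, hC]
  simp only [hB, hD]
  simp only [mul_add, mul_sub, Finset.sum_add_distrib, Finset.sum_sub_distrib, Finset.mul_sum]
  have e1 : ∀ j : Fin (k + 2), ∀ X : ℝ, (-1 : ℝ) ^ ((j : ℕ) + 1) * (f x * X)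
    = f x * ((-1 : ℝ) ^ ((j : ℕ) + 1) * X) := fun j X => by ring
  simp only [e1]
  ring

/-- The differential on arguments `(a, c, A_1, …, A_n)`. -/
theorem differential_vecCons_vecCons {J : ∀ x : M, E x [⋀^Fin (k + 2)]→ₗ[ℝ] ℝ}
    (hJ : IsSmoothEForm (d := d) (r := r) J) (a c : Sec (d := d) (r := r) E)
    (A : Fin (k + 1) → Sec (d := d) (r := r) E) (x : M) :
    L.differential J (Matrix.vecCons a (Matrix.vecCons c A)) x
      = anchorForm L hJ x a (Matrix.vecCons c A) - anchorForm L hJ x c (Matrix.vecCons a A)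
        + (∑ μ, anchorForm L hJ x (A μ) (Matrix.vecCons a (Function.update A μ c)))
        - formAt J x (Matrix.vecCons (L.bracket a c) A)
        - (∑ μ, formAt J x (Matrix.vecCons c (Function.update A μ (L.bracket a (A μ)))))
        + (∑ μ, formAt J x (Matrix.vecCons a (Function.update A μ (L.bracket c (A μ)))))
        - ∑ μ, ∑ ν ∈ Finset.Ioi μ, formAt J x (Matrix.vecCons a
          (Function.update (Function.update A μ c) ν (L.bracket (A μ) (A ν)))) := by
  rw [differential_eq L hJ, alternatizeUncurryFin_vecCons_vecCons, bracketSum_vecCons_vecCons]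
  ring

end Anomaly


/-! ### Bracket compatibility in a patch -/

section Compatibility

variable {d r n : ℕ} {M : Type*} [TopologicalSpace M] [T2Space M] [ChartedSpace (Pt d) M]
  [IsManifold (𝓡 d) ∞ M]
  {E : M → Type*} [TopologicalSpace (TotalSpace (EuclideanSpace ℝ (Fin r)) E)]
  [∀ x, AddCommGroup (E x)] [∀ x, Module ℝ (E x)] [∀ x, TopologicalSpace (E x)]
  [FiberBundle (EuclideanSpace ℝ (Fin r)) E] [VectorBundle ℝ (EuclideanSpace ℝ (Fin r)) E]
  [ContMDiffVectorBundle ∞ (EuclideanSpace ℝ (Fin r)) E (𝓡 d)]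
  {L : LieAlgebroid (d := d) (r := r) E} {J : ∀ x : M, E x [⋀^Fin (n + 1)]→ₗ[ℝ] ℝ}
  {H : ∀ x : M, TangentSpace (𝓡 d) x [⋀^Fin (n + 2)]→L[ℝ] ℝ}

theorem sec_comp_vecCons (P : Patch (d := d) (r := r) E) {k : ℕ} (a : Fin r → ℝ)
    (A : Fin k → Fin r → ℝ) :
    (fun l => P.sec ((Matrix.vecCons a A : Fin (k + 1) → Fin r → ℝ) l))
      = Matrix.vecCons (P.sec a) (fun l => P.sec (A l)) := by
  funext l
  refine Fin.cases ?_ (fun l => ?_) l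
  · rfl
  · rfl

theorem sec_comp_update (P : Patch (d := d) (r := r) E) {k : ℕ}
    (A : Fin k → Fin r → ℝ) (μ : Fin k) (a : Fin r → ℝ) :
    (fun l => P.sec (Function.update A μ a l))
      = Function.update (fun l => P.sec (A l)) μ (P.sec a) :=
  Function.comp_update (fun v => P.sec v) A μ a

theorem formAt_sec (P : Patch (d := d) (r := r) E) (L : LieAlgebroid (d := d) (r := r) E)
    (J : ∀ x : M, E x [⋀^Fin (n + 1)]→ₗ[ℝ] ℝ)
    (H : ∀ x : M, TangentSpace (𝓡 d) x [⋀^Fin (n + 2)]→L[ℝ] ℝ) (y : Pt d)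
    (v : Fin (n + 1) → Fin r → ℝ) :
    formAt J (P.chart.symm y) (fun l => P.sec (v l)) = (P.localTarget L J H).JL y v := by
  rw [LocalTarget.JL_apply, P.J_localTarget]
  rfl

theorem anchorForm_sec (P : Patch (d := d) (r := r) E) (hJ : IsSmoothEForm (d := d) (r := r) J)
    (hH : IsSmoothForm H) {y : Pt d} (hy : y ∈ P.chart.target) (a : Fin r → ℝ)
    (v : Fin (n + 1) → Fin r → ℝ) :
    anchorForm L hJ (P.chart.symm y) (P.sec a) (fun l => P.sec (v l))
      = fderiv ℝ (P.localTarget L J H).JL y ((P.localTarget L J H).rhoL y a) v := by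
  rw [(P.isSmooth (L := L) hJ hH).fderiv_JL_eq hy, P.rhoL_localTarget]
  refine (fderiv_comp_symm P.chart_mem hy (mdifferentiableAt_formAt hJ _ _) _).symm.trans ?_
  simp only [formAt_sec P L J H, LocalTarget.JL_apply]

/-- In a patch the anomaly on sections with constant coefficients is `defect`. -/
theorem anomaly_sec (hn : 1 ≤ n) (P : Patch (d := d) (r := r) E)
    (hJ : IsSmoothEForm (d := d) (r := r) J) (hH : IsSmoothForm H) {y : Pt d}
    (hy : y ∈ P.chart.target) (a b : Fin r → ℝ) (A : Fin n → Fin r → ℝ) :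
    L.differential J (Matrix.vecCons (P.sec a) (Matrix.vecCons (P.sec b) fun μ => P.sec (A μ)))
        (P.chart.symm y)
      + H (P.chart.symm y) (fun i => L.anchor (P.chart.symm y)
        ((Matrix.vecCons (P.sec a) (Matrix.vecCons (P.sec b) fun μ => P.sec (A μ)) :
          Fin (n + 2) → Sec (d := d) (r := r) E) i (P.chart.symm y)))
      = defect (P.localTarget L J H) y a b A := by
  obtain ⟨k, rfl⟩ : ∃ k, n = k + 1 := ⟨n - 1, by omega⟩
  have hx := P.chart.map_target hy
  have hbr : ∀ u v, L.bracket (P.sec u) (P.sec v) (P.chart.symm y)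
      = P.sec ((P.localTarget L J H).CL y u v) (P.chart.symm y) := fun u v => by
    rw [P.CL_localTarget, P.sec_comp hx fun x => L.bracket (P.sec u) (P.sec v) x]
  have hc : ∀ (s t : Sec (d := d) (r := r) E) (u u' : Fin (k + 1) → Sec (d := d) (r := r) E),
      s (P.chart.symm y) = t (P.chart.symm y) →
      (∀ l, u l (P.chart.symm y) = u' l (P.chart.symm y)) →
      formAt J (P.chart.symm y) (Matrix.vecCons s u)
        = formAt J (P.chart.symm y) (Matrix.vecCons t u') := fun s t u u' h h' =>
    formAt_congr fun l => by
      refine Fin.cases ?_ (fun l => ?_) l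
      · exact h
      · exact h' l
  have hu : ∀ (u : Fin (k + 1) → Sec (d := d) (r := r) E) (μ : Fin (k + 1)) (s t : Sec (d := d) (r := r) E),
      s (P.chart.symm y) = t (P.chart.symm y) → ∀ l,
      Function.update u μ s l (P.chart.symm y) = Function.update u μ t l (P.chart.symm y) := by
    intro u μ s t h l
    by_cases hl : l = μ
    · subst hl; simpa using h
    · simp [Function.update_of_ne hl]
  rw [differential_vecCons_vecCons L hJ, defect]
  rw [hc _ _ _ _ (hbr a b) fun _ => rfl]
  simp only [fun c v μ => hc (P.sec c) (P.sec c) _ _ rfl (hu (fun μ => P.sec (A μ)) μ _ _ (hbr v (A μ))),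
    fun c μ ν => hc (P.sec c) (P.sec c) _ _ rfl (hu (Function.update (fun μ => P.sec (A μ)) μ (P.sec b)) ν _ _ (hbr (A μ) (A ν)))]
  simp only [← sec_comp_update, ← sec_comp_vecCons, formAt_sec P L J H, anchorForm_sec P hJ hH hy]
  congr 1
  have hH' : ∀ v, L.anchor (P.chart.symm y) (P.sec v (P.chart.symm y))
      = mfderiv (𝓡 d) (𝓡 d) P.chart.symm y ((P.localTarget L J H).rhoL y v) := fun v => by
    rw [P.rhoL_localTarget]
    have h2 := (mdifferentiable_chart P.chart_mem).symm_comp_deriv hx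
    rw [P.chart.right_inv hy] at h2
    exact (congrArg (fun F => F (L.anchor (P.chart.symm y) (P.sec v (P.chart.symm y)))) h2).symm
  refine congrArg (H (P.chart.symm y)) (funext fun i => ?_)
  refine Fin.cases (hH' a) (fun i => ?_) i
  refine Fin.cases (hH' b) (fun μ => hH' (A μ)) i

/-- If the anomaly vanishes on the frames of a patch then it vanishes on all sections at the points
of the patch: the arguments are expanded in the frame one after the other. -/
theorem anomaly_eq_zero_of_frame (hn : 1 ≤ n) (P : Patch (d := d) (r := r) E)
    (hJ : IsSmoothEForm (d := d) (r := r) J) {x : M} (hx : x ∈ P.chart.source)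
    (h : ∀ a : Fin (n + 2) → Fin r, L.differential J (fun i => P.frame (a i)) x
      + H x (fun i => L.anchor x (P.frame (a i) x)) = 0)
    (s : Fin (n + 2) → Sec (d := d) (r := r) E) :
    L.differential J s x + H x (fun i => L.anchor x (s i x)) = 0 := by
  obtain ⟨k, rfl⟩ : ∃ k, n = k + 1 := ⟨n - 1, by omega⟩
  obtain ⟨K, hK⟩ := exists_anomaly L hJ H x
  have hlin : ∀ (f : M → ℝ) (hf : ContMDiff (𝓡 d) 𝓘(ℝ, ℝ) ∞ f) (i : Fin (k + 3))
      (t : Sec (d := d) (r := r) E) (s : Fin (k + 3) → Sec (d := d) (r := r) E),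
      K (Function.update s i (fsmul f hf t)) = f x * K (Function.update s i t) := by
    intro f hf i t s
    rw [map_update_eq_removeNth, map_update_eq_removeNth, hK, hK, differential_fsmul L hJ hf]
    have hv : (fun j => L.anchor x ((Matrix.vecCons (fsmul f hf t) (i.removeNth s) :
          Fin (k + 3) → Sec (d := d) (r := r) E) j x))
        = Matrix.vecCons (f x • L.anchor x (t x)) fun j => L.anchor x (i.removeNth s j x) := by
      funext j
      refine Fin.cases ?_ (fun j => rfl) j
      exact map_smul (L.anchor x) (f x) (t x)
    have hv' : (fun j => L.anchor x ((Matrix.vecCons t (i.removeNth s) :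
          Fin (k + 3) → Sec (d := d) (r := r) E) j x))
        = Matrix.vecCons (L.anchor x (t x)) fun j => L.anchor x (i.removeNth s j x) := by
      funext j
      exact Fin.cases rfl (fun j => rfl) j
    have hs := congrArg (fun F => F fun j => L.anchor x (i.removeNth s j x))
      (map_smul (H x).toAlternatingMap.curryLeft (f x) (L.anchor x (t x)))
    have hs' : H x (Matrix.vecCons (f x • L.anchor x (t x)) fun j => L.anchor x (i.removeNth s j x))
        = f x * H x (Matrix.vecCons (L.anchor x (t x)) fun j => L.anchor x (i.removeNth s j x)) := hs
    rw [hv, hv', hs']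
    ring
  have key : ∀ m : ℕ, ∀ s : Fin (k + 3) → Sec (d := d) (r := r) E,
      (∀ i : Fin (k + 3), m ≤ i → ∃ a, s i = P.frame a) → K s = 0 := by
    intro m
    induction m with
    | zero =>
      intro s hs
      choose a ha using fun i => hs i (Nat.zero_le _)
      rw [show s = fun i => P.frame (a i) from funext ha, hK]
      exact h a
    | succ m ih =>
      intro s hs
      by_cases hm : m < k + 3
      · let i₀ : Fin (k + 3) := ⟨m, hm⟩
        obtain ⟨χ, hχ, hg, h1, e⟩ := P.exists_cutoff_expansion (s i₀) hx
        have e1 := hlin χ hχ i₀ (s i₀) s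
        rw [e, Function.update_eq_self, h1.eq_of_nhds, Pi.one_apply, one_mul,
          AlternatingMap.map_update_sum] at e1
        rw [← e1]
        refine Finset.sum_eq_zero fun c _ => ?_
        rw [hlin, ih, mul_zero]
        intro i hi
        by_cases hi' : i = i₀
        · exact ⟨c, by rw [hi', Function.update_self]⟩
        · rw [Function.update_of_ne hi']
          refine hs i ?_
          have : (i : ℕ) ≠ m := fun h => hi' (Fin.ext h)
          omega
      · exact ih s fun i hi => absurd i.isLt (by omega)
  rw [← hK]
  exact key (k + 3) s fun i hi => absurd i.isLt (by omega)

/-- Every point has a patch: a local frame of a trivialization is made global by a cutoff function,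
and the chart is restricted to where this function is `1`. -/
theorem exists_patch (x : M) : ∃ P : Patch (d := d) (r := r) E, x ∈ P.chart.source := by
  let e := trivializationAt (EuclideanSpace ℝ (Fin r)) E x
  have he : x ∈ e.baseSet := FiberBundle.mem_baseSet_trivializationAt' x
  let b := (EuclideanSpace.basisFun (Fin r) ℝ).toBasis
  obtain ⟨χ, hχ, h1, hs⟩ := exists_cutoff (d := d) e.open_baseSet he
  obtain ⟨W, hW, hWo, hxW⟩ := eventually_nhds_iff.1 h1
  let c := chartAt (Pt d) x
  have hsub : (c.restr W).source ⊆ W := by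
    rw [c.restr_source, hWo.interior_eq]
    exact Set.inter_subset_right
  have hWe : W ⊆ e.baseSet := fun z hz => hs (subset_tsupport _ (by
    rw [Function.mem_support, hW z hz]; exact one_ne_zero))
  refine ⟨{
    chart := c.restr W
    chart_mem := restr_mem_maximalAtlas (contDiffGroupoid ∞ (𝓡 d))
      (IsManifold.chart_mem_maximalAtlas x) hWo
    frame := fun a => ⟨χ • e.localFrame b a, ContMDiffOn.smul_section_of_tsupport hχ.contMDiffOn
      e.open_baseSet hs (e.contMDiffOn_localFrame_baseSet ∞ b a)⟩
    isFrame := ?_ }, ?_⟩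
  · refine ((e.isLocalFrameOn_localFrame_baseSet (𝓡 d) ∞ b).mono (hsub.trans hWe)).congr
      fun a z hz => ?_
    have : χ z = 1 := hW z (hsub hz)
    change e.localFrame b a z = χ z • e.localFrame b a z
    rw [this, one_smul]
  · change x ∈ (c.restr W).source
    rw [c.restr_source, hWo.interior_eq]
    exact ⟨mem_chart_source _ x, hxW⟩

theorem defect_eq_zero_of_bracketCompatible (hn : 1 ≤ n) (hJ : IsSmoothEForm (d := d) (r := r) J)
    (hH : IsSmoothForm H) (hc : BracketCompatible L J H) (P : Patch (d := d) (r := r) E) {y : Pt d}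
    (hy : y ∈ P.chart.target) (a b : Fin r → ℝ) (A : Fin n → Fin r → ℝ) :
    defect (P.localTarget L J H) y a b A = 0 := by
  rw [← anomaly_sec hn P hJ hH hy, hc, neg_add_cancel]

theorem firstClass_iff (hn : 1 ≤ n) (hJ : IsSmoothEForm (d := d) (r := r) J)
    (hH : IsSmoothForm H) : FirstClass L J H ↔ BracketCompatible L J H := by
  refine ⟨fun hF s x => ?_, fun hc P => closedAlgebra_of_defect (P.isLieAlgebroid hJ hH)
    fun y hy a b A => defect_eq_zero_of_bracketCompatible hn hJ hH hc P hy _ _ A⟩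
  obtain ⟨P, hx⟩ := exists_patch (d := d) (r := r) (E := E) x
  refine eq_neg_of_add_eq_zero_left (anomaly_eq_zero_of_frame hn P hJ hx (fun a => ?_) s)
  have hd := defect_eq_zero_of_closedAlgebra hn (P.isLieAlgebroid hJ hH) (hF P) (P.chart x)
    (P.chart.map_source hx) (a 0) (a 1) fun μ => Pi.single (a μ.succ.succ) 1
  rw [← anomaly_sec hn P hJ hH (P.chart.map_source hx), P.chart.left_inv hx] at hd
  have e : (Matrix.vecCons (P.sec (Pi.single (a 0) 1)) (Matrix.vecCons (P.sec (Pi.single (a 1) 1))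
      fun μ : Fin n => P.sec (Pi.single (a μ.succ.succ) 1)) : Fin (n + 2) → _)
      = fun i => P.frame (a i) := by
    simp only [P.sec_single]
    funext i
    exact Fin.cases rfl (fun i => Fin.cases rfl (fun i => rfl) i) i
  rw [e] at hd
  exact hd

end Compatibility

end LASM

end

theorem mainTheorem2 {d r n : ℕ} (hn : 1 ≤ n)
    {M : Type*} [TopologicalSpace M] [T2Space M] [SecondCountableTopology M]
    [ChartedSpace (EuclideanSpace ℝ (Fin d)) M] [IsManifold (𝓡 d) ∞ M]
    {E : M → Type*} [TopologicalSpace (TotalSpace (EuclideanSpace ℝ (Fin r)) E)]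
    [∀ x, AddCommGroup (E x)] [∀ x, Module ℝ (E x)] [∀ x, TopologicalSpace (E x)]
    [∀ x, IsTopologicalAddGroup (E x)] [∀ x, ContinuousSMul ℝ (E x)]
    [FiberBundle (EuclideanSpace ℝ (Fin r)) E] [VectorBundle ℝ (EuclideanSpace ℝ (Fin r)) E]
    [ContMDiffVectorBundle ∞ (EuclideanSpace ℝ (Fin r)) E (𝓡 d)]
    (L : LASM.LieAlgebroid (d := d) (r := r) E)
    (J : ∀ x : M, E x [⋀^Fin (n + 1)]→ₗ[ℝ] ℝ) (hJ : LASM.IsSmoothEForm (d := d) (r := r) J)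
    (H : ∀ x : M, TangentSpace (𝓡 d) x [⋀^Fin (n + 2)]→L[ℝ] ℝ)
    (hH : LASM.IsSmoothForm H) (hdH : LASM.IsClosedForm H) :
    (LASM.FirstClass L J H ↔ LASM.BracketCompatible L J H) ∧
    (LASM.BracketCompatible L J H →
      ∀ (P : LASM.Patch (d := d) (r := r) E) (φ : LASM.Fields d r n),
        LASM.IsField (P.localTarget L J H) φ →
          LASM.ExplicitAlgebra (P.localTarget L J H) φ ∧
          ∀ D : CovariantDerivative (𝓡 d) (EuclideanSpace ℝ (Fin r)) E,
            CovariantDerivative.ContMDiffCovariantDerivative D ∞ →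
              LASM.CovariantAlgebra (P.localTarget L J H) (P.localConnection L D) φ) := by
  refine ⟨LASM.firstClass_iff hn hJ hH, fun hc P φ hφ => ?_⟩
  have h := P.isLieAlgebroid (L := L) hJ hH
  have hd : ∀ y ∈ (P.localTarget L J H).dom, ∀ a b A, LASM.defect (P.localTarget L J H) y
      (Pi.single a 1) (Pi.single b 1) A = 0 := fun y hy a b A =>
    LASM.defect_eq_zero_of_bracketCompatible hn hJ hH hc P hy _ _ A
  exact ⟨LASM.explicitAlgebra h hd hφ, fun D hD =>
    LASM.covariantAlgebra h (P.isConnection L J H hD) hd hφ⟩
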